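/- Let $k\ge 1$, and let $\mathbf M_k=(i\mathfrak u(k)\otimes\mathbb H)\oplus(\mathbb C^k\otimes_{\mathbb R}\mathbb H)$ be the space of pairs $(T,P)$, acted on by $G_k=U(k)\times Sp(1)$ via $(u,\beta)(T,P)=(uTu^{-1},uP\beta^{-1})$ and given the flat invariant metric for which $\operatorname{Im}(T^*T+PP^*)$ is (up to a constant) the hyperkähler moment map. Here $*$ is the quaternionic conjugate of the complex adjoint. Identify $\mathbb R^4=\mathbb H$ and put $\mathcal R_x=((T-x)^*,P):\mathbb C^k\otimes\mathbb C^2\oplus\mathbb C^2\to\mathbb C^k\otimes\mathbb C^2$. Let $\overline A_k$ be the set of $(T,P)$ with $\operatorname{Im}(T^*T+PP^*)=0$, and $A_k\subset\overline A_k$ the subset where $\mathcal R_x$ is surjective for all $x\in\mathbb R^4$; the charge-$k$ moduli space is $A_k/G_k$ (and $A_0=\mathbf M_0$ is a point). The bundle with fibre $\ker\mathcal R_x$ over $(x,T,P)$ carries the $G_k$-invariant connection obtained by orthogonal projection from $\mathbb C^k\otimes\mathbb C^2\oplus\mathbb C^2$; it descends to the quotient by $G_k$ by means of the horizontal spaces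 orthogonal to the orbits. Let $c^k=\frac1{8\pi^2}\operatorname{tr}(F\wedge F)$ be the second Chern form of the descended connection, pulled back to a basic form near $\mathbb R^4\times A_k$. Orient $\mathbb R^4$ so that the ADHM connections are anti-self-dual. Let $\Sigma\subset\mathbb R^4$ be a compact oriented submanifold without boundary, of dimension $d\le 3$, and let $\mathrm{PD}(\Sigma)$ be a Poincaré dual form: a smooth, closed, compactly supported $(4-d)$-form with $\int_\Sigma\beta=\int_{\mathbb R^4}\beta\wedge\mathrm{PD}(\Sigma)$ for all closed $\beta$. The pullback to $\mathbf M_k$ of the $\mu$-form of $\Sigma$ is the basic $(4-d)$-form $$\mu^k(\Sigma)=\int_{\mathbb R^4}c^k\wedge\mathrm{PD}(\Sigma),\qquad\text{respectively}\qquad \mu^k_\Sigma=\int_\Sigma c^k ,$$ defined near $A_k$ (for $k=0$ it is zero). Let $\mathrm{Sing}^k_1\subset\mathbf M_k$ be the linear subspace of points where the vector field of $\operatorname{diag}(i,0,\dots,0)\in\mathfrak u(k)$ vanishes. Its points are $T=\begin{pmatrix}T_0&0\\0&T_1\end{pmatrix}$, $P=\begin{pmatrix}0\\P_1\end{pmatrix}$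 with $T_0\in\mathbb R^4$ and $(T_1,P_1)\in\mathbf M_{k-1}$. Let $\iota_1$ be its inclusion and $p_1(T,P)=T_0$. Consider the points of $\mathrm{Sing}_1^k$ with $(T_1,P_1)\in A_{k-1}$. Since these points lie outside $A_k$, the restriction $\iota_1^*\omega$ of a form $\omega$ defined near $A_k$ is understood as its non-tangential boundary value: at such a point $y$, and for any vectors $v_i$ tangent to $\mathrm{Sing}^k_1$, it is $\lim\omega_{y'}(v_1,v_2,\dots)$ as $y'\to y$ in $A_k$ with $|y'-y|\le C\operatorname{dist}(y',\overline A_k\setminus A_k)$, for every constant $C$. Then each such $y$ is a limit of points of $A_k$ in such a region for some $C$, and: 1. For every Poincaré dual form $\mathrm{PD}(\Sigma)$ there is a smooth $G_k$-basic $(3-d)$-form $\gamma(\Sigma)$ on $\mathbf M_k$ (a form on $\mathbf M_k/G_k$) such that at every $(T,P)\in\mathrm{Sing}_1^k$ with $(T_1,P_1)\in A_{k-1}$ the restriction exists and $$\iota_1^*\mu^k(\Sigma)_{(T,P)}=\mu^{k-1}(\Sigma)_{(T_1,P_1)}+p_1^*\mathrm{PD}(\Sigma)_{T_0}+\iota_1^*d\gamma(\Sigma).$$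 2. For the representative $\mu^k_\Sigma=\int_\Sigma c^k$, whose Poincaré dual is the current of integration over $\Sigma$ and vanishes off $\Sigma$, there is a smooth $G_k$-basic $(3-d)$-form $\gamma$ on $\mathbf M_k$ with $\iota_1^*\mu^k_{\Sigma,(T,P)}=\mu^{k-1}_{\Sigma,(T_1,P_1)}+\iota_1^*d\gamma$ at all such points with $T_0\notin\Sigma$. -/

import Mathlib

open Topology MeasureTheory Filter
open scoped Matrix Kronecker ContDiff

noncomputable section

namespace ADHM

/-! ### Quaternions acting on the spinor space `ℂ²` -/

/-- Euclidean four-space, identified with the quaternions by `x ↦ ∑ a, x a • quat a`. -/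
abbrev R4 : Type := EuclideanSpace ℝ (Fin 4)

/-- The canonical basis `1, i, j, k` of the quaternions. -/
def quat : Fin 4 → Quaternion ℝ := ![⟨1, 0, 0, 0⟩, ⟨0, 1, 0, 0⟩, ⟨0, 0, 1, 0⟩, ⟨0, 0, 0, 1⟩]

/-- The coordinates of a quaternion in the basis `quat`. -/
def coord (q : Quaternion ℝ) : Fin 4 → ℝ := ![q.re, q.imI, q.imJ, q.imK]

/-- The action of the basis quaternions on `ℂ²`. -/
def spin : Fin 4 → Matrix (Fin 2) (Fin 2) ℂ :=
  ![1, !![Complex.I, 0; 0, -Complex.I], !![0, 1; -1, 0], !![0, Complex.I; Complex.I, 0]]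

/-- The quaternionic product in coordinates. -/
theorem coord_mul (p q : Quaternion ℝ) :
    coord (p * q) =
      ![p.re * q.re - p.imI * q.imI - p.imJ * q.imJ - p.imK * q.imK,
        p.re * q.imI + p.imI * q.re + p.imJ * q.imK - p.imK * q.imJ,
        p.re * q.imJ - p.imI * q.imK + p.imJ * q.re + p.imK * q.imI,
        p.re * q.imK + p.imI * q.imJ - p.imJ * q.imI + p.imK * q.re] := by
  simp [coord]

/-- `spin` is multiplicative, so it extends to a representation of the quaternions. -/
theorem spin_mul (a b : Fin 4) :
    spin a * spin b = ∑ c, ((coord (quat a * quat b) c : ℝ) : ℂ) • spin c := by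
  rw [coord_mul]
  fin_cases a <;> fin_cases b <;> ext s t <;> fin_cases s <;> fin_cases t <;>
    simp [spin, quat, Fin.sum_univ_four, Matrix.mul_apply]

/-- `spin` is unitary: quaternionic conjugation becomes the conjugate transpose. -/
theorem spin_star (a : Fin 4) :
    (spin a)ᴴ = ∑ c, ((coord (star (quat a)) c : ℝ) : ℂ) • spin c := by
  have h : ∀ q : Quaternion ℝ, coord (star q) = ![q.re, -q.imI, -q.imJ, -q.imK] := by
    intro q
    simp [coord]
  rw [h]
  fin_cases a <;> ext s t <;> fin_cases s <;> fin_cases t <;>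
    simp [spin, quat, Fin.sum_univ_four]

/-! ### The flat space of ADHM data -/

/-- `i𝔲(k) ⊗ ℍ`: the elements `∑ a, T a ⊗ quat a` with Hermitian matrices `T a`. -/
def hermQuat (k : ℕ) : Submodule ℝ (Fin 4 → Fin k → Fin k → ℂ) where
  carrier := {T | ∀ a i j, T a i j = star (T a j i)}
  add_mem' := by
    intro S T hS hT a i j
    simp only [Pi.add_apply, star_add]
    rw [hS a i j, hT a i j]
  zero_mem' := by intro a i j; simp
  smul_mem' := by
    intro r T hT a i j
    simp only [Pi.smul_apply, star_smul, star_trivial]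
    rw [hT a i j]

/-- The data space `(i𝔲(k) ⊕ ℂᵏ) ⊗_ℝ ℍ` of pairs `(T, P)` of charge `k`. -/
abbrev Data (k : ℕ) : Type := hermQuat k × (Fin 4 → Fin k → ℂ)

/-- The Hermitian matrix `T_a`. -/
def Data.T {k : ℕ} (y : Data k) (a : Fin 4) : Matrix (Fin k) (Fin k) ℂ := Matrix.of (y.1.1 a)

/-- The vector `P_a`. -/
def Data.P {k : ℕ} (y : Data k) (a : Fin 4) : Fin k → ℂ := y.2 a

/-- The three components of `Im (T* T + P P*)`, where `*` is the quaternionic conjugate of the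
complex adjoint: the component along `quat c` for `c = 1, 2, 3`. -/
def moment {k : ℕ} (y : Data k) (c : Fin 3) : Matrix (Fin k) (Fin k) ℂ :=
  ∑ a, ∑ b,
    (((coord (star (quat a) * quat b) c.succ : ℝ) : ℂ) • ((y.T a)ᴴ * y.T b) +
      ((coord (quat a * star (quat b)) c.succ : ℝ) : ℂ) •
        Matrix.vecMulVec (y.P a) (star (y.P b)))

/-- The index set of `ℂᵏ ⊗ ℂ² ⊕ ℂ²`. -/
abbrev Idx (k : ℕ) : Type := (Fin k × Fin 2) ⊕ Fin 2

/-- The operator `R_x = ((T - x)*, P) : ℂᵏ ⊗ ℂ² ⊕ ℂ² → ℂᵏ ⊗ ℂ²`. -/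
def Rop {k : ℕ} (x : R4) (y : Data k) : Matrix (Fin k × Fin 2) (Idx k) ℂ :=
  Matrix.fromCols
    (∑ a, (y.T a - ((x a : ℝ) : ℂ) • (1 : Matrix (Fin k) (Fin k) ℂ)) ⊗ₖ spin a)ᴴ
    (Matrix.of fun p s => ∑ a, y.P a p.1 * spin a p.2 s)

/-- The data satisfying the ADHM equation `Im (T* T + P P*) = 0`. -/
def Abar (k : ℕ) : Set (Data k) := {y | ∀ c, moment y c = 0}

/-- The nondegenerate ADHM data: moreover `R_x` is surjective for every `x`. -/
def A (k : ℕ) : Set (Data k) :=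
  {y | y ∈ Abar k ∧ ∀ x : R4, Function.Surjective (Rop x y).mulVec}

/-! ### The group `U(k) × Sp(1)`, infinitesimally -/

/-- The Lie algebra `𝔲(k)` of skew-Hermitian matrices. -/
def uLie (k : ℕ) : Submodule ℝ (Fin k → Fin k → ℂ) where
  carrier := {ξ | ∀ i j, ξ i j = -star (ξ j i)}
  add_mem' := by
    intro S T hS hT i j
    simp only [Pi.add_apply, star_add]
    rw [hS i j, hT i j]
    ring
  zero_mem' := by intro i j; simp
  smul_mem' := by
    intro r T hT i j
    simp only [Pi.smul_apply, star_smul, star_trivial]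
    rw [hT i j, smul_neg]

/-- The Lie algebra `𝔲(k) ⊕ 𝔰𝔭(1)`; an imaginary quaternion is given by its coordinates in
`i, j, k`. -/
abbrev gLie (k : ℕ) : Type := uLie k × (Fin 3 → ℝ)

/-- The skew-Hermitian matrix of an element of `𝔲(k) ⊕ 𝔰𝔭(1)`. -/
def gLie.mat {k : ℕ} (g : gLie k) : Matrix (Fin k) (Fin k) ℂ := Matrix.of g.1.1

/-- The vector field `X_(ξ, η) (T, P) = ([ξ, T], ξ P - P η)` of the action
`(u, β) (T, P) = (u T u⁻¹, u P β⁻¹)` of `U(k) × Sp(1)`. -/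
def X (k : ℕ) : gLie k →ₗ[ℝ] Data k →ₗ[ℝ] Data k :=
  LinearMap.mk₂ ℝ
    (fun g y =>
      (⟨fun a i j => (g.mat * y.T a - y.T a * g.mat) i j, by
        intro a i j
        have hT : ∀ p q, y.T a p q = star (y.T a q p) := y.1.2 a
        have hg : ∀ p q, g.mat p q = -star (g.mat q p) := g.1.2
        simp only [Matrix.sub_apply, Matrix.mul_apply, star_sub, star_sum, star_mul]
        have e1 : ∀ p, star (y.T a p i) * star (g.mat j p) = -(y.T a i p * g.mat p j) := by
          intro p
          rw [hT i p, hg p j]; ring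
        have e2 : ∀ p, star (g.mat p i) * star (y.T a j p) = -(g.mat i p * y.T a p j) := by
          intro p
          rw [hT p j, hg i p]; ring
        rw [Finset.sum_congr rfl fun p _ => e1 p, Finset.sum_congr rfl fun p _ => e2 p,
          Finset.sum_neg_distrib, Finset.sum_neg_distrib]
        ring⟩,
       fun a i => (∑ j, g.mat i j * y.P a j) -
        ∑ b, ∑ c : Fin 3,
          y.P b i * ((g.2 c * coord (quat b * quat c.succ) a : ℝ) : ℂ)))
    (by
      intro g g' y
      refine Prod.ext (Subtype.ext ?_) ?_
      · funext a i j
        simp [gLie.mat, Data.T, Matrix.mul_apply, mul_add, add_mul, Finset.sum_add_distrib]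
        ring
      · funext a i
        simp [gLie.mat, Data.P, mul_add, add_mul, Finset.sum_add_distrib]
        ring)
    (by
      intro r g y
      refine Prod.ext (Subtype.ext ?_) ?_
      · funext a i j
        simp [gLie.mat, Data.T, Matrix.mul_apply, Finset.mul_sum, mul_sub,
          mul_assoc, mul_left_comm]
      · funext a i
        simp [gLie.mat, Data.P, Finset.mul_sum, mul_sub, mul_assoc, mul_left_comm])
    (by
      intro g y y'
      refine Prod.ext (Subtype.ext ?_) ?_
      · funext a i j
        simp [gLie.mat, Data.T, Matrix.mul_apply, mul_add, add_mul, Finset.sum_add_distrib]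
        ring
      · funext a i
        simp [gLie.mat, Data.P, mul_add, add_mul, Finset.sum_add_distrib]
        ring)
    (by
      intro r g y
      refine Prod.ext (Subtype.ext ?_) ?_
      · funext a i j
        simp [gLie.mat, Data.T, Matrix.mul_apply, Finset.mul_sum, mul_sub,
          mul_assoc, mul_left_comm]
      · funext a i
        simp [gLie.mat, Data.P, Finset.mul_sum, mul_sub, mul_assoc, mul_left_comm])

/-- The action of `𝔲(k) ⊕ 𝔰𝔭(1)` on the fibre `ℂᵏ ⊗ ℂ² ⊕ ℂ²`. -/
def rho {k : ℕ} (g : gLie k) : Matrix (Idx k) (Idx k) ℂ :=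
  Matrix.fromBlocks (g.mat ⊗ₖ (1 : Matrix (Fin 2) (Fin 2) ℂ)) 0 0
    (∑ c : Fin 3, ((g.2 c : ℝ) : ℂ) • spin c.succ)

/-- The flat metric on the data space. The relative factor `2` makes `Im (T* T + P P*)` a
hyperkähler moment map for it, up to an overall constant. -/
def metric (k : ℕ) : Data k →ₗ[ℝ] Data k →ₗ[ℝ] ℝ :=
  LinearMap.mk₂ ℝ
    (fun y z => ∑ a, ((∑ i, ∑ j, (star (y.T a i j) * z.T a i j).re) +
      2 * ∑ i, (star (y.P a i) * z.P a i).re))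
    (by
      intro y y' z
      rw [← Finset.sum_add_distrib]
      refine Finset.sum_congr rfl fun a _ => ?_
      simp only [Data.T, Data.P, Matrix.of_apply, Prod.fst_add, Prod.snd_add, Submodule.coe_add,
        Pi.add_apply, star_add, add_mul, Complex.add_re, Finset.sum_add_distrib]
      ring)
    (by
      intro r y z
      rw [Finset.smul_sum]
      refine Finset.sum_congr rfl fun a _ => ?_
      simp only [Data.T, Data.P, Matrix.of_apply, Prod.smul_fst, Prod.smul_snd,
        Submodule.coe_smul, Pi.smul_apply, star_smul, star_trivial, smul_mul_assoc,
        Complex.smul_re, smul_eq_mul, ← Finset.mul_sum]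
      ring)
    (by
      intro y z z'
      rw [← Finset.sum_add_distrib]
      refine Finset.sum_congr rfl fun a _ => ?_
      simp only [Data.T, Data.P, Matrix.of_apply, Prod.fst_add, Prod.snd_add, Submodule.coe_add,
        Pi.add_apply, mul_add, Complex.add_re, Finset.sum_add_distrib]
      ring)
    (by
      intro r y z
      rw [Finset.smul_sum]
      refine Finset.sum_congr rfl fun a _ => ?_
      simp only [Data.T, Data.P, Matrix.of_apply, Prod.smul_fst, Prod.smul_snd,
        Submodule.coe_smul, Pi.smul_apply, mul_smul_comm,
        Complex.smul_re, smul_eq_mul, ← Finset.mul_sum]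
      ring)

/-! ### The connection on the principal bundle `A k → A k / (U(k) × Sp(1))` -/

/-- The infinitesimal orbit map `ξ ↦ X_ξ(y)`. -/
def orbitMap {k : ℕ} (y : Data k) : gLie k →L[ℝ] Data k :=
  LinearMap.toContinuousLinearMap ((X k).flip y)

/-- `v ↦ (ξ ↦ ⟨v, X_ξ(y)⟩)`. -/
def orbitPairing {k : ℕ} (y : Data k) : Data k →L[ℝ] (gLie k →L[ℝ] ℝ) :=
  LinearMap.toContinuousLinearMap
    { toFun := fun v => LinearMap.toContinuousLinearMap (metric k v ∘ₗ (X k).flip y)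
      map_add' := by intro v w; ext g <;> simp
      map_smul' := by intro r v; ext g <;> simp }

/-- The connection form with horizontal spaces orthogonal to the orbits: if the action is locally
free at `y`, then `theta y v` is the unique `ξ` with `v - X_ξ(y)` orthogonal to the orbit. -/
def theta {k : ℕ} (y : Data k) : Data k →L[ℝ] gLie k :=
  (orbitPairing y ∘L orbitMap y).inverse ∘L orbitPairing y

/-! ### The universal bundle, its connection, and the second Chern form -/

/-- The orthogonal projection of `ℂᵏ ⊗ ℂ² ⊕ ℂ²` onto the fibre `ker R_x` of the universal
bundle (where `R_x` is surjective). -/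
def proj {k : ℕ} (z : R4 × Data k) : Matrix (Idx k) (Idx k) ℂ :=
  1 - (Rop z.1 z.2)ᴴ * (Rop z.1 z.2 * (Rop z.1 z.2)ᴴ)⁻¹ * Rop z.1 z.2

/-- The covariant derivative in the direction `u` of a section `s` of the bundle of the spaces
`ker R_x`, for the connection pulled back from the quotient by `U(k) × Sp(1)`: the
projection of the trivial connection, corrected by `Ψ ∘ θ`, where `Ψ(ξ)` is the compression of
the action of `ξ` on the fibre. On invariant sections it is the derivative in the
direction of the horizontal part of `u`. -/
def covD {k : ℕ} (u : R4 × Data k) (s : R4 × Data k → Idx k → ℂ) :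
    R4 × Data k → Idx k → ℂ :=
  fun z => proj z *ᵥ (fderiv ℝ s z u - rho (theta z.2 u.2) *ᵥ s z)

/-- The curvature `∇_u ∇_v - ∇_v ∇_u` (for constant vector fields `u`, `v`), extended by zero to
the orthogonal complement of the fibre. -/
def curv {k : ℕ} (z u v : R4 × Data k) : Matrix (Idx k) (Idx k) ℂ :=
  Matrix.of fun i j =>
    let s : R4 × Data k → Idx k → ℂ := fun z' => proj z' *ᵥ Pi.single j 1
    (covD u (covD v s) z - covD v (covD u s) z) i

/-- The form `(1 / 8π²) tr (F ∧ F)` evaluated on four vectors. -/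
def chern {k : ℕ} (z : R4 × Data k) (u : Fin 4 → R4 × Data k) : ℝ :=
  (1 / (4 * Real.pi ^ 2)) *
    (Matrix.trace (curv z (u 0) (u 1) * curv z (u 2) (u 3) -
      curv z (u 0) (u 2) * curv z (u 1) (u 3) +
      curv z (u 0) (u 3) * curv z (u 1) (u 2))).re

/-- The `d`-form on `ℝ⁴` obtained by contracting the Chern form at `(x, y)` with the
`n + 1` tangent vectors `v` of the data space. -/
def chernSlice {k d n : ℕ} (hdn : d + n = 3) (y : Data k) (v : Fin (n + 1) → Data k) (x : R4)
    (e : Fin d → R4) : ℝ :=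
  chern (x, y) fun i =>
    Fin.append (fun p => ((0 : R4), v p)) (fun p => (e p, (0 : Data k)))
      (Fin.cast (by omega : 4 = n + 1 + d) i)

/-! ### Forms on `ℝ⁴` -/

/-- The value of `b ∧ a` on the standard basis `e₀, e₁, e₂, e₃`, where `b` has degree `d` and `a`
has degree `n + 1`. -/
def wedgeTop {d n : ℕ} (hdn : d + n = 3) (b : (Fin d → R4) → ℝ)
    (a : (Fin (n + 1) → R4) → ℝ) : ℝ :=
  (1 / ((d.factorial : ℝ) * ((n + 1).factorial : ℝ))) *
    ∑ σ : Equiv.Perm (Fin 4), ((Equiv.Perm.sign σ : ℤ) : ℝ) *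
      b (fun p => EuclideanSpace.single
        (σ (Fin.cast (by omega : d + (n + 1) = 4) (Fin.castAdd (n + 1) p))) 1) *
      a (fun p => EuclideanSpace.single
        (σ (Fin.cast (by omega : d + (n + 1) = 4) (Fin.natAdd d p))) 1)

/-- The integral over `ℝ⁴` of the top-degree form whose value on the standard basis is `f`. The
orientation is the one for which the ADHM connections (with `R_x = ((T - x)*, P)`) are
anti-self-dual; `1, i, j, k` is a negative basis for it. -/
def integralR4 (f : R4 → ℝ) : ℝ := -∫ x, f x

/-- A compact oriented embedded smooth submanifold of `ℝ⁴` without boundary, of dimension `d` and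
codimension `n + 1`. The orientation is given at each point by an orthonormal frame of the
tangent space together with a sign; the resulting unit `d`-vector is continuous. -/
structure Submfd (d n : ℕ) where
  carrier : Set R4
  frame : R4 → Fin d → R4
  sign : R4 → ℝ
  isCompact : IsCompact carrier
  sign_eq : ∀ x ∈ carrier, sign x = 1 ∨ sign x = -1
  orthonormal : ∀ x ∈ carrier, Orthonormal ℝ (frame x)
  locally_regular : ∀ x ∈ carrier, ∃ U : Set R4, IsOpen U ∧ x ∈ U ∧
    ∃ g : R4 → EuclideanSpace ℝ (Fin (n + 1)), ContDiffOn ℝ ∞ g U ∧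
      (∀ z ∈ U, z ∈ carrier ↔ g z = 0) ∧
      ∀ z ∈ U ∩ carrier, Function.Surjective (fderiv ℝ g z) ∧
        Submodule.span ℝ (Set.range (frame z)) = LinearMap.ker (fderiv ℝ g z).toLinearMap
  orientation_continuous : ∀ b : R4 [⋀^Fin d]→L[ℝ] ℝ,
    ContinuousOn (fun x => sign x * b (frame x)) carrier

/-- The integral of a `d`-form over a compact oriented submanifold. -/
def Submfd.integral {d n : ℕ} (S : Submfd d n) (b : R4 → (Fin d → R4) → ℝ) : ℝ :=
  ∫ x in S.carrier, S.sign x * b x (S.frame x) ∂(μHE[d] : Measure R4)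

/-- A Poincaré dual form of a submanifold: a closed, compactly supported smooth form `α` with
`∫_S β = ∫_{ℝ⁴} β ∧ α` for all closed `β`. -/
structure IsPoincareDual {d n : ℕ} (hdn : d + n = 3) (S : Submfd d n)
    (α : R4 → R4 [⋀^Fin (n + 1)]→L[ℝ] ℝ) : Prop where
  smooth : ContDiff ℝ ∞ α
  compact_support : HasCompactSupport α
  closed : ∀ x, extDeriv α x = 0
  dual : ∀ β : R4 → R4 [⋀^Fin d]→L[ℝ] ℝ, ContDiff ℝ ∞ β → (∀ x, extDeriv β x = 0) →
    S.integral (fun x => β x) = integralR4 fun x => wedgeTop hdn (β x) (α x)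

/-! ### The `μ`-forms, pulled back to the data space -/

/-- The form `μ(S) = ∫_{ℝ⁴} c ∧ α` of degree `n + 1`, for a Poincaré dual form `α` of `S`, pulled
back to the data space and evaluated at `y` on the vectors `v`. -/
def muDual {k d n : ℕ} (hdn : d + n = 3) (α : R4 → R4 [⋀^Fin (n + 1)]→L[ℝ] ℝ) (y : Data k)
    (v : Fin (n + 1) → Data k) : ℝ :=
  integralR4 fun x => wedgeTop hdn (chernSlice hdn y v x) (α x)

/-- The form `μ(S) = ∫_S c` of degree `n + 1`, pulled back to the data space and evaluated at `y`
on the vectors `v`. -/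
def muSub {k d n : ℕ} (hdn : d + n = 3) (S : Submfd d n) (y : Data k)
    (v : Fin (n + 1) → Data k) : ℝ :=
  S.integral fun x => chernSlice hdn y v x

/-- Smooth forms on the quotient of the data space by `U(k) × Sp(1)`, that is, smooth basic forms:
`ι_X γ = 0` and `ι_X dγ = 0` for the vector fields `X` of the (connected) group. -/
structure IsBasic {k n : ℕ} (γ : Data k → Data k [⋀^Fin n]→L[ℝ] ℝ) : Prop where
  smooth : ContDiff ℝ ∞ γ
  horizontal : ∀ (y : Data k) (v : Fin n → Data k),
    (∃ i ξ, v i = X k ξ y) → γ y v = 0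
  invariant : ∀ (y : Data k) (v : Fin (n + 1) → Data k),
    (∃ i ξ, v i = X k ξ y) → extDeriv γ y v = 0

/-! ### The fixed set of the first circle -/

/-- The generator `diag(i, 0, …, 0)` of the first circle of the maximal torus of `U(k + 1)`. -/
def xi1 (k : ℕ) : gLie (k + 1) :=
  (⟨fun p q => if p = 0 ∧ q = 0 then Complex.I else 0, by
    intro p q
    by_cases h : p = 0 ∧ q = 0
    · simp [h.1, h.2]
    · have h' : ¬(q = 0 ∧ p = 0) := fun t => h ⟨t.2, t.1⟩
      simp only [if_neg h, if_neg h', star_zero, neg_zero]⟩, 0)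

/-- The fixed set `Sing_1`, where the vector field of the first circle vanishes; as a linear
subspace it is its own tangent space at each point. -/
def Sing1 (k : ℕ) : Submodule ℝ (Data (k + 1)) := LinearMap.ker (X (k + 1) (xi1 k))

/-- The projection `(T, P) ↦ T_0 ∈ ℝ⁴` to the upper left entry of `T`. -/
def T0 {k : ℕ} (y : Data (k + 1)) : R4 := WithLp.toLp 2 fun a => (y.T a 0 0).re

/-- The projection `(T, P) ↦ (T_1, P_1)` deleting the first row and column. -/
def lower {k : ℕ} (y : Data (k + 1)) : Data k :=
  (⟨fun a i j => y.1.1 a i.succ j.succ, fun a i j => y.1.2 a i.succ j.succ⟩,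
    fun a i => y.2 a i.succ)

/-- The points of `Sing_1` for which `(T_1, P_1)` is nondegenerate ADHM data of charge one less. -/
def Sing1reg (k : ℕ) : Set (Data (k + 1)) := {y | y ∈ Sing1 k ∧ lower y ∈ A k}

/-- A non-tangential approach region at `y` inside the nondegenerate ADHM data: the distance
to `y` is at most `C` times the distance to the degenerate ADHM data. -/
def approach {k : ℕ} (C : ℝ) (y : Data k) : Set (Data k) :=
  {y' | y' ∈ A k ∧ dist y' y ≤ C * Metric.infDist y' (Abar k \ A k)}

/-- `RestrictsTo f η U` says that the form `f`, defined near the nondegenerate ADHM data, has the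
pullback `η` to the set `U` of fixed points: at each point of `U` and on all vectors tangent to
the fixed set, the coefficients of `f` have the non-tangential limit prescribed by `η`. -/
def RestrictsTo {k m : ℕ} (f η : Data (k + 1) → (Fin m → Data (k + 1)) → ℝ)
    (U : Set (Data (k + 1))) : Prop :=
  ∀ y ∈ U, ∀ v : Fin m → Data (k + 1), (∀ i, v i ∈ Sing1 k) → ∀ C : ℝ,
    Tendsto (fun y' => f y' v) (𝓝[approach C y] y) (𝓝 (η y v))

end ADHM

end

noncomputable section

open Topology MeasureTheory Filter
open scoped Matrix Kronecker ContDiff ComplexOrder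

set_option maxSynthPendingDepth 3
set_option synthInstance.maxHeartbeats 200000

namespace ADHM

open Finset (card_univ mem_univ mul_sum single_le_sum smul_sum sum_add_distrib sum_comm
  sum_congr sum_const_zero sum_eq_single sum_eq_zero sum_eq_zero_iff_of_nonneg sum_ite_eq
  sum_le_card_nsmul sum_le_sum sum_mul sum_mul_sum sum_neg_distrib sum_nonneg sum_smul
  sum_sub_distrib)
open Matrix (add_mulVec conjTranspose conjTranspose_add conjTranspose_apply
  conjTranspose_conjTranspose conjTranspose_kronecker conjTranspose_mul conjTranspose_one
  conjTranspose_smul conjTranspose_sub conjTranspose_sum det_kronecker diag dotProduct_mulVec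
  exists_mulVec_eq_zero_iff fromBlocks fromBlocks_add fromBlocks_neg fromCols fromCols_apply_inl
  fromCols_apply_inr kroneckerMap_apply kronecker_apply mulVec mulVec_mulVec mulVec_single_one
  mulVec_smul mul_kronecker_mul mul_nonsing_inv mul_vecMulVec nonsing_inv_mul of_apply one_mulVec
  smul_mul smul_mulVec star_mulVec sub_mulVec trace_add trace_fin_two trace_mul_comm trace_neg
  trace_smul trace_sub trace_sum vecMul vecMulVec vecMulVec_apply zero_kronecker)
open Complex (I I_mul_I I_ne_zero I_sq add_re coe_smul conj_ofReal continuous_re neg_re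
  normSq_eq_conj_mul_self normSq_eq_norm_sq norm_real ofReal_mul ofReal_re ofReal_sub reCLM
  re_add_im re_le_norm re_ofReal_mul re_sum real_smul star_def sub_re zero_re)
open Fin (addCases append exists_fin_two natAdd succ_ne_zero sum_univ_four sum_univ_succ
  sum_univ_three sum_univ_two tail)
open EuclideanSpace (basisFun norm_eq norm_sq_eq single)
open Sum (elim inl inr)
open LinearMap (id_apply ker_eq_bot mk₂ range_eq_top toContinuousLinearMap)

lemma sum_ext {ι M : Type*} [AddCommMonoid M] {s : Finset ι} {f g : ι → M}
    (h : ∀ a ∈ s, f a = g a) : ∑ a ∈ s, f a = ∑ a ∈ s, g a := sum_congr rfl h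

variable {k : ℕ} {y : Data k}

local notation "Mat" n:max => Matrix (Fin n) (Fin n) ℂ
local notation "Data₁" => Data (k + 1)

local instance : Norm (Data k) := inferInstance
local instance : Norm (gLie k) := inferInstance
local instance : AddCommGroup (Data k) := inferInstance
local instance : AddCommGroup (gLie k) := inferInstance
local instance : AddCommMonoid (Data k) := inferInstance
local instance : AddCommMonoid (gLie k) := inferInstance
local instance : Module ℝ (Data k) := inferInstance
local instance : Module ℝ (gLie k) := inferInstance

lemma Data.T_conjTranspose (y : Data k) (a : Fin 4) : (y.T a)ᴴ = y.T a := by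
  ext i j
  exact (y.1.2 a i j).symm

/-- The Hermitian matrix `T_a - x_a`. -/
def tau (x : R4) (y : Data k) (a : Fin 4) : Mat k := y.T a - ((x a : ℝ) : ℂ) • (1 : Mat k)

lemma tau_conjTranspose (x : R4) (y : Data k) (a : Fin 4) : (tau x y a)ᴴ = tau x y a := by
  simp [tau, conjTranspose_sub, y.T_conjTranspose, conjTranspose_smul]

/-- The real part of `(T - x)* (T - x) + P P*`. -/
def Dm (x : R4) (y : Data k) : Mat k :=
  ∑ a, (tau x y a * tau x y a + vecMulVec (y.P a) (star (y.P a)))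

lemma coord_star_mul (p q : Quaternion ℝ) : coord (star p * q) =
      ![p.re * q.re + p.imI * q.imI + p.imJ * q.imJ + p.imK * q.imK,
        p.re * q.imI - p.imI * q.re - p.imJ * q.imK + p.imK * q.imJ,
        p.re * q.imJ + p.imI * q.imK - p.imJ * q.re - p.imK * q.imI,
        p.re * q.imK - p.imI * q.imJ + p.imJ * q.imI - p.imK * q.re] := by
  simp [coord_mul, sub_eq_add_neg]

lemma coord_mul_star (p q : Quaternion ℝ) : coord (p * star q) =
      ![p.re * q.re + p.imI * q.imI + p.imJ * q.imJ + p.imK * q.imK,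
        -(p.re * q.imI) + p.imI * q.re - p.imJ * q.imK + p.imK * q.imJ,
        -(p.re * q.imJ) + p.imI * q.imK + p.imJ * q.re - p.imK * q.imI,
        -(p.re * q.imK) - p.imI * q.imJ + p.imJ * q.imI + p.imK * q.re] := by
  simp [coord_mul, sub_eq_add_neg]

lemma spin_star_mul (a b : Fin 4) :
    (spin a)ᴴ * spin b = ∑ c, ((coord (star (quat a) * quat b) c : ℝ) : ℂ) • spin c := by
  rw [coord_star_mul]
  fin_cases a <;> fin_cases b <;> ext s t <;> fin_cases s <;> fin_cases t <;>
    simp [spin, quat, sum_univ_four, Matrix.mul_apply]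

lemma spin_mul_star (a b : Fin 4) :
    spin a * (spin b)ᴴ = ∑ c, ((coord (quat a * star (quat b)) c : ℝ) : ℂ) • spin c := by
  rw [coord_mul_star]
  fin_cases a <;> fin_cases b <;> ext s t <;> fin_cases s <;> fin_cases t <;>
    simp [spin, quat, sum_univ_four, Matrix.mul_apply]

/-- The block of `Rop` coming from `P`. -/
def Pblock (y : Data k) : Matrix (Fin k × Fin 2) (Fin 2) ℂ :=
  Matrix.of fun p s => ∑ a, y.P a p.1 * spin a p.2 s

lemma Rop_eq (x : R4) (y : Data k) :
    Rop x y = fromCols (∑ a, tau x y a ⊗ₖ (spin a)ᴴ) (Pblock y) := by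
  simp only [Rop, Pblock, conjTranspose_sum, conjTranspose_kronecker]
  congr 1
  refine sum_ext fun a _ => ?_
  have := tau_conjTranspose x y a
  rw [tau] at this ⊢
  rw [this]

lemma Pblock_mul_conjTranspose (y : Data k) : Pblock y * (Pblock y)ᴴ =
      ∑ a, ∑ b, vecMulVec (y.P a) (star (y.P b)) ⊗ₖ (spin a * (spin b)ᴴ) := by
  ext ⟨i, s⟩ ⟨j, t⟩
  simp only [Matrix.mul_apply, Pblock, conjTranspose_apply, of_apply, Matrix.sum_apply,
    kronecker_apply, vecMulVec_apply, star_sum, star_mul', sum_univ_four, sum_univ_two,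
    Pi.star_apply, star_add, Matrix.add_apply]
  ring

lemma Rop_mul_conjTranspose (x : R4) (y : Data k) : Rop x y * (Rop x y)ᴴ =
      Dm x y ⊗ₖ (1 : Mat 2) + ∑ c, moment y c ⊗ₖ spin c.succ := by
  have h1 : (∑ a, tau x y a ⊗ₖ (spin a)ᴴ) * (∑ a, tau x y a ⊗ₖ (spin a)ᴴ)ᴴ =
      ∑ a, ∑ b, (tau x y a * tau x y b) ⊗ₖ ((spin a)ᴴ * spin b) := by
    simp only [conjTranspose_sum, conjTranspose_kronecker, conjTranspose_conjTranspose,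
      tau_conjTranspose, sum_mul_sum, mul_kronecker_mul]
  rw [Rop_eq, Matrix.conjTranspose_fromCols_eq_fromRows_conjTranspose, Matrix.fromCols_mul_fromRows,
    h1, Pblock_mul_conjTranspose]
  ext ⟨i, s⟩ ⟨j, t⟩
  have e1 : ∀ a, y.T a = tau x y a + ((x a : ℝ) : ℂ) • 1 := fun a => by simp [tau]
  have e2 : ∀ a b, (y.T a)ᴴ * y.T b = tau x y a * tau x y b + ((x a : ℝ) : ℂ) • tau x y b +
      ((x b : ℝ) : ℂ) • tau x y a + ((x a * x b : ℝ) : ℂ) • 1 := by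
    intro a b
    rw [y.T_conjTranspose, e1 a, e1 b]
    simp only [add_mul, mul_add, smul_mul, Matrix.mul_smul, one_mul, mul_one, smul_smul]
    push_cast
    rw [mul_comm (x b : ℂ)]
    abel
  simp only [moment, Dm, e2, spin_star_mul, spin_mul_star, coord_star_mul, coord_mul_star,
    Matrix.add_apply, Matrix.sum_apply, kronecker_apply, sum_univ_four, sum_univ_three,
    Matrix.smul_apply]
  simp [quat, spin]
  fin_cases s <;> fin_cases t <;> simp <;> ring

/-- The operator `Rop` is real linear in the point and the data jointly. -/
def RopL (k : ℕ) : R4 × Data k →ₗ[ℝ] Matrix (Fin k × Fin 2) (Idx k) ℂ where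
  toFun z := Rop z.1 z.2
  map_add' z w := by
    ext ⟨i, s⟩ (⟨j, t⟩ | t) <;>
    simp [Rop_eq, tau, Pblock, Data.T, Data.P, Matrix.sum_apply, sum_univ_four, kronecker_apply] <;>
      ring
  map_smul' r z := by
    ext ⟨i, s⟩ (⟨j, t⟩ | t) <;>
    simp [Rop_eq, tau, Pblock, Data.T, Data.P, Matrix.sum_apply, sum_univ_four, kronecker_apply] <;>
      ring

@[simp] theorem RopL_apply (z : R4 × Data k) : RopL k z = Rop z.1 z.2 := rfl

lemma gLie.mat_conjTranspose (g : gLie k) : g.matᴴ = -g.mat := by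
  ext i j
  have := g.1.2 j i
  simp only [conjTranspose_apply, gLie.mat, of_apply, Matrix.neg_apply]
  rw [this]
  simp

lemma rho_conjTranspose (g : gLie k) : (rho g)ᴴ = -rho g := by
  simp only [rho, Matrix.fromBlocks_conjTranspose, conjTranspose_kronecker, g.mat_conjTranspose,
    conjTranspose_one, Matrix.conjTranspose_zero, fromBlocks_neg, neg_zero, conjTranspose_sum,
    conjTranspose_smul]
  congr 1
  · ext ⟨i, s⟩ ⟨j, t⟩
    simp [kronecker_apply]
  · ext s t
    fin_cases s <;> fin_cases t <;> simp [sum_univ_three, spin] <;> ring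

lemma X_T (g : gLie k) (y : Data k) (a : Fin 4) :
    (X k g y).T a = g.mat * y.T a - y.T a * g.mat := rfl

lemma X_P (g : gLie k) (y : Data k) (a : Fin 4) (i : Fin k) :
    (X k g y).P a i = (∑ j, g.mat i j * y.P a j) -
        ∑ b, ∑ c : Fin 3, y.P b i * ((g.2 c * coord (quat b * quat c.succ) a : ℝ) : ℂ) := rfl

lemma Rop_X (g : gLie k) (x : R4) (y : Data k) :
    Rop 0 (X k g y) = (g.mat ⊗ₖ (1 : Mat 2)) * Rop x y - Rop x y * rho g := by
  rw [Rop_eq, Rop_eq, Matrix.mul_fromCols, rho, Matrix.fromCols_mul_fromBlocks]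
  simp only [Matrix.mul_zero, add_zero, zero_add]
  have h1 : (∑ a, tau 0 (X k g y) a ⊗ₖ (spin a)ᴴ) =
      g.mat ⊗ₖ (1 : Mat 2) * (∑ a, tau x y a ⊗ₖ (spin a)ᴴ) -
      (∑ a, tau x y a ⊗ₖ (spin a)ᴴ) * g.mat ⊗ₖ (1 : Mat 2) := by
    rw [mul_sum, sum_mul, ← sum_sub_distrib]
    refine sum_ext fun a _ => ?_
    rw [← mul_kronecker_mul, ← mul_kronecker_mul, one_mul, mul_one, tau, X_T, tau]
    ext ⟨i, s⟩ ⟨j, t⟩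
    simp [kronecker_apply, mul_sub, sub_mul]
  have h2 : Pblock (X k g y) = g.mat ⊗ₖ (1 : Mat 2) * Pblock y -
      Pblock y * ∑ c : Fin 3, ((g.2 c : ℝ) : ℂ) • spin c.succ := by
    ext ⟨i, s⟩ t
    have e : (g.mat ⊗ₖ (1 : Mat 2) * Pblock y) (i, s) t =
        ∑ a, (∑ j, g.mat i j * y.P a j) * spin a s t := by
      simp only [Matrix.mul_apply, Fintype.sum_prod_type, kronecker_apply, Pblock, of_apply,
        Matrix.one_apply, mul_ite, mul_one, mul_zero, ite_mul, zero_mul, sum_ite_eq, mem_univ,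
        if_true, mul_sum, sum_mul]
      rw [sum_comm]
      simp only [mul_assoc, Finset.sum_ite_irrel, sum_const_zero, sum_ite_eq, mem_univ, if_true]
      rw [sum_comm]
    rw [Matrix.sub_apply, e]
    simp only [Pblock, of_apply, X_P, sub_mul, sum_sub_distrib]
    congr 1
    simp only [coord_mul, Matrix.mul_apply, of_apply, sum_univ_four, sum_univ_three, sum_univ_two]
    simp [quat, spin]
    rcases exists_fin_two.mp ⟨s, rfl⟩ with rfl | rfl <;>
      rcases exists_fin_two.mp ⟨t, rfl⟩ with rfl | rfl <;> simp <;> ring_nf <;>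
      simp only [I_sq] <;> ring
  ext p (⟨j, t⟩ | t)
  · exact congr_fun₂ h1 p (j, t)
  · exact congr_fun₂ h2 p t

section

variable {E : Type*} [NormedAddCommGroup E] [NormedSpace ℝ E] {l m p : Type*}

/-- Entrywise differentiability of a matrix-valued function. -/
def MDiffAt (M : E → Matrix l m ℂ) (z : E) : Prop :=
  ∀ i j, DifferentiableAt ℝ (fun z' => M z' i j) z

/-- Entrywise smoothness of a matrix-valued function. -/
def MSmoothAt (M : E → Matrix l m ℂ) (z : E) : Prop := ∀ i j, ContDiffAt ℝ ∞ (fun z' => M z' i j) z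

/-- The entrywise directional derivative of a matrix-valued function. -/
def mderiv (M : E → Matrix l m ℂ) (z u : E) : Matrix l m ℂ :=
  Matrix.of fun i j => fderiv ℝ (fun z' => M z' i j) z u

lemma MSmoothAt.mdiffAt {M : E → Matrix l m ℂ} {z : E} (h : MSmoothAt M z) : MDiffAt M z :=
  fun i j => (h i j).differentiableAt (by simp)

lemma mdiffAt_const (A : Matrix l m ℂ) (z : E) : MDiffAt (fun _ => A) z :=
  fun _ _ => differentiableAt_const _

lemma msmoothAt_const (A : Matrix l m ℂ) (z : E) : MSmoothAt (fun _ => A) z :=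
  fun _ _ => contDiffAt_const

lemma mderiv_const (A : Matrix l m ℂ) (z u : E) : mderiv (fun _ => A) z u = 0 := by
  ext i j; simp [mderiv]

lemma MSmoothAt.sub {M N : E → Matrix l m ℂ} {z : E} (hM : MSmoothAt M z) (hN : MSmoothAt N z) :
    MSmoothAt (fun z => M z - N z) z := fun i j => (hM i j).sub (hN i j)

lemma MDiffAt.sub {M N : E → Matrix l m ℂ} {z : E} (hM : MDiffAt M z) (hN : MDiffAt N z) :
    MDiffAt (fun z => M z - N z) z := fun i j => (hM i j).sub (hN i j)

lemma mderiv_sub {M N : E → Matrix l m ℂ} {z : E} (hM : MDiffAt M z) (hN : MDiffAt N z) (u : E) :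
    mderiv (fun z => M z - N z) z u = mderiv M z u - mderiv N z u := by
  ext i j
  simp [mderiv, fderiv_fun_sub (hM i j) (hN i j)]

variable [Fintype m]

lemma MSmoothAt.mul {M : E → Matrix l m ℂ} {N : E → Matrix m p ℂ} {z : E}
    (hM : MSmoothAt M z) (hN : MSmoothAt N z) : MSmoothAt (fun z => M z * N z) z := by
  intro i j
  simp only [Matrix.mul_apply]
  exact ContDiffAt.sum fun k _ => (hM i k).mul (hN k j)

lemma MDiffAt.mul {M : E → Matrix l m ℂ} {N : E → Matrix m p ℂ} {z : E}
    (hM : MDiffAt M z) (hN : MDiffAt N z) : MDiffAt (fun z => M z * N z) z := by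
  intro i j
  simp only [Matrix.mul_apply]
  exact DifferentiableAt.fun_sum fun k _ => (hM i k).mul (hN k j)

lemma mderiv_mul {M : E → Matrix l m ℂ} {N : E → Matrix m p ℂ} {z : E}
    (hM : MDiffAt M z) (hN : MDiffAt N z) (u : E) :
    mderiv (fun z => M z * N z) z u = mderiv M z u * N z + M z * mderiv N z u := by
  ext i j
  have h : HasFDerivAt (fun z' => (M z' * N z') i j)
      (∑ k, (M z i k • fderiv ℝ (fun z' => N z' k j) z +
        N z k j • fderiv ℝ (fun z' => M z' i k) z)) z := by
    simp only [Matrix.mul_apply]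
    exact HasFDerivAt.fun_sum fun k _ => (hM i k).hasFDerivAt.mul (hN k j).hasFDerivAt
  have h' := congrArg (fun L : E →L[ℝ] ℂ => L u) h.fderiv
  simp only [ContinuousLinearMap.sum_apply] at h'
  refine h'.trans ?_
  simp only [Matrix.add_apply, Matrix.mul_apply, mderiv, of_apply]
  rw [← sum_add_distrib]
  refine sum_ext fun k _ => ?_
  simp
  ring

omit [Fintype m] in
lemma MSmoothAt.conjTranspose {M : E → Matrix l m ℂ} {z : E} (hM : MSmoothAt M z) :
    MSmoothAt (fun z => (M z)ᴴ) z :=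
  fun i j => (starL' ℝ : ℂ ≃L[ℝ] ℂ).contDiff.contDiffAt.comp z (hM j i)

lemma MSmoothAt.det [DecidableEq m] {M : E → Matrix m m ℂ} {z : E} (hM : MSmoothAt M z) :
    ContDiffAt ℝ ∞ (fun z => (M z).det) z := by
  simp only [Matrix.det_apply]
  exact ContDiffAt.sum fun σ _ => (contDiffAt_prod fun i _ => hM _ _).const_smul _

lemma MSmoothAt.inv [DecidableEq m] {M : E → Matrix m m ℂ} {z : E} (hM : MSmoothAt M z)
    (hz : (M z).det ≠ 0) : MSmoothAt (fun z => (M z)⁻¹) z := by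
  intro i j
  simp only [Matrix.inv_def, Matrix.smul_apply, Ring.inverse_eq_inv', smul_eq_mul,
    Matrix.adjugate_apply]
  refine (hM.det.inv hz).mul (MSmoothAt.det ?_)
  intro a b
  by_cases h : a = j
  · subst h
    simp only [Matrix.updateRow_self]
    exact contDiffAt_const
  · simp only [Matrix.updateRow_ne h]
    exact hM a b

omit [Fintype m] in
lemma mderiv_congr {M N : E → Matrix l m ℂ} {z : E} (h : M =ᶠ[𝓝 z] N) (u : E) :
    mderiv M z u = mderiv N z u := by
  ext i j
  simp only [mderiv, of_apply]
  have h' : (fun z' => M z' i j) =ᶠ[𝓝 z] fun z' => N z' i j :=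
    h.mono fun z' hz' => congr_fun₂ hz' i j
  rw [h'.fderiv_eq]

omit [Fintype m] in
lemma MSmoothAt.mderiv {M : E → Matrix l m ℂ} {z : E} (hM : MSmoothAt M z) (v : E) :
    MDiffAt (fun z' => mderiv M z' v) z := fun i j =>
  (((hM i j).fderiv_right (m := 1) (by norm_cast)).differentiableAt
    (by simp)).clm_apply (differentiableAt_const _)

omit [Fintype m] in
lemma MSmoothAt.mderiv_comm {M : E → Matrix l m ℂ} {z : E} (hM : MSmoothAt M z) (u v : E) :
    ADHM.mderiv (fun z' => ADHM.mderiv M z' v) z u =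
      ADHM.mderiv (fun z' => ADHM.mderiv M z' u) z v := by
  ext i j
  have hd : DifferentiableAt ℝ (fderiv ℝ fun z' => M z' i j) z :=
    ((hM i j).fderiv_right (m := 1) (by norm_cast)).differentiableAt (by simp)
  have hs : IsSymmSndFDerivAt ℝ (fun z' => M z' i j) z :=
    (hM i j).isSymmSndFDerivAt (by simp [minSmoothness_of_isRCLikeNormedField]; norm_cast)
  simp only [ADHM.mderiv, of_apply]
  rw [fderiv_clm_apply hd (differentiableAt_const _), fderiv_clm_apply hd (differentiableAt_const _)]
  simpa using hs u v

omit [Fintype m] in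
lemma mderiv_conjTranspose {M : E → Matrix l m ℂ} {z : E} (hM : MDiffAt M z) (u : E) :
    mderiv (fun z => (M z)ᴴ) z u = (mderiv M z u)ᴴ := by
  ext i j
  have := (hM j i).hasFDerivAt.star.fderiv
  simp only [mderiv, of_apply, conjTranspose_apply, this]
  simp

variable {V : Type*} [NormedAddCommGroup V] [NormedSpace ℝ V] [FiniteDimensional ℝ V]

/-- The entries of a linear matrix-valued map. -/
def entryL (Λ : V →ₗ[ℝ] Matrix l m ℂ) (i : l) (j : m) : V →L[ℝ] ℂ := toContinuousLinearMap
    { toFun := fun w => Λ w i j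
      map_add' := by intro a b; simp
      map_smul' := by intro a b; simp }

omit [Fintype m] in
lemma mdiffAt_linear (Λ : V →ₗ[ℝ] Matrix l m ℂ) {g : E → V} {z : E}
    (hg : DifferentiableAt ℝ g z) : MDiffAt (fun z => Λ (g z)) z :=
  fun i j => (entryL Λ i j).differentiableAt.comp z hg

omit [Fintype m] in
lemma msmoothAt_linear (Λ : V →ₗ[ℝ] Matrix l m ℂ) {g : E → V} {z : E}
    (hg : ContDiffAt ℝ ∞ g z) : MSmoothAt (fun z => Λ (g z)) z :=
  fun i j => (entryL Λ i j).contDiff.contDiffAt.comp z hg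

omit [Fintype m] in
lemma mderiv_linear (Λ : V →ₗ[ℝ] Matrix l m ℂ) {g : E → V} {z : E}
    (hg : DifferentiableAt ℝ g z) (u : E) :
    mderiv (fun z => Λ (g z)) z u = Λ (fderiv ℝ g z u) := by
  ext i j
  exact congrArg (fun L : E →L[ℝ] ℂ => L u)
    (((entryL Λ i j).hasFDerivAt.comp z hg.hasFDerivAt).fderiv)

lemma fderiv_mulVec_const {M : E → Matrix l m ℂ} {z : E} (hM : MDiffAt M z) [Fintype l]
    (w : m → ℂ) (u : E) : fderiv ℝ (fun z => M z *ᵥ w) z u = mderiv M z u *ᵥ w := by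
  have h : ∀ i, HasFDerivAt (fun z => (M z *ᵥ w) i)
      (∑ j, (fderiv ℝ (fun z' => M z' i j) z).smulRight (w j)) z := by
    intro i
    simp only [mulVec, dotProduct]
    exact HasFDerivAt.fun_sum fun j _ => (hM i j).hasFDerivAt.mul_const' (w j)
  rw [(hasFDerivAt_pi.2 h).fderiv]
  ext i
  simp [mulVec, dotProduct, mderiv, ContinuousLinearMap.sum_apply]

end

lemma curvature_algebra_aux {n N : Type*} [Fintype n] [DecidableEq n] [Fintype N] [DecidableEq N]
    {P dPu dPv dd au av duav : Matrix N N ℂ} {R Ru Rv : Matrix n N ℂ} {F : Matrix n n ℂ}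
    (hP : P = 1 - Rᴴ * F * R) (hPP : P * P = P) (h1 : R * dPv = -(Rv * P))
    (h2 : dPu * Rᴴ = -(P * Ruᴴ)) (h3 : dPu = dPu * P + P * dPu) (hau : auᴴ = -au) :
    P * (dPu * (dPv - av * P) + P * (dd - (duav * P + av * dPu)) - au * (P * (dPv - av * P))) =
      P * ((Ru + R * au)ᴴ * F * (Rv + R * av) + au * av - duav) * P + P * dd - P * av * dPu -
        P * au * dPv := by
  have hQ : Rᴴ * F * R = 1 - P := by rw [hP]; abel
  have ku : P * dPu = -(P * Ruᴴ * F * R) := by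
    have e : P * dPu * P = 0 := by
      have := congrArg (fun M => P * M) h3
      simp only [mul_add] at this
      rw [← mul_assoc P P dPu, hPP, ← mul_assoc] at this
      simpa using this
    calc P * dPu = P * dPu * (1 - P) := by rw [mul_sub, mul_one, e, sub_zero]
      _ = P * (dPu * Rᴴ) * F * R := by rw [← hQ]; simp only [Matrix.mul_assoc]
      _ = _ := by rw [h2, Matrix.mul_neg, ← Matrix.mul_assoc P P, hPP]; simp only [Matrix.neg_mul]
  have t1 : P * dPu * dPv = P * Ruᴴ * F * Rv * P := by
    rw [ku, Matrix.neg_mul, Matrix.mul_assoc _ R, h1]; simp [Matrix.mul_assoc]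
  have t3 : P * dPu * av * P = -(P * Ruᴴ * F * R * av * P) := by rw [ku]; simp
  have t5 : P * au * P * dPv = P * au * dPv + P * au * Rᴴ * F * Rv * P := by
    have : P * au * (Rᴴ * F * (R * dPv)) = P * au * ((1 - P) * dPv) := by
      rw [← hQ]; simp only [Matrix.mul_assoc]
    rw [h1, sub_mul, one_mul, mul_sub] at this
    simp only [Matrix.mul_neg, ← Matrix.mul_assoc] at this
    rw [← sub_eq_iff_eq_add', ← neg_sub, ← this, neg_neg]
  have t7 : P * au * P * av * P = P * au * av * P - P * au * Rᴴ * F * R * av * P := by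
    have : P * au * (1 - P) * av * P = P * au * (Rᴴ * F * R) * av * P := by rw [hQ]
    rw [mul_sub, mul_one, sub_mul, sub_mul] at this
    simp only [← Matrix.mul_assoc] at this
    rw [← this]; abel
  simp only [conjTranspose_add, conjTranspose_mul, hau, Matrix.mul_add, Matrix.add_mul,
    Matrix.mul_sub, Matrix.sub_mul, Matrix.neg_mul, Matrix.mul_neg, ← Matrix.mul_assoc, hPP]
  rw [t1, t3, t5, t7]
  abel

lemma curvature_algebra {n N : Type*} [Fintype n] [DecidableEq n] [Fintype N] [DecidableEq N]
    {P dPu dPv dd au av duav dvau : Matrix N N ℂ} {R Ru Rv : Matrix n N ℂ} {F : Matrix n n ℂ}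
    (hP : P = 1 - Rᴴ * F * R) (hPP : P * P = P)
    (h1u : R * dPu = -(Ru * P)) (h1v : R * dPv = -(Rv * P))
    (h2u : dPu * Rᴴ = -(P * Ruᴴ)) (h2v : dPv * Rᴴ = -(P * Rvᴴ))
    (h3u : dPu = dPu * P + P * dPu) (h3v : dPv = dPv * P + P * dPv)
    (hau : auᴴ = -au) (hav : avᴴ = -av) :
    P * (dPu * (dPv - av * P) + P * (dd - (duav * P + av * dPu)) - au * (P * (dPv - av * P))) -
      P * (dPv * (dPu - au * P) + P * (dd - (dvau * P + au * dPv)) - av * (P * (dPu - au * P))) =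
    P * ((Ru + R * au)ᴴ * F * (Rv + R * av) - (Rv + R * av)ᴴ * F * (Ru + R * au) +
      (au * av - av * au) - (duav - dvau)) * P := by
  rw [curvature_algebra_aux hP hPP h1v h2u h3u hau, curvature_algebra_aux hP hPP h1u h2v h3v hav]
  simp only [mul_add, add_mul, mul_sub, sub_mul]
  abel

/-- The operator `R R*`. -/
def RR (z : R4 × Data k) : Matrix (Fin k × Fin 2) (Fin k × Fin 2) ℂ := Rop z.1 z.2 * (Rop z.1 z.2)ᴴ

lemma msmoothAt_Rop (z : R4 × Data k) : MSmoothAt (fun z : R4 × Data k => Rop z.1 z.2) z :=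
  msmoothAt_linear (RopL k) contDiffAt_id

lemma mderiv_Rop (z u : R4 × Data k) :
    mderiv (fun z : R4 × Data k => Rop z.1 z.2) z u = Rop u.1 u.2 := by
  have := mderiv_linear (RopL k) (differentiableAt_id (𝕜 := ℝ) (x := z)) u
  simpa using this

lemma msmoothAt_RR (z : R4 × Data k) : MSmoothAt (RR (k := k)) z :=
  (msmoothAt_Rop z).mul (msmoothAt_Rop z).conjTranspose

lemma msmoothAt_proj {z : R4 × Data k} (hz : (RR z).det ≠ 0) : MSmoothAt (proj (k := k)) z :=
  (msmoothAt_const 1 z).sub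
    (((msmoothAt_Rop z).conjTranspose.mul ((msmoothAt_RR z).inv hz)).mul (msmoothAt_Rop z))

lemma proj_eq (z : R4 × Data k) : proj z = 1 - (Rop z.1 z.2)ᴴ * (RR z)⁻¹ * Rop z.1 z.2 := rfl

lemma Rop_mul_proj {z : R4 × Data k} (hz : (RR z).det ≠ 0) : Rop z.1 z.2 * proj z = 0 := by
  rw [proj_eq, Matrix.mul_sub, Matrix.mul_one, ← Matrix.mul_assoc, ← Matrix.mul_assoc]
  change Rop z.1 z.2 - RR z * (RR z)⁻¹ * Rop z.1 z.2 = 0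
  rw [mul_nonsing_inv _ (Ne.isUnit hz), Matrix.one_mul, sub_self]

lemma RR_conjTranspose (z : R4 × Data k) : (RR z)ᴴ = RR z := by simp [RR, conjTranspose_mul]

lemma proj_conjTranspose (z : R4 × Data k) : (proj z)ᴴ = proj z := by
  rw [proj_eq]
  simp [conjTranspose_sub, conjTranspose_mul, Matrix.conjTranspose_nonsing_inv, RR_conjTranspose,
    Matrix.mul_assoc]

lemma proj_mul_Rop {z : R4 × Data k} (hz : (RR z).det ≠ 0) : proj z * (Rop z.1 z.2)ᴴ = 0 := by
  have := congrArg conjTranspose (Rop_mul_proj hz)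
  simpa [conjTranspose_mul, proj_conjTranspose] using this

lemma proj_mul_proj {z : R4 × Data k} (hz : (RR z).det ≠ 0) : proj z * proj z = proj z := by
  nth_rewrite 1 [proj_eq]
  rw [Matrix.sub_mul, Matrix.one_mul, Matrix.mul_assoc, Rop_mul_proj hz, Matrix.mul_zero, sub_zero]

/-- `rho` as a linear map. -/
def rhoL (k : ℕ) : gLie k →ₗ[ℝ] Matrix (Idx k) (Idx k) ℂ where
  toFun g := rho g
  map_add' g h := by
    ext (⟨i, s⟩ | s) (⟨j, t⟩ | t) <;>
      simp [rho, gLie.mat, kronecker_apply, add_mul, Matrix.sum_apply, sum_add_distrib]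
  map_smul' r g := by
    ext (⟨i, s⟩ | s) (⟨j, t⟩ | t) <;>
      simp [rho, gLie.mat, kronecker_apply, Matrix.sum_apply, mul_sum, mul_assoc]

@[simp] theorem rhoL_apply (g : gLie k) : rhoL k g = rho g := rfl

lemma eventually_det_ne {z : R4 × Data k} (hz : (RR z).det ≠ 0) : ∀ᶠ z' in 𝓝 z, (RR z').det ≠ 0 :=
  ((msmoothAt_RR z).det.continuousAt).eventually_ne hz

lemma covD_proj (v : R4 × Data k) {z : R4 × Data k} (hz : (RR z).det ≠ 0) (w : Idx k → ℂ) :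
    covD v (fun z' => proj z' *ᵥ w) z =
      (proj z * (mderiv proj z v - rho (theta z.2 v.2) * proj z)) *ᵥ w := by
  rw [covD, fderiv_mulVec_const (msmoothAt_proj hz).mdiffAt]
  simp only [mulVec_mulVec, ← sub_mulVec]

lemma curv_eq_of_differentiableAt {z : R4 × Data k} (hz : (RR z).det ≠ 0)
    (hθ : ∀ v, DifferentiableAt ℝ (fun y => theta y v) z.2) (u v : R4 × Data k) :
    curv z u v = proj z * ((Rop u.1 u.2 + Rop z.1 z.2 * rho (theta z.2 u.2))ᴴ * (RR z)⁻¹ *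
          (Rop v.1 v.2 + Rop z.1 z.2 * rho (theta z.2 v.2)) -
        (Rop v.1 v.2 + Rop z.1 z.2 * rho (theta z.2 v.2))ᴴ * (RR z)⁻¹ *
          (Rop u.1 u.2 + Rop z.1 z.2 * rho (theta z.2 u.2)) +
        (rho (theta z.2 u.2) * rho (theta z.2 v.2) - rho (theta z.2 v.2) * rho (theta z.2 u.2)) -
        (rho (fderiv ℝ (fun y => theta y v.2) z.2 u.2) -
          rho (fderiv ℝ (fun y => theta y u.2) z.2 v.2))) * proj z := by
  have hev := eventually_det_ne hz
  have hPs := msmoothAt_proj hz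
  have hP := hPs.mdiffAt
  have hθ' : ∀ w : R4 × Data k, DifferentiableAt ℝ (fun z' : R4 × Data k => theta z'.2 w.2) z :=
    fun w => (hθ w.2).comp z differentiableAt_snd
  have ha : ∀ w : R4 × Data k, MDiffAt (fun z' : R4 × Data k => rho (theta z'.2 w.2)) z :=
    fun w => mdiffAt_linear (rhoL k) (hθ' w)
  have hda : ∀ w t : R4 × Data k, mderiv (fun z' : R4 × Data k => rho (theta z'.2 w.2)) z t =
      rho (fderiv ℝ (fun y => theta y w.2) z.2 t.2) := by
    intro w t
    have h1 := mderiv_linear (rhoL k) (hθ' w) t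
    simp only [rhoL_apply] at h1
    have h2 : HasFDerivAt (fun z' : R4 × Data k => theta z'.2 w.2)
      ((fderiv ℝ (fun y => theta y w.2) z.2).comp (ContinuousLinearMap.snd ℝ R4 (Data k))) z :=
      (hθ w.2).hasFDerivAt.comp z hasFDerivAt_snd
    rw [h1, h2.fderiv]
    rfl
  have hW : ∀ w : R4 × Data k, MDiffAt
      (fun z' => proj z' * (mderiv proj z' w - rho (theta z'.2 w.2) * proj z')) z :=
    fun w => hP.mul ((hPs.mderiv w).sub ((ha w).mul hP))
  have hcov : ∀ (w t : R4 × Data k) (c : Idx k → ℂ), covD t (covD w fun z' => proj z' *ᵥ c) z =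
      (proj z * (mderiv (fun z' => proj z' * (mderiv proj z' w - rho (theta z'.2 w.2) * proj z'))
        z t - rho (theta z.2 t.2) *
          (proj z * (mderiv proj z w - rho (theta z.2 w.2) * proj z)))) *ᵥ c := by
    intro w t c
    have he : covD w (fun z' => proj z' *ᵥ c) =ᶠ[𝓝 z]
        fun z' => (proj z' * (mderiv proj z' w - rho (theta z'.2 w.2) * proj z')) *ᵥ c :=
      hev.mono fun z' hz' => covD_proj w hz' c
    rw [covD, he.fderiv_eq, he.eq_of_nhds, fderiv_mulVec_const (hW w)]
    simp only [mulVec_mulVec, ← sub_mulVec]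
  have hdW : ∀ w t : R4 × Data k,
      mderiv (fun z' => proj z' * (mderiv proj z' w - rho (theta z'.2 w.2) * proj z')) z t =
      mderiv proj z t * (mderiv proj z w - rho (theta z.2 w.2) * proj z) +
        proj z * (mderiv (fun z' => mderiv proj z' w) z t -
          (rho (fderiv ℝ (fun y => theta y w.2) z.2 t.2) * proj z +
            rho (theta z.2 w.2) * mderiv proj z t)) := by
    intro w t
    rw [mderiv_mul hP ((hPs.mderiv w).sub ((ha w).mul hP)), mderiv_sub (hPs.mderiv w) ((ha w).mul
      hP), mderiv_mul (ha w) hP, hda]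
  have hcurv : curv z u v =
      proj z * (mderiv (fun z' => proj z' * (mderiv proj z' v - rho (theta z'.2 v.2) * proj z'))
        z u - rho (theta z.2 u.2) * (proj z * (mderiv proj z v - rho (theta z.2 v.2) * proj z))) -
      proj z * (mderiv (fun z' => proj z' * (mderiv proj z' u - rho (theta z'.2 u.2) * proj z'))
        z v - rho (theta z.2 v.2) *
          (proj z * (mderiv proj z u - rho (theta z.2 u.2) * proj z))) := by
    ext i j
    simp only [curv, of_apply, Pi.sub_apply, hcov]
    simp only [mulVec_single_one, Matrix.col_apply, Matrix.sub_apply]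
  have h1 : ∀ t : R4 × Data k, Rop z.1 z.2 * mderiv proj z t = -(Rop t.1 t.2 * proj z) := by
    intro t
    have h := mderiv_mul (msmoothAt_Rop z).mdiffAt hP t
    have he : (fun z' : R4 × Data k => Rop z'.1 z'.2 * proj z') =ᶠ[𝓝 z] fun _ => 0 :=
      hev.mono fun z' hz' => Rop_mul_proj hz'
    rw [mderiv_congr he, mderiv_const, mderiv_Rop] at h
    exact (neg_eq_of_add_eq_zero_right h.symm).symm
  have h0 : ∀ t : R4 × Data k, (mderiv proj z t)ᴴ = mderiv proj z t := by
    intro t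
    rw [← mderiv_conjTranspose hP]
    simp only [proj_conjTranspose]
  have h2 : ∀ t : R4 × Data k, mderiv proj z t * (Rop z.1 z.2)ᴴ = -(proj z * (Rop t.1 t.2)ᴴ) := by
    intro t
    have := congrArg conjTranspose (h1 t)
    simpa [conjTranspose_mul, h0, proj_conjTranspose] using this
  have h3 : ∀ t : R4 × Data k, mderiv proj z t = mderiv proj z t * proj z + proj z * mderiv proj z t := by
    intro t
    rw [← mderiv_mul hP hP]
    exact (mderiv_congr (hev.mono fun z' hz' => proj_mul_proj hz') t).symm
  rw [hcurv, hdW, hdW, hPs.mderiv_comm v u]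
  exact curvature_algebra (proj_eq z) (proj_mul_proj hz) (h1 u) (h1 v) (h2 u) (h2 v) (h3 u) (h3 v)
    (rho_conjTranspose _) (rho_conjTranspose _)

lemma metric_apply (y z : Data k) :
    metric k y z = ∑ a, ((∑ i, ∑ j, (star (y.T a i j) * z.T a i j).re) +
      2 * ∑ i, (star (y.P a i) * z.P a i).re) := rfl

lemma metric_comm (y z : Data k) : metric k y z = metric k z y := by
  simp only [metric_apply]
  refine sum_ext fun a _ => ?_
  congr 1
  · refine sum_ext fun i _ => sum_ext fun j _ => ?_
    simp; ring
  · congr 1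
    refine sum_ext fun i _ => ?_
    simp; ring

lemma metric_self_nonneg (y : Data k) : 0 ≤ metric k y y := by
  have h : ∀ c : ℂ, 0 ≤ (star c * c).re := fun c => by
    simp [← normSq_eq_conj_mul_self, Complex.normSq_nonneg]
  rw [metric_apply]
  exact sum_nonneg fun a _ => add_nonneg (sum_nonneg fun i _ => sum_nonneg fun j _ => h _)
    (mul_nonneg zero_le_two (sum_nonneg fun i _ => h _))

lemma metric_self_eq_zero (h : metric k y y = 0) : y = 0 := by
  have h0 : ∀ c : ℂ, 0 ≤ (star c * c).re := fun c => by
    simp [← normSq_eq_conj_mul_self, Complex.normSq_nonneg]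
  have h1 : ∀ c : ℂ, (star c * c).re = 0 → c = 0 := fun c hc => by
    simpa [← normSq_eq_conj_mul_self] using hc
  have hT : ∀ a, 0 ≤ ∑ i, ∑ j, (star (y.T a i j) * y.T a i j).re := fun a =>
    sum_nonneg fun i _ => sum_nonneg fun j _ => h0 _
  have hP : ∀ a, 0 ≤ ∑ i, (star (y.P a i) * y.P a i).re := fun a => sum_nonneg fun i _ => h0 _
  rw [metric_apply, sum_eq_zero_iff_of_nonneg fun a _ => by
    have := hT a; have := hP a; positivity] at h
  have h' : ∀ a, (∑ i, ∑ j, (star (y.T a i j) * y.T a i j).re) = 0 ∧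
      (∑ i, (star (y.P a i) * y.P a i).re) = 0 := fun a => by
    have := h a (mem_univ _)
    have := hT a
    have := hP a
    constructor <;> linarith
  refine Prod.ext (Subtype.ext ?_) ?_
  · funext a i j
    have e := (sum_eq_zero_iff_of_nonneg fun i _ =>
      sum_nonneg fun j _ => h0 _).1 (h' a).1 i (mem_univ _)
    exact h1 _ ((sum_eq_zero_iff_of_nonneg fun j _ => h0 _).1 e j (mem_univ _))
  · funext a i
    exact h1 _ ((sum_eq_zero_iff_of_nonneg fun i _ => h0 _).1 (h' a).2 i (mem_univ _))

/-- The infinitesimal action is locally free at `y`. -/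
def IsFree (y : Data k) : Prop := ∀ ξ, X k ξ y = 0 → ξ = 0

lemma orbitPairing_orbitMap_apply (y : Data k) (ξ η : gLie k) :
    (orbitPairing y ∘L orbitMap y) ξ η = metric k (X k ξ y) (X k η y) := rfl

lemma IsFree.isInvertible (h : IsFree y) : (orbitPairing y ∘L orbitMap y).IsInvertible := by
  have hinj : Function.Injective (orbitPairing y ∘L orbitMap y).toLinearMap := by
    refine (injective_iff_map_eq_zero (orbitPairing y ∘L orbitMap y).toLinearMap).2 fun ξ hξ => ?_
    apply h
    apply metric_self_eq_zero
    rw [← orbitPairing_orbitMap_apply]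
    exact congrArg (fun L : gLie k →L[ℝ] ℝ => L ξ) hξ
  have hdim : Module.finrank ℝ (gLie k) = Module.finrank ℝ (gLie k →L[ℝ] ℝ) := by
    rw [← (toContinuousLinearMap (𝕜 := ℝ) (E := gLie k) (F' := ℝ)).finrank_eq]
    exact (Subspace.dual_finrank_eq (K := ℝ) (V := gLie k)).symm
  refine ⟨(LinearEquiv.ofInjectiveOfFinrankEq _ hinj hdim).toContinuousLinearEquiv, ?_⟩
  exact ContinuousLinearMap.ext fun ξ => ContinuousLinearMap.ext fun η => rfl

lemma metric_theta (h : IsFree y) (v : Data k) (ξ : gLie k) :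
    metric k (X k (theta y v) y) (X k ξ y) = metric k v (X k ξ y) := by
  obtain ⟨e, he⟩ := h.isInvertible
  have h1 : (orbitPairing y ∘L orbitMap y) (theta y v) = orbitPairing y v := by
    rw [theta, ← he, ContinuousLinearMap.inverse_equiv]
    simp
  exact congrArg (fun L : gLie k →L[ℝ] ℝ => L ξ) h1

lemma contDiff_orbitMap : ContDiff ℝ ∞ (orbitMap (k := k)) := (toContinuousLinearMap
    { toFun := fun y : Data k => orbitMap y
      map_add' := by intro a b; refine ContinuousLinearMap.ext fun g => ?_; simp [orbitMap]
      map_smul' := by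
        intro a b; refine ContinuousLinearMap.ext fun g => ?_; simp [orbitMap] }).contDiff

lemma contDiff_orbitPairing : ContDiff ℝ ∞ (orbitPairing (k := k)) := (toContinuousLinearMap
    { toFun := fun y : Data k => orbitPairing y
      map_add' := by
        intro a b
        refine ContinuousLinearMap.ext fun v => ContinuousLinearMap.ext fun g => ?_
        simp [orbitPairing]
      map_smul' := by
        intro a b
        refine ContinuousLinearMap.ext fun v => ContinuousLinearMap.ext fun g => ?_
        simp [orbitPairing] }).contDiff

lemma contDiffAt_theta (h : IsFree y) : ContDiffAt ℝ ∞ (theta (k := k)) y := by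
  have h1 : ContDiffAt ℝ ∞ (fun y : Data k => orbitPairing y ∘L orbitMap y) y :=
    ((contDiff_orbitPairing (k := k)).clm_comp (contDiff_orbitMap (k := k))).contDiffAt
  exact (h.isInvertible.contDiffAt_map_inverse.comp y h1).clm_comp
    (contDiff_orbitPairing (k := k)).contDiffAt

lemma eventually_isFree (h : IsFree y) : ∀ᶠ y' in 𝓝 y, IsFree y' := by
  have h1 : ContinuousAt (fun y : Data k => orbitPairing y ∘L orbitMap y) y :=
    ((contDiff_orbitPairing (k := k)).clm_comp (contDiff_orbitMap (k := k))).continuous.continuousAt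
  obtain ⟨e, he⟩ := h.isInvertible
  have h2 := h1.eventually (he ▸ ContinuousLinearEquiv.nhds e)
  filter_upwards [h2] with y' hy' ξ hξ
  obtain ⟨e', he'⟩ := hy'
  have : e' ξ = 0 := by
    have h3 : (e' : gLie k →L[ℝ] (gLie k →L[ℝ] ℝ)) ξ = 0 := by
      rw [he']
      refine ContinuousLinearMap.ext fun η => ?_
      change metric k (X k ξ y') (X k η y') = 0
      simp [hξ]
    exact h3
  simpa using this

lemma metric_X (ξ : gLie k) (v w : Data k) : metric k (X k ξ v) w = -metric k v (X k ξ w) := by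
  have hg : ∀ i j, star (ξ.mat i j) = -ξ.mat j i := fun i j => by
    have := congr_fun₂ ξ.mat_conjTranspose j i
    simpa using this
  have hT : ∀ a, (∑ i, ∑ j, (star ((X k ξ v).T a i j) * w.T a i j).re) =
      -∑ i, ∑ j, (star (v.T a i j) * (X k ξ w).T a i j).re := by
    intro a
    have e : ∀ p q : Mat k, (∑ i, ∑ j, (star (p i j) * q i j).re) = (Matrix.trace (pᴴ * q)).re := by
      intro p q
      simp only [Matrix.trace, diag, Matrix.mul_apply, conjTranspose_apply, re_sum]
      exact sum_comm
    rw [e, e, ← neg_re, ← trace_neg, X_T, X_T]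
    congr 1
    simp only [conjTranspose_sub, conjTranspose_mul, ξ.mat_conjTranspose, Matrix.sub_mul,
      Matrix.mul_sub, trace_sub, trace_neg, Matrix.mul_neg, Matrix.neg_mul, v.T_conjTranspose,
      Matrix.mul_assoc]
    rw [trace_mul_comm ξ.mat]
    simp only [Matrix.mul_assoc]
    ring
  have hP : (∑ a, ∑ i, (star ((X k ξ v).P a i) * w.P a i).re) =
      -∑ a, ∑ i, (star (v.P a i) * (X k ξ w).P a i).re := by
    have e1 : ∀ a, (∑ i, star (∑ j, ξ.mat i j * v.P a j) * w.P a i) =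
        -∑ i, star (v.P a i) * ∑ j, ξ.mat i j * w.P a j := by
      intro a
      simp only [star_sum, star_mul', hg, sum_mul, mul_sum]
      rw [sum_comm, ← sum_neg_distrib]
      refine sum_ext fun i _ => ?_
      rw [← sum_neg_distrib]
      exact sum_ext fun j _ => by ring
    have e2 : ∀ i, (∑ a, star (∑ b, ∑ c : Fin 3,
          v.P b i * ((ξ.2 c * coord (quat b * quat c.succ) a : ℝ) : ℂ)) * w.P a i) =
        -∑ a, star (v.P a i) * ∑ b, ∑ c : Fin 3,
          w.P b i * ((ξ.2 c * coord (quat b * quat c.succ) a : ℝ) : ℂ) := by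
      intro i
      simp only [coord_mul, sum_univ_four, sum_univ_three]
      simp [quat]
      ring
    simp only [← re_sum, ← neg_re, X_P, star_sub, sub_mul, mul_sub, sum_sub_distrib, e1]
    congr 1
    have e3 : (∑ a, ∑ i, star (∑ b, ∑ c : Fin 3,
          v.P b i * ((ξ.2 c * coord (quat b * quat c.succ) a : ℝ) : ℂ)) * w.P a i) =
        -∑ a, ∑ i, star (v.P a i) * ∑ b, ∑ c : Fin 3,
          w.P b i * ((ξ.2 c * coord (quat b * quat c.succ) a : ℝ) : ℂ) := by
      rw [sum_comm, sum_ext fun i _ => e2 i, sum_neg_distrib, sum_comm]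
    rw [e3, sum_neg_distrib]
    ring
  simp only [metric_apply, sum_add_distrib, ← mul_sum, hT, hP, sum_neg_distrib]
  ring

lemma Rop_zero_injective {y z : Data k} (h : Rop 0 y = Rop 0 z) : y = z := by
  have e : ∀ p q, Rop 0 y p q = Rop 0 z p q := fun p q => by rw [h]
  refine Prod.ext (Subtype.ext ?_) ?_
  · funext a i j
    have h00 := e (i, 0) (inl (j, 0))
    have h01 := e (i, 0) (inl (j, 1))
    have h10 := e (i, 1) (inl (j, 0))
    have h11 := e (i, 1) (inl (j, 1))
    simp [Rop_eq, tau, Matrix.sum_apply, sum_univ_four, spin] at h00 h01 h10 h11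
    change y.T a i j = z.T a i j
    have hI := I_mul_I
    fin_cases a <;> simp
    · linear_combination (h00 + h11) / 2
    · linear_combination I * (h00 - h11) / 2 + (y.T 1 i j - z.T 1 i j) * hI
    · linear_combination (h10 - h01) / 2
    · linear_combination I * (h10 + h01) / 2 + (y.T 3 i j - z.T 3 i j) * hI
  · funext a i
    have h00 := e (i, 0) (inr 0)
    have h01 := e (i, 0) (inr 1)
    have h10 := e (i, 1) (inr 0)
    have h11 := e (i, 1) (inr 1)
    simp [Rop_eq, Pblock, sum_univ_four, spin] at h00 h01 h10 h11
    change y.P a i = z.P a i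
    have hI := I_mul_I
    fin_cases a <;> simp
    · linear_combination (h00 + h11) / 2
    · linear_combination -I * (h00 - h11) / 2 + (y.P 1 i - z.P 1 i) * hI
    · linear_combination (h01 - h10) / 2
    · linear_combination -I * (h10 + h01) / 2 + (y.P 3 i - z.P 3 i) * hI

/-- The Lie bracket of `𝔲(k) ⊕ 𝔰𝔭(1)`. -/
def bracket (g h : gLie k) : gLie k := (⟨fun i j => (g.mat * h.mat - h.mat * g.mat) i j, by
    intro i j
    have : (g.mat * h.mat - h.mat * g.mat)ᴴ = -(g.mat * h.mat - h.mat * g.mat) := by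
      simp [conjTranspose_sub, conjTranspose_mul, gLie.mat_conjTranspose]
    have := congr_fun₂ this i j
    simp only [conjTranspose_apply, Matrix.neg_apply] at this
    rw [this, neg_neg]⟩,
   ![2 * (g.2 1 * h.2 2 - g.2 2 * h.2 1), 2 * (g.2 2 * h.2 0 - g.2 0 * h.2 2),
     2 * (g.2 0 * h.2 1 - g.2 1 * h.2 0)])

lemma bracket_mat (g h : gLie k) : (bracket g h).mat = g.mat * h.mat - h.mat * g.mat := rfl

lemma rho_bracket (g h : gLie k) : rho (bracket g h) = rho g * rho h - rho h * rho g := by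
  simp only [rho, Matrix.fromBlocks_multiply, bracket_mat, Matrix.mul_zero, Matrix.zero_mul,
    add_zero, zero_add, ← mul_kronecker_mul, mul_one]
  rw [sub_eq_add_neg (fromBlocks _ _ _ _), fromBlocks_neg, fromBlocks_add]
  congr 1
  · ext ⟨i, s⟩ ⟨j, t⟩
    simp [kronecker_apply, sub_mul]
    ring
  · simp
  · simp
  · ext s t
    fin_cases s <;> fin_cases t <;>
      simp [bracket, spin, sum_univ_three, Matrix.mul_apply, sum_univ_two] <;>
      ring_nf <;> simp only [I_sq] <;> ring

lemma X_bracket (g h : gLie k) (y : Data k) :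
    X k (bracket g h) y = X k g (X k h y) - X k h (X k g y) := by
  apply Rop_zero_injective
  have e := map_sub (RopL k) ((0 : R4), X k g (X k h y)) (0, X k h (X k g y))
  simp only [RopL_apply, Prod.mk_sub_mk, sub_zero] at e
  rw [e, Rop_X _ 0, Rop_X _ 0 (X k h y), Rop_X _ 0 (X k g y), Rop_X h 0 y, Rop_X g 0 y, rho_bracket,
    bracket_mat]
  have e2 : (g.mat * h.mat - h.mat * g.mat) ⊗ₖ (1 : Mat 2) =
      g.mat ⊗ₖ (1 : Mat 2) * h.mat ⊗ₖ (1 : Mat 2) -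
      h.mat ⊗ₖ (1 : Mat 2) * g.mat ⊗ₖ (1 : Mat 2) := by
    rw [← mul_kronecker_mul, ← mul_kronecker_mul]
    ext ⟨i, s⟩ ⟨j, t⟩
    simp [kronecker_apply, sub_mul]
  rw [e2]
  simp only [Matrix.mul_sub, Matrix.sub_mul, Matrix.mul_assoc]
  abel

/-- The component of a vector orthogonal to the orbit. -/
def hor (y v : Data k) : Data k := v - X k (theta y v) y

lemma metric_hor (h : IsFree y) (v : Data k) (ξ : gLie k) : metric k (hor y v) (X k ξ y) = 0 := by
  rw [hor, map_sub, LinearMap.sub_apply, metric_theta h, sub_self]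

lemma metric_fderiv_theta (h : IsFree y) (u v : Data k) (ξ : gLie k) :
    metric k (X k (fderiv ℝ (fun y => theta y v) y u) y) (X k ξ y) =
      metric k (hor y v) (X k ξ u) - metric k (X k (theta y v) u) (X k ξ y) := by
  have hd : HasFDerivAt (fun y => theta y v) (fderiv ℝ (fun y => theta y v) y) y :=
    (((contDiffAt_theta h).differentiableAt (by simp)).clm_apply
      (differentiableAt_const v)).hasFDerivAt
  set B : gLie k →L[ℝ] Data k →L[ℝ] Data k := toContinuousLinearMap
    ((toContinuousLinearMap (𝕜 := ℝ) (E := Data k) (F' := Data k)).toLinearMap ∘ₗ X k)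
    with hB
  have hBa : ∀ g y, B g y = X k g y := fun g y => rfl
  set M : Data k →L[ℝ] Data k →L[ℝ] ℝ := toContinuousLinearMap
    ((toContinuousLinearMap (𝕜 := ℝ) (E := Data k) (F' := ℝ)).toLinearMap ∘ₗ metric k)
    with hM
  have hMa : ∀ g y, M g y = metric k g y := fun g y => rfl
  have h1 : HasFDerivAt (fun y => B (theta y v) y)
      (B.precompR (Data k) (theta y v) (ContinuousLinearMap.id ℝ (Data k)) +
        B.precompL (Data k) (fderiv ℝ (fun y => theta y v) y) y) y :=
    B.hasFDerivAt_of_bilinear hd (hasFDerivAt_id y)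
  have h2 : HasFDerivAt (fun y => B ξ y) (B ξ) y := (B ξ).hasFDerivAt
  have h3 := (M.hasFDerivAt_of_bilinear h1 h2).sub ((M v).hasFDerivAt.comp y h2)
  have h4 : (fun y => M (B (theta y v) y) (B ξ y) - M v (B ξ y)) =ᶠ[𝓝 y] fun _ => (0 : ℝ) :=
    (eventually_isFree h).mono fun y' hy' => by
      change metric k _ _ - metric k _ _ = 0
      rw [sub_eq_zero]
      exact metric_theta hy' v ξ
  have h5 := congrArg (fun L : Data k →L[ℝ] ℝ => L u) (h3.fderiv.symm.trans h4.fderiv_eq)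
  simp [hBa, hMa] at h5
  rw [hor, map_sub, LinearMap.sub_apply]
  linarith

lemma metric_curvature_theta (h : IsFree y) (u v : Data k) (ξ : gLie k) :
    metric k (X k (fderiv ℝ (fun y => theta y v) y u - fderiv ℝ (fun y => theta y u) y v -
      bracket (theta y u) (theta y v)) y) (X k ξ y) =
      2 * metric k (hor y v) (X k ξ (hor y u)) := by
  have hu : u = hor y u + X k (theta y u) y := by simp [hor]
  have hv : v = hor y v + X k (theta y v) y := by simp [hor]
  have key : ∀ w (a : gLie k), metric k w (X k ξ (X k a y)) =
      metric k w (X k (bracket ξ a) y) - metric k (X k a w) (X k ξ y) := by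
    intro w a
    rw [X_bracket, map_sub, metric_X a]
    ring
  rw [map_sub, map_sub, LinearMap.sub_apply, LinearMap.sub_apply, map_sub, map_sub,
    LinearMap.sub_apply, LinearMap.sub_apply, metric_fderiv_theta h, metric_fderiv_theta h,
    X_bracket]
  have e1 : metric k (hor y v) (X k ξ u) = metric k (hor y v) (X k ξ (hor y u)) -
      metric k (X k (theta y u) (hor y v)) (X k ξ y) := by
    nth_rewrite 1 [hu]
    rw [map_add, map_add, key, metric_hor h]
    ring
  have e2 : metric k (hor y u) (X k ξ v) = -metric k (hor y v) (X k ξ (hor y u)) -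
      metric k (X k (theta y v) (hor y u)) (X k ξ y) := by
    nth_rewrite 1 [hv]
    rw [map_add, map_add, key, metric_hor h, ← metric_comm (X k ξ (hor y v)), metric_X]
    ring
  have e3 : metric k (X k (theta y v) u) (X k ξ y) =
      metric k (X k (theta y v) (hor y u)) (X k ξ y) +
      metric k (X k (theta y v) (X k (theta y u) y)) (X k ξ y) := by
    nth_rewrite 1 [hu]
    rw [map_add, map_add, LinearMap.add_apply]
  have e4 : metric k (X k (theta y u) v) (X k ξ y) =
      metric k (X k (theta y u) (hor y v)) (X k ξ y) +
      metric k (X k (theta y u) (X k (theta y v) y)) (X k ξ y) := by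
    nth_rewrite 1 [hv]
    rw [map_add, map_add, LinearMap.add_apply]
  rw [e1, e2, e3, e4, map_sub, LinearMap.sub_apply]
  ring

/-- The curvature form of the connection with horizontal spaces orthogonal to the orbits. -/
def omega (y u v : Data k) : gLie k :=
  fderiv ℝ (fun y => theta y v) y u - fderiv ℝ (fun y => theta y u) y v -
    bracket (theta y u) (theta y v)

lemma Rop_add (x x' : R4) (y y' : Data k) : Rop (x + x') (y + y') = Rop x y + Rop x' y' :=
  (RopL k).map_add (x, y) (x', y')

lemma Rop_sub (x x' : R4) (y y' : Data k) : Rop (x - x') (y - y') = Rop x y - Rop x' y' :=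
  (RopL k).map_sub (x, y) (x', y')

/-- The unprojected curvature: second fundamental form of the subbundle on horizontal vectors
minus the action of the curvature of the principal connection. -/
def curvCore (z u v : R4 × Data k) : Matrix (Idx k) (Idx k) ℂ :=
  (Rop u.1 (hor z.2 u.2))ᴴ * (RR z)⁻¹ * Rop v.1 (hor z.2 v.2) -
    (Rop v.1 (hor z.2 v.2))ᴴ * (RR z)⁻¹ * Rop u.1 (hor z.2 u.2) - rho (omega z.2 u.2 v.2)

lemma curv_eq {z : R4 × Data k} (hz : (RR z).det ≠ 0)
    (hθ : ∀ v, DifferentiableAt ℝ (fun y => theta y v) z.2)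
    (u v : R4 × Data k) : curv z u v = proj z * curvCore z u v * proj z := by
  rw [curv_eq_of_differentiableAt hz hθ]
  have hH : ∀ w : R4 × Data k, (Rop w.1 w.2 + Rop z.1 z.2 * rho (theta z.2 w.2)) * proj z =
      Rop w.1 (hor z.2 w.2) * proj z := by
    intro w
    have : Rop w.1 (hor z.2 w.2) = Rop w.1 w.2 - Rop 0 (X k (theta z.2 w.2) z.2) := by
      rw [← Rop_sub, sub_zero, hor]
    rw [this, Rop_X _ z.1, Matrix.add_mul, Matrix.sub_mul, Matrix.sub_mul, Matrix.mul_assoc _ (Rop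
      z.1 z.2), Rop_mul_proj hz]
    simp
  have hH' : ∀ w : R4 × Data k, proj z * (Rop w.1 w.2 + Rop z.1 z.2 * rho (theta z.2 w.2))ᴴ =
      proj z * (Rop w.1 (hor z.2 w.2))ᴴ := by
    intro w
    have := congrArg conjTranspose (hH w)
    simpa only [conjTranspose_mul, proj_conjTranspose] using this
  have hω : rho (theta z.2 u.2) * rho (theta z.2 v.2) - rho (theta z.2 v.2) * rho (theta z.2 u.2) -
      (rho (fderiv ℝ (fun y => theta y v.2) z.2 u.2) -
          rho (fderiv ℝ (fun y => theta y u.2) z.2 v.2)) = -rho (omega z.2 u.2 v.2) := by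
    rw [← rho_bracket, omega, ← rhoL_apply, ← rhoL_apply, ← rhoL_apply, ← rhoL_apply, map_sub,
      map_sub]
    abel
  rw [add_sub_assoc, hω, curvCore]
  have hu := hH u
  have hv := hH v
  have hu' := hH' u
  have hv' := hH' v
  generalize Rop u.1 u.2 + Rop z.1 z.2 * rho (theta z.2 u.2) = Hu at *
  generalize Rop v.1 v.2 + Rop z.1 z.2 * rho (theta z.2 v.2) = Hv at *
  simp only [Matrix.mul_add, Matrix.add_mul, Matrix.mul_sub, Matrix.sub_mul, ← Matrix.mul_assoc,
    hu', hv']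
  simp only [Matrix.mul_assoc, hu, hv]
  simp only [Matrix.mul_neg, Matrix.neg_mul, sub_eq_add_neg]

section

variable {V : Type*} [NormedAddCommGroup V] [InnerProductSpace ℂ V] [FiniteDimensional ℂ V]

lemma exists_eigenvector_mem (B : V →ₗ[ℂ] V) (K : Submodule ℂ V) (hK : K ≠ ⊥)
    (hB : ∀ v ∈ K, B v ∈ K) : ∃ v ∈ K, v ≠ 0 ∧ ∃ β : ℂ, B v = β • v := by
  have : Nontrivial K := Submodule.nontrivial_iff_ne_bot.2 hK
  obtain ⟨β, hβ⟩ := Module.End.exists_eigenvalue (B.restrict hB)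
  obtain ⟨v, hv⟩ := hβ.exists_hasEigenvector
  refine ⟨v, v.2, fun h => hv.2 (Subtype.ext h), β, ?_⟩
  exact congrArg Subtype.val hv.apply_eq_smul

lemma exists_common_eigenvector [Nontrivial V] (A B A' B' : V →ₗ[ℂ] V) (p q : V)
    (hA : ∀ v w, inner ℂ (A v) w = inner ℂ v (A' w)) (hB : ∀ v w, inner ℂ (B v) w = inner ℂ v (B' w))
    (hAB : ∀ v, A (B v) - B (A v) = -(inner ℂ q v • p)) :
    (∃ v ≠ 0, (∃ α : ℂ, A v = α • v) ∧ (∃ β : ℂ, B v = β • v) ∧ inner ℂ q v = 0) ∨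
    (∃ v ≠ 0, (∃ α : ℂ, A' v = α • v) ∧ (∃ β : ℂ, B' v = β • v) ∧ inner ℂ p v = 0) := by
  obtain ⟨α, hα⟩ := Module.End.exists_eigenvalue A
  set K := LinearMap.ker (A - α • LinearMap.id) with hKdef
  have hKmem : ∀ v, v ∈ K ↔ A v = α • v := fun v => by simp [hKdef, LinearMap.mem_ker, sub_eq_zero]
  have hK : K ≠ ⊥ := by
    obtain ⟨v, hv⟩ := hα.exists_hasEigenvector
    intro h
    exact hv.2 ((Submodule.mem_bot ℂ).1 (h ▸ (hKmem v).2 hv.apply_eq_smul))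
  by_cases hq : ∀ v ∈ K, inner ℂ q v = 0
  · left
    obtain ⟨v, hvK, hv0, β, hβ⟩ := exists_eigenvector_mem B K hK (by
      intro v hv
      rw [hKmem]
      have := hAB v
      rw [hq v hv, (hKmem v).1 hv, map_smul, zero_smul, neg_zero, sub_eq_zero] at this
      exact this)
    exact ⟨v, hv0, ⟨α, (hKmem v).1 hvK⟩, ⟨β, hβ⟩, hq v hvK⟩
  · right
    push Not at hq
    obtain ⟨w, hwK, hw⟩ := hq
    set I := LinearMap.range (A - α • LinearMap.id) with hI
    have hp : p ∈ I := by
      refine ⟨-(inner ℂ q w)⁻¹ • B w, ?_⟩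
      have := hAB w
      rw [(hKmem w).1 hwK, map_smul] at this
      simp only [LinearMap.sub_apply, LinearMap.smul_apply, id_apply, map_smul]
      rw [this, smul_neg, neg_smul, neg_neg, smul_smul, inv_mul_cancel₀ hw, one_smul]
    have hBI : ∀ v ∈ I, B v ∈ I := by
      rintro _ ⟨v, rfl⟩
      have e : B ((A - α • LinearMap.id : V →ₗ[ℂ] V) v) =
          (A - α • LinearMap.id : V →ₗ[ℂ] V) (B v) + inner ℂ q v • p := by
        have := hAB v
        simp only [LinearMap.sub_apply, LinearMap.smul_apply, id_apply, map_sub, map_smul]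
        rw [sub_eq_iff_eq_add] at this
        rw [this]; abel
      rw [e]
      exact I.add_mem ⟨_, rfl⟩ (I.smul_mem _ hp)
    have hIo : Iᗮ ≠ ⊥ := by
      rw [Ne, Submodule.orthogonal_eq_bot_iff]
      intro h
      apply hK
      exact ker_eq_bot.2 (LinearMap.injective_iff_surjective.2 (range_eq_top.1 h))
    obtain ⟨v, hvI, hv0, β, hβ⟩ := exists_eigenvector_mem B' Iᗮ hIo (by
      intro v hv u hu
      rw [← hB]
      exact hv _ (hBI u hu))
    refine ⟨v, hv0, ⟨(starRingEnd ℂ) α, ?_⟩, ⟨β, hβ⟩, hvI p hp⟩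
    rw [← sub_eq_zero, ← inner_self_eq_zero (𝕜 := ℂ)]
    have : ∀ u, inner ℂ u (A' v - (starRingEnd ℂ) α • v) = 0 := by
      intro u
      have := hvI _ ⟨u, rfl⟩
      simp only [LinearMap.sub_apply, LinearMap.smul_apply, id_apply, inner_sub_left,
        inner_smul_left] at this
      rw [inner_sub_right, inner_smul_right, ← hA, this]
    exact this _

end

lemma Rop_conjTranspose_mulVec_injective {x : R4}
    (h : Function.Surjective (Rop x y).mulVec) {w : Fin k × Fin 2 → ℂ}
    (hw : (Rop x y)ᴴ *ᵥ w = 0) : w = 0 := by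
  obtain ⟨v, rfl⟩ := h w
  have : star (Rop x y *ᵥ v) ⬝ᵥ (Rop x y *ᵥ v) = 0 := by
    rw [star_mulVec, ← dotProduct_mulVec, hw, dotProduct_zero]
  exact dotProduct_star_self_eq_zero.1 this

lemma det_RR_ne_zero {x : R4} (h : Function.Surjective (Rop x y).mulVec) : (RR (x, y)).det ≠ 0 := by
  intro h0
  obtain ⟨v, hv, hv0⟩ := exists_mulVec_eq_zero_iff.2 h0
  exact hv (Rop_conjTranspose_mulVec_injective h
    ((Matrix.self_mul_conjTranspose_mulVec_eq_zero _ _).1 hv0))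

/-- The two halves of the block `P`. -/
def Phalf (y : Data k) (s : Fin 2) : Matrix (Fin k) (Fin 2) ℂ :=
  Matrix.of fun i u => Pblock y (i, s) u

/-- The element of `𝔰𝔭(1)` as a matrix. -/
def spMat (g : gLie k) : Mat 2 := ∑ c : Fin 3, ((g.2 c : ℝ) : ℂ) • spin c.succ

lemma Abar_complex_equation (hy : y ∈ Abar k) : (y.T 0 - I • y.T 1) * (y.T 2 + I • y.T 3) -
      (y.T 2 + I • y.T 3) * (y.T 0 - I • y.T 1) =
      -(Phalf y 0 * (Phalf y 1)ᴴ) := by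
  have h := Rop_mul_conjTranspose 0 y
  rw [sum_ext fun c _ => by rw [hy c, zero_kronecker], sum_const_zero, add_zero] at h
  ext i j
  have h1 := congr_fun₂ h (i, 0) (j, 1)
  rw [Rop_eq, Matrix.conjTranspose_fromCols_eq_fromRows_conjTranspose, Matrix.fromCols_mul_fromRows]
    at h1
  have e1 : (Pblock y * (Pblock y)ᴴ) (i, 0) (j, 1) = (Phalf y 0 * (Phalf y 1)ᴴ) i j := by
    simp [Matrix.mul_apply, Phalf]
  rw [Matrix.add_apply, e1] at h1
  have e2 : ((∑ a, tau 0 y a ⊗ₖ (spin a)ᴴ) * (∑ a, tau 0 y a ⊗ₖ (spin a)ᴴ)ᴴ) (i, 0) (j, 1) =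
      ((y.T 0 - I • y.T 1) * (y.T 2 + I • y.T 3) -
      (y.T 2 + I • y.T 3) * (y.T 0 - I • y.T 1)) i j := by
    simp only [conjTranspose_sum, conjTranspose_kronecker, conjTranspose_conjTranspose,
      tau_conjTranspose, sum_mul_sum, ← mul_kronecker_mul, spin_star_mul, coord_star_mul]
    simp only [sum_univ_four]
    simp [kronecker_apply, spin, tau, sub_mul, mul_sub, add_mul, mul_add, quat]
    ring_nf
    simp only [I_sq]
    ring
  rw [e2] at h1
  simp [kronecker_apply] at h1
  rw [Matrix.neg_apply, Matrix.sub_apply]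
  linear_combination h1

lemma eq_zero_of_mulVec {x : R4} (h : Function.Surjective (Rop x y).mulVec)
    {v : Fin k → ℂ} (s : Fin 2) (hT : ∀ t, ∑ a, spin a t s • (tau x y a *ᵥ v) = 0)
    (hP : (Phalf y s)ᴴ *ᵥ v = 0) : v = 0 := by
  have hw : (Rop x y)ᴴ *ᵥ (fun p => if p.2 = s then v p.1 else 0) = 0 := by
    ext (⟨j, t⟩ | u)
    · have e := congrFun (hT t) j
      simp only [Finset.sum_apply, Pi.smul_apply, mulVec, dotProduct, smul_eq_mul, Pi.zero_apply]
        at e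
      refine Eq.trans ?_ e
      simp only [mulVec, dotProduct, conjTranspose_apply, Rop_eq, fromCols_apply_inl,
        Fintype.sum_prod_type, mul_ite, mul_zero, Finset.sum_ite_eq', sum_ite_eq, mem_univ, if_true]
      simp only [Matrix.sum_apply, kronecker_apply, star_sum, star_mul', conjTranspose_apply,
        star_star, sum_mul, mul_sum]
      rw [sum_comm]
      refine sum_ext fun a _ => sum_ext fun i _ => ?_
      have := congr_fun₂ (tau_conjTranspose x y a) j i
      rw [conjTranspose_apply] at this
      rw [this]
      ring
    · have e := congrFun hP u
      simpa [mulVec, dotProduct, Rop_eq, Fintype.sum_prod_type, Phalf] using e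
  have := Rop_conjTranspose_mulVec_injective h hw
  ext i
  simpa using congrFun this (i, s)

lemma spMat_conjTranspose (g : gLie k) : (spMat g)ᴴ = -spMat g := by
  ext s t
  fin_cases s <;> fin_cases t <;> simp [spMat, sum_univ_three, spin] <;> ring

lemma spMat_trace (g : gLie k) : (spMat g).trace = 0 := by
  simp [spMat, sum_univ_three, spin, trace_fin_two]

lemma eq_zero_of_spMat_eq_zero {g : gLie k} (h : spMat g = 0) : g.2 = 0 := by
  have h0 := congr_fun₂ h 0 0
  have h1 := congr_fun₂ h 0 1
  simp [spMat, sum_univ_three, spin] at h0 h1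
  have h2 := congrArg Complex.re h1
  have h3 := congrArg Complex.im h1
  simp at h2 h3
  ext c
  fin_cases c <;> simp [h0, h2, h3]

lemma mat_mul_Phalf {g : gLie k} (h : X k g y = 0) (s : Fin 2) :
    g.mat * Phalf y s = Phalf y s * spMat g := by
  have e := Rop_X g 0 y
  rw [h] at e
  have e0 : Rop (0 : R4) (0 : Data k) = 0 := (RopL k).map_zero
  rw [e0, Rop_eq, Matrix.mul_fromCols, rho, Matrix.fromCols_mul_fromBlocks] at e
  ext i u
  have e1 := congr_fun₂ e (i, s) (inr u)
  rw [Matrix.sub_apply, fromCols_apply_inr, fromCols_apply_inr, Matrix.mul_zero, zero_add] at e1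
  have e2 : (g.mat ⊗ₖ (1 : Mat 2) * Pblock y) (i, s) u = (g.mat * Phalf y s) i u := by
    simp [Matrix.mul_apply, Fintype.sum_prod_type, kronecker_apply, Matrix.one_apply, Phalf]
  rw [← e2]
  exact sub_eq_zero.1 e1.symm

lemma mat_commute_T {g : gLie k} (h : X k g y = 0) (a : Fin 4) : g.mat * y.T a = y.T a * g.mat := by
  have : (X k g y).T a = 0 := by rw [h]; rfl
  rwa [X_T, sub_eq_zero] at this

lemma exists_spanning_eigenvector (N : Mat 2) (μ : ℂ) (hN : N.trace = 0)
    (h : N ≠ 0 ∨ μ ≠ 0) : ∃ e : Fin 2 → ℂ, N *ᵥ e = μ • e ∧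
      ∀ c, N *ᵥ c = μ • c → star e ⬝ᵥ c = 0 → c = 0 := by
  by_cases hc : ∀ c, N *ᵥ c = μ • c → c = 0
  · exact ⟨0, by simp, fun c h _ => hc c h⟩
  push Not at hc
  obtain ⟨e, he, he0⟩ := hc
  refine ⟨e, he, fun c hcc hec => ?_⟩
  by_contra hc0
  have hs : ∀ w : Fin 2 → ℂ, w ≠ 0 → star w ⬝ᵥ w ≠ 0 := fun w hw h' =>
    hw (dotProduct_star_self_eq_zero.1 h')
  set Q : Mat 2 := !![e 0, c 0; e 1, c 1] with hQ
  have hdet : Q.det ≠ 0 := by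
    intro hd
    rw [hQ, Matrix.det_fin_two_of] at hd
    have hec' : star (e 0) * c 0 + star (e 1) * c 1 = 0 := by
      simpa [dotProduct, sum_univ_two] using hec
    have hse := hs e he0
    simp only [dotProduct, sum_univ_two, Pi.star_apply] at hse
    apply hc0
    ext i
    fin_cases i
    · apply mul_left_cancel₀ hse
      simp only [Fin.zero_eta, Pi.zero_apply, mul_zero]
      linear_combination e 0 * hec' - star (e 1) * hd
    · apply mul_left_cancel₀ hse
      simp only [Fin.mk_one, Pi.zero_apply, mul_zero]
      linear_combination e 1 * hec' + star (e 0) * hd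
  have hNQ : N * Q = μ • Q := by
    ext i j
    have h1 := congrFun he i
    have h2 := congrFun hcc i
    simp only [mulVec, dotProduct, sum_univ_two, Pi.smul_apply, smul_eq_mul] at h1 h2
    fin_cases j
    · simpa [hQ, Matrix.mul_apply, sum_univ_two] using (by fin_cases i <;> simpa using h1)
    · simpa [hQ, Matrix.mul_apply, sum_univ_two] using (by fin_cases i <;> simpa using h2)
  have hNμ : N = μ • 1 := by
    have := congrArg (fun M => M * Q⁻¹) hNQ
    simpa [Matrix.mul_assoc, mul_nonsing_inv _ (Ne.isUnit hdet)] using this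
  have hμ : μ = 0 := by
    rw [hNμ] at hN
    simpa [trace_fin_two] using hN
  rw [hμ, zero_smul] at hNμ
  tauto

lemma exists_dual_spanning_eigenvector (N : Mat 2) (μ : ℂ) (hN : N.trace = 0)
    (h : N ≠ 0 ∨ μ ≠ 0) : ∃ e e' : Fin 2 → ℂ, N *ᵥ e = μ • e ∧ N *ᵥ e' = μ • e' ∧
      ∀ c, N *ᵥ c = μ • c → c = (star e ⬝ᵥ c) • e' ∧
        (star e ⬝ᵥ c = 0 ∨ star e' ⬝ᵥ c = 0 → c = 0) := by
  obtain ⟨e, he, h'⟩ := exists_spanning_eigenvector N μ hN h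
  by_cases he0 : e = 0
  · refine ⟨0, 0, by simp, by simp, fun c hc => ?_⟩
    simp [h' c hc (by simp [he0])]
  · have hn := mt dotProduct_star_self_eq_zero.1 he0
    refine ⟨e, (star e ⬝ᵥ e)⁻¹ • e, he, by rw [mulVec_smul, he, smul_comm], fun c hc =>
      ⟨sub_eq_zero.1 (h' _ ?_ ?_), fun h0 => h' c hc ?_⟩⟩
    · simp only [Matrix.mulVec_sub, mulVec_smul, hc, he, smul_sub, smul_comm μ]
    · rw [dotProduct_sub, smul_smul, dotProduct_smul, smul_eq_mul, inv_mul_cancel_right₀ hn, sub_self]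
    · rw [star_smul, smul_dotProduct, smul_eq_zero, star_eq_zero, inv_eq_zero] at h0
      tauto

lemma eq_zero_of_mat_eigenvector (hy : y ∈ A k) {g : gLie k} (h : X k g y = 0)
    {μ : ℂ} (hμ : spMat g ≠ 0 ∨ μ ≠ 0) {v : Fin k → ℂ} (hv : g.mat *ᵥ v = μ • v) : v = 0 := by
  by_contra hv0
  obtain ⟨e, e', he, he', hspan⟩ := exists_dual_spanning_eigenvector _ μ (spMat_trace g) hμ
  set L := fun M : Mat k => Matrix.toEuclideanLin M with hL
  set V : Submodule ℂ (EuclideanSpace ℂ (Fin k)) := LinearMap.ker (L g.mat - μ • LinearMap.id)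
  have hV : ∀ w, w ∈ V ↔ g.mat *ᵥ w.ofLp = μ • w.ofLp := by
    intro w
    simp only [V, LinearMap.mem_ker, LinearMap.sub_apply, sub_eq_zero]
    exact ⟨congrArg WithLp.ofLp, fun h => WithLp.ofLp_injective 2 h⟩
  have : Nontrivial V := ⟨⟨⟨WithLp.toLp 2 v, (hV _).2 hv⟩, 0, fun h =>
    hv0 (congrArg (fun w : V => w.1.ofLp) h)⟩⟩
  have hR : ∀ M : Mat k, g.mat * M = M * g.mat → ∀ w ∈ V, L M w ∈ V := by
    intro M hM w hw
    rw [hV] at hw ⊢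
    change g.mat *ᵥ (M *ᵥ w.ofLp) = μ • (M *ᵥ w.ofLp)
    rw [mulVec_mulVec, hM, ← mulVec_mulVec, hw, mulVec_smul]
  have hc := mat_commute_T h
  have hPV : ∀ s {e}, spMat g *ᵥ e = μ • e → WithLp.toLp 2 (Phalf y s *ᵥ e) ∈ V := by
    intro s e he
    rw [hV, mulVec_mulVec, mat_mul_Phalf h, ← mulVec_mulVec, he, mulVec_smul]
  have hPN : ∀ s (w : V), spMat g *ᵥ ((Phalf y s)ᴴ *ᵥ w.1.ofLp) = μ • ((Phalf y s)ᴴ *ᵥ w.1.ofLp) := by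
    intro s w
    have := congrArg conjTranspose (mat_mul_Phalf h s)
    rw [conjTranspose_mul, conjTranspose_mul, spMat_conjTranspose, g.mat_conjTranspose,
      Matrix.mul_neg, Matrix.neg_mul, neg_inj] at this
    rw [mulVec_mulVec, ← this, ← mulVec_mulVec, (hV w).1 w.2, mulVec_smul]
  have hinner : ∀ s e (w : EuclideanSpace ℂ (Fin k)), inner ℂ (WithLp.toLp 2 (Phalf y s *ᵥ e)) w =
      star e ⬝ᵥ ((Phalf y s)ᴴ *ᵥ w.ofLp) := by
    intro s e w
    rw [EuclideanSpace.inner_eq_star_dotProduct, dotProduct_comm, star_mulVec, ← dotProduct_mulVec]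
  have hadj : ∀ M M' (hM : Mᴴ = M') (v w : EuclideanSpace ℂ (Fin k)),
      inner ℂ (L M v) w = inner ℂ v (L M' w) := by
    rintro M _ rfl v w
    change WithLp.ofLp w ⬝ᵥ star (M *ᵥ v.ofLp) = (Mᴴ *ᵥ w.ofLp) ⬝ᵥ star v.ofLp
    rw [dotProduct_comm, star_mulVec, ← dotProduct_mulVec, dotProduct_comm]
  have hx : ∀ α β : ℂ, ∃ x : R4, (x 0 : ℂ) - I * x 1 = α ∧ (x 2 : ℂ) + I * x 3 = β :=
    fun α β => ⟨!₂[α.re, -α.im, β.re, β.im], by simp [mul_comm I, re_add_im],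
      by simp [mul_comm I, re_add_im]⟩
  rcases exists_common_eigenvector
    ((L (y.T 0 - I • y.T 1)).restrict (hR _ (by simp [mul_sub, sub_mul, hc])))
    ((L (y.T 2 + I • y.T 3)).restrict (hR _ (by simp [mul_add, add_mul, hc])))
    ((L (y.T 0 + I • y.T 1)).restrict (hR _ (by simp [mul_add, add_mul, hc])))
    ((L (y.T 2 - I • y.T 3)).restrict (hR _ (by simp [mul_sub, sub_mul, hc])))
    ⟨_, hPV 0 he'⟩ ⟨_, hPV 1 he⟩
    (fun v w => hadj _ _ (by
      simp [conjTranspose_sub, conjTranspose_smul, y.T_conjTranspose]) v.1 w.1)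
    (fun v w => hadj _ _ (by simp [conjTranspose_smul, y.T_conjTranspose, sub_eq_add_neg]) v.1 w.1)
    (by
      intro w
      refine Subtype.ext (WithLp.ofLp_injective 2 ?_)
      change (y.T 0 - I • y.T 1) *ᵥ ((y.T 2 + I • y.T 3) *ᵥ w.1.ofLp) -
        (y.T 2 + I • y.T 3) *ᵥ ((y.T 0 - I • y.T 1) *ᵥ w.1.ofLp) =
        -(inner ℂ (WithLp.toLp 2 (Phalf y 1 *ᵥ e)) w.1 • (Phalf y 0 *ᵥ e'))
      rw [mulVec_mulVec, mulVec_mulVec, ← sub_mulVec, Abar_complex_equation hy.1, Matrix.neg_mulVec,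
        ← mulVec_mulVec, (hspan _ (hPN 1 w)).1, mulVec_smul, hinner]) with
    ⟨w, hw0, ⟨α, hα⟩, ⟨β, hβ⟩, hq⟩ | ⟨w, hw0, ⟨α, hα⟩, ⟨β, hβ⟩, hq⟩ <;>
  replace hα := congrArg (fun v : V => v.1.ofLp) hα <;>
  replace hβ := congrArg (fun v : V => v.1.ofLp) hβ
  · obtain ⟨x, rfl, rfl⟩ := hx α β
    refine hw0 (Subtype.ext (WithLp.ofLp_injective 2 (eq_zero_of_mulVec (hy.2 x) 1 (fun t => ?_)
      ((hspan _ (hPN 1 w)).2 (Or.inl ((hinner 1 e w.1).symm.trans hq))))))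
    change (y.T 0 - I • y.T 1) *ᵥ w.1.ofLp = _ • w.1.ofLp at hα
    change (y.T 2 + I • y.T 3) *ᵥ w.1.ofLp = _ • w.1.ofLp at hβ
    simp only [tau, sub_mulVec, add_mulVec, smul_mulVec, one_mulVec, sum_univ_four] at hα hβ ⊢
    ext j
    have a := congrFun hα j
    have b := congrFun hβ j
    fin_cases t <;> simp [spin] at a b ⊢
    · linear_combination b
    · linear_combination a
  · obtain ⟨x, hx0, hx1⟩ := hx (starRingEnd ℂ α) (starRingEnd ℂ β)
    replace hx0 := congrArg (starRingEnd ℂ) hx0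
    replace hx1 := congrArg (starRingEnd ℂ) hx1
    simp at hx0 hx1
    refine hw0 (Subtype.ext (WithLp.ofLp_injective 2 (eq_zero_of_mulVec (hy.2 x) 0 (fun t => ?_)
      ((hspan _ (hPN 0 w)).2 (Or.inr ((hinner 0 e' w.1).symm.trans hq))))))
    change (y.T 0 + I • y.T 1) *ᵥ w.1.ofLp = α • w.1.ofLp at hα
    change (y.T 2 - I • y.T 3) *ᵥ w.1.ofLp = β • w.1.ofLp at hβ
    simp only [tau, sub_mulVec, add_mulVec, smul_mulVec, one_mulVec, sum_univ_four, ← hx0, ← hx1]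
      at hα hβ ⊢
    ext j
    have a := congrFun hα j
    have b := congrFun hβ j
    fin_cases t <;> simp [spin] at a b ⊢
    · linear_combination a
    · linear_combination -b

lemma isFree_of_mem_A (hk : 0 < k) (hy : y ∈ A k) : IsFree y := by
  intro g hg
  have : Nonempty (Fin k) := ⟨⟨0, hk⟩⟩
  by_cases hN : spMat g = 0
  · refine Prod.ext (Subtype.ext ?_) (eq_zero_of_spMat_eq_zero hN)
    change g.mat = 0
    have hH : (I • g.mat).IsHermitian := by
      rw [Matrix.IsHermitian, conjTranspose_smul, g.mat_conjTranspose]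
      simp
    have h0 : I • g.mat = 0 := by
      rw [← hH.eigenvalues_eq_zero_iff]
      ext i
      by_contra hne
      have h1 := hH.mulVec_eigenvectorBasis i
      have h2 : (hH.eigenvectorBasis i).ofLp = 0 := by
        refine eq_zero_of_mat_eigenvector hy hg (μ := -I * hH.eigenvalues i) (Or.inr ?_) ?_
        · simpa using hne
        · rw [smul_mulVec] at h1
          have := congrArg (fun w => (-I) • w) h1
          simp only [smul_smul] at this
          rw [neg_mul, I_mul_I, neg_neg, one_smul] at this
          rw [this]
          ext j
          simp [mul_assoc]
      exact (hH.eigenvectorBasis.orthonormal.ne_zero i) (WithLp.ofLp_injective 2 h2)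
    simpa using h0
  · exfalso
    obtain ⟨μ, hμ⟩ := Module.End.exists_eigenvalue (Matrix.mulVecLin g.mat)
    obtain ⟨v, hv⟩ := hμ.exists_hasEigenvector
    exact hv.2 (eq_zero_of_mat_eigenvector hy hg (Or.inl hN) hv.apply_eq_smul)

/-- The matrix of right multiplication by an imaginary unit. -/
def rightJ (c : Fin 3) (a b : Fin 4) : ℝ := coord (star (quat a) * quat b) c.succ

/-- The matrix of left multiplication by an imaginary unit. -/
def leftJ (c : Fin 3) (a b : Fin 4) : ℝ := coord (quat a * star (quat b)) c.succ

lemma rightJ_antisymm (c : Fin 3) (a b : Fin 4) : rightJ c b a = -rightJ c a b := by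
  simp only [rightJ, coord_star_mul]
  fin_cases c <;> fin_cases a <;> fin_cases b <;> simp [quat]

lemma leftJ_antisymm (c : Fin 3) (a b : Fin 4) : leftJ c b a = -leftJ c a b := by
  simp only [leftJ, coord_mul_star]
  fin_cases c <;> fin_cases a <;> fin_cases b <;> simp [quat]

lemma sum_rightJ_mul_self (c : Fin 3) (a b : Fin 4) :
    ∑ e, rightJ c a e * rightJ c e b = if a = b then -1 else 0 := by
  simp only [rightJ, coord_star_mul]
  fin_cases c <;> fin_cases a <;> fin_cases b <;> simp [quat, sum_univ_four]

lemma sum_leftJ_mul_self (c : Fin 3) (a b : Fin 4) :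
    ∑ e, leftJ c a e * leftJ c e b = if a = b then -1 else 0 := by
  simp only [leftJ, coord_mul_star]
  fin_cases c <;> fin_cases a <;> fin_cases b <;> simp [quat, sum_univ_four]

lemma exists_mul_eq {c c' : Fin 3} (h : c ≠ c') : ∃ (e : Fin 3) (r : ℝ),
    (∀ a b, ∑ d, rightJ c a d * rightJ c' d b = r * rightJ e a b) ∧
    (∀ a b, ∑ d, leftJ c a d * leftJ c' d b = r * leftJ e a b) := by
  have key : ∀ (c c' e : Fin 3) (r : ℝ),
      ((∀ a b, ∑ d, rightJ c a d * rightJ c' d b = r * rightJ e a b) ∧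
      (∀ a b, ∑ d, leftJ c a d * leftJ c' d b = r * leftJ e a b)) →
      ∃ (e : Fin 3) (r : ℝ),
      (∀ a b, ∑ d, rightJ c a d * rightJ c' d b = r * rightJ e a b) ∧
      (∀ a b, ∑ d, leftJ c a d * leftJ c' d b = r * leftJ e a b) :=
    fun c c' e r h => ⟨e, r, h⟩
  have hsum : c.1 + c'.1 = 1 ∨ c.1 + c'.1 = 2 ∨ c.1 + c'.1 = 3 := by
    have := c.2; have := c'.2
    have : c.1 ≠ c'.1 := fun e => h (Fin.ext e)
    omega
  simp only [rightJ, leftJ, coord_star_mul, coord_mul_star] at key ⊢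
  fin_cases c <;> fin_cases c'
  · exact absurd rfl h
  · refine key _ _ 2 1 ⟨fun a b => ?_, fun a b => ?_⟩ <;> fin_cases a <;> fin_cases b <;>
      simp [quat, sum_univ_four]
  · refine key _ _ 1 (-1) ⟨fun a b => ?_, fun a b => ?_⟩ <;> fin_cases a <;> fin_cases b <;>
      simp [quat, sum_univ_four]
  · refine key _ _ 2 (-1) ⟨fun a b => ?_, fun a b => ?_⟩ <;> fin_cases a <;> fin_cases b <;>
      simp [quat, sum_univ_four]
  · exact absurd rfl h
  · refine key _ _ 0 1 ⟨fun a b => ?_, fun a b => ?_⟩ <;> fin_cases a <;> fin_cases b <;>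
      simp [quat, sum_univ_four]
  · refine key _ _ 1 1 ⟨fun a b => ?_, fun a b => ?_⟩ <;> fin_cases a <;> fin_cases b <;>
      simp [quat, sum_univ_four]
  · refine key _ _ 0 (-1) ⟨fun a b => ?_, fun a b => ?_⟩ <;> fin_cases a <;> fin_cases b <;>
      simp [quat, sum_univ_four]
  · exact absurd rfl h

/-- Recombination of the four quaternionic components by real matrices. -/
def recombine (α β : Fin 4 → Fin 4 → ℝ) : Data k →ₗ[ℝ] Data k where
  toFun y := (∑ b, (⟨fun a i j => (α a b : ℂ) * y.1.1 b i j, by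
    intro a i j
    have := y.1.2 b i j
    dsimp only
    rw [this]; simp⟩ : hermQuat k), fun a i => ∑ b, (β a b : ℂ) * y.2 b i)
  map_add' y z := by
    refine Prod.ext (Subtype.ext ?_) ?_
    · funext a i j
      simp [sum_univ_four]; ring
    · funext a i
      simp [sum_univ_four]; ring
  map_smul' r y := by
    refine Prod.ext (Subtype.ext ?_) ?_
    · funext a i j
      simp [sum_univ_four]; ring
    · funext a i
      simp [sum_univ_four]; ring

lemma recombine_T (α β : Fin 4 → Fin 4 → ℝ) (y : Data k) (a : Fin 4) :
    (recombine α β y).T a = ∑ b, ((α a b : ℝ) : ℂ) • y.T b := by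
  ext i j
  simp [Data.T, recombine, sum_univ_four]

lemma recombine_P (α β : Fin 4 → Fin 4 → ℝ) (y : Data k) (a : Fin 4) :
    (recombine α β y).P a = ∑ b, ((β a b : ℝ) : ℂ) • y.P b := by
  ext i
  simp [Data.P, recombine, sum_univ_four]

lemma Data.ext' {y z : Data k} (hT : ∀ a, y.T a = z.T a) (hP : ∀ a, y.P a = z.P a) : y = z := by
  refine Prod.ext (Subtype.ext ?_) ?_
  · funext a
    exact Matrix.of.injective (hT a)
  · funext a
    exact hP a

lemma recombine_recombine (α β α' β' : Fin 4 → Fin 4 → ℝ) (y : Data k) :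
    recombine α β (recombine α' β' y) =
      recombine (fun a b => ∑ d, α a d * α' d b) (fun a b => ∑ d, β a d * β' d b) y := by
  refine Data.ext' (fun a => ?_) fun a => ?_
  · simp only [recombine_T, smul_sum, smul_smul]
    rw [sum_comm]
    refine sum_ext fun b _ => ?_
    rw [← sum_smul]
    congr 1
    push_cast
    rfl
  · simp only [recombine_P, smul_sum, smul_smul]
    rw [sum_comm]
    refine sum_ext fun b _ => ?_
    rw [← sum_smul]
    congr 1
    push_cast
    rfl

/-- The three complex structures of the data space. -/
def J (c : Fin 3) : Data k →ₗ[ℝ] Data k := recombine (rightJ c) (leftJ c)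

lemma J_J_self (c : Fin 3) (y : Data k) : J c (J c y) = -y := by
  rw [J, recombine_recombine]
  refine Data.ext' (fun a => ?_) fun a => ?_
  · simp only [recombine_T, sum_rightJ_mul_self]
    rw [sum_eq_single a (fun b _ hb => by simp [Ne.symm hb]) (by simp)]
    simp [Data.T]
  · simp only [recombine_P, sum_leftJ_mul_self]
    rw [sum_eq_single a (fun b _ hb => by simp [Ne.symm hb]) (by simp)]
    simp [Data.P]

lemma exists_J_J_eq {c c' : Fin 3} (h : c ≠ c') : ∃ (e : Fin 3) (r : ℝ), ∀ y : Data k,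
    J c (J c' y) = r • J e y := by
  obtain ⟨e, r, h1, h2⟩ := exists_mul_eq h
  refine ⟨e, r, fun y => ?_⟩
  rw [J, J, J, recombine_recombine]
  simp only [h1, h2]
  refine Data.ext' (fun a => ?_) fun a => ?_
  · rw [recombine_T]
    ext i j
    simp [Data.T, recombine, sum_univ_four, mul_add, mul_assoc]
  · rw [recombine_P]
    ext i
    simp [Data.P, recombine, sum_univ_four, mul_add, mul_assoc]

lemma metric_eq_trace (y z : Data k) : metric k y z = ∑ a, ((Matrix.trace (y.T a * z.T a)).re +
      2 * (star (y.P a) ⬝ᵥ z.P a).re) := by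
  rw [metric_apply]
  refine sum_ext fun a _ => ?_
  congr 1
  · simp only [Matrix.trace, diag, Matrix.mul_apply, re_sum]
    rw [sum_comm]
    refine sum_ext fun i _ => sum_ext fun j _ => ?_
    rw [show y.T a i j = star (y.T a j i) from (congr_fun₂ (y.T_conjTranspose a) i j).symm]
  · simp [dotProduct, re_sum]

lemma metric_J (c : Fin 3) (y z : Data k) : metric k (J c y) z = -metric k y (J c z) := by
  simp only [metric_eq_trace, J, recombine_T, recombine_P, Matrix.sum_mul, Matrix.mul_sum,
    trace_sum, re_sum, smul_mul_assoc, mul_smul_comm, trace_smul, smul_eq_mul, star_sum, star_smul,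
    sum_dotProduct, dotProduct_sum, smul_dotProduct, dotProduct_smul, star_def, conj_ofReal,
    re_ofReal_mul]
  rw [sum_add_distrib, sum_add_distrib, neg_add]
  congr 1
  · rw [sum_comm, ← sum_neg_distrib]
    refine sum_ext fun a _ => ?_
    rw [← sum_neg_distrib]
    refine sum_ext fun b _ => ?_
    rw [rightJ_antisymm, neg_mul]
  · simp only [mul_sum]
    rw [sum_comm, ← sum_neg_distrib]
    refine sum_ext fun a _ => ?_
    rw [← sum_neg_distrib]
    refine sum_ext fun b _ => ?_
    rw [leftJ_antisymm]; ring

/-- The polarization of the moment map. -/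
def mom (y z : Data k) (c : Fin 3) : Mat k :=
  ∑ a, (y.T a * (J c z).T a + vecMulVec (y.P a) (star ((J c z).P a)))

lemma moment_eq (y : Data k) (c : Fin 3) : moment y c = mom y y c := by
  simp only [moment, mom, Data.T_conjTranspose]
  refine sum_ext fun a _ => ?_
  rw [sum_add_distrib]
  congr 1
  · rw [J, recombine_T, Matrix.mul_sum]
    simp only [mul_smul_comm]
    rfl
  · rw [J, recombine_P]
    ext i j
    simp [vecMulVec_apply, sum_univ_four, leftJ]
    ring

lemma sum_mul_J_T (y z : Data k) (c : Fin 3) :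
    ∑ a, y.T a * (J c z).T a = -∑ a, (J c y).T a * z.T a := by
  simp only [J, recombine_T, Matrix.mul_sum, Matrix.sum_mul, mul_smul_comm, smul_mul_assoc]
  rw [sum_comm, ← sum_neg_distrib]
  refine sum_ext fun a _ => ?_
  rw [← sum_neg_distrib]
  refine sum_ext fun b _ => ?_
  rw [rightJ_antisymm]; push_cast; rw [neg_smul]

lemma sum_vecMulVec_J_P (y z : Data k) (c : Fin 3) : ∑ a, vecMulVec (y.P a) (star ((J c z).P a)) =
      -∑ a, vecMulVec ((J c y).P a) (star (z.P a)) := by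
  ext i j
  simp only [J, recombine_P, Matrix.sum_apply, Matrix.neg_apply, vecMulVec_apply, Finset.sum_apply,
    Pi.smul_apply, Pi.star_apply, star_sum, star_smul, star_def, conj_ofReal, mul_sum, sum_mul,
    smul_eq_mul]
  rw [sum_comm, ← sum_neg_distrib]
  refine sum_ext fun a _ => ?_
  rw [← sum_neg_distrib]
  refine sum_ext fun b _ => ?_
  rw [leftJ_antisymm]; push_cast; simp; ring

lemma mom_conjTranspose (y z : Data k) (c : Fin 3) : (mom y z c)ᴴ = -mom z y c := by
  rw [mom, mom, conjTranspose_sum, sum_add_distrib, sum_mul_J_T z y, sum_vecMulVec_J_P z y, ←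
    neg_add, neg_neg, ← sum_add_distrib]
  refine sum_ext fun a _ => ?_
  rw [conjTranspose_add, conjTranspose_mul, Data.T_conjTranspose, Data.T_conjTranspose,
    Matrix.conjTranspose_vecMulVec, star_star]

/-- An element of `𝔲(k)` as an infinitesimal symmetry. -/
def toG (ξ : uLie k) : gLie k := (ξ, 0)

lemma X_toG_T (ξ : uLie k) (y : Data k) (a : Fin 4) :
    (X k (toG ξ) y).T a = (toG ξ).mat * y.T a - y.T a * (toG ξ).mat := rfl

lemma X_toG_P (ξ : uLie k) (y : Data k) (a : Fin 4) :
    (X k (toG ξ) y).P a = (toG ξ).mat *ᵥ y.P a := by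
  funext i
  rw [X_P]
  simp [toG, mulVec, dotProduct]

lemma metric_X_J (ξ : uLie k) (y z : Data k) (c : Fin 3) : metric k (X k (toG ξ) y) (J c z) =
      (Matrix.trace ((toG ξ).mat * (mom y z c + mom z y c))).re := by
  have h1 : mom z y c = -∑ a, ((J c z).T a * y.T a + vecMulVec ((J c z).P a) (star (y.P a))) := by
    rw [mom, sum_add_distrib, sum_mul_J_T, sum_vecMulVec_J_P, ← neg_add, sum_add_distrib]
  rw [h1, mom, ← sub_eq_add_neg, ← sum_sub_distrib, metric_eq_trace, Matrix.mul_sum, trace_sum,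
    re_sum]
  refine sum_ext fun a _ => ?_
  rw [X_toG_T, X_toG_P]
  set g := (toG ξ).mat with hg
  set W := J c z
  have e1 : Matrix.trace (g * vecMulVec (W.P a) (star (y.P a))) =
      -(star (g *ᵥ y.P a) ⬝ᵥ W.P a) := by
    rw [mul_vecMulVec, Matrix.trace_vecMulVec, star_mulVec, gLie.mat_conjTranspose,
      Matrix.vecMul_neg, neg_dotProduct, neg_neg, ← dotProduct_mulVec, dotProduct_comm]
  have e2 : Matrix.trace (g * vecMulVec (y.P a) (star (W.P a))) =
      star (star (g *ᵥ y.P a) ⬝ᵥ W.P a) := by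
    rw [mul_vecMulVec, Matrix.trace_vecMulVec, Matrix.star_dotProduct, dotProduct_comm]
    simp
  have e3 : Matrix.trace ((g * y.T a - y.T a * g) * W.T a) =
      Matrix.trace (g * (y.T a * W.T a)) - Matrix.trace (g * (W.T a * y.T a)) := by
    rw [sub_mul, trace_sub, mul_assoc]
    congr 1
    rw [mul_assoc, trace_mul_comm, mul_assoc]
  rw [e3, show g * (y.T a * W.T a + vecMulVec (y.P a) (star (W.P a)) -
      (W.T a * y.T a + vecMulVec (W.P a) (star (y.P a)))) =
      g * (y.T a * W.T a) - g * (W.T a * y.T a) +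
      (g * vecMulVec (y.P a) (star (W.P a)) - g * vecMulVec (W.P a) (star (y.P a)))
      by simp only [mul_add, mul_sub]; abel]
  rw [trace_add, trace_sub, trace_sub, e1, e2]
  simp
  ring

lemma J_X_toG (c : Fin 3) (ξ : uLie k) (y : Data k) :
    J c (X k (toG ξ) y) = X k (toG ξ) (J c y) := by
  refine Data.ext' (fun a => ?_) fun a => ?_
  · simp only [J, recombine_T, X_toG_T, Matrix.mul_sum, Matrix.sum_mul, ← sum_sub_distrib,
      mul_smul_comm, smul_mul_assoc, smul_sub]
  · simp only [J, recombine_P, X_toG_P, Matrix.mulVec_sum, mulVec_smul]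

lemma mom_X_add (ξ : uLie k) (y : Data k) (c : Fin 3) :
    mom y (X k (toG ξ) y) c + mom (X k (toG ξ) y) y c =
      (toG ξ).mat * moment y c - moment y c * (toG ξ).mat := by
  rw [moment_eq, mom, mom, mom, ← sum_add_distrib, Matrix.mul_sum, Matrix.sum_mul, ←
    sum_sub_distrib]
  refine sum_ext fun a _ => ?_
  rw [J_X_toG, X_toG_T, X_toG_T, X_toG_P, X_toG_P]
  have e : vecMulVec (y.P a) (star ((toG ξ).mat *ᵥ (J c y).P a)) =
      -(vecMulVec (y.P a) (star ((J c y).P a)) * (toG ξ).mat) := by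
    rw [star_mulVec, gLie.mat_conjTranspose, Matrix.vecMul_neg, Matrix.vecMulVec_neg,
      Matrix.vecMulVec_mul]
  rw [e, ← mul_vecMulVec]
  noncomm_ring

lemma metric_X_J_X (hy : y ∈ Abar k) (ξ η : uLie k) (c : Fin 3) :
    metric k (X k (toG ξ) y) (J c (X k (toG η) y)) = 0 := by
  rw [metric_X_J, mom_X_add, hy c]
  simp

lemma metric_J_X_J_X (hy : y ∈ Abar k) (ξ η : uLie k) {c c' : Fin 3} (h : c ≠ c') :
    metric k (J c (X k (toG ξ) y)) (J c' (X k (toG η) y)) = 0 := by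
  obtain ⟨e, r, he⟩ := exists_J_J_eq h
  rw [metric_J, he, map_smul, metric_X_J_X hy]
  simp

lemma metric_J_J (c : Fin 3) (u v : Data k) : metric k (J c u) (J c v) = metric k u v := by
  rw [metric_J, J_J_self, map_neg, neg_neg]

/-- The moment map polarized and symmetrized, as a map to `𝔲(k)³`. -/
def momU (y z : Data k) (c : Fin 3) : uLie k := ⟨(mom y z c + mom z y c : Mat k), by
    intro i j
    have h : (mom y z c + mom z y c)ᴴ = -(mom y z c + mom z y c) := by
      rw [conjTranspose_add, mom_conjTranspose, mom_conjTranspose]; abel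
    have := congr_fun₂ h i j
    rw [conjTranspose_apply, Matrix.neg_apply] at this
    rw [this, neg_neg]⟩

lemma mom_add_left (y y' z : Data k) (c : Fin 3) : mom (y + y') z c = mom y z c + mom y' z c := by
  simp only [mom, ← sum_add_distrib]
  refine sum_ext fun a _ => ?_
  rw [show (y + y').T a = y.T a + y'.T a from rfl, show (y + y').P a = y.P a + y'.P a from rfl,
    add_mul, Matrix.add_vecMulVec]
  abel

lemma mom_smul_left (r : ℝ) (y z : Data k) (c : Fin 3) : mom (r • y) z c = r • mom y z c := by
  simp only [mom, smul_sum]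
  refine sum_ext fun a _ => ?_
  rw [show (r • y).T a = r • y.T a from rfl, show (r • y).P a = r • y.P a from rfl, smul_mul,
    Matrix.smul_vecMulVec, smul_add]

lemma mom_add_right (y z z' : Data k) (c : Fin 3) : mom y (z + z') c = mom y z c + mom y z' c := by
  have := congrArg conjTranspose (mom_add_left z z' y c)
  rw [conjTranspose_add, mom_conjTranspose, mom_conjTranspose, mom_conjTranspose, ← neg_add] at this
  exact neg_injective this

lemma mom_smul_right (r : ℝ) (y z : Data k) (c : Fin 3) : mom y (r • z) c = r • mom y z c := by
  have := congrArg conjTranspose (mom_smul_left r z y c)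
  rw [conjTranspose_smul, mom_conjTranspose, mom_conjTranspose, star_trivial, smul_neg] at this
  exact neg_injective this

/-- `momU` as a bilinear map. -/
def momL (k : ℕ) : Data k →ₗ[ℝ] Data k →ₗ[ℝ] (Fin 3 → uLie k) := mk₂ ℝ momU (by
      intro y y' z
      funext c
      refine Subtype.ext ?_
      change mom (y + y') z c + mom z (y + y') c = _
      rw [mom_add_left, mom_add_right]
      change _ = (mom y z c + mom z y c) + (mom y' z c + mom z y' c)
      abel)
    (by
      intro r y z
      funext c
      refine Subtype.ext ?_
      change mom (r • y) z c + mom z (r • y) c = r • (mom y z c + mom z y c)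
      rw [mom_smul_left, mom_smul_right, smul_add])
    (by
      intro y z z'
      funext c
      refine Subtype.ext ?_
      change mom y (z + z') c + mom (z + z') y c = _
      rw [mom_add_left, mom_add_right]
      change _ = (mom y z c + mom z y c) + (mom y z' c + mom z' y c)
      abel)
    (by
      intro r y z
      funext c
      refine Subtype.ext ?_
      change mom y (r • z) c + mom (r • z) y c = r • (mom y z c + mom z y c)
      rw [mom_smul_left, mom_smul_right, smul_add])

lemma momL_apply (y z : Data k) (c : Fin 3) :
    ((momL k y z c).1 : Fin k → Fin k → ℂ) = mom y z c + mom z y c := rfl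

lemma metric_X_J_momL (ξ : uLie k) (y z : Data k) (c : Fin 3) : metric k (X k (toG ξ) y) (J c z) =
      (Matrix.trace ((toG ξ).mat * (toG (momL k y z c)).mat)).re :=
  metric_X_J ξ y z c

lemma momL_surjective (hy : y ∈ A k) : Function.Surjective (momL k y) := by
  rcases Nat.eq_zero_or_pos k with rfl | hk
  · intro t
    refine ⟨0, ?_⟩
    funext c
    refine Subtype.ext ?_
    funext i
    exact i.elim0
  have hf := isFree_of_mem_A hk hy
  let adj : (Fin 3 → uLie k) →ₗ[ℝ] Data k :=
    { toFun := fun Ξ => ∑ c, J c (X k (toG (Ξ c)) y)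
      map_add' := by
        intro Ξ Ξ'
        rw [← sum_add_distrib]
        refine sum_ext fun c _ => ?_
        rw [show toG ((Ξ + Ξ') c) = toG (Ξ c) + toG (Ξ' c) by simp [toG], map_add,
          LinearMap.add_apply, map_add]
      map_smul' := by
        intro r Ξ
        rw [RingHom.id_apply, smul_sum]
        refine sum_ext fun c _ => ?_
        rw [show toG ((r • Ξ) c) = r • toG (Ξ c) by simp [toG], map_smul,
          LinearMap.smul_apply, map_smul] }
  have hadj : ∀ Ξ, adj Ξ = ∑ c, J c (X k (toG (Ξ c)) y) := fun _ => rfl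
  have hadj0 : ∀ Ξ, adj Ξ = 0 → Ξ = 0 := by
    intro Ξ h
    funext c
    have h1 : metric k (adj Ξ) (J c (X k (toG (Ξ c)) y)) =
        metric k (X k (toG (Ξ c)) y) (X k (toG (Ξ c)) y) := by
      rw [hadj, map_sum, LinearMap.sum_apply, sum_eq_single c
        (fun b _ hb => metric_J_X_J_X hy.1 _ _ hb) (by simp), metric_J_J]
    rw [h, map_zero, LinearMap.zero_apply] at h1
    have h2 := hf _ (metric_self_eq_zero h1.symm)
    exact congrArg Prod.fst h2
  have hinj : Function.Injective (momL k y ∘ₗ adj) := by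
    refine (injective_iff_map_eq_zero _).2 fun Ξ h => hadj0 Ξ ?_
    rw [LinearMap.comp_apply] at h
    refine metric_self_eq_zero ?_
    nth_rewrite 1 [hadj]
    rw [map_sum, LinearMap.sum_apply]
    refine sum_eq_zero fun c _ => ?_
    rw [metric_J, metric_X_J_momL, h]
    have : (toG ((0 : Fin 3 → uLie k) c)).mat = 0 := rfl
    rw [this]
    simp
  intro t
  obtain ⟨Ξ, hΞ⟩ := (LinearMap.injective_iff_surjective.1 hinj) t
  exact ⟨adj Ξ, hΞ⟩

/-- The moment map as a map to `𝔲(k)³`. -/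
def momentU (y : Data k) : Fin 3 → uLie k := (1 / 2 : ℝ) • momL k y y

lemma momentU_apply (y : Data k) (c : Fin 3) :
    ((momentU y c).1 : Fin k → Fin k → ℂ) = moment y c := by
  change (1 / 2 : ℝ) • (mom y y c + mom y y c) = _
  rw [moment_eq, ← two_smul ℝ (mom y y c), smul_smul]
  norm_num

lemma momentU_eq_zero : momentU y = 0 ↔ y ∈ Abar k := by
  constructor
  · intro h c
    rw [← momentU_apply, h]
    rfl
  · intro h
    funext c
    refine Subtype.ext ?_
    rw [momentU_apply, h c]
    rfl

lemma momL_comm (y z : Data k) : momL k y z = momL k z y := by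
  funext c
  refine Subtype.ext ?_
  rw [momL_apply, momL_apply, add_comm]

/-- `momL` as a continuous bilinear map. -/
def momCL (k : ℕ) : Data k →L[ℝ] Data k →L[ℝ] (Fin 3 → uLie k) := toContinuousLinearMap
    { toFun := fun y => toContinuousLinearMap (momL k y)
      map_add' := by intro y z; ext w <;> simp
      map_smul' := by intro r z; ext w <;> simp }

lemma hasStrictFDerivAt_momentU (y : Data k) :
    HasStrictFDerivAt (momentU (k := k)) (momCL k y) y := by
  have h := ((momCL k).hasStrictFDerivAt_of_bilinear (hasStrictFDerivAt_id y)
    (hasStrictFDerivAt_id y)).const_smul (1 / 2 : ℝ)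
  refine h.congr_fderiv ?_
  refine ContinuousLinearMap.ext fun z => ?_
  simp only [ContinuousLinearMap.smul_apply, ContinuousLinearMap.add_apply]
  change (1 / 2 : ℝ) • (momL k y z + momL k z y) = momL k y z
  rw [momL_comm z y, ← two_smul ℝ (momL k y z), smul_smul]
  norm_num

lemma HasStrictFDerivAt.exists_dist_le {E F : Type*} [NormedAddCommGroup E] [NormedSpace ℝ E]
    [CompleteSpace E] [NormedAddCommGroup F] [NormedSpace ℝ F] [CompleteSpace F] {f : E → F}
    {f' : E →L[ℝ] F} {a : E} (hf : HasStrictFDerivAt f f' a) (h : Function.Surjective f') :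
    ∃ C > 0, ∀ᶠ p : E × F in 𝓝 (a, f a), ∃ z', f z' = p.2 ∧ ‖z' - p.1‖ ≤ C * ‖f p.1 - p.2‖ := by
  let g := f'.nonlinearRightInverseOfSurjective (range_eq_top.2 h)
  have hg : 0 < g.nnnorm := f'.nonlinearRightInverseOfSurjective_nnnorm_pos _
  have hc : (0 : NNReal) < (g.nnnorm)⁻¹ / 2 := by positivity
  obtain ⟨s, hs, happ⟩ := hf.approximates_deriv_on_nhds (Or.inr hc)
  obtain ⟨δ, hδ, hball⟩ := Metric.mem_nhds_iff.1 hs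
  have hgr : (0 : ℝ) < g.nnnorm := hg
  refine ⟨2 * g.nnnorm, by positivity, ?_⟩
  have hcont : Tendsto (fun p : E × F => 2 * (g.nnnorm : ℝ) * ‖f p.1 - p.2‖) (𝓝 (a, f a))
      (𝓝 0) := by
    have h1 : ContinuousAt (fun p : E × F => f p.1) (a, f a) :=
      ContinuousAt.comp (f := Prod.fst) hf.continuousAt continuousAt_fst
    have := ((h1.sub continuousAt_snd).norm).const_mul (2 * (g.nnnorm : ℝ))
    simpa [ContinuousAt] using this
  have hfst : ∀ᶠ p : E × F in 𝓝 (a, f a), p.1 ∈ Metric.ball a (δ / 2) :=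
    continuousAt_fst.eventually (Metric.ball_mem_nhds a (half_pos hδ))
  filter_upwards [hcont.eventually (gt_mem_nhds (half_pos hδ)), hfst] with p hz hza
  have hsub : Metric.closedBall p.1 (2 * (g.nnnorm : ℝ) * ‖f p.1 - p.2‖) ⊆ s := by
    refine subset_trans ?_ hball
    intro w hw
    rw [Metric.mem_closedBall] at hw
    rw [Metric.mem_ball] at hza ⊢
    calc dist w a ≤ dist w p.1 + dist p.1 a := dist_triangle _ _ _
      _ < δ := by linarith
  have := happ.surjOn_closedBall_of_nonlinearRightInverse g (b := p.1)
    (ε := 2 * (g.nnnorm : ℝ) * ‖f p.1 - p.2‖) (by positivity) hsub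
  obtain ⟨z', hz', he⟩ := this (show p.2 ∈ _ by
    rw [Metric.mem_closedBall, dist_comm, dist_eq_norm]
    push_cast
    field_simp
    norm_num)
  refine ⟨z', he, ?_⟩
  rw [← dist_eq_norm]
  exact hz'

lemma exists_mem_Abar_near (hy : y ∈ A k) :
    ∃ C > 0, ∀ᶠ z in 𝓝 y, ∃ z' ∈ Abar k, ‖z' - z‖ ≤ C * ‖momentU z‖ := by
  obtain ⟨C, hC, h⟩ := HasStrictFDerivAt.exists_dist_le (hasStrictFDerivAt_momentU y)
    (momL_surjective hy)
  rw [momentU_eq_zero.2 hy.1] at h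
  have hcont : Tendsto (fun z : Data k => (z, (0 : Fin 3 → uLie k))) (𝓝 y) (𝓝 (y, 0)) :=
    (continuous_id.prodMk continuous_const).tendsto y
  refine ⟨C, hC, (hcont.eventually h).mono fun z ⟨z', h1, h2⟩ => ⟨z', momentU_eq_zero.1 h1, ?_⟩⟩
  simpa using h2

lemma norm_T_le (y : Data k) (a : Fin 4) (i j : Fin k) : ‖y.T a i j‖ ≤ ‖y‖ :=
  calc ‖y.1.1 a i j‖ ≤ ‖y.1.1 a i‖ := norm_le_pi_norm _ j
    _ ≤ ‖y.1.1 a‖ := norm_le_pi_norm (y.1.1 a) i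
    _ ≤ ‖y.1.1‖ := norm_le_pi_norm y.1.1 a
    _ ≤ ‖y‖ := norm_fst_le y

lemma norm_P_le (y : Data k) (a : Fin 4) (i : Fin k) : ‖y.P a i‖ ≤ ‖y‖ :=
  calc ‖y.2 a i‖ ≤ ‖y.2 a‖ := norm_le_pi_norm _ i
    _ ≤ ‖y.2‖ := norm_le_pi_norm y.2 a
    _ ≤ ‖y‖ := norm_snd_le y

lemma Data.norm_le {C : ℝ} (hC : 0 ≤ C) (hT : ∀ a i j, ‖y.T a i j‖ ≤ C)
    (hP : ∀ a i, ‖y.P a i‖ ≤ C) : ‖y‖ ≤ C := by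
  refine max_le ?_ ?_
  · change ‖y.1.1‖ ≤ C
    exact (pi_norm_le_iff_of_nonneg hC).2 fun a => (pi_norm_le_iff_of_nonneg hC).2 fun i =>
      (pi_norm_le_iff_of_nonneg hC).2 fun j => hT a i j
  · exact (pi_norm_le_iff_of_nonneg hC).2 fun a => (pi_norm_le_iff_of_nonneg hC).2 fun i => hP a i

/-- The space of off-diagonal parts: columns for `T` and scalars for `P`. -/
abbrev Off (k : ℕ) : Type := (Fin 4 → Fin k → ℂ) × (Fin 4 → ℂ)

lemma norm_off_fst_le (e : Off k) (a : Fin 4) (i : Fin k) : ‖e.1 a i‖ ≤ ‖e‖ :=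
  calc ‖e.1 a i‖ ≤ ‖e.1 a‖ := norm_le_pi_norm _ i
    _ ≤ ‖e.1‖ := norm_le_pi_norm e.1 a
    _ ≤ ‖e‖ := norm_fst_le e

lemma norm_off_snd_le (e : Off k) (a : Fin 4) : ‖e.2 a‖ ≤ ‖e‖ :=
  (norm_le_pi_norm _ a).trans (norm_snd_le e)

lemma Off.norm_le {e : Off k} {C : ℝ} (hC : 0 ≤ C) (h1 : ∀ a i, ‖e.1 a i‖ ≤ C)
    (h2 : ∀ a, ‖e.2 a‖ ≤ C) : ‖e‖ ≤ C :=
  max_le ((pi_norm_le_iff_of_nonneg hC).2 fun a => (pi_norm_le_iff_of_nonneg hC).2 fun i => h1 a i)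
    ((pi_norm_le_iff_of_nonneg hC).2 h2)

/-- The components `a ↦ ((T_c - x_c) a, P_c* a)` of the adjoint of `R_x`. -/
def symb (x : R4) (y : Data k) : (Fin k → ℂ) →ₗ[ℂ] Off k where
  toFun a := (fun c => tau x y c *ᵥ a, fun c => star (y.P c) ⬝ᵥ a)
  map_add' a b := by
    refine Prod.ext ?_ ?_
    · funext c; exact Matrix.mulVec_add (tau x y c) a b
    · funext c; exact dotProduct_add (star (y.P c)) a b
  map_smul' r a := by
    refine Prod.ext ?_ ?_
    · funext c; exact mulVec_smul (tau x y c) r a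
    · funext c; exact dotProduct_smul r (star (y.P c)) a

lemma symb_fst (x : R4) (y : Data k) (a : Fin k → ℂ) (c : Fin 4) :
    (symb x y a).1 c = tau x y c *ᵥ a := rfl

lemma symb_snd (x : R4) (y : Data k) (a : Fin k → ℂ) (c : Fin 4) :
    (symb x y a).2 c = star (y.P c) ⬝ᵥ a := rfl

lemma tau_mulVec (x : R4) (y : Data k) (c : Fin 4) (a : Fin k → ℂ) :
    tau x y c *ᵥ a = y.T c *ᵥ a - ((x c : ℝ) : ℂ) • a := by
  rw [tau, sub_mulVec, smul_mulVec, one_mulVec]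

lemma norm_mulVec_le {M : Mat k} {C : ℝ} (hM : ∀ i j, ‖M i j‖ ≤ C)
    (a : Fin k → ℂ) (i : Fin k) : ‖(M *ᵥ a) i‖ ≤ k * C * ‖a‖ := by
  rw [mulVec, dotProduct]
  refine (norm_sum_le _ _).trans ?_
  refine (sum_le_card_nsmul _ _ (C * ‖a‖) fun j _ => ?_).trans ?_
  · rw [norm_mul]
    exact mul_le_mul (hM i j) (norm_le_pi_norm a j) (norm_nonneg _) ((norm_nonneg _).trans (hM i j))
  · simp [mul_assoc]

lemma norm_dotProduct_le {v : Fin k → ℂ} {C : ℝ} (hv : ∀ i, ‖v i‖ ≤ C) (a : Fin k → ℂ) :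
    ‖v ⬝ᵥ a‖ ≤ k * C * ‖a‖ := by
  rw [dotProduct]
  refine (norm_sum_le _ _).trans ?_
  refine (sum_le_card_nsmul _ _ (C * ‖a‖) fun j _ => ?_).trans ?_
  · rw [norm_mul]
    exact mul_le_mul (hv j) (norm_le_pi_norm a j) (norm_nonneg _) ((norm_nonneg _).trans (hv j))
  · simp [mul_assoc]

lemma norm_symb_sub_le (x : R4) (y z : Data k) (a : Fin k → ℂ) :
    ‖symb x y a - symb x z a‖ ≤ k * ‖y - z‖ * ‖a‖ := by
  refine Off.norm_le (by positivity) (fun c i => ?_) fun c => ?_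
  · have : (symb x y a - symb x z a).1 c = (y - z).T c *ᵥ a := by
      change tau x y c *ᵥ a - tau x z c *ᵥ a = _
      rw [tau_mulVec, tau_mulVec, sub_sub_sub_cancel_right, ← sub_mulVec]
      rfl
    rw [this]
    exact norm_mulVec_le (norm_T_le _ _) _ _
  · have : (symb x y a - symb x z a).2 c = star ((y - z).P c) ⬝ᵥ a := by
      change star (y.P c) ⬝ᵥ a - star (z.P c) ⬝ᵥ a = _
      rw [← sub_dotProduct, ← star_sub]
      rfl
    rw [this]
    refine norm_dotProduct_le (fun i => ?_) _
    rw [Pi.star_apply, norm_star]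
    exact norm_P_le _ _ _

lemma norm_coord_le (x : R4) (c : Fin 4) : ‖((x c : ℝ) : ℂ)‖ ≤ ‖x‖ := by
  rw [norm_real]
  exact PiLp.norm_apply_le x c

lemma norm_symb_sub_le' (x x' : R4) (y : Data k) (a : Fin k → ℂ) :
    ‖symb x y a - symb x' y a‖ ≤ ‖x - x'‖ * ‖a‖ := by
  refine Off.norm_le (by positivity) (fun c i => ?_) fun c => ?_
  · have : (symb x y a - symb x' y a).1 c = -(((x - x') c : ℝ) : ℂ) • a := by
      change tau x y c *ᵥ a - tau x' y c *ᵥ a = _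
      rw [tau_mulVec, tau_mulVec, sub_sub_sub_cancel_left, ← sub_smul]
      simp
    rw [this, Pi.smul_apply, norm_smul, norm_neg]
    exact mul_le_mul (norm_coord_le _ _) (norm_le_pi_norm a i) (norm_nonneg _) (norm_nonneg _)
  · have : (symb x y a - symb x' y a).2 c = 0 := sub_self _
    rw [this, norm_zero]
    positivity

lemma norm_le_of_coord_le {x : R4} {C : ℝ} (h : ∀ c, |x c| ≤ C) : ‖x‖ ≤ 2 * C := by
  have hC : 0 ≤ C := (abs_nonneg _).trans (h 0)
  rw [norm_eq, Real.sqrt_le_left (by positivity)]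
  simp only [sum_univ_four, Real.norm_eq_abs]
  have := fun c => mul_self_le_mul_self (abs_nonneg _) (h c)
  nlinarith [this 0, this 1, this 2, this 3]

lemma RR_eq_of_mem_Abar (hy : y ∈ Abar k) (x : R4) : RR (x, y) = Dm x y ⊗ₖ (1 : Mat 2) := by
  rw [RR, Rop_mul_conjTranspose, sum_ext fun c _ => by
    rw [hy c, zero_kronecker], sum_const_zero, add_zero]

lemma det_Dm_ne_zero (hy : y ∈ A k) (x : R4) : (Dm x y).det ≠ 0 := by
  have := det_RR_ne_zero (hy.2 x)
  rw [RR_eq_of_mem_Abar hy.1, det_kronecker] at this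
  exact fun h => this (by simp [h])

lemma dotProduct_Dm_mulVec (x : R4) (y : Data k) (a b : Fin k → ℂ) : star a ⬝ᵥ (Dm x y *ᵥ b) =
      ∑ c, (star ((symb x y a).1 c) ⬝ᵥ (symb x y b).1 c +
        star ((symb x y a).2 c) * (symb x y b).2 c) := by
  rw [Dm, Matrix.sum_mulVec, dotProduct_sum]
  refine sum_ext fun c _ => ?_
  rw [add_mulVec, dotProduct_add, symb_fst, symb_fst, symb_snd, symb_snd, star_mulVec,
    tau_conjTranspose, ← mulVec_mulVec, dotProduct_mulVec]
  congr 1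
  rw [Matrix.vecMulVec_mulVec]
  have e : star (star (y.P c) ⬝ᵥ a) = star a ⬝ᵥ y.P c := by rw [Matrix.star_dotProduct, star_star]
  rw [e, dotProduct_smul]
  simp

lemma Dm_mulVec_eq_zero {x : R4} {a : Fin k → ℂ} : Dm x y *ᵥ a = 0 ↔ symb x y a = 0 := by
  constructor
  · intro h
    have h1 := dotProduct_Dm_mulVec x y a a
    rw [h, dotProduct_zero] at h1
    have hn : ∀ c ∈ Finset.univ, 0 ≤ (star ((symb x y a).1 c) ⬝ᵥ (symb x y a).1 c +
        star ((symb x y a).2 c) * (symb x y a).2 c).re := fun c _ => by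
      rw [add_re]
      refine add_nonneg ?_ ?_
      · rw [dotProduct, re_sum]
        refine sum_nonneg fun i _ => ?_
        simp [mul_self_nonneg, add_nonneg]
      · simp [mul_self_nonneg, add_nonneg]
    have h2 := congrArg Complex.re h1
    rw [zero_re, re_sum, eq_comm, sum_eq_zero_iff_of_nonneg hn] at h2
    have h3 : ∀ c, (symb x y a).1 c = 0 ∧ (symb x y a).2 c = 0 := by
      intro c
      have := h2 c (mem_univ c)
      rw [add_re, dotProduct, re_sum] at this
      have hs : ∀ z : ℂ, (star z * z).re = ‖z‖ ^ 2 := fun z => by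
        rw [star_def, ← normSq_eq_conj_mul_self, ofReal_re, normSq_eq_norm_sq]
      simp only [Pi.star_apply, hs] at this
      have hs1 : 0 ≤ ∑ i, ‖(symb x y a).1 c i‖ ^ 2 := sum_nonneg fun i _ => sq_nonneg _
      have hs2 := sq_nonneg ‖(symb x y a).2 c‖
      have e1 : ∑ i, ‖(symb x y a).1 c i‖ ^ 2 = 0 := by linarith
      have e2 : ‖(symb x y a).2 c‖ ^ 2 = 0 := by linarith
      refine ⟨?_, by simpa using e2⟩
      funext i
      have := (sum_eq_zero_iff_of_nonneg fun i _ => sq_nonneg _).1 e1 i (mem_univ i)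
      simpa using this
    exact Prod.ext (funext fun c => (h3 c).1) (funext fun c => (h3 c).2)
  · intro h
    rw [Dm, Matrix.sum_mulVec]
    refine sum_eq_zero fun c _ => ?_
    have e1 : tau x y c *ᵥ a = 0 := congrFun (congrArg Prod.fst h) c
    have e2 : star (y.P c) ⬝ᵥ a = 0 := congrFun (congrArg Prod.snd h) c
    rw [add_mulVec, ← mulVec_mulVec, e1, Matrix.mulVec_zero, Matrix.vecMulVec_mulVec, e2]
    simp

lemma symb_injective (hy : y ∈ A k) (x : R4) {a : Fin k → ℂ} (h : symb x y a = 0) : a = 0 := by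
  by_contra ha
  exact det_Dm_ne_zero hy x (exists_mulVec_eq_zero_iff.1 ⟨a, ha, Dm_mulVec_eq_zero.2 h⟩)

lemma mem_A_iff : y ∈ A k ↔ y ∈ Abar k ∧ ∀ x a, symb x y a = 0 → a = 0 := by
  refine ⟨fun h => ⟨h.1, fun x a => symb_injective h x⟩, fun ⟨h1, h2⟩ => ⟨h1, fun x => ?_⟩⟩
  have hD : (Dm x y).det ≠ 0 := fun h0 => by
    obtain ⟨a, ha, ha0⟩ := exists_mulVec_eq_zero_iff.2 h0
    exact ha (h2 x a (Dm_mulVec_eq_zero.1 ha0))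
  have hR : IsUnit (RR (x, y)).det := by
    rw [RR_eq_of_mem_Abar h1, det_kronecker, isUnit_iff_ne_zero]
    simp [hD]
  intro w
  refine ⟨(Rop x y)ᴴ *ᵥ ((RR (x, y))⁻¹ *ᵥ w), ?_⟩
  rw [mulVec_mulVec, mulVec_mulVec]
  change (RR (x, y) * (RR (x, y))⁻¹) *ᵥ w = w
  rw [mul_nonsing_inv _ hR, one_mulVec]

lemma exists_norm_symb_ge (hy : y ∈ A k) : ∃ c > 0, ∀ x a, c * ‖a‖ ≤ ‖symb x y a‖ := by
  set K : ℝ := 2 * (k * ‖y‖ + 1) with hK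
  have hcompact : IsCompact (Metric.closedBall (0 : R4) K ×ˢ Metric.sphere (0 : Fin k → ℂ) 1) :=
    (isCompact_closedBall _ _).prod (isCompact_sphere _ _)
  have hcont : Continuous fun p : R4 × (Fin k → ℂ) => ‖symb p.1 y p.2‖ := by
    refine Continuous.norm (Continuous.prodMk ?_ ?_)
    · refine continuous_pi fun c => ?_
      simp only [tau_mulVec]
      refine Continuous.sub (Continuous.matrix_mulVec continuous_const continuous_snd) ?_
      exact (Complex.continuous_ofReal.comp ((PiLp.continuous_apply 2 _ c).comp
        continuous_fst)).smul continuous_snd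
    · exact continuous_pi fun c => Continuous.dotProduct continuous_const continuous_snd
  obtain ⟨c, hc, hbd⟩ : ∃ c > 0, ∀ p ∈ Metric.closedBall (0 : R4) K ×ˢ
      Metric.sphere (0 : Fin k → ℂ) 1, c ≤ ‖symb p.1 y p.2‖ := by
    rcases (Metric.closedBall (0 : R4) K ×ˢ Metric.sphere (0 : Fin k → ℂ) 1).eq_empty_or_nonempty
      with he | hne
    · exact ⟨1, one_pos, fun p hp => by rw [he] at hp; exact hp.elim⟩
    · obtain ⟨p, hp, hmin⟩ := hcompact.exists_isMinOn hne hcont.continuousOn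
      refine ⟨‖symb p.1 y p.2‖, norm_pos_iff.2 fun h0 => ?_, fun q hq => hmin hq⟩
      have h1 := symb_injective hy p.1 h0
      have h2 : ‖p.2‖ = 1 := by simpa using hp.2
      rw [h1] at h2
      simp at h2
  refine ⟨min c 1, lt_min hc one_pos, fun x a => ?_⟩
  rcases eq_or_ne a 0 with rfl | ha
  · simp
  by_cases hx : ‖x‖ ≤ K
  · have ha' : ‖a‖ ≠ 0 := norm_ne_zero_iff.2 ha
    have := hbd (x, ((‖a‖⁻¹ : ℝ) : ℂ) • a) ⟨by simpa using hx, by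
      rw [mem_sphere_zero_iff_norm, norm_smul, norm_real, norm_inv, norm_norm, inv_mul_cancel₀ ha']⟩
    rw [map_smul, norm_smul, norm_real, norm_inv, norm_norm] at this
    calc min c 1 * ‖a‖ ≤ c * ‖a‖ := by gcongr; exact min_le_left _ _
      _ ≤ (‖a‖⁻¹ * ‖symb x y a‖) * ‖a‖ := by gcongr
      _ = ‖symb x y a‖ := by field_simp
  · push Not at hx
    obtain ⟨e, he⟩ : ∃ e, k * ‖y‖ + 1 < |x e| := by
      by_contra! h
      exact absurd (norm_le_of_coord_le h) (not_le.2 hx)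
    have h1 : ∀ i, |x e| * ‖a i‖ ≤ ‖symb x y a‖ + k * ‖y‖ * ‖a‖ := by
      intro i
      have h2 : ((x e : ℝ) : ℂ) * a i = (y.T e *ᵥ a) i - (symb x y a).1 e i := by
        rw [symb_fst, tau_mulVec]; simp
      have h3 : |x e| * ‖a i‖ = ‖((x e : ℝ) : ℂ) * a i‖ := by
        rw [norm_mul, norm_real, Real.norm_eq_abs]
      rw [h3, h2, add_comm]
      exact (norm_sub_le _ _).trans (add_le_add (norm_mulVec_le (norm_T_le _ _) _ _)
        (norm_off_fst_le _ _ _))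
    obtain ⟨i, hi⟩ : ∃ i, ‖a‖ ≤ ‖a i‖ := by
      by_contra! h
      exact lt_irrefl _ ((pi_norm_lt_iff (norm_pos_iff.2 ha)).2 h)
    have h4 : (k * ‖y‖ + 1) * ‖a‖ ≤ |x e| * ‖a i‖ :=
      mul_le_mul he.le hi (norm_nonneg _) (abs_nonneg _)
    have h5 : min c 1 * ‖a‖ ≤ 1 * ‖a‖ := by gcongr; exact min_le_right _ _
    linarith [h1 i]

/-- The off-diagonal part of a datum of charge `k + 1`. -/
def off (y : Data₁) : Off k := (fun a j => y.T a j.succ 0, fun a => star (y.P a 0))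

lemma T_zero_succ (y : Data₁) (a : Fin 4) (j : Fin k) : y.T a 0 j.succ = star ((off y).1 a j) :=
  y.1.2 a 0 j.succ

lemma T_zero_zero (y : Data₁) (a : Fin 4) : y.T a 0 0 = ((T0 y a : ℝ) : ℂ) :=
  (Complex.conj_eq_iff_re.1 (y.1.2 a 0 0).symm).symm

lemma norm_T0_sub_le (y z : Data₁) (a : Fin 4) : |T0 y a - T0 z a| ≤ ‖y - z‖ := by
  have : T0 y a - T0 z a = ((y - z).T a 0 0).re := rfl
  rw [this]
  exact (Complex.abs_re_le_norm _).trans (norm_T_le _ _ _ _)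

lemma off_sub (y z : Data₁) : off (y - z) = off y - off z := by
  refine Prod.ext rfl ?_
  funext a
  change star (y.P a 0 - z.P a 0) = _
  rw [star_sub]
  rfl

lemma norm_off_le (y : Data₁) : ‖off y‖ ≤ ‖y‖ := by
  refine Off.norm_le (norm_nonneg _) (fun a i => norm_T_le y a _ _) fun a => ?_
  change ‖star (y.P a 0)‖ ≤ _
  rw [norm_star]
  exact norm_P_le _ _ _

lemma lower_sub (y z : Data₁) : lower (y - z) = lower y - lower z := rfl

lemma norm_lower_le (y : Data₁) : ‖lower y‖ ≤ ‖y‖ :=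
  Data.norm_le (norm_nonneg _) (fun a i j => norm_T_le y a i.succ j.succ)
    fun a i => norm_P_le y a i.succ

lemma Data.norm_le_of_blocks {y : Data₁} {C : ℝ} (h0 : ∀ a, |T0 y a| ≤ C)
    (h1 : ‖off y‖ ≤ C) (h2 : ‖lower y‖ ≤ C) : ‖y‖ ≤ C := by
  have hC : 0 ≤ C := (norm_nonneg _).trans h1
  refine Data.norm_le hC (fun a i j => ?_) fun a i => ?_
  · refine Fin.cases ?_ (fun i => ?_) i <;> refine Fin.cases ?_ (fun j => ?_) j
    · rw [T_zero_zero, norm_real]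
      exact h0 a
    · rw [T_zero_succ, norm_star]
      exact (norm_off_fst_le _ _ _).trans h1
    · exact (norm_off_fst_le (off y) a i).trans h1
    · exact (norm_T_le (lower y) a i j).trans h2
  · refine Fin.cases ?_ (fun i => ?_) i
    · rw [← norm_star]
      exact (norm_off_snd_le (off y) a).trans h1
    · exact (norm_P_le (lower y) a i).trans h2

lemma mem_Sing1_iff {y : Data₁} : y ∈ Sing1 k ↔ off y = 0 := by
  have hX : ∀ i j, (xi1 k).mat i j = if i = 0 ∧ j = 0 then I else 0 := fun _ _ => rfl
  have hX2 : (xi1 k).2 = 0 := rfl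
  rw [Sing1, LinearMap.mem_ker]
  constructor
  · intro h
    refine Prod.ext ?_ ?_
    · funext a j
      have h1 : (X _ (xi1 k) y).T a j.succ 0 = 0 := by rw [h]; rfl
      rw [X_T, Matrix.sub_apply, Matrix.mul_apply, Matrix.mul_apply] at h1
      simp [hX] at h1
      exact h1
    · funext a
      have h1 : (X _ (xi1 k) y).P a 0 = 0 := by rw [h]; rfl
      rw [X_P] at h1
      simp [hX, hX2] at h1
      simp [off, h1]
  · intro h
    have h1 : ∀ a (j : Fin k), y.T a j.succ 0 = 0 := fun a j => congr_fun₂ (congrArg Prod.fst h) a j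
    have h1' : ∀ a (j : Fin k), y.T a 0 j.succ = 0 := fun a j => by rw [T_zero_succ, h]; simp
    have h2 : ∀ a, y.P a 0 = 0 := fun a => by
      have := congrFun (congrArg Prod.snd h) a
      simpa [off] using this
    refine Data.ext' (fun a => ?_) fun a => ?_
    · ext i j
      change (X _ (xi1 k) y).T a i j = 0
      rw [X_T, Matrix.sub_apply, Matrix.mul_apply, Matrix.mul_apply, sum_univ_succ, sum_univ_succ]
      simp only [hX]
      cases i using Fin.cases <;> cases j using Fin.cases <;> simp [h1, h1', mul_comm]
    · funext i
      change (X _ (xi1 k) y).P a i = 0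
      rw [X_P, sum_univ_succ]
      simp only [hX, hX2]
      refine Fin.cases ?_ (fun i => ?_) i <;> simp [h2]

lemma symb_fst_succ (x : R4) (y : Data₁) (a : Fin (k + 1) → ℂ) (c : Fin 4) (j : Fin k) :
    (symb x y a).1 c j.succ = (symb x (lower y) (tail a)).1 c j + a 0 * (off y).1 c j := by
  rw [symb_fst, symb_fst, tau_mulVec, tau_mulVec]
  simp only [Pi.sub_apply, Pi.smul_apply, mulVec, dotProduct, sum_univ_succ]
  change y.T c j.succ 0 * a 0 + ∑ i : Fin k, y.T c j.succ i.succ * a i.succ - _ =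
    ∑ i : Fin k, y.T c j.succ i.succ * a i.succ - _ + a 0 * y.T c j.succ 0
  simp only [tail]
  ring

lemma symb_fst_zero (x : R4) (y : Data₁) (a : Fin (k + 1) → ℂ) (c : Fin 4) :
    (symb x y a).1 c 0 = ((T0 y c - x c : ℝ) : ℂ) * a 0 + star ((off y).1 c) ⬝ᵥ tail a := by
  rw [symb_fst, tau_mulVec]
  simp only [Pi.sub_apply, Pi.smul_apply, mulVec, dotProduct, sum_univ_succ, T_zero_zero,
    T_zero_succ, Pi.star_apply, smul_eq_mul]
  push_cast
  simp only [tail]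
  ring

lemma symb_snd_succ (x : R4) (y : Data₁) (a : Fin (k + 1) → ℂ) (c : Fin 4) :
    (symb x y a).2 c = (symb x (lower y) (tail a)).2 c + a 0 * (off y).2 c := by
  rw [symb_snd, symb_snd, dotProduct, sum_univ_succ]
  change star (y.P c 0) * a 0 + _ = _ + a 0 * star (y.P c 0)
  rw [mul_comm, add_comm]
  rfl

lemma norm_lower_symb_le (x : R4) (y : Data₁) (a : Fin (k + 1) → ℂ) :
    ‖symb x (lower y) (tail a) + a 0 • off y‖ ≤ ‖symb x y a‖ := by
  refine Off.norm_le (norm_nonneg _) (fun c i => ?_) fun c => ?_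
  · have := norm_off_fst_le (symb x y a) c i.succ
    rw [symb_fst_succ] at this
    exact this
  · have := norm_off_snd_le (symb x y a) c
    rw [symb_snd_succ] at this
    exact this

/-- The estimate transverse to the degenerate data: the off-diagonal part of `y'` stays away from
the tangent directions to the orbit of `y`, relative to the distance of `y'` from `y`. -/
def IsTransverse (y : Data₁) (c : ℝ) (y' : Data₁) : Prop :=
  ∀ ζ, c * ‖y' - y‖ ≤ ‖off y' - symb (T0 y) (lower y) ζ‖

lemma real_bound {C c0 r0 : ℝ} (hC : 0 < C) (hc0 : 0 < c0) (hr0 : 0 < r0)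
    (hsmall : 2 * r0 * C ≤ c0 / 2) {K ε r A0 A1 N : ℝ} (hε : 0 ≤ ε) (hr : 0 ≤ r) (hA0 : 0 ≤ A0)
    (hA1 : 0 ≤ A1) (hN : 0 ≤ N) (hεr : 16 * ε ≤ r0) (hKr : K * ε ≤ r0) (hKC : 8 * (K * ε) * C ≤ 1)
    (hεC : r0 * C ≤ 1 / 2)
    (h1 : A1 ≤ C * (N + ε * A0)) (h2 : r * A0 ≤ 2 * (N + K * ε * A1 + ε * A0))
    (h3 : c0 * ε * A0 ≤ N + (K * ε + r) * A1) :
    (r + ε) * A0 + A1 ≤ (20 + 12 / c0 + 20 * C + 4 * C / c0) * N := by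
  have hCN : 0 ≤ C * N := by positivity
  have hKA : K * ε * A1 ≤ (N + ε * A0) / 8 := by
    rcases le_or_gt (K * ε) 0 with h | h
    · nlinarith [mul_nonneg hε hA0]
    · have : K * ε * A1 ≤ K * ε * (C * (N + ε * A0)) := mul_le_mul_of_nonneg_left h1 h.le
      nlinarith [mul_nonneg hε hA0]
  have hpos : 0 ≤ 12 / c0 * N := by positivity
  have hpos' : 0 ≤ 4 * C / c0 * N := by positivity
  rcases le_or_gt r r0 with h | h
  · have h4 : (K * ε + r) * A1 ≤ 2 * r0 * (C * (N + ε * A0)) :=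
      mul_le_mul (by linarith) h1 hA1 (by positivity)
    have h5 : 2 * r0 * (C * (N + ε * A0)) ≤ N + c0 / 2 * (ε * A0) := by
      have e : 2 * r0 * (C * (N + ε * A0)) = 2 * (r0 * C) * N + 2 * r0 * C * (ε * A0) := by ring
      rw [e]
      have := mul_le_mul_of_nonneg_right hsmall (mul_nonneg hε hA0)
      have := mul_le_mul_of_nonneg_right hεC hN
      linarith
    have h6 : ε * A0 ≤ 4 / c0 * N := by
      rw [div_mul_eq_mul_div, le_div_iff₀ hc0]
      nlinarith
    have h7 : C * (ε * A0) ≤ C * (4 / c0 * N) := mul_le_mul_of_nonneg_left h6 hC.le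
    have e1 : C * (4 / c0 * N) = 4 * C / c0 * N := by ring
    have e2 : 12 / c0 * N = 3 * (4 / c0 * N) := by ring
    have e3 : (20 + 12 / c0 + 20 * C + 4 * C / c0) * N =
      20 * N + 12 / c0 * N + 20 * (C * N) + 4 * C / c0 * N := by ring
    nlinarith
  · have h4 : ε * A0 ≤ r * A0 / 16 := by nlinarith
    have h5 : r * A0 ≤ 4 * N := by nlinarith
    have h6 : C * (ε * A0) ≤ C * (N / 4) := mul_le_mul_of_nonneg_left (by linarith) hC.le
    have e3 : (20 + 12 / c0 + 20 * C + 4 * C / c0) * N =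
      20 * N + 12 / c0 * N + 20 * (C * N) + 4 * C / c0 * N := by ring
    nlinarith

lemma exists_symb_ge {y : Data₁} (hy : y ∈ Sing1reg k) {c0 : ℝ} (hc0 : 0 < c0) :
    ∃ C > 0, ∀ᶠ y' in 𝓝 y, IsTransverse y c0 y' → ∀ x a,
      (‖x - T0 y‖ + ‖y' - y‖) * ‖a 0‖ + ‖tail a‖ ≤ C * ‖symb x y' a‖ := by
  obtain ⟨cl, hcl, hlow⟩ := exists_norm_symb_ge hy.2
  set C : ℝ := 2 / cl with hC
  have hCpos : 0 < C := by positivity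
  set r0 : ℝ := min (c0 / (4 * C)) (1 / (2 * C)) with hr0
  have hr0pos : 0 < r0 := lt_min (by positivity) (by positivity)
  have hs1 : 2 * r0 * C ≤ c0 / 2 := by
    have : r0 * (4 * C) ≤ c0 := (le_div_iff₀ (by positivity)).1 (min_le_left _ _)
    linarith
  have hs2 : r0 * C ≤ 1 / 2 := by
    have : r0 * (2 * C) ≤ 1 := (le_div_iff₀ (by positivity)).1 (min_le_right _ _)
    linarith
  refine ⟨20 + 12 / c0 + 20 * C + 4 * C / c0, by positivity, ?_⟩
  have hlim : Tendsto (fun y' : Data₁ => ‖y' - y‖) (𝓝 y) (𝓝 0) := by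
    have : Continuous fun y' : Data₁ => ‖y' - y‖ := by fun_prop
    simpa using this.tendsto y
  have hev : ∀ {m b : ℝ}, 0 < b → ∀ᶠ y' in 𝓝 y, m * ‖y' - y‖ ≤ b := fun {m b} hb => by
    have := hlim.const_mul m
    rw [mul_zero] at this
    exact (this.eventually (gt_mem_nhds hb)).mono fun _ h => h.le
  filter_upwards [hev (m := 16) hr0pos, hev (m := k) hr0pos,
    hev (m := 8 * k * C) one_pos, hev (m := k) (half_pos hcl)] with y' h1 h2 h3 h4 htr x a
  set ε := ‖y' - y‖ with hε
  have hε0 : 0 ≤ ε := norm_nonneg _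
  set N := ‖symb x y' a‖ with hN
  have hoffy : off y = 0 := mem_Sing1_iff.1 hy.1
  have hoff : ‖off y'‖ ≤ ε := by
    have := norm_off_le (y' - y)
    rwa [off_sub, hoffy, sub_zero] at this
  have hlowd : ‖lower y' - lower y‖ ≤ ε := norm_lower_le (y' - y)
  have hN1 := norm_lower_symb_le x y' a
  have hd : ‖symb x (lower y') (tail a) - symb x (lower y) (tail a)‖ ≤
      k * ε * ‖tail a‖ := (norm_symb_sub_le _ _ _ _).trans (by gcongr)
  refine real_bound hCpos hc0 hr0pos hs1 hε0 (norm_nonneg _) (norm_nonneg _) (norm_nonneg _)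
    (norm_nonneg _) h1 h2 (K := k) (by linarith) hs2 ?_ ?_ ?_
  · have e1 := hlow x (tail a)
    have e2 : ‖symb x (lower y) (tail a)‖ ≤
        ‖symb x (lower y') (tail a) + a 0 • off y'‖ + ‖a 0‖ * ε + k * ε * ‖tail a‖ := by
      have : symb x (lower y) (tail a) =
          (symb x (lower y') (tail a) + a 0 • off y') - a 0 • off y' -
          (symb x (lower y') (tail a) - symb x (lower y) (tail a)) := by abel
      rw [this]
      refine (norm_sub_le _ _).trans (add_le_add ((norm_sub_le _ _).trans ?_) hd)
      rw [norm_smul]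
      gcongr
    have e3 := mul_le_mul_of_nonneg_right h4 (norm_nonneg (tail a))
    have e4 : cl / 2 * ‖tail a‖ ≤ N + ε * ‖a 0‖ := by nlinarith
    rw [hC, div_mul_eq_mul_div, le_div_iff₀ hcl]
    linarith
  · have e1 : ∀ c, |(x - T0 y) c| * ‖a 0‖ ≤ N + k * ε * ‖tail a‖ + ε * ‖a 0‖ := by
      intro c
      have f1 := norm_off_fst_le (symb x y' a) c 0
      rw [symb_fst_zero] at f1
      have f2 : ‖star ((off y').1 c) ⬝ᵥ tail a‖ ≤ k * ε * ‖tail a‖ :=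
        norm_dotProduct_le (fun i => by
          rw [Pi.star_apply, norm_star]
          exact (norm_off_fst_le _ _ _).trans hoff) _
      have f3 : |(x - T0 y) c| ≤ |T0 y' c - x c| + ε := by
        have := norm_T0_sub_le y' y c
        have e : (x - T0 y) c = (T0 y' c - T0 y c) - (T0 y' c - x c) := by rw [PiLp.sub_apply]; ring
        rw [e]
        exact (abs_sub _ _).trans (by linarith)
      have f4 : |T0 y' c - x c| * ‖a 0‖ ≤ N + k * ε * ‖tail a‖ := by
        have e : ‖((T0 y' c - x c : ℝ) : ℂ) * a 0‖ = |T0 y' c - x c| * ‖a 0‖ := by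
          rw [norm_mul, norm_real, Real.norm_eq_abs]
        rw [← e]
        have g := norm_sub_le (((T0 y' c - x c : ℝ) : ℂ) * a 0 +
          star ((off y').1 c) ⬝ᵥ tail a) (star ((off y').1 c) ⬝ᵥ tail a)
        rw [add_sub_cancel_right] at g
        linarith
      have := mul_le_mul_of_nonneg_right f3 (norm_nonneg (a 0))
      linarith
    rcases eq_or_ne (a 0) 0 with ha | ha
    · rw [ha]; simp only [norm_zero, mul_zero, add_zero]; positivity
    · have hpos : 0 < ‖a 0‖ := norm_pos_iff.2 ha
      have := norm_le_of_coord_le (x := x - T0 y) fun c => (le_div_iff₀ hpos).2 (e1 c)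
      rw [← mul_div_assoc, le_div_iff₀ hpos] at this
      exact this
  · rcases eq_or_ne (a 0) 0 with ha | ha
    · rw [ha]; simp only [norm_zero, mul_zero]; positivity
    · have e1 := htr (-(a 0)⁻¹ • tail a)
      rw [map_smul, neg_smul, sub_neg_eq_add] at e1
      have e2 : ‖a 0‖ * ‖off y' + (a 0)⁻¹ • symb (T0 y) (lower y) (tail a)‖ =
          ‖a 0 • off y' + symb (T0 y) (lower y) (tail a)‖ := by
        rw [← norm_smul, smul_add, smul_smul, mul_inv_cancel₀ ha, one_smul]
      have e3 := mul_le_mul_of_nonneg_left e1 (norm_nonneg (a 0))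
      rw [e2] at e3
      have e4 : a 0 • off y' + symb (T0 y) (lower y) (tail a) =
          (symb x (lower y') (tail a) + a 0 • off y') -
          (symb x (lower y') (tail a) - symb x (lower y) (tail a)) -
          (symb x (lower y) (tail a) - symb (T0 y) (lower y) (tail a)) := by abel
      have e5 : ‖a 0 • off y' + symb (T0 y) (lower y) (tail a)‖ ≤
          N + k * ε * ‖tail a‖ + ‖x - T0 y‖ * ‖tail a‖ := by
        rw [e4]
        refine (norm_sub_le _ _).trans (add_le_add ((norm_sub_le _ _).trans
          (add_le_add hN1 hd)) (norm_symb_sub_le' _ _ _ _))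
      linarith

lemma mem_A_of_isTransverse {y y' : Data₁} {C : ℝ} (hne : y' ≠ y)
    (h : ∀ x a, (‖x - T0 y‖ + ‖y' - y‖) * ‖a 0‖ + ‖tail a‖ ≤ C * ‖symb x y' a‖)
    (hA : y' ∈ Abar (k + 1)) : y' ∈ A (k + 1) := by
  refine mem_A_iff.2 ⟨hA, fun x a h0 => ?_⟩
  have h1 := h x a
  rw [h0, norm_zero, mul_zero] at h1
  have hpos : 0 < ‖x - T0 y‖ + ‖y' - y‖ :=
    add_pos_of_nonneg_of_pos (norm_nonneg _) (norm_pos_iff.2 (sub_ne_zero.2 hne))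
  have h2 : 0 ≤ (‖x - T0 y‖ + ‖y' - y‖) * ‖a 0‖ := by positivity
  have h3 := norm_nonneg (tail a)
  have h4 : ‖a 0‖ = 0 := by
    have : (‖x - T0 y‖ + ‖y' - y‖) * ‖a 0‖ = 0 := by linarith
    exact (mul_eq_zero.1 this).resolve_left hpos.ne'
  have h5 : ‖tail a‖ = 0 := by linarith
  funext i
  refine Fin.cases (norm_eq_zero.1 h4) (fun i => ?_) i
  exact congrFun (norm_eq_zero.1 h5) i

/-- The action of a matrix `u` (meant to be unitary) on the data: `(T, P) ↦ (u T u*, u P)`. -/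
def conjAct (u : Mat k) (y : Data k) : Data k := (⟨fun a => (u * y.T a * uᴴ : Mat k), by
    intro a i j
    have h : (u * y.T a * uᴴ)ᴴ = u * y.T a * uᴴ := by
      simp [conjTranspose_mul, Data.T_conjTranspose, mul_assoc]
    exact (congr_fun₂ h i j).symm⟩, fun a => u *ᵥ y.P a)

lemma conjAct_T (u : Mat k) (y : Data k) (a : Fin 4) : (conjAct u y).T a = u * y.T a * uᴴ := rfl

lemma conjAct_P (u : Mat k) (y : Data k) (a : Fin 4) : (conjAct u y).P a = u *ᵥ y.P a := rfl

lemma J_conjAct (c : Fin 3) (u : Mat k) (y : Data k) : J c (conjAct u y) = conjAct u (J c y) := by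
  refine Data.ext' (fun a => ?_) fun a => ?_
  · simp only [J, recombine_T, conjAct_T, Matrix.mul_sum, Matrix.sum_mul, mul_smul_comm,
      smul_mul_assoc]
  · simp only [J, recombine_P, conjAct_P, Matrix.mulVec_sum, mulVec_smul]

lemma moment_conjAct {u : Mat k} (hu : uᴴ * u = 1) (y : Data k) (c : Fin 3) :
    moment (conjAct u y) c = u * moment y c * uᴴ := by
  rw [moment_eq, moment_eq, mom, mom, J_conjAct, Matrix.mul_sum, Matrix.sum_mul]
  refine sum_ext fun a _ => ?_
  rw [conjAct_T, conjAct_T, conjAct_P, conjAct_P, mul_add, add_mul]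
  congr 1
  · calc u * y.T a * uᴴ * (u * (J c y).T a * uᴴ) = u * y.T a * (uᴴ * u) * (J c y).T a * uᴴ := by
          noncomm_ring
      _ = _ := by rw [hu]; noncomm_ring
  · rw [star_mulVec, ← Matrix.vecMulVec_mul, ← mul_vecMulVec, mul_assoc]

lemma symb_conjAct {u : Mat k} (hu : uᴴ * u = 1) (x : R4) (y : Data k)
    {a : Fin k → ℂ} (h : symb x y a = 0) : symb x (conjAct u y) (u *ᵥ a) = 0 := by
  have h1 : ∀ c, tau x y c *ᵥ a = 0 := fun c => congrFun (congrArg Prod.fst h) c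
  have h2 : ∀ c, star (y.P c) ⬝ᵥ a = 0 := fun c => congrFun (congrArg Prod.snd h) c
  refine Prod.ext (funext fun c => ?_) (funext fun c => ?_)
  · change tau x (conjAct u y) c *ᵥ (u *ᵥ a) = 0
    have h3 := h1 c
    rw [tau_mulVec] at h3 ⊢
    rw [conjAct_T, mulVec_mulVec, mul_assoc, hu, mul_one, ← mulVec_mulVec, sub_eq_zero.1 h3,
      mulVec_smul, sub_self]
  · change star (u *ᵥ y.P c) ⬝ᵥ (u *ᵥ a) = 0
    rw [star_mulVec, ← dotProduct_mulVec, mulVec_mulVec, hu, one_mulVec, h2]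

lemma conjAct_mem_Abar_diff {u : Mat (k + 1)} (hu : uᴴ * u = 1)
    {p : Data₁} (hp : p ∈ Abar (k + 1)) (hoff : off p = 0) :
    conjAct u p ∈ Abar (k + 1) \ A (k + 1) := by
  refine ⟨fun c => by rw [moment_conjAct hu, hp c, mul_zero, zero_mul], fun h => ?_⟩
  have h0 : symb (T0 p) p (Pi.single 0 1) = 0 := by
    have ht : tail (Pi.single 0 1 : Fin (k + 1) → ℂ) = 0 := by
      funext i
      simp [tail]
    refine Prod.ext (funext fun c => funext fun i => ?_) (funext fun c => ?_)
    · refine Fin.cases ?_ (fun i => ?_) i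
      · rw [symb_fst_zero, hoff, ht]; simp
      · rw [symb_fst_succ, hoff, ht]; simp
    · rw [symb_snd_succ, hoff, ht]; simp
  have h1 := symb_injective h _ (symb_conjAct hu _ _ h0)
  have h2 : uᴴ *ᵥ (u *ᵥ (Pi.single 0 1 : Fin (k + 1) → ℂ)) = Pi.single 0 1 := by
    rw [mulVec_mulVec, hu, one_mulVec]
  rw [h1, Matrix.mulVec_zero] at h2
  have := congrFun h2 0
  simp at this

/-- The skew-Hermitian matrix with first column `(0, -ζ)`. -/
def offGen (k : ℕ) : (Fin k → ℂ) →ₗ[ℝ] Mat (k + 1) where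
  toFun ζ := Matrix.of fun i j =>
    Fin.cases (Fin.cases 0 (fun j => star (ζ j)) j) (fun i => Fin.cases (-ζ i) (fun _ => 0) j) i
  map_add' ζ η := by
    ext i j
    cases i using Fin.cases <;> cases j using Fin.cases <;> simp
    ring
  map_smul' r ζ := by
    ext i j
    cases i using Fin.cases <;> cases j using Fin.cases <;> simp

lemma offGen_zero_zero (ζ : Fin k → ℂ) : offGen k ζ 0 0 = 0 := rfl
lemma offGen_zero_succ (ζ : Fin k → ℂ) (j : Fin k) : offGen k ζ 0 j.succ = star (ζ j) := rfl
lemma offGen_succ_zero (ζ : Fin k → ℂ) (i : Fin k) : offGen k ζ i.succ 0 = -ζ i := rfl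
lemma offGen_succ_succ (ζ : Fin k → ℂ) (i j : Fin k) : offGen k ζ i.succ j.succ = 0 := rfl

lemma offGen_conjTranspose (ζ : Fin k → ℂ) : (offGen k ζ)ᴴ = -offGen k ζ := by
  ext i j
  rw [conjTranspose_apply, Matrix.neg_apply]
  cases i using Fin.cases <;> cases j using Fin.cases <;>
    simp [offGen_zero_zero, offGen_zero_succ, offGen_succ_zero, offGen_succ_succ]

/-- The Cayley transform. -/
def cayley (ζ : Fin k → ℂ) : Mat (k + 1) :=
  (1 + (1 / 2 : ℝ) • offGen k ζ) * (1 - (1 / 2 : ℝ) • offGen k ζ)⁻¹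

lemma conjTranspose_mul_cayley {ζ : Fin k → ℂ} (h : (1 - (1 / 2 : ℝ) • offGen k ζ).det ≠ 0) :
    (cayley ζ)ᴴ * cayley ζ = 1 := by
  set B := 1 - (1 / 2 : ℝ) • offGen k ζ with hB
  set A := 1 + (1 / 2 : ℝ) • offGen k ζ with hA
  have hAB : Aᴴ = B := by
    rw [hA, hB, conjTranspose_add, conjTranspose_smul, offGen_conjTranspose, conjTranspose_one,
      star_trivial, smul_neg, sub_eq_add_neg]
  have hBA : Bᴴ = A := by rw [← hAB, conjTranspose_conjTranspose]
  have hcomm : B * A = A * B := by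
    rw [hA, hB]
    generalize (1 / 2 : ℝ) • offGen k ζ = Z
    noncomm_ring
  have hBu : IsUnit B.det := isUnit_iff_ne_zero.2 h
  have hAu : IsUnit A.det := by
    rw [← hBA, Matrix.det_conjTranspose, isUnit_iff_ne_zero]
    simpa using h
  rw [cayley, conjTranspose_mul, Matrix.conjTranspose_nonsing_inv, ← hB, ← hA, hAB, hBA]
  calc A⁻¹ * B * (A * B⁻¹) = A⁻¹ * (B * A) * B⁻¹ := by noncomm_ring
    _ = (A⁻¹ * A) * (B * B⁻¹) := by rw [hcomm]; noncomm_ring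
    _ = 1 := by rw [nonsing_inv_mul _ hAu, mul_nonsing_inv _ hBu, mul_one]

/-- The Hermitian matrix `T_a` as a linear map. -/
def TL (k : ℕ) (a : Fin 4) : Data k →ₗ[ℝ] Mat k where
  toFun y := y.T a
  map_add' _ _ := rfl
  map_smul' _ _ := rfl

/-- The vector `P_a` as a linear map to one-column matrices. -/
def PL (k : ℕ) (a : Fin 4) : Data k →ₗ[ℝ] Matrix (Fin k) (Fin 1) ℂ where
  toFun y := Matrix.of fun i _ => y.P a i
  map_add' _ _ := rfl
  map_smul' _ _ := rfl

lemma mderiv_linear_id {V : Type*} [NormedAddCommGroup V] [NormedSpace ℝ V]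
    [FiniteDimensional ℝ V] {l m : Type*} (Λ : V →ₗ[ℝ] Matrix l m ℂ) (z u : V) :
    mderiv (fun z => Λ z) z u = Λ u := by
  have := mderiv_linear Λ (differentiableAt_id (𝕜 := ℝ) (x := z)) u
  rw [fderiv_id] at this
  exact this

lemma msmoothAt_linear_id {V : Type*} [NormedAddCommGroup V] [NormedSpace ℝ V]
    [FiniteDimensional ℝ V] {l m : Type*} (Λ : V →ₗ[ℝ] Matrix l m ℂ) (z : V) :
    MSmoothAt (fun z => Λ z) z := msmoothAt_linear Λ contDiffAt_id

lemma MSmoothAt.eventually_norm_le {E : Type*} [NormedAddCommGroup E] [NormedSpace ℝ E]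
    {l m : Type*} {M : E → Matrix l m ℂ} {z : E} (hM : MSmoothAt M z) {c : ℝ} (hc : 0 < c)
    (i : l) (j : m) :
    ∀ᶠ w in 𝓝 z, ‖M w i j - M z i j - ADHM.mderiv M z (w - z) i j‖ ≤ c * ‖w - z‖ :=
  (hM.mdiffAt i j).hasFDerivAt.isLittleO.def hc

section

variable (y : Data (k + 1))

lemma msmoothAt_one_sub (r : ℝ) (q : (Fin k → ℂ) × Data₁) :
    MSmoothAt (fun q : (Fin k → ℂ) × Data₁ => 1 - r • offGen k q.1) q :=
  (msmoothAt_const 1 q).sub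
    (msmoothAt_linear_id ((r • offGen k) ∘ₗ LinearMap.fst ℝ (Fin k → ℂ) Data₁) q)

lemma mderiv_one_sub (r : ℝ) (q v : (Fin k → ℂ) × Data₁) :
    mderiv (fun q : (Fin k → ℂ) × Data₁ => 1 - r • offGen k q.1) q v = -(r • offGen k v.1) := by
  have h := mderiv_linear_id ((r • offGen k) ∘ₗ LinearMap.fst ℝ (Fin k → ℂ) Data₁) q v
  have h' := msmoothAt_linear_id ((r • offGen k) ∘ₗ LinearMap.fst ℝ (Fin k → ℂ) Data₁) q
  have := mderiv_sub (mdiffAt_const 1 q) h'.mdiffAt v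
  rw [mderiv_const, h, zero_sub] at this
  exact this

lemma det_one_sub_zero : (1 - (1 / 2 : ℝ) • offGen k ((0 : Fin k → ℂ), y).1).det ≠ 0 := by simp

lemma msmoothAt_cayley :
    MSmoothAt (fun q : (Fin k → ℂ) × Data₁ => cayley q.1) ((0 : Fin k → ℂ), y) := by
  have h1 := msmoothAt_one_sub (-(1 / 2)) ((0 : Fin k → ℂ), y)
  have h2 := (msmoothAt_one_sub (1 / 2) ((0 : Fin k → ℂ), y)).inv (det_one_sub_zero y)
  have := h1.mul h2
  simp only [neg_smul, sub_neg_eq_add] at this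
  exact this

lemma cayley_zero : cayley (0 : Fin k → ℂ) = 1 := by simp [cayley]

lemma mderiv_cayley (v : (Fin k → ℂ) × Data₁) :
    mderiv (fun q : (Fin k → ℂ) × Data₁ => cayley q.1) ((0 : Fin k → ℂ), y) v = offGen k v.1 := by
  have h1 := msmoothAt_one_sub (1 / 2) ((0 : Fin k → ℂ), y)
  have h2 : (fun q : (Fin k → ℂ) × Data₁ =>
      cayley q.1 * (1 - (1 / 2 : ℝ) • offGen k q.1)) =ᶠ[𝓝 ((0 : Fin k → ℂ), y)]
      fun q => 1 - (-(1 / 2) : ℝ) • offGen k q.1 := by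
    filter_upwards [h1.det.continuousAt.eventually_ne (det_one_sub_zero y)] with q hq
    rw [cayley, mul_assoc, nonsing_inv_mul _ (isUnit_iff_ne_zero.2 hq), mul_one, neg_smul,
      sub_neg_eq_add]
  have h3 := mderiv_congr h2 v
  rw [mderiv_mul (msmoothAt_cayley y).mdiffAt h1.mdiffAt, mderiv_one_sub, mderiv_one_sub,
    cayley_zero] at h3
  simp only [map_zero, smul_zero, sub_zero, mul_one, one_mul, neg_smul, neg_neg] at h3
  rw [← sub_eq_add_neg, sub_eq_iff_eq_add] at h3
  rw [h3, ← add_smul]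
  norm_num

lemma eventually_conjAct_T {c : ℝ} (hc : 0 < c) (a : Fin 4) (i j : Fin (k + 1)) :
    ∀ᶠ q in 𝓝 ((0 : Fin k → ℂ), y), ‖(conjAct (cayley q.1) q.2).T a i j - q.2.T a i j -
      (offGen k q.1 * y.T a - y.T a * offGen k q.1) i j‖ ≤ c * ‖q - (0, y)‖ := by
  have h1 := msmoothAt_cayley y
  have h2 : MSmoothAt (fun q : (Fin k → ℂ) × Data₁ => q.2.T a) ((0 : Fin k → ℂ), y) :=
    msmoothAt_linear_id (TL (k + 1) a ∘ₗ LinearMap.snd ℝ (Fin k → ℂ) Data₁) _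
  have h2' : ∀ v, mderiv (fun q : (Fin k → ℂ) × Data₁ => q.2.T a) ((0 : Fin k → ℂ), y) v =
      v.2.T a :=
    fun v => mderiv_linear_id (TL (k + 1) a ∘ₗ LinearMap.snd ℝ (Fin k → ℂ) Data₁) _ v
  filter_upwards [((h1.mul h2).mul h1.conjTranspose).eventually_norm_le hc i j] with q hq
  convert hq using 2
  rw [mderiv_mul (h1.mul h2).mdiffAt h1.conjTranspose.mdiffAt, mderiv_mul h1.mdiffAt h2.mdiffAt,
    mderiv_conjTranspose h1.mdiffAt, mderiv_cayley, h2', cayley_zero]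
  simp only [conjTranspose_one, mul_one, one_mul, offGen_conjTranspose, conjAct_T, Matrix.add_apply,
    Matrix.sub_apply, mul_neg, Matrix.neg_apply, Prod.fst_sub, Prod.snd_sub, sub_zero]
  rw [show (q.2 - y).T a i j = q.2.T a i j - y.T a i j from rfl]
  ring

lemma eventually_conjAct_P {c : ℝ} (hc : 0 < c) (a : Fin 4) (i : Fin (k + 1)) :
    ∀ᶠ q in 𝓝 ((0 : Fin k → ℂ), y), ‖(conjAct (cayley q.1) q.2).P a i - q.2.P a i -
      (offGen k q.1 *ᵥ y.P a) i‖ ≤ c * ‖q - (0, y)‖ := by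
  have h1 := msmoothAt_cayley y
  have h2 : MSmoothAt (fun q : (Fin k → ℂ) × Data₁ => PL (k + 1) a q.2) ((0 : Fin k → ℂ), y) :=
    msmoothAt_linear_id (PL (k + 1) a ∘ₗ LinearMap.snd ℝ (Fin k → ℂ) Data₁) _
  have h2' : ∀ v, mderiv (fun q : (Fin k → ℂ) × Data₁ => PL (k + 1) a q.2)
      ((0 : Fin k → ℂ), y) v = PL (k + 1) a v.2 :=
    fun v => mderiv_linear_id (PL (k + 1) a ∘ₗ LinearMap.snd ℝ (Fin k → ℂ) Data₁) _ v
  filter_upwards [(h1.mul h2).eventually_norm_le hc i 0] with q hq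
  convert hq using 2
  rw [mderiv_mul h1.mdiffAt h2.mdiffAt, mderiv_cayley, h2', cayley_zero]
  simp only [Matrix.one_mul, Matrix.add_apply, Prod.fst_sub, Prod.snd_sub, sub_zero, map_sub,
    Matrix.sub_apply]
  change (cayley q.1 *ᵥ q.2.P a) i - q.2.P a i - (offGen k q.1 *ᵥ y.P a) i =
    (cayley q.1 *ᵥ q.2.P a) i - y.P a i - ((offGen k q.1 *ᵥ y.P a) i + (q.2.P a i - y.P a i))
  ring

end

lemma offGen_commutator_zero_zero {y : Data₁} (hy : off y = 0) (ζ : Fin k → ℂ)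
    (a : Fin 4) : (offGen k ζ * y.T a - y.T a * offGen k ζ) 0 0 = 0 := by
  have h1' : ∀ j, y.T a 0 (Fin.succ j) = 0 := fun j => by rw [T_zero_succ, hy]; simp
  have h1 : ∀ j, y.T a (Fin.succ j) 0 = 0 := fun j => congr_fun₂ (congrArg Prod.fst hy) a j
  rw [Matrix.sub_apply, Matrix.mul_apply, Matrix.mul_apply, sum_univ_succ, sum_univ_succ]
  simp [h1, h1', offGen_zero_zero]

lemma offGen_commutator_succ_succ {y : Data₁} (hy : off y = 0) (ζ : Fin k → ℂ)
    (a : Fin 4) (i j : Fin k) :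
    (offGen k ζ * y.T a - y.T a * offGen k ζ) i.succ j.succ = 0 := by
  have h1' : ∀ j, y.T a 0 (Fin.succ j) = 0 := fun j => by rw [T_zero_succ, hy]; simp
  have h1 : ∀ j, y.T a (Fin.succ j) 0 = 0 := fun j => congr_fun₂ (congrArg Prod.fst hy) a j
  rw [Matrix.sub_apply, Matrix.mul_apply, Matrix.mul_apply, sum_univ_succ, sum_univ_succ]
  simp [h1, h1', offGen_succ_succ]

lemma offGen_commutator_succ_zero {y : Data₁} (hy : off y = 0) (ζ : Fin k → ℂ)
    (a : Fin 4) (i : Fin k) :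
    (offGen k ζ * y.T a - y.T a * offGen k ζ) i.succ 0 = (symb (T0 y) (lower y) ζ).1 a i := by
  have h1' : ∀ j, y.T a 0 (Fin.succ j) = 0 := fun j => by rw [T_zero_succ, hy]; simp
  have h1 : ∀ j, y.T a (Fin.succ j) 0 = 0 := fun j => congr_fun₂ (congrArg Prod.fst hy) a j
  rw [Matrix.sub_apply, Matrix.mul_apply, Matrix.mul_apply, sum_univ_succ, sum_univ_succ, symb_fst,
    tau_mulVec]
  simp only [h1, h1', offGen_succ_zero, offGen_succ_succ, T_zero_zero, Pi.sub_apply, Pi.smul_apply,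
    smul_eq_mul, mulVec, dotProduct, zero_mul, sum_const_zero, add_zero, zero_add, mul_neg,
    sum_neg_distrib]
  change _ = ∑ x : Fin k, y.T a i.succ x.succ * ζ x - _
  ring

lemma offGen_mulVec_zero {y : Data₁} (hy : off y = 0) (ζ : Fin k → ℂ) (a : Fin 4) :
    star ((offGen k ζ *ᵥ y.P a) 0) = (symb (T0 y) (lower y) ζ).2 a := by
  rw [symb_snd]
  simp only [mulVec, dotProduct, sum_univ_succ, offGen_zero_zero, offGen_zero_succ]
  change star (0 * y.P a 0 + ∑ i : Fin k, star (ζ i) * y.P a i.succ) =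
    ∑ i : Fin k, star (y.P a i.succ) * ζ i
  simp [mul_comm]

lemma offGen_mulVec_succ {y : Data₁} (hy : off y = 0) (ζ : Fin k → ℂ) (a : Fin 4)
    (i : Fin k) : (offGen k ζ *ᵥ y.P a) i.succ = 0 := by
  have h2 : y.P a 0 = 0 := by
    have := congrFun (congrArg Prod.snd hy) a
    simpa [off] using this
  simp [mulVec, dotProduct, sum_univ_succ, offGen_succ_succ, h2]

lemma eventually_exists_degenerate {y : Data₁} (hy : off y = 0) {c : ℝ} (hc : 0 < c) :
    ∀ᶠ q in 𝓝 ((0 : Fin k → ℂ), y), q.2 ∈ Abar (k + 1) → off q.2 = 0 →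
      ∃ d ∈ Abar (k + 1) \ A (k + 1), (∀ a, |T0 d a - T0 q.2 a| ≤ c * ‖q - (0, y)‖) ∧
        ‖off d - symb (T0 y) (lower y) q.1‖ ≤ c * ‖q - (0, y)‖ ∧
        ‖lower d - lower q.2‖ ≤ c * ‖q - (0, y)‖ := by
  have hdet : ∀ᶠ q in 𝓝 ((0 : Fin k → ℂ), y), (1 - (1 / 2 : ℝ) • offGen k q.1).det ≠ 0 :=
    (msmoothAt_one_sub (1 / 2) ((0 : Fin k → ℂ), y)).det.continuousAt.eventually_ne
      (det_one_sub_zero y)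
  have hT := eventually_all.2 fun a => eventually_all.2 fun i => eventually_all.2 fun j =>
    eventually_conjAct_T y hc a i j
  have hP := eventually_all.2 fun a => eventually_all.2 fun i => eventually_conjAct_P y hc a i
  filter_upwards [hdet, hT, hP] with q hq hqT hqP hA hoff
  have hC : 0 ≤ c * ‖q - (0, y)‖ := by positivity
  refine ⟨conjAct (cayley q.1) q.2,
    conjAct_mem_Abar_diff (conjTranspose_mul_cayley hq) hA hoff, fun a => ?_, ?_, ?_⟩
  · have := hqT a 0 0
    rw [offGen_commutator_zero_zero hy, sub_zero, T_zero_zero, T_zero_zero, ← ofReal_sub, norm_real]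
      at this
    exact this
  · refine Off.norm_le hC (fun a i => ?_) fun a => ?_
    · have := hqT a i.succ 0
      rw [offGen_commutator_succ_zero hy, show q.2.T a i.succ 0 = 0 from congr_fun₂ (congrArg
        Prod.fst hoff) a i, sub_zero] at this
      exact this
    · have := hqP a 0
      have h2 : q.2.P a 0 = 0 := by
        have := congrFun (congrArg Prod.snd hoff) a
        simpa [off] using this
      rw [h2, sub_zero, ← norm_star, star_sub, offGen_mulVec_zero hy] at this
      exact this
  · refine Data.norm_le hC (fun a i j => ?_) fun a i => ?_
    · have := hqT a i.succ j.succ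
      rw [offGen_commutator_succ_succ hy, sub_zero] at this
      exact this
    · have := hqP a i.succ
      rw [offGen_mulVec_succ hy, sub_zero] at this
      exact this

/-- The datum of charge `k + 1` with the given blocks. -/
def blockData (t : R4) (e : Off k) (z : Data k) : Data₁ :=
  (⟨fun a i j => Fin.cases (Fin.cases ((t a : ℝ) : ℂ) (fun j => star (e.1 a j)) j)
      (fun i => Fin.cases (e.1 a i) (fun j => z.T a i j) j) i, by
    intro a i j
    cases i using Fin.cases <;> cases j using Fin.cases <;> first | exact z.1.2 _ _ _ | simp⟩,
    fun a i => Fin.cases (star (e.2 a)) (fun i => z.P a i) i)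

lemma T0_blockData (t : R4) (e : Off k) (z : Data k) : T0 (blockData t e z) = t := by
  ext a
  exact ofReal_re _

lemma off_blockData (t : R4) (e : Off k) (z : Data k) : off (blockData t e z) = e := by
  refine Prod.ext rfl ?_
  funext a
  exact star_star _

lemma lower_blockData (t : R4) (e : Off k) (z : Data k) : lower (blockData t e z) = z := rfl

lemma moment_apply (y : Data k) (c : Fin 3) (i j : Fin k) :
    moment y c i j = ∑ a, ∑ b, ((rightJ c a b : ℂ) * ∑ p, y.T a i p * y.T b p j +
      (leftJ c a b : ℂ) * (y.P a i * star (y.P b j))) := by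
  simp only [moment, Matrix.sum_apply, Matrix.add_apply, Matrix.smul_apply, smul_eq_mul,
    Data.T_conjTranspose, Matrix.mul_apply, vecMulVec_apply, Pi.star_apply]
  rfl

lemma moment_succ_succ (y : Data₁) (c : Fin 3) (i j : Fin k) :
    moment y c i.succ j.succ = moment (lower y) c i j +
      ∑ a, ∑ b, (rightJ c a b : ℂ) * ((off y).1 a i * star ((off y).1 b j)) := by
  rw [moment_apply, moment_apply, ← sum_add_distrib]
  refine sum_ext fun a _ => ?_
  rw [← sum_add_distrib]
  refine sum_ext fun b _ => ?_
  rw [sum_univ_succ, T_zero_succ]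
  change (rightJ c a b : ℂ) * ((off y).1 a i * star ((off y).1 b j) +
    ∑ p, (lower y).T a i p * (lower y).T b p j) + (leftJ c a b : ℂ) * ((lower y).P a i *
      star ((lower y).P b j)) = _
  ring

lemma moment_succ_zero (y : Data₁) (c : Fin 3) (i : Fin k) :
    moment y c i.succ 0 = ∑ a, ∑ b, ((rightJ c a b : ℂ) *
      (tau (T0 y) (lower y) a *ᵥ (off y).1 b) i +
      (leftJ c a b : ℂ) * ((lower y).P a i * (off y).2 b)) := by
  rw [moment_apply]
  have h1 : ∀ a b, (rightJ c a b : ℂ) * ∑ p, y.T a i.succ p * y.T b p 0 +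
      (leftJ c a b : ℂ) * (y.P a i.succ * star (y.P b 0)) =
      (rightJ c a b : ℂ) * ((off y).1 a i * ((T0 y b : ℝ) : ℂ)) +
      ((rightJ c a b : ℂ) * ((lower y).T a *ᵥ (off y).1 b) i +
      (leftJ c a b : ℂ) * ((lower y).P a i * (off y).2 b)) := by
    intro a b
    rw [sum_univ_succ, T_zero_zero, mul_add, add_assoc]
    rfl
  have h2 : ∑ a, ∑ b, (rightJ c a b : ℂ) * ((off y).1 a i * ((T0 y b : ℝ) : ℂ)) =
      -∑ a, ∑ b, (rightJ c a b : ℂ) * (((T0 y a : ℝ) : ℂ) * (off y).1 b i) := by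
    rw [sum_comm, ← sum_neg_distrib]
    refine sum_ext fun a _ => ?_
    rw [← sum_neg_distrib]
    refine sum_ext fun b _ => ?_
    rw [rightJ_antisymm]; push_cast; ring
  rw [sum_ext fun a _ => sum_ext fun b _ => h1 a b]
  simp only [sum_add_distrib] at *
  rw [h2, ← add_assoc, ← sum_neg_distrib, ← sum_add_distrib]
  congr 1
  refine sum_ext fun a _ => ?_
  rw [← sum_neg_distrib, ← sum_add_distrib]
  refine sum_ext fun b _ => ?_
  rw [tau_mulVec]
  simp only [Pi.sub_apply, Pi.smul_apply, smul_eq_mul]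
  ring

lemma moment_zero_zero (y : Data₁) (c : Fin 3) :
    moment y c 0 0 = ∑ a, ∑ b, ((rightJ c a b : ℂ) * (star ((off y).1 a) ⬝ᵥ (off y).1 b) +
      (leftJ c a b : ℂ) * (star ((off y).2 a) * (off y).2 b)) := by
  rw [moment_apply]
  have h1 : ∀ a b, (rightJ c a b : ℂ) * ∑ p, y.T a 0 p * y.T b p 0 +
      (leftJ c a b : ℂ) * (y.P a 0 * star (y.P b 0)) =
      (rightJ c a b : ℂ) * (((T0 y a : ℝ) : ℂ) * ((T0 y b : ℝ) : ℂ)) +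
      ((rightJ c a b : ℂ) * (star ((off y).1 a) ⬝ᵥ (off y).1 b) +
      (leftJ c a b : ℂ) * (star ((off y).2 a) * (off y).2 b)) := by
    intro a b
    rw [sum_univ_succ, T_zero_zero, T_zero_zero, mul_add, add_assoc]
    congr 2
    · congr 1
      refine sum_ext fun p _ => ?_
      rw [T_zero_succ]
      rfl
    · simp [off]
  have h2 : ∑ a, ∑ b, (rightJ c a b : ℂ) * (((T0 y a : ℝ) : ℂ) * ((T0 y b : ℝ) : ℂ)) = 0 := by
    have : ∑ a, ∑ b, (rightJ c a b : ℂ) * (((T0 y a : ℝ) : ℂ) * ((T0 y b : ℝ) : ℂ)) =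
        -∑ a, ∑ b, (rightJ c a b : ℂ) * (((T0 y a : ℝ) : ℂ) * ((T0 y b : ℝ) : ℂ)) := by
      conv_lhs => rw [sum_comm]
      rw [← sum_neg_distrib]
      refine sum_ext fun a _ => ?_
      rw [← sum_neg_distrib]
      refine sum_ext fun b _ => ?_
      rw [rightJ_antisymm]; push_cast; ring
    exact self_eq_neg.1 this
  rw [sum_ext fun a _ => sum_ext fun b _ => h1 a b]
  simp only [sum_add_distrib] at *
  rw [h2, zero_add]

lemma moment_conjTranspose (y : Data k) (c : Fin 3) : (moment y c)ᴴ = -moment y c := by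
  rw [moment_eq, mom_conjTranspose]

lemma mem_Abar_succ_iff {y : Data₁} : y ∈ Abar (k + 1) ↔
    ∀ c, (∀ i j : Fin k, moment y c i.succ j.succ = 0) ∧ (∀ i : Fin k, moment y c i.succ 0 = 0) ∧
      moment y c 0 0 = 0 := by
  constructor
  · intro h c
    rw [h c]
    exact ⟨fun _ _ => rfl, fun _ => rfl, rfl⟩
  · intro h c
    obtain ⟨h1, h2, h3⟩ := h c
    ext i j
    refine Fin.cases ?_ (fun i => ?_) i <;> refine Fin.cases ?_ (fun j => ?_) j
    · exact h3
    · have := congr_fun₂ (moment_conjTranspose y c) 0 j.succ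
      rw [conjTranspose_apply, h2 j, star_zero, Matrix.neg_apply] at this
      exact neg_eq_zero.1 this.symm
    · exact h2 i
    · exact h1 i j

lemma blockData_zero_mem_Abar (t : R4) {z : Data k} (hz : z ∈ Abar k) :
    blockData t 0 z ∈ Abar (k + 1) := by
  refine mem_Abar_succ_iff.2 fun c => ⟨fun i j => ?_, fun i => ?_, ?_⟩
  · rw [moment_succ_succ, off_blockData, lower_blockData, hz c]; simp
  · rw [moment_succ_zero, off_blockData]; simp
  · rw [moment_zero_zero, off_blockData]; simp

lemma abs_rightJ_le (c : Fin 3) (a b : Fin 4) : |rightJ c a b| ≤ 1 := by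
  have h := sum_rightJ_mul_self c a a
  rw [if_pos rfl] at h
  have h1 : ∑ e, rightJ c a e ^ 2 = 1 := by
    have : ∀ e, rightJ c a e ^ 2 = -(rightJ c a e * rightJ c e a) := fun e => by
      rw [rightJ_antisymm c a e]; ring
    rw [sum_ext fun e _ => this e, sum_neg_distrib, h, neg_neg]
  rw [← sq_le_one_iff_abs_le_one, ← h1]
  exact single_le_sum (f := fun e => rightJ c a e ^ 2) (fun e _ => sq_nonneg _) (mem_univ b)

lemma norm_momentU_lower_le {y : Data₁} (hy : y ∈ Abar (k + 1)) :
    ‖momentU (lower y)‖ ≤ 16 * ‖off y‖ ^ 2 := by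
  have hn : (0 : ℝ) ≤ 16 * ‖off y‖ ^ 2 := by positivity
  refine (pi_norm_le_iff_of_nonneg hn).2 fun c => ?_
  change ‖((momentU (lower y) c).1 : Fin k → Fin k → ℂ)‖ ≤ _
  refine (pi_norm_le_iff_of_nonneg hn).2 fun i => (pi_norm_le_iff_of_nonneg hn).2 fun j => ?_
  rw [momentU_apply]
  have h1 := moment_succ_succ y c i j
  rw [hy c] at h1
  rw [eq_neg_of_add_eq_zero_left h1.symm, norm_neg]
  calc ‖∑ a, ∑ b, (rightJ c a b : ℂ) * ((off y).1 a i * star ((off y).1 b j))‖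
      ≤ ∑ a : Fin 4, ∑ b : Fin 4, ‖off y‖ ^ 2 := by
        refine (norm_sum_le _ _).trans (sum_le_sum fun a _ =>
          (norm_sum_le _ _).trans (sum_le_sum fun b _ => ?_))
        rw [norm_mul, norm_mul, norm_star, norm_real, Real.norm_eq_abs, sq]
        calc _ ≤ 1 * (‖off y‖ * ‖off y‖) := by
              gcongr
              · exact abs_rightJ_le c a b
              · exact norm_off_fst_le _ _ _
              · exact norm_off_fst_le _ _ _
          _ = _ := one_mul _
    _ = 16 * ‖off y‖ ^ 2 := by simp; ring

lemma T0_sub (y z : Data₁) (a : Fin 4) : T0 (y - z) a = T0 y a - T0 z a := rfl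

lemma eventually_isTransverse {y : Data₁} (hy : y ∈ Sing1reg k) (C : ℝ) :
    ∃ c0 > 0, ∀ᶠ y' in 𝓝[approach C y] y, IsTransverse y c0 y' := by
  have hoffy : off y = 0 := mem_Sing1_iff.1 hy.1
  obtain ⟨cl, hcl, hlow⟩ := exists_norm_symb_ge hy.2
  obtain ⟨Cm, hCm, hreg⟩ := exists_mem_Abar_near hy.2
  set C1 : ℝ := max C 1 with hC1
  have hC1pos : 0 < C1 := lt_max_of_lt_right one_pos
  set K : ℝ := 2 / cl + 2 with hK
  have hKpos : 0 < K := by positivity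
  have hcpos : 0 < 1 / (4 * C1 * K) := by positivity
  have hdeg := eventually_exists_degenerate hoffy hcpos
  obtain ⟨δ, hδ, hball⟩ := Metric.eventually_nhds_iff.1 hdeg
  refine ⟨min (1 / (4 * C1)) 1, lt_min (by positivity) one_pos, ?_⟩
  have hlim : Tendsto (fun y' : Data₁ => ‖y' - y‖) (𝓝 y) (𝓝 0) := by
    have : Continuous fun y' : Data₁ => ‖y' - y‖ := by fun_prop
    simpa using this.tendsto y
  have hev : ∀ {m b : ℝ}, 0 < b → ∀ᶠ y' in 𝓝 y, m * ‖y' - y‖ < b := fun {m b} hb => by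
    have := hlim.const_mul m
    rw [mul_zero] at this
    exact this.eventually (gt_mem_nhds hb)
  have hcontlow : Tendsto (lower (k := k)) (𝓝 y) (𝓝 (lower y)) := by
    rw [tendsto_iff_norm_sub_tendsto_zero]
    exact squeeze_zero (fun _ => norm_nonneg _) (fun y' => norm_lower_le (y' - y)) hlim
  filter_upwards [nhdsWithin_le_nhds (hev (m := K) hδ),
    nhdsWithin_le_nhds (hev (m := 16 * Cm * (4 * C1)) one_pos),
    nhdsWithin_le_nhds (hev (m := 16 * Cm) one_pos),
    nhdsWithin_le_nhds (hcontlow.eventually hreg), self_mem_nhdsWithin] with y' h1 h2 h3 h4 h5 ζ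
  by_contra! hlt
  set ε := ‖y' - y‖ with hε
  obtain ⟨z', hz', hz'd⟩ := h4
  have hε0 : 0 < ε := by
    rcases (norm_nonneg (y' - y)).lt_or_eq with h | h
    · exact h
    · rw [hε, ← h, mul_zero] at hlt
      exact absurd hlt (not_lt.2 (norm_nonneg _))
  have hoff : ‖off y'‖ ≤ ε := by
    have := norm_off_le (y' - y)
    rwa [off_sub, hoffy, sub_zero] at this
  have hzζ : ‖ζ‖ ≤ 2 / cl * ε := by
    have e1 := hlow (T0 y) ζ
    have e2 := norm_sub_norm_le (symb (T0 y) (lower y) ζ) (off y')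
    rw [norm_sub_rev] at e2
    have e3 : min (1 / (4 * C1)) 1 * ε ≤ 1 * ε := by gcongr; exact min_le_right _ _
    rw [div_mul_eq_mul_div, le_div_iff₀ hcl]
    linarith
  have hzz : ‖z' - lower y'‖ ≤ 16 * Cm * ε * ε := by
    refine hz'd.trans ?_
    have := norm_momentU_lower_le h5.1.1
    have h6 : ‖off y'‖ ^ 2 ≤ ε ^ 2 := by gcongr
    calc Cm * ‖momentU (lower y')‖ ≤ Cm * (16 * ε ^ 2) := by gcongr; linarith
      _ = _ := by ring
  have hzz1 : ‖z' - lower y'‖ ≤ ε := hzz.trans (by nlinarith)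
  have hpy : ‖blockData (T0 y') 0 z' - y‖ ≤ 2 * ε := by
    refine Data.norm_le_of_blocks (fun a => ?_) ?_ ?_
    · rw [T0_sub, T0_blockData]
      linarith [norm_T0_sub_le y' y a]
    · rw [off_sub, off_blockData, hoffy, sub_zero, norm_zero]
      linarith
    · rw [lower_sub, lower_blockData]
      have : z' - lower y = (z' - lower y') + (lower y' - lower y) := by abel
      rw [this]
      refine (norm_add_le _ _).trans ?_
      have e : ‖lower y' - lower y‖ ≤ ε := norm_lower_le (y' - y)
      linarith
  have hq : ‖((ζ, blockData (T0 y') 0 z') : (Fin k → ℂ) × Data₁) - (0, y)‖ ≤ K * ε := by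
    rw [Prod.mk_sub_mk, sub_zero]
    refine max_le ?_ ?_
    · exact hzζ.trans (by rw [hK]; nlinarith)
    · refine hpy.trans ?_
      rw [hK]
      have : 0 ≤ 2 / cl * ε := by positivity
      linarith
  obtain ⟨d, hd, hd0, hd1, hd2⟩ := hball (lt_of_le_of_lt ((dist_eq_norm _ _).trans_le hq) h1)
    (blockData_zero_mem_Abar _ hz') (off_blockData _ _ _)
  have hcq : 1 / (4 * C1 * K) * ‖((ζ, blockData (T0 y') 0 z') : (Fin k → ℂ) × Data₁) -
      (0, y)‖ ≤ ε / (4 * C1) := by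
    calc _ ≤ 1 / (4 * C1 * K) * (K * ε) := by gcongr
      _ = _ := by field_simp
  have hsm : 16 * Cm * ε * ε ≤ ε / (4 * C1) := by
    rw [le_div_iff₀ (by positivity)]
    nlinarith
  have hfin : ‖d - y'‖ ≤ ε / (4 * C1) + ε / (4 * C1) := by
    have hp : 0 < ε / (4 * C1) := by positivity
    refine Data.norm_le_of_blocks (fun a => ?_) ?_ ?_
    · have := hd0 a
      rw [T0_blockData] at this
      rw [T0_sub]
      linarith
    · rw [off_sub]
      have : off d - off y' = (off d - symb (T0 y) (lower y) ζ) -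
        (off y' - symb (T0 y) (lower y) ζ) := by abel
      rw [this]
      refine (norm_sub_le _ _).trans (add_le_add (hd1.trans hcq) (hlt.le.trans ?_))
      calc _ ≤ 1 / (4 * C1) * ε := by gcongr; exact min_le_left _ _
        _ = _ := by ring
    · rw [lower_sub]
      have : lower d - lower y' = (lower d - z') + (z' - lower y') := by abel
      rw [this]
      exact (norm_add_le _ _).trans (add_le_add (hd2.trans hcq) (hzz.trans hsm))
  have h6 := h5.2
  have h7 : Metric.infDist y' (Abar (k + 1) \ A (k + 1)) ≤ ‖d - y'‖ := by
    rw [← dist_eq_norm, dist_comm]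
    exact Metric.infDist_le_dist_of_mem hd
  rw [dist_eq_norm] at h6
  have h8 : ε ≤ C1 * (ε / (4 * C1) + ε / (4 * C1)) :=
    calc ε ≤ C * Metric.infDist y' (Abar (k + 1) \ A (k + 1)) := h6
      _ ≤ C1 * Metric.infDist y' (Abar (k + 1) \ A (k + 1)) :=
        mul_le_mul_of_nonneg_right (le_max_left _ _) Metric.infDist_nonneg
      _ ≤ _ := by gcongr; exact h7.trans hfin
  have h9 : C1 * (ε / (4 * C1) + ε / (4 * C1)) = ε / 2 := by field_simp; norm_num
  linarith

/-- The matrix with two columns that corresponds to an off-diagonal part. -/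
def colMat (e : Off k) : Matrix (Idx k) (Fin 2) ℂ :=
  Matrix.of fun p s => elim (fun q : Fin k × Fin 2 => ∑ a, e.1 a q.1 * spin a q.2 s)
    (fun t => ∑ a, e.2 a * star (spin a s t)) p

/-- The inverse of `colMat`. -/
def colInv (M : Matrix (Idx k) (Fin 2) ℂ) : Off k :=
  (fun a j => (1 / 2 : ℂ) * ∑ t, ∑ s, star (spin a t s) * M (inl (j, t)) s,
    fun a => (1 / 2 : ℂ) * ∑ t, ∑ s, spin a s t * M (inr t) s)

lemma colMat_colInv (M : Matrix (Idx k) (Fin 2) ℂ) : colMat (colInv M) = M := by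
  ext p s
  rcases p with ⟨j, t⟩ | t
  · rcases exists_fin_two.mp ⟨s, rfl⟩ with rfl | rfl <;>
    rcases exists_fin_two.mp ⟨t, rfl⟩ with rfl | rfl <;>
    simp [colMat, colInv, sum_univ_four, spin] <;> ring_nf <;> simp only [I_sq] <;> ring
  · rcases exists_fin_two.mp ⟨s, rfl⟩ with rfl | rfl <;>
    rcases exists_fin_two.mp ⟨t, rfl⟩ with rfl | rfl <;>
    simp [colMat, colInv, sum_univ_four, spin] <;> ring_nf <;> simp only [I_sq] <;> ring

lemma Rop_blockData_zero_inl_zero (t : R4) (e : Off k) (z : Data k) (s u : Fin 2) :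
    Rop t (blockData t e z) (0, s) (inl (0, u)) = 0 := by
  rw [Rop_eq, fromCols_apply_inl, Matrix.sum_apply]
  refine sum_eq_zero fun a _ => ?_
  rw [kroneckerMap_apply, tau, Matrix.sub_apply, T_zero_zero, T0_blockData]
  simp

lemma Rop_blockData_zero_inl_succ (t : R4) (e : Off k) (z : Data k) (s u : Fin 2) (j : Fin k) :
    Rop t (blockData t e z) (0, s) (inl (j.succ, u)) = star (colMat e (inl (j, u)) s) := by
  rw [Rop_eq, fromCols_apply_inl, Matrix.sum_apply, colMat, of_apply, Sum.elim_inl, star_sum]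
  refine sum_ext fun a _ => ?_
  rw [kroneckerMap_apply, tau, Matrix.sub_apply, T_zero_succ, off_blockData]
  simp [(succ_ne_zero j).symm, mul_comm]

lemma Rop_blockData_zero_inr (t : R4) (e : Off k) (z : Data k) (s u : Fin 2) :
    Rop t (blockData t e z) (0, s) (inr u) = star (colMat e (inr u) s) := by
  rw [Rop_eq, fromCols_apply_inr, colMat, of_apply, Sum.elim_inr, star_sum]
  change ∑ a, (blockData t e z).P a 0 * spin a s u = _
  refine sum_ext fun a _ => ?_
  rw [star_mul, star_star, mul_comm]
  rfl

lemma Rop_succ_inl_succ (x : R4) (y : Data₁) (i j : Fin k) (s u : Fin 2) :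
    Rop x y (i.succ, s) (inl (j.succ, u)) = Rop x (lower y) (i, s) (inl (j, u)) := by
  rw [Rop_eq, Rop_eq, fromCols_apply_inl, fromCols_apply_inl, Matrix.sum_apply, Matrix.sum_apply]
  refine sum_ext fun a _ => ?_
  rw [kroneckerMap_apply, kroneckerMap_apply]
  congr 1
  simp only [tau, Matrix.sub_apply, Matrix.smul_apply, Matrix.one_apply, Fin.succ_inj]
  rfl

lemma Rop_succ_inr (x : R4) (y : Data₁) (i : Fin k) (s u : Fin 2) :
    Rop x y (i.succ, s) (inr u) = Rop x (lower y) (i, s) (inr u) := by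
  rw [Rop_eq, Rop_eq, fromCols_apply_inr, fromCols_apply_inr]
  rfl

lemma RR_blockData_succ_zero (t : R4) (e : Off k) (z : Data k) (i : Fin k) (s u : Fin 2) :
    RR (t, blockData t e z) (i.succ, s) (0, u) = (Rop t z * colMat e) (i, s) u := by
  rw [RR, Matrix.mul_apply, Matrix.mul_apply, Fintype.sum_sum_type, Fintype.sum_sum_type,
    Fintype.sum_prod_type, Fintype.sum_prod_type, sum_univ_succ]
  simp only [conjTranspose_apply, Rop_blockData_zero_inl_zero, Rop_blockData_zero_inl_succ,
    Rop_blockData_zero_inr, star_star, star_zero, mul_zero, sum_const_zero, zero_add,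
    Rop_succ_inl_succ, Rop_succ_inr, lower_blockData]

lemma RR_blockData_zero_zero (t : R4) (e : Off k) (z : Data k) (s u : Fin 2) :
    RR (t, blockData t e z) (0, s) (0, u) = ((colMat e)ᴴ * colMat e) s u := by
  rw [RR, Matrix.mul_apply, Matrix.mul_apply, Fintype.sum_sum_type, Fintype.sum_sum_type,
    Fintype.sum_prod_type, Fintype.sum_prod_type, sum_univ_succ]
  simp only [conjTranspose_apply, Rop_blockData_zero_inl_zero, Rop_blockData_zero_inl_succ,
    Rop_blockData_zero_inr, star_star, star_zero, mul_zero, sum_const_zero, zero_add]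

lemma RR_apply (x : R4) (y : Data k) (i j : Fin k) (s u : Fin 2) :
    RR (x, y) (i, s) (j, u) = Dm x y i j * (1 : Mat 2) s u +
      ∑ c, moment y c i j * spin c.succ s u := by
  rw [RR, Rop_mul_conjTranspose, Matrix.add_apply, Matrix.sum_apply]
  rfl

lemma spin_coeff {M : Mat 2} {d : ℂ} {m : Fin 3 → ℂ}
    (h : ∀ s u, M s u = d * (1 : Mat 2) s u + ∑ c, m c * spin c.succ s u) :
    2 * d = M 0 0 + M 1 1 ∧ 2 * I * m 0 = M 0 0 - M 1 1 ∧ 2 * m 1 = M 0 1 - M 1 0 ∧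
      2 * I * m 2 = M 0 1 + M 1 0 := by
  have h00 := h 0 0
  have h01 := h 0 1
  have h10 := h 1 0
  have h11 := h 1 1
  simp [sum_univ_three, spin] at h00 h01 h10 h11
  rw [h00, h01, h10, h11]
  refine ⟨?_, ?_, ?_, ?_⟩ <;> ring

lemma spin_coeff_eq_zero {d : ℂ} {m : Fin 3 → ℂ}
    (h : ∀ s u, 0 = d * (1 : Mat 2) s u + ∑ c, m c * spin c.succ s u) :
    d = 0 ∧ ∀ c, m c = 0 := by
  obtain ⟨h0, h1, h2, h3⟩ := spin_coeff (M := 0) h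
  simp at h0 h1 h2 h3
  refine ⟨h0, fun c => ?_⟩
  fin_cases c
  · exact h1
  · exact h2
  · exact h3

lemma of_Rop_mul_colMat_eq_zero {t : R4} {e : Off k} {z : Data k}
    (h : Rop t z * colMat e = 0) (i : Fin k) :
    Dm t (blockData t e z) i.succ 0 = 0 ∧ ∀ c, moment (blockData t e z) c i.succ 0 = 0 := by
  refine spin_coeff_eq_zero fun s u => ?_
  rw [← RR_apply, RR_blockData_succ_zero, h]
  rfl

/-- The Hermitian pairing of off-diagonal parts. -/
def offInner (f e : Off k) : ℂ := ∑ c, (star (f.1 c) ⬝ᵥ e.1 c + star (f.2 c) * e.2 c)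

lemma norm_offInner_le (f e : Off k) : ‖offInner f e‖ ≤ 4 * (k + 1) * ‖f‖ * ‖e‖ := by
  have h : ∀ c, ‖star (f.1 c) ⬝ᵥ e.1 c + star (f.2 c) * e.2 c‖ ≤ (k + 1) * ‖f‖ * ‖e‖ := fun c => by
    refine (norm_add_le _ _).trans ?_
    have h1 : ‖star (f.1 c) ⬝ᵥ e.1 c‖ ≤ k * ‖f‖ * ‖e.1 c‖ := norm_dotProduct_le (fun i => by
        rw [Pi.star_apply, norm_star]; exact norm_off_fst_le _ _ _) _
    have h2 : ‖e.1 c‖ ≤ ‖e‖ := (norm_le_pi_norm e.1 c).trans (norm_fst_le e)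
    have h3 : ‖star (f.2 c) * e.2 c‖ ≤ ‖f‖ * ‖e‖ := by
      rw [norm_mul, norm_star]
      gcongr
      · exact norm_off_snd_le _ _
      · exact norm_off_snd_le _ _
    have h4 : (k : ℝ) * ‖f‖ * ‖e.1 c‖ ≤ k * ‖f‖ * ‖e‖ := by gcongr
    linarith
  refine (norm_sum_le_of_le _ fun c _ => h c).trans ?_
  simp
  linarith

lemma offInner_self (e : Off k) :
    offInner e e = ((∑ c, (∑ i, ‖e.1 c i‖ ^ 2 + ‖e.2 c‖ ^ 2) : ℝ) : ℂ) := by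
  have hs : ∀ z : ℂ, star z * z = ((‖z‖ ^ 2 : ℝ) : ℂ) := fun z => by
    rw [star_def, Complex.conj_mul']; norm_cast
  simp only [offInner, dotProduct, Pi.star_apply, hs]
  push_cast
  rfl

lemma norm_sq_le_offInner_self (e : Off k) : ‖e‖ ^ 2 ≤ ‖offInner e e‖ := by
  have hn : 0 ≤ ∑ c, (∑ i, ‖e.1 c i‖ ^ 2 + ‖e.2 c‖ ^ 2) :=
    sum_nonneg fun c _ => add_nonneg (sum_nonneg fun _ _ => sq_nonneg _) (sq_nonneg _)
  rw [offInner_self, norm_real, Real.norm_eq_abs, abs_of_nonneg hn]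
  have hc : ∀ c, (∑ i, ‖e.1 c i‖ ^ 2 + ‖e.2 c‖ ^ 2) ≤ ∑ c, (∑ i, ‖e.1 c i‖ ^ 2 + ‖e.2 c‖ ^ 2) :=
    fun c => single_le_sum (f := fun c => (∑ i, ‖e.1 c i‖ ^ 2 + ‖e.2 c‖ ^ 2))
      (fun c _ => add_nonneg (sum_nonneg fun _ _ => sq_nonneg _) (sq_nonneg _))
      (mem_univ c)
  have : ‖e‖ ≤ Real.sqrt (∑ c, (∑ i, ‖e.1 c i‖ ^ 2 + ‖e.2 c‖ ^ 2)) := by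
    refine Off.norm_le (Real.sqrt_nonneg _) (fun c i => ?_) fun c => ?_
    · refine Real.le_sqrt_of_sq_le (le_trans ?_ (hc c))
      have h5 : ‖e.1 c i‖ ^ 2 ≤ ∑ i, ‖e.1 c i‖ ^ 2 :=
        single_le_sum (f := fun i => ‖e.1 c i‖ ^ 2) (fun _ _ => sq_nonneg _) (mem_univ i)
      have := sq_nonneg ‖e.2 c‖
      linarith
    · refine Real.le_sqrt_of_sq_le (le_trans ?_ (hc c))
      have : 0 ≤ ∑ i, ‖e.1 c i‖ ^ 2 := sum_nonneg fun _ _ => sq_nonneg _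
      linarith
  calc ‖e‖ ^ 2 ≤ (Real.sqrt _) ^ 2 := by gcongr
    _ = _ := Real.sq_sqrt hn

lemma offInner_symb {t : R4} {e : Off k} {z : Data k} (h : Rop t z * colMat e = 0)
    (ζ : Fin k → ℂ) : offInner e (symb t z ζ) = 0 := by
  have h1 : star (Pi.single 0 1 : Fin (k + 1) → ℂ) ⬝ᵥ
      (Dm t (blockData t e z) *ᵥ (Fin.cons 0 ζ : Fin (k + 1) → ℂ)) = 0 := by
    have hD : ∀ j : Fin k, Dm t (blockData t e z) 0 j.succ = 0 := fun j => by
      have hH : (Dm t (blockData t e z))ᴴ = Dm t (blockData t e z) := by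
        simp [Dm, conjTranspose_sum, tau_conjTranspose, Matrix.conjTranspose_vecMulVec]
      rw [← hH, conjTranspose_apply, (of_Rop_mul_colMat_eq_zero h j).1, star_zero]
    rw [show star (Pi.single 0 1 : Fin (k + 1) → ℂ) = Pi.single 0 1 by
      funext i; refine Fin.cases ?_ (fun i => ?_) i <;> simp, single_one_dotProduct]
    simp [mulVec, dotProduct, sum_univ_succ, hD]
  rw [dotProduct_Dm_mulVec] at h1
  rw [← h1, offInner]
  have ht : tail (Pi.single 0 1 : Fin (k + 1) → ℂ) = 0 := by funext i; simp [tail]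
  refine sum_ext fun c _ => ?_
  congr 1
  · rw [dotProduct, dotProduct, sum_univ_succ]
    simp [symb_fst_zero, symb_fst_succ, ht, T0_blockData, off_blockData, lower_blockData]
  · simp [symb_snd_succ, ht, off_blockData, lower_blockData]

lemma norm_le_of_Rop_mul_colMat {t : R4} {e : Off k} {z : Data k} (h : Rop t z * colMat e = 0)
    (ζ : Fin k → ℂ) : ‖e‖ ≤ 4 * (k + 1) * ‖e - symb t z ζ‖ := by
  have h1 : offInner e (e - symb t z ζ) = offInner e e := by
    have : offInner e (e - symb t z ζ) = offInner e e - offInner e (symb t z ζ) := by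
      simp only [offInner, ← sum_sub_distrib]
      refine sum_ext fun c _ => ?_
      rw [Prod.fst_sub, Prod.snd_sub, Pi.sub_apply, Pi.sub_apply, dotProduct_sub]
      ring
    rw [this, offInner_symb h, sub_zero]
  have h2 := norm_offInner_le e (e - symb t z ζ)
  rw [h1] at h2
  have h3 := norm_sq_le_offInner_self e
  rcases eq_or_ne ‖e‖ 0 with h0 | h0
  · rw [h0]; positivity
  · have hpos : 0 < ‖e‖ := lt_of_le_of_ne (norm_nonneg _) (Ne.symm h0)
    nlinarith

lemma exists_kernel_frame (t : R4) (y : Data k) :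
    ∃ S : Matrix (Idx k) (Fin 2) ℂ, Rop t y * S = 0 ∧ Sᴴ * S = 1 := by
  let L := Matrix.toLin' (Rop t y) ∘ₗ (WithLp.linearEquiv 2 ℂ (Idx k → ℂ)).toLinearMap
  have hfin : 2 ≤ Module.finrank ℂ (LinearMap.ker L) := by
    have h1 := L.finrank_range_add_finrank_ker
    have h2 := (LinearMap.range L).finrank_le
    rw [Module.finrank_fintype_fun_eq_card] at h2
    rw [finrank_euclideanSpace] at h1
    simp only [Fintype.card_sum, Fintype.card_prod, Fintype.card_fin] at h1 h2
    omega
  let b := stdOrthonormalBasis ℂ (LinearMap.ker L)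
  let f : Fin 2 → Fin (Module.finrank ℂ (LinearMap.ker L)) := fun s => ⟨s.1, by omega⟩
  refine ⟨Matrix.of fun p s => (b (f s) : EuclideanSpace ℂ (Idx k)) p, ?_, ?_⟩
  · ext i s
    have := LinearMap.mem_ker.1 (b (f s)).2
    exact congrFun this i
  · ext s u
    have h1 := (orthonormal_iff_ite.1 b.orthonormal) (f s) (f u)
    have h2 : f s = f u ↔ s = u := by
      constructor
      · intro h
        exact Fin.ext (by simpa [f] using h)
      · rintro rfl; rfl
    rw [Submodule.coe_inner, PiLp.inner_apply] at h1
    rw [Matrix.mul_apply, Matrix.one_apply]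
    simp only [h2] at h1
    rw [← h1]
    refine sum_ext fun p _ => ?_
    simp [mul_comm]

/-- Traceless Hermitian `2 × 2` matrices. -/
def pauli : (Fin 3 → ℝ) →ₗ[ℝ] Mat 2 where
  toFun b := ∑ c, ((b c : ℂ) * I) • spin c.succ
  map_add' b b' := by
    rw [← sum_add_distrib]
    refine sum_ext fun c _ => ?_
    rw [← add_smul, ← add_mul]; simp
  map_smul' r b := by
    rw [RingHom.id_apply, smul_sum]
    refine sum_ext fun c _ => ?_
    ext s u
    simp [mul_assoc]

lemma pauli_eq (b : Fin 3 → ℝ) : pauli b =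
    !![-(b 0 : ℂ), -(b 2 : ℂ) + b 1 * I; -(b 2 : ℂ) - b 1 * I, (b 0 : ℂ)] := by
  ext s u
  rcases exists_fin_two.mp ⟨s, rfl⟩ with rfl | rfl <;>
  rcases exists_fin_two.mp ⟨u, rfl⟩ with rfl | rfl <;>
  simp [pauli, sum_univ_three, spin, mul_assoc] <;> ring

/-- Off-diagonal data as data of charge `k + 1`. -/
def blockOff (k : ℕ) : Off k →ₗ[ℝ] Data (k + 1) where
  toFun e := blockData 0 e 0
  map_add' e f := by
    refine Data.ext' (fun a => ?_) fun a => ?_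
    · ext i j
      refine Fin.cases ?_ (fun i => ?_) i <;> refine Fin.cases ?_ (fun j => ?_) j
      · change ((0 : ℝ) : ℂ) = ((0 : ℝ) : ℂ) + ((0 : ℝ) : ℂ)
        simp
      · exact star_add _ _
      · rfl
      · exact (add_zero (0 : ℂ)).symm
    · funext i
      refine Fin.cases ?_ (fun i => ?_) i
      · exact star_add _ _
      · exact (add_zero (0 : ℂ)).symm
  map_smul' r e := by
    refine Data.ext' (fun a => ?_) fun a => ?_
    · ext i j
      refine Fin.cases ?_ (fun i => ?_) i <;> refine Fin.cases ?_ (fun j => ?_) j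
      · change ((0 : ℝ) : ℂ) = r • ((0 : ℝ) : ℂ)
        simp
      · change star (r • e.1 a j) = r • star (e.1 a j)
        rw [star_smul, star_trivial]
      · rfl
      · exact (smul_zero r).symm
    · funext i
      refine Fin.cases ?_ (fun i => ?_) i
      · change star (r • e.2 a) = r • star (e.2 a)
        rw [star_smul, star_trivial]
      · exact (smul_zero r).symm

/-- The lower right block of the values of the moment map. -/
def lowerU (k : ℕ) : (Fin 3 → uLie (k + 1)) →ₗ[ℝ] (Fin 3 → uLie k) where
  toFun x c := ⟨fun i j => (x c).1 i.succ j.succ, fun i j => (x c).2 i.succ j.succ⟩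
  map_add' _ _ := rfl
  map_smul' _ _ := rfl

/-- The upper left entries of the values of the moment map, divided by the imaginary unit. -/
def cornerU (k : ℕ) : (Fin 3 → uLie (k + 1)) →ₗ[ℝ] (Fin 3 → ℝ) where
  toFun x c := ((x c).1 0 0).im
  map_add' _ _ := rfl
  map_smul' r x := by
    funext c
    exact Complex.smul_im _ _

lemma cornerU_momentU (y : Data₁) (c : Fin 3) :
    moment y c 0 0 = ((cornerU k (momentU y) c : ℝ) : ℂ) * I := by
  have h := congr_fun₂ (moment_conjTranspose y c) 0 0
  rw [conjTranspose_apply, Matrix.neg_apply] at h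
  have h1 : (moment y c 0 0).re = 0 := by
    have := congrArg Complex.re h
    simp at this
    linarith
  have h2 : cornerU k (momentU y) c = (moment y c 0 0).im := by
    change (((momentU y c).1 : Fin (k + 1) → Fin (k + 1) → ℂ) 0 0).im = _
    rw [momentU_apply]
  rw [h2]
  apply Complex.ext <;> simp [h1]

lemma contDiff_momentU : ContDiff ℝ ∞ (momentU (k := k)) := by
  have : ContDiff ℝ ∞ fun y : Data k => (1 / 2 : ℝ) • momCL k y y :=
    ((momCL k).contDiff.clm_apply contDiff_id).const_smul _
  exact this

lemma blockData_mem_Abar {t : R4} {e : Off k} {z : Data k} (h : Rop t z * colMat e = 0)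
    {ε : ℝ} (h1 : momentU z + ε ^ 2 • lowerU k (momentU (blockOff k e)) = 0)
    (h2 : cornerU k (momentU (blockOff k e)) = 0) : blockData t (ε • e) z ∈ Abar (k + 1) := by
  have hm : ∀ c, moment (0 : Data k) c = 0 := fun c => by
    rw [moment_eq]
    have := mom_smul_left 0 (0 : Data k) 0 c
    rwa [zero_smul, zero_smul] at this
  refine mem_Abar_succ_iff.2 fun c => ⟨fun i j => ?_, fun i => ?_, ?_⟩
  · have e1 : moment z c i j + (ε : ℂ) ^ 2 * moment (blockOff k e) c i.succ j.succ = 0 := by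
      have := congr_fun₂ (congrArg Subtype.val (congrFun h1 c)) i j
      change ((momentU z c).1 : Fin k → Fin k → ℂ) i j + ε ^ 2 •
        ((momentU (blockOff k e) c).1 : Fin (k + 1) → Fin (k + 1) → ℂ) i.succ j.succ = 0 at this
      rw [momentU_apply, momentU_apply, real_smul] at this
      push_cast at this
      exact this
    change moment z c i j + (ε : ℂ) ^ 2 * moment (blockData 0 e 0) c i.succ j.succ = 0 at e1
    rw [moment_succ_succ, lower_blockData, off_blockData, hm] at e1
    rw [moment_succ_succ, lower_blockData, off_blockData, ← e1]
    simp only [Matrix.zero_apply, zero_add, mul_sum, Prod.smul_fst, Pi.smul_apply, star_smul,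
      star_trivial, real_smul]
    congr 1
    refine sum_ext fun a _ => sum_ext fun b _ => ?_
    rw [star_mul, star_def, conj_ofReal]
    ring
  · have e1 := (of_Rop_mul_colMat_eq_zero h i).2 c
    rw [moment_succ_zero, T0_blockData, lower_blockData, off_blockData] at e1 ⊢
    rw [← mul_zero (ε : ℂ), ← e1, mul_sum]
    refine sum_ext fun a _ => ?_
    rw [mul_sum]
    refine sum_ext fun b _ => ?_
    rw [Prod.smul_fst, Prod.smul_snd, Pi.smul_apply, Pi.smul_apply, mulVec_smul, Pi.smul_apply,
      real_smul, real_smul]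
    ring
  · have e1 : moment (blockData 0 e 0) c 0 0 = 0 := by
      have := cornerU_momentU (blockOff k e) c
      rw [h2] at this
      simp only [Pi.zero_apply, Complex.ofReal_zero, zero_mul] at this
      exact this
    rw [moment_zero_zero, off_blockData] at e1 ⊢
    rw [← mul_zero ((ε : ℂ) ^ 2), ← e1, mul_sum]
    refine sum_ext fun a _ => ?_
    rw [mul_sum]
    refine sum_ext fun b _ => ?_
    simp only [Prod.smul_fst, Prod.smul_snd, Pi.smul_apply, star_smul, star_trivial,
      smul_dotProduct, dotProduct_smul, real_smul, star_mul, star_def, conj_ofReal]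
    ring

/-- Candidate off-diagonal parts, in the kernel of `R_t`. -/
def kerOff (t : R4) (S : Matrix (Idx k) (Fin 2) ℂ) (q : Data k × (Fin 3 → ℝ)) : Off k :=
  colInv (proj (t, q.1) * S * (1 + pauli q.2))

lemma Rop_mul_kerOff {t : R4} {S : Matrix (Idx k) (Fin 2) ℂ} {q : Data k × (Fin 3 → ℝ)}
    (h : (RR (t, q.1)).det ≠ 0) : Rop t q.1 * colMat (kerOff t S q) = 0 := by
  rw [kerOff, colMat_colInv, ← Matrix.mul_assoc, ← Matrix.mul_assoc]
  have := Rop_mul_proj h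
  simp only at this
  rw [this]
  simp

lemma cornerU_kerOff {t : R4} {S : Matrix (Idx k) (Fin 2) ℂ}
    (hS : Rop t y * S = 0) (hS1 : Sᴴ * S = 1) (b : Fin 3 → ℝ) :
    cornerU k (momentU (blockOff k (kerOff t S (y, b)))) = (2 : ℝ) • b := by
  have hP : proj (t, y) * S = S := by
    rw [proj_eq, Matrix.sub_mul, Matrix.mul_assoc _ _ S, hS]
    simp
  have hM : (colMat (kerOff t S (y, b)))ᴴ * colMat (kerOff t S (y, b)) =
      (1 + pauli b)ᴴ * (1 + pauli b) := by
    rw [kerOff, colMat_colInv, hP, conjTranspose_mul, Matrix.mul_assoc, ← Matrix.mul_assoc Sᴴ, hS1,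
      Matrix.one_mul]
  obtain ⟨-, h1, h2, h3⟩ := spin_coeff (M := (1 + pauli b)ᴴ * (1 + pauli b))
    (d := Dm 0 (blockOff k (kerOff t S (y, b))) 0 0)
    (m := fun c => moment (blockOff k (kerOff t S (y, b))) c 0 0) (fun s u => by
      rw [← hM, ← RR_blockData_zero_zero 0 _ 0, RR_apply]
      rfl)
  simp only [cornerU_momentU] at h1 h2 h3
  rw [pauli_eq] at h1 h2 h3
  simp [Matrix.mul_apply, conjTranspose_apply, Matrix.one_apply] at h1 h2 h3
  have hI := I_sq
  have hI0 := I_ne_zero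
  funext c
  apply Complex.ofReal_injective
  fin_cases c
  · simp
    linear_combination (-1 / 2 : ℂ) * h1 + (cornerU k (momentU (blockOff k (kerOff t S (y, b)))) 0
      : ℂ) * hI
  · simp
    apply mul_right_cancel₀ hI0
    linear_combination (1 / 2 : ℂ) * h2
  · simp
    linear_combination (-1 / 2 : ℂ) * h3 + (cornerU k (momentU (blockOff k (kerOff t S (y, b)))) 2
      : ℂ) * hI

lemma contDiffAt_kerOff {t : R4} (S : Matrix (Idx k) (Fin 2) ℂ) {q : Data k × (Fin 3 → ℝ)}
    (h : (RR (t, q.1)).det ≠ 0) : ContDiffAt ℝ ∞ (kerOff t S) q := by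
  have h1 : MSmoothAt (fun q : Data k × (Fin 3 → ℝ) => proj (t, q.1)) q := fun i j =>
    (msmoothAt_proj (z := (t, q.1)) h i j).comp q (contDiffAt_const.prodMk contDiffAt_fst)
  have h2 : MSmoothAt (fun q : Data k × (Fin 3 → ℝ) => 1 + pauli q.2) q := fun i j =>
    contDiffAt_const.add (msmoothAt_linear pauli contDiffAt_snd i j)
  have h3 := (h1.mul (msmoothAt_const S q)).mul h2
  refine ContDiffAt.prodMk ?_ ?_
  · refine contDiffAt_pi.2 fun a => contDiffAt_pi.2 fun j => contDiffAt_const.mul ?_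
    exact ContDiffAt.sum fun s _ => ContDiffAt.sum fun u _ => contDiffAt_const.mul (h3 _ _)
  · refine contDiffAt_pi.2 fun a => contDiffAt_const.mul ?_
    exact ContDiffAt.sum fun s _ => ContDiffAt.sum fun u _ => contDiffAt_const.mul (h3 _ _)

/-- The equations to be solved for a family of nondegenerate data approaching the fixed set. -/
def glueMap (t : R4) (S : Matrix (Idx k) (Fin 2) ℂ) (p : ℝ × Data k × (Fin 3 → ℝ)) :
    ℝ × (Fin 3 → uLie k) × (Fin 3 → ℝ) :=
  (p.1, momentU p.2.1 + p.1 ^ 2 • lowerU k (momentU (blockOff k (kerOff t S p.2))),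
    cornerU k (momentU (blockOff k (kerOff t S p.2))))

lemma exists_strict_surjective {Z B F H : Type*} [NormedAddCommGroup Z] [NormedSpace ℝ Z]
    [NormedAddCommGroup B] [NormedSpace ℝ B] [NormedAddCommGroup F] [NormedSpace ℝ F]
    [NormedAddCommGroup H] [NormedSpace ℝ H] {m : Z → F} {N : Z × B → F} {M : Z × B → H}
    {m' : Z →L[ℝ] F} {N' : Z × B →L[ℝ] F} {M' : Z × B →L[ℝ] H} {y : Z}
    (hm : HasStrictFDerivAt m m' y) (hN : HasStrictFDerivAt N N' (y, 0))
    (hM : HasStrictFDerivAt M M' (y, 0)) (hm' : Function.Surjective m')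
    (hM' : Function.Surjective fun b => M' (0, b)) :
    ∃ G' : ℝ × Z × B →L[ℝ] ℝ × F × H,
      HasStrictFDerivAt (fun p : ℝ × Z × B => (p.1, m p.2.1 + p.1 ^ 2 • N p.2, M p.2)) G'
        (0, y, 0) ∧ Function.Surjective G' := by
  have hq : HasStrictFDerivAt (fun p : ℝ × Z × B => p.2)
      (ContinuousLinearMap.snd ℝ ℝ (Z × B)) (0, y, 0) := hasStrictFDerivAt_snd
  have hz : HasStrictFDerivAt (fun p : ℝ × Z × B => p.2.1)
      ((ContinuousLinearMap.fst ℝ Z B).comp (ContinuousLinearMap.snd ℝ ℝ (Z × B))) (0, y, 0) :=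
    HasStrictFDerivAt.comp (g := Prod.fst) (0, y, 0) hasStrictFDerivAt_fst hq
  have hsq : HasStrictFDerivAt (fun p : ℝ × Z × B => p.1 ^ 2) (0 : ℝ × Z × B →L[ℝ] ℝ)
      (0, y, 0) := by
    have := (hasStrictFDerivAt_fst (𝕜 := ℝ) (p := ((0 : ℝ), (y, (0 : B))))).pow 2
    simpa using this
  have h1 := HasStrictFDerivAt.comp (g := m) (0, y, 0) hm hz
  have h2 := hsq.smul (HasStrictFDerivAt.comp (g := N) (0, y, 0) hN hq)
  have h3 := HasStrictFDerivAt.comp (g := M) (0, y, 0) hM hq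
  refine ⟨_, (hasStrictFDerivAt_fst.prodMk ((h1.add h2).prodMk h3)), ?_⟩
  rintro ⟨τ, u, β⟩
  obtain ⟨dz, hdz⟩ := hm' u
  obtain ⟨b, hb⟩ := hM' (β - M' (dz, 0))
  refine ⟨(τ, dz, b), Prod.ext rfl (Prod.ext ?_ ?_)⟩
  · simp [hdz]
  · change M' (dz, b) = β
    have e : (dz, b) = (dz, (0 : B)) + ((0 : Z), b) := by simp
    have hb' : M' (0, b) = β - M' (dz, 0) := hb
    rw [e, map_add, hb']
    abel

set_option maxHeartbeats 1000000 in
lemma exists_glueMap_deriv (hy : y ∈ A k) {t : R4}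
    {S : Matrix (Idx k) (Fin 2) ℂ} (hS : Rop t y * S = 0) (hS1 : Sᴴ * S = 1) :
    ∃ G' : ℝ × Data k × (Fin 3 → ℝ) →L[ℝ] ℝ × (Fin 3 → uLie k) × (Fin 3 → ℝ),
      HasStrictFDerivAt (glueMap t S) G' (0, y, 0) ∧ Function.Surjective G' := by
  have hN : ContDiffAt ℝ ∞ (fun q : Data k × (Fin 3 → ℝ) => momentU (blockOff k (kerOff t S q)))
      (y, 0) :=
    contDiff_momentU.contDiffAt.comp _ ((toContinuousLinearMap
      (blockOff k)).contDiff.contDiffAt.comp _ (contDiffAt_kerOff S (det_RR_ne_zero (hy.2 t))))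
  obtain ⟨L1, hN1⟩ : ∃ L1, HasStrictFDerivAt (fun q : Data k × (Fin 3 → ℝ) =>
      lowerU k (momentU (blockOff k (kerOff t S q)))) L1 (y, 0) :=
    ⟨_, ((toContinuousLinearMap (lowerU k)).contDiff.contDiffAt.comp _
      hN).hasStrictFDerivAt (by norm_cast)⟩
  obtain ⟨L, hN2⟩ : ∃ L, HasStrictFDerivAt (fun q : Data k × (Fin 3 → ℝ) =>
      cornerU k (momentU (blockOff k (kerOff t S q)))) L (y, 0) :=
    ⟨_, ((toContinuousLinearMap (cornerU k)).contDiff.contDiffAt.comp _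
      hN).hasStrictFDerivAt (by norm_cast)⟩
  have hm' : Function.Surjective (momCL k y) := momL_surjective hy
  have hLb : ∀ b : Fin 3 → ℝ, L (0, b) = (2 : ℝ) • b := by
    have h1 : HasFDerivAt (fun b : Fin 3 → ℝ => (y, b)) (ContinuousLinearMap.inr ℝ (Data k) _) 0 :=
      hasFDerivAt_prodMk_right y 0
    have h2 := (hN2.hasFDerivAt).comp (0 : Fin 3 → ℝ) h1
    have h3 : HasFDerivAt (fun b : Fin 3 → ℝ => (2 : ℝ) • b)
        ((2 : ℝ) • ContinuousLinearMap.id ℝ (Fin 3 → ℝ)) 0 :=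
      ((2 : ℝ) • ContinuousLinearMap.id ℝ (Fin 3 → ℝ)).hasFDerivAt
    have h4 : ((fun q : Data k × (Fin 3 → ℝ) => cornerU k (momentU (blockOff k (kerOff t S q)))) ∘
        fun b : Fin 3 → ℝ => (y, b)) = fun b : Fin 3 → ℝ => (2 : ℝ) • b := by
      funext b
      exact cornerU_kerOff hS hS1 b
    rw [h4] at h2
    intro b
    have := DFunLike.congr_fun (h2.unique h3) b
    simpa using this
  have h2 : Function.Surjective fun b : Fin 3 → ℝ => L (0, b) := fun β => ⟨(1 / 2 : ℝ) • β, by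
      change L (0, (1 / 2 : ℝ) • β) = β
      rw [hLb, smul_smul]
      norm_num⟩
  exact exists_strict_surjective (hasStrictFDerivAt_momentU y) hN1 hN2 hm' h2

lemma colMat_zero : colMat (0 : Off k) = 0 := by
  ext p s
  rcases p with ⟨j, t⟩ | t <;> simp [colMat]

lemma eventually_exists_blockData (hy : y ∈ A k) (t : R4) :
    ∃ C > 0, ∃ c > 0, ∀ᶠ ε in 𝓝[>] (0 : ℝ), ∃ (e : Off k) (z : Data k),
      Rop t z * colMat e = 0 ∧ c ≤ ‖e‖ ∧ ‖e‖ ≤ C ∧ ‖z - y‖ ≤ C * ε ^ 2 ∧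
        blockData t (ε • e) z ∈ Abar (k + 1) := by
  obtain ⟨S, hS, hS1⟩ := exists_kernel_frame t y
  obtain ⟨G', hG, hsurj⟩ := exists_glueMap_deriv hy hS hS1
  obtain ⟨C, hC, hev⟩ := HasStrictFDerivAt.exists_dist_le hG hsurj
  have hcorner0 : cornerU k (momentU (blockOff k (kerOff t S (y, 0)))) = 0 := by
    rw [cornerU_kerOff hS hS1, smul_zero]
  have hy0 : momentU y = 0 := momentU_eq_zero.2 hy.1
  have hG0 : glueMap t S (0, y, 0) = 0 := by
    simp only [glueMap, hcorner0, hy0]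
    simp
  set K := ‖lowerU k (momentU (blockOff k (kerOff t S (y, 0))))‖ with hK
  have hdet : ∀ᶠ p : ℝ × Data k × (Fin 3 → ℝ) in 𝓝 (0, y, 0), (RR (t, p.2.1)).det ≠ 0 := by
    have h1 := eventually_det_ne (z := (t, y)) (det_RR_ne_zero (hy.2 t))
    have h2 : ContinuousAt (fun p : ℝ × Data k × (Fin 3 → ℝ) => (t, p.2.1)) (0, y, 0) := by fun_prop
    exact h2.eventually h1
  have hcont : ContinuousAt (fun p : ℝ × Data k × (Fin 3 → ℝ) => ‖kerOff t S p.2‖) (0, y, 0) := by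
    have h1 := (contDiffAt_kerOff (q := (y, (0 : Fin 3 → ℝ))) S
      (det_RR_ne_zero (hy.2 t))).continuousAt
    have h2 : ContinuousAt (fun p : ℝ × Data k × (Fin 3 → ℝ) => p.2) (0, y, 0) := continuousAt_snd
    exact (ContinuousAt.comp (x := ((0 : ℝ), y, (0 : Fin 3 → ℝ))) (g := kerOff t S)
      (f := fun p : ℝ × Data k × (Fin 3 → ℝ) => p.2) h1 h2).norm
  have he0 : 0 < ‖kerOff t S (y, 0)‖ := by
    refine norm_pos_iff.2 fun h0 => ?_
    have h1 : colMat (kerOff t S (y, 0)) = S := by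
      rw [kerOff, colMat_colInv, map_zero, add_zero, Matrix.mul_one, proj_eq, Matrix.sub_mul,
        Matrix.mul_assoc _ _ S, hS]
      simp
    rw [h0, colMat_zero] at h1
    rw [← h1] at hS1
    have := congr_fun₂ hS1 0 0
    simp at this
  set E0 := ‖kerOff t S (y, 0)‖ with hE0
  have hlow := hcont.eventually (lt_mem_nhds (show E0 / 2 < ‖kerOff t S (y, 0)‖ by
    rw [← hE0]; linarith))
  have hupp := hcont.eventually (gt_mem_nhds (show ‖kerOff t S (y, 0)‖ < 2 * E0 by
    rw [← hE0]; linarith))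
  obtain ⟨δ, hδ, hball⟩ := Metric.eventually_nhds_iff.1 (hdet.and (hlow.and hupp))
  refine ⟨C * K + 2 * E0, by positivity, E0 / 2, by positivity, ?_⟩
  have hpair : Tendsto (fun ε : ℝ => (((ε, y, 0), (ε, 0, 0)) :
      (ℝ × Data k × (Fin 3 → ℝ)) × (ℝ × (Fin 3 → uLie k) × (Fin 3 → ℝ)))) (𝓝[>] 0)
      (𝓝 ((0, y, 0), glueMap t S (0, y, 0))) := by
    rw [hG0]
    have : Continuous fun ε : ℝ => (((ε, y, 0), (ε, 0, 0)) :
      (ℝ × Data k × (Fin 3 → ℝ)) × (ℝ × (Fin 3 → uLie k) × (Fin 3 → ℝ))) := by fun_prop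
    exact (this.tendsto 0).mono_left nhdsWithin_le_nhds
  have hsmall : ∀ᶠ ε : ℝ in 𝓝[>] 0, C * K * ε ^ 2 + ε < δ := by
    have : Continuous fun ε : ℝ => C * K * ε ^ 2 + ε := by fun_prop
    have h := this.tendsto 0
    simp only [ne_eq, OfNat.ofNat_ne_zero, not_false_eq_true, zero_pow, mul_zero, add_zero] at h
    exact nhdsWithin_le_nhds (h.eventually (gt_mem_nhds hδ))
  filter_upwards [hpair.eventually hev, hsmall, self_mem_nhdsWithin] with ε hε hεδ hpos
  have hpos' : (0 : ℝ) < ε := hpos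
  obtain ⟨p, hp1, hp2⟩ := hε
  have hdef : ‖glueMap t S (ε, y, 0) - (ε, 0, 0)‖ ≤ K * ε ^ 2 := by
    simp only [glueMap, hcorner0, hy0, zero_add, Prod.mk_sub_mk, sub_self, sub_zero]
    refine max_le ?_ (max_le ?_ ?_)
    · rw [norm_zero]; positivity
    · rw [norm_smul, Real.norm_eq_abs, abs_of_nonneg (sq_nonneg ε), mul_comm]
    · rw [norm_zero]; positivity
  have hp3 : ‖p - (ε, y, 0)‖ ≤ C * K * ε ^ 2 := by
    refine hp2.trans ?_
    rw [mul_assoc]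
    exact mul_le_mul_of_nonneg_left hdef hC.le
  have hp4 : dist p (0, y, 0) < δ := by
    rw [dist_eq_norm]
    have : p - (0, y, 0) = (p - (ε, y, 0)) + (ε, 0, 0) := by
      rw [sub_add]
      simp
    rw [this]
    refine (norm_add_le _ _).trans_lt (lt_of_le_of_lt (add_le_add hp3 ?_) hεδ)
    refine max_le ?_ (max_le ?_ ?_)
    · rw [Real.norm_eq_abs, abs_of_pos hpos']
    · rw [norm_zero]; exact hpos'.le
    · rw [norm_zero]; exact hpos'.le
  obtain ⟨hd, hl, hu⟩ := hball hp4
  have hp11 : p.1 = ε := congrArg Prod.fst hp1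
  have hp12 := congrArg (fun w => w.2.1) hp1
  have hp13 := congrArg (fun w => w.2.2) hp1
  simp only [glueMap, hp11] at hp12 hp13
  have hCK : 0 ≤ C * K := mul_nonneg hC.le (norm_nonneg _)
  refine ⟨kerOff t S p.2, p.2.1, Rop_mul_kerOff hd, hl.le, by linarith, ?_,
    blockData_mem_Abar (Rop_mul_kerOff hd) hp12 hp13⟩
  have h5 : ‖p.2.1 - y‖ ≤ ‖p - (ε, y, 0)‖ :=
    (norm_fst_le (p.2 - (y, 0))).trans (norm_snd_le (p - (ε, y, 0)))
  refine h5.trans (hp3.trans ?_)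
  have : 0 ≤ 2 * E0 * ε ^ 2 := by positivity
  linarith

lemma conjAct_one (y : Data k) : conjAct 1 y = y :=
  Data.ext' (fun a => by rw [conjAct_T]; simp) fun a => by rw [conjAct_P]; simp

lemma blockData_of_off_eq_zero {y : Data₁} (hy : off y = 0) : blockData (T0 y) 0 (lower y) = y := by
  rw [← sub_eq_zero, ← norm_eq_zero]
  refine le_antisymm (Data.norm_le_of_blocks (fun a => ?_) ?_ ?_) (norm_nonneg _)
  · rw [T0_sub, T0_blockData]; simp
  · rw [off_sub, off_blockData, hy]; simp
  · rw [lower_sub, lower_blockData]; simp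

lemma Sing1reg_subset {y : Data₁} (hy : y ∈ Sing1reg k) : y ∈ Abar (k + 1) \ A (k + 1) := by
  have hoff := mem_Sing1_iff.1 hy.1
  have hA : y ∈ Abar (k + 1) := by
    rw [← blockData_of_off_eq_zero hoff]
    exact blockData_zero_mem_Abar _ hy.2.1
  have := conjAct_mem_Abar_diff (u := 1) (by simp) hA hoff
  rwa [conjAct_one] at this

set_option maxHeartbeats 1000000 in
lemma exists_mem_closure_approach {y : Data₁} (hy : y ∈ Sing1reg k) :
    ∃ C : ℝ, y ∈ closure (approach C y) := by
  have hoffy : off y = 0 := mem_Sing1_iff.1 hy.1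
  obtain ⟨C, hC, c, hc, hev⟩ := eventually_exists_blockData hy.2 (T0 y)
  obtain ⟨cl, hcl, hlow⟩ := exists_norm_symb_ge hy.2
  set m : ℝ := c / (4 * (k + 1)) with hm
  have hmpos : 0 < m := by positivity
  have hmc : m ≤ c := by
    rw [hm, div_le_iff₀ (by positivity)]
    have : (0 : ℝ) ≤ k := by positivity
    nlinarith
  set η : ℝ := m / 2 with hη
  have hηpos : 0 < η := by positivity
  set c0 : ℝ := min (m / 4) 1 / (C + 1 + η) with hc0
  have hc0pos : 0 < c0 := by positivity
  obtain ⟨C2, hC2, hcoer⟩ := exists_symb_ge hy hc0pos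
  obtain ⟨δ, hδ, hball⟩ := Metric.eventually_nhds_iff.1 hcoer
  refine ⟨(C + 1) / η, ?_⟩
  rw [Metric.mem_closure_iff]
  intro ρ hρ
  set Z : ℝ := (1 + C + η) / cl with hZ
  have hs : ∀ {b : ℝ} (a : ℝ), 0 < b → ∀ᶠ ε : ℝ in 𝓝[>] 0, a * ε < b := fun {b} a hb => by
    have : Continuous fun ε : ℝ => a * ε := by fun_prop
    have h := this.tendsto 0
    rw [mul_zero] at h
    exact nhdsWithin_le_nhds (h.eventually (gt_mem_nhds hb))
  obtain ⟨ε, ⟨e, z, hker, he1, he2, hz, hA⟩, h1, h2, h3, h4, h11, hpos⟩ :=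
    (hev.and ((hs (C + 1) hρ).and ((hs (C + 1 + η) hδ).and ((hs C one_pos).and
      ((hs (k * C * Z) (show 0 < m / 4 by positivity)).and
      ((hs 1 one_pos).and self_mem_nhdsWithin)))))).exists
  have hε : (0 : ℝ) < ε := hpos
  set y' := blockData (T0 y) (ε • e) z with hy'
  have hεe : ‖ε • e‖ = ε * ‖e‖ := by rw [norm_smul, Real.norm_eq_abs, abs_of_pos hε]
  have hdist : ‖y' - y‖ ≤ (C + 1) * ε := by
    refine Data.norm_le_of_blocks (fun a => ?_) ?_ ?_
    · rw [T0_sub, T0_blockData, sub_self, abs_zero]; positivity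
    · rw [off_sub, off_blockData, hoffy, sub_zero, hεe]
      nlinarith
    · rw [lower_sub, lower_blockData]
      refine hz.trans ?_
      nlinarith
  have hfar : η * ε < ‖y' - y‖ := by
    have h5 := norm_off_le (y' - y)
    rw [off_sub, off_blockData, hoffy, sub_zero, hεe] at h5
    have : η < ‖e‖ := by rw [hη]; linarith
    nlinarith
  have hnear : ∀ d : Data₁, d ∈ Abar (k + 1) → ‖d - y'‖ ≤ η * ε → d ∈ A (k + 1) := by
    intro d hdA hd
    have hdy : ‖d - y‖ ≤ (C + 1 + η) * ε := by
      have : d - y = (d - y') + (y' - y) := by abel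
      rw [this]
      refine (norm_add_le _ _).trans ?_
      linarith
    have hne : d ≠ y := by
      rintro rfl
      rw [norm_sub_rev] at hd
      linarith
    refine mem_A_of_isTransverse hne (hball ((dist_eq_norm _ _).trans_lt
      (lt_of_le_of_lt hdy h2)) ?_) hdA
    intro ζ
    by_contra! hlt
    have hN : ‖off d - symb (T0 y) (lower y) ζ‖ < min (m / 4) 1 * ε := by
      refine hlt.trans_le ?_
      calc c0 * ‖d - y‖ ≤ c0 * ((C + 1 + η) * ε) := by gcongr
        _ = _ := by rw [hc0]; field_simp
    have hN1 : ‖off d - symb (T0 y) (lower y) ζ‖ < m / 4 * ε :=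
      hN.trans_le (by gcongr; exact min_le_left _ _)
    have hN2 : ‖off d - symb (T0 y) (lower y) ζ‖ < 1 * ε :=
      hN.trans_le (by gcongr; exact min_le_right _ _)
    have hoffd : ‖off d - ε • e‖ ≤ η * ε := by
      have := norm_off_le (d - y')
      rw [off_sub, off_blockData] at this
      exact this.trans hd
    have hζ : ‖ζ‖ ≤ Z * ε := by
      have e1 := hlow (T0 y) ζ
      have e2 : ‖symb (T0 y) (lower y) ζ‖ ≤ 1 * ε + η * ε + C * ε := by
        have : symb (T0 y) (lower y) ζ =
          -(off d - symb (T0 y) (lower y) ζ) + (off d - ε • e) + ε • e := by abel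
        rw [this]
        refine (norm_add₃_le).trans (add_le_add (add_le_add ?_ hoffd) ?_)
        · rw [norm_neg]; exact hN2.le
        · rw [hεe]; nlinarith
      rw [hZ, div_mul_eq_mul_div, le_div_iff₀ hcl]
      linarith
    have h6 : ‖symb (T0 y) z ζ - symb (T0 y) (lower y) ζ‖ ≤ m / 4 * ε := by
      refine (norm_symb_sub_le _ _ _ _).trans ?_
      have hz' : ‖z - lower y‖ ≤ C * ε * ε := by rw [mul_assoc, ← sq]; exact hz
      have hz1 : ‖z - lower y‖ ≤ ε := by nlinarith
      calc (k : ℝ) * ‖z - lower y‖ * ‖ζ‖ ≤ k * (C * ε * ε) * ‖ζ‖ := by gcongr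
        _ ≤ k * (C * ε * ε) * (Z * ε) := by gcongr
        _ = (k * C * Z * ε) * ε * ε := by ring
        _ ≤ (m / 4) * ε * ε := by gcongr
        _ ≤ m / 4 * ε := by
            have : m / 4 * ε * ε ≤ m / 4 * ε * 1 := by gcongr; linarith
            linarith
    have h7 := norm_le_of_Rop_mul_colMat hker (((ε⁻¹ : ℝ) : ℂ) • ζ)
    have h8 : ε * ‖e - symb (T0 y) z (((ε⁻¹ : ℝ) : ℂ) • ζ)‖ = ‖ε • e - symb (T0 y) z ζ‖ := by
      have : ε • e - symb (T0 y) z ζ = ε • (e - symb (T0 y) z (((ε⁻¹ : ℝ) : ℂ) • ζ)) := by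
        rw [map_smul, smul_sub, coe_smul, smul_smul, mul_inv_cancel₀ hε.ne', one_smul]
      rw [this, norm_smul, Real.norm_eq_abs, abs_of_pos hε]
    have h9 : m * ε ≤ ‖ε • e - symb (T0 y) z ζ‖ := by
      rw [← h8, mul_comm]
      gcongr
      rw [hm, div_le_iff₀ (by positivity)]
      linarith
    have h10 : ‖ε • e - symb (T0 y) z ζ‖ < η * ε + m / 4 * ε + m / 4 * ε := by
      have : ε • e - symb (T0 y) z ζ = -(off d - ε • e) + (off d - symb (T0 y) (lower y) ζ) -
        (symb (T0 y) z ζ - symb (T0 y) (lower y) ζ) := by abel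
      rw [this]
      refine (norm_sub_le _ _).trans_lt (add_lt_add_of_lt_of_le ((norm_add_le _ _).trans_lt
        (add_lt_add_of_le_of_lt ?_ hN1)) h6)
      rw [norm_neg]
      exact hoffd
    rw [hη] at h10
    linarith
  refine ⟨y', ⟨hnear y' hA (by rw [sub_self, norm_zero]; positivity), ?_⟩, ?_⟩
  · rw [dist_eq_norm]
    have h5 : η * ε ≤ Metric.infDist y' (Abar (k + 1) \ A (k + 1)) := by
      refine (Metric.le_infDist ⟨y, Sing1reg_subset hy⟩).2 fun d hd => ?_
      by_contra! hlt
      rw [dist_comm, dist_eq_norm] at hlt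
      exact hd.2 (hnear d hd.1 hlt.le)
    calc ‖y' - y‖ ≤ (C + 1) * ε := hdist
      _ = (C + 1) / η * (η * ε) := by field_simp
      _ ≤ _ := by gcongr
  · rw [dist_comm, dist_eq_norm]
    exact hdist.trans_lt h1

lemma exists_bilin_bound {E F G : Type*} [NormedAddCommGroup E] [NormedSpace ℝ E]
    [FiniteDimensional ℝ E] [NormedAddCommGroup F] [NormedSpace ℝ F] [FiniteDimensional ℝ F]
    [NormedAddCommGroup G] [NormedSpace ℝ G] (B : E →ₗ[ℝ] F →ₗ[ℝ] G) :
    ∃ C > 0, ∀ x y, ‖B x y‖ ≤ C * ‖x‖ * ‖y‖ := by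
  let B' : E →L[ℝ] F →L[ℝ] G := toContinuousLinearMap
    { toFun := fun x => toContinuousLinearMap (B x)
      map_add' := by intro x x'; ext y; simp
      map_smul' := by intro r x; ext y; simp }
  refine ⟨‖B'‖ + 1, by positivity, fun x y => ?_⟩
  calc ‖B' x y‖ ≤ ‖B'‖ * ‖x‖ * ‖y‖ := B'.le_opNorm₂ x y
    _ ≤ _ := by gcongr; linarith

lemma eventually_norm_sub_lt {E : Type*} [NormedAddCommGroup E] (y : E) {r : ℝ} (hr : 0 < r) :
    ∀ᶠ y' in 𝓝 y, ‖y' - y‖ < r := by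
  filter_upwards [Metric.ball_mem_nhds y hr] with y' h using mem_ball_iff_norm.1 h

lemma exists_X_bound (k : ℕ) : ∃ C > 0, ∀ (ξ : gLie k) (y : Data k),
    ‖X k ξ y‖ ≤ C * ‖ξ‖ * ‖y‖ := exists_bilin_bound (X k)

lemma exists_metric_bound (k : ℕ) : ∃ C > 0, ∀ y z : Data k,
    |metric k y z| ≤ C * ‖y‖ * ‖z‖ := exists_bilin_bound (metric k)

lemma norm_sq_le_metric (y : Data k) : ‖y‖ ^ 2 ≤ metric k y y := by
  have hre : ∀ z : ℂ, (star z * z).re = ‖z‖ ^ 2 := fun z => by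
    rw [star_def, ← normSq_eq_conj_mul_self, ofReal_re, normSq_eq_norm_sq]
  have h := metric_self_nonneg y
  have h1 : ∀ a, 0 ≤ (∑ i, ∑ j, ‖y.T a i j‖ ^ 2) + 2 * ∑ i, ‖y.P a i‖ ^ 2 := fun a => by positivity
  have h2 : metric k y y = ∑ a, ((∑ i, ∑ j, ‖y.T a i j‖ ^ 2) + 2 * ∑ i, ‖y.P a i‖ ^ 2) := by
    rw [metric_apply]; simp only [hre]
  have h3 : ∀ a, (∑ i, ∑ j, ‖y.T a i j‖ ^ 2) + 2 * ∑ i, ‖y.P a i‖ ^ 2 ≤ metric k y y := fun a => by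
    rw [h2]
    exact single_le_sum (f := fun a => (∑ i, ∑ j, ‖y.T a i j‖ ^ 2) +
      2 * ∑ i, ‖y.P a i‖ ^ 2) (fun a _ => h1 a) (mem_univ a)
  have h4 : ‖y‖ ≤ Real.sqrt (metric k y y) := by
    refine Data.norm_le (Real.sqrt_nonneg _) (fun a i j => ?_) fun a i => ?_
    · refine Real.le_sqrt_of_sq_le (le_trans ?_ (h3 a))
      have e1 : ‖y.T a i j‖ ^ 2 ≤ ∑ j, ‖y.T a i j‖ ^ 2 :=
        single_le_sum (f := fun j => ‖y.T a i j‖ ^ 2) (fun _ _ => sq_nonneg _) (mem_univ j)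
      have e2 : ∑ j, ‖y.T a i j‖ ^ 2 ≤ ∑ i, ∑ j, ‖y.T a i j‖ ^ 2 :=
        single_le_sum (f := fun i => ∑ j, ‖y.T a i j‖ ^ 2)
          (fun _ _ => sum_nonneg fun _ _ => sq_nonneg _) (mem_univ i)
      have e3 : 0 ≤ 2 * ∑ i, ‖y.P a i‖ ^ 2 := by positivity
      linarith
    · refine Real.le_sqrt_of_sq_le (le_trans ?_ (h3 a))
      have e1 : ‖y.P a i‖ ^ 2 ≤ ∑ i, ‖y.P a i‖ ^ 2 :=
        single_le_sum (f := fun i => ‖y.P a i‖ ^ 2) (fun _ _ => sq_nonneg _) (mem_univ i)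
      have e2 : 0 ≤ ∑ i, ∑ j, ‖y.T a i j‖ ^ 2 := by positivity
      have e3 := sq_nonneg ‖y.P a i‖
      linarith
  calc ‖y‖ ^ 2 ≤ Real.sqrt (metric k y y) ^ 2 := by gcongr
    _ = _ := Real.sq_sqrt h

/-- The component of an infinitesimal symmetry along the first circle. -/
def circleG (ξ : gLie (k + 1)) : ℝ := (ξ.mat 0 0).im

/-- The off-diagonal part of an infinitesimal symmetry. -/
def offG (ξ : gLie (k + 1)) : Fin k → ℂ := fun i => ξ.mat i.succ 0

/-- The lower right block of an infinitesimal symmetry. -/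
def lowerG (ξ : gLie (k + 1)) : gLie k :=
  (⟨fun i j => ξ.1.1 i.succ j.succ, fun i j => ξ.1.2 i.succ j.succ⟩, ξ.2)

lemma mat_star (ξ : gLie k) (i j : Fin k) : ξ.mat i j = -star (ξ.mat j i) := ξ.1.2 i j

lemma mat_zero_succ (ξ : gLie (k + 1)) (j : Fin k) : ξ.mat 0 j.succ = -star (offG ξ j) :=
  ξ.1.2 0 j.succ

lemma mat_zero_zero (ξ : gLie (k + 1)) : ξ.mat 0 0 = (circleG ξ : ℂ) * I := by
  have h := congrArg Complex.re (mat_star ξ 0 0)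
  have h1 : (ξ.mat 0 0).re = 0 := by
    simp at h
    linarith
  apply Complex.ext <;> simp [h1, circleG]

lemma gLie.norm_le {ξ : gLie k} {C : ℝ} (hC : 0 ≤ C) (h1 : ∀ i j, ‖ξ.mat i j‖ ≤ C)
    (h2 : ∀ c, |ξ.2 c| ≤ C) : ‖ξ‖ ≤ C := by
  refine max_le ?_ ((pi_norm_le_iff_of_nonneg hC).2 h2)
  change ‖(ξ.1.1 : Fin k → Fin k → ℂ)‖ ≤ C
  exact (pi_norm_le_iff_of_nonneg hC).2 fun i => (pi_norm_le_iff_of_nonneg hC).2 fun j => h1 i j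

lemma gLie.norm_mat_le (ξ : gLie k) (i j : Fin k) : ‖ξ.mat i j‖ ≤ ‖ξ‖ :=
  calc ‖ξ.1.1 i j‖ ≤ ‖ξ.1.1 i‖ := norm_le_pi_norm _ j
    _ ≤ ‖ξ.1.1‖ := norm_le_pi_norm ξ.1.1 i
    _ ≤ ‖ξ‖ := norm_fst_le ξ

lemma gLie.abs_snd_le (ξ : gLie k) (c : Fin 3) : |ξ.2 c| ≤ ‖ξ‖ :=
  (norm_le_pi_norm ξ.2 c).trans (norm_snd_le ξ)

lemma circleG_sub (ξ η : gLie (k + 1)) : circleG (ξ - η) = circleG ξ - circleG η := rfl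
lemma offG_sub (ξ η : gLie (k + 1)) : offG (ξ - η) = offG ξ - offG η := rfl
lemma lowerG_sub (ξ η : gLie (k + 1)) : lowerG (ξ - η) = lowerG ξ - lowerG η := rfl

lemma xi1_mat (i j : Fin (k + 1)) : (xi1 k).mat i j = if i = 0 ∧ j = 0 then I else 0 := rfl

/-- The component of an infinitesimal symmetry off the first circle. -/
def restG (ξ : gLie (k + 1)) : gLie (k + 1) := ξ - circleG ξ • xi1 k

lemma circleG_smul_xi1 (r : ℝ) : circleG (r • xi1 k) = r := by
  change (r • I).im = r
  simp

lemma offG_smul_xi1 (r : ℝ) : offG (r • xi1 k) = 0 := by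
  funext i
  change r • (xi1 k).mat i.succ 0 = 0
  simp [xi1_mat]

lemma lowerG_smul_xi1 (r : ℝ) : lowerG (r • xi1 k) = 0 := by
  refine Prod.ext (Subtype.ext ?_) ?_
  · funext i j
    change r • (xi1 k).mat i.succ j.succ = 0
    simp [xi1_mat]
  · exact smul_zero r

lemma circleG_restG (ξ : gLie (k + 1)) : circleG (restG ξ) = 0 := by
  rw [restG, circleG_sub, circleG_smul_xi1, sub_self]

lemma offG_restG (ξ : gLie (k + 1)) : offG (restG ξ) = offG ξ := by
  rw [restG, offG_sub, offG_smul_xi1, sub_zero]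

lemma lowerG_restG (ξ : gLie (k + 1)) : lowerG (restG ξ) = lowerG ξ := by
  rw [restG, lowerG_sub, lowerG_smul_xi1, sub_zero]

lemma restG_add (ξ : gLie (k + 1)) : circleG ξ • xi1 k + restG ξ = ξ := by rw [restG]; abel

lemma norm_restG_le (ξ : gLie (k + 1)) : ‖restG ξ‖ ≤ ‖offG ξ‖ + ‖lowerG ξ‖ := by
  have h0 : 0 ≤ ‖offG ξ‖ := norm_nonneg _
  have h1 : 0 ≤ ‖lowerG ξ‖ := norm_nonneg _
  refine gLie.norm_le (by positivity) (fun i j => ?_) fun c => ?_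
  · refine Fin.cases ?_ (fun i => ?_) i <;> refine Fin.cases ?_ (fun j => ?_) j
    · rw [mat_zero_zero, circleG_restG]; simp; positivity
    · rw [mat_zero_succ, offG_restG, norm_neg, norm_star]
      linarith [norm_le_pi_norm (offG ξ) j]
    · have : (restG ξ).mat i.succ 0 = offG ξ i := congrFun (offG_restG ξ) i
      rw [this]
      linarith [norm_le_pi_norm (offG ξ) i]
    · have : (restG ξ).mat i.succ j.succ = (lowerG ξ).mat i j := by rw [← lowerG_restG]; rfl
      rw [this]
      linarith [gLie.norm_mat_le (lowerG ξ) i j]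
  · have : (restG ξ).2 c = (lowerG ξ).2 c := by rw [← lowerG_restG]; rfl
    rw [this]
    linarith [gLie.abs_snd_le (lowerG ξ) c]

lemma off_X_xi1 (y : Data₁) : off (X _ (xi1 k) y) = -I • off y := by
  refine Prod.ext ?_ ?_
  · funext a j
    change (X _ (xi1 k) y).T a j.succ 0 = -I * y.T a j.succ 0
    rw [X_T, Matrix.sub_apply, Matrix.mul_apply, Matrix.mul_apply, sum_univ_succ, sum_univ_succ]
    simp [xi1_mat, mul_comm]
  · funext a
    change star ((X _ (xi1 k) y).P a 0) = -I * star (y.P a 0)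
    have h2 : (xi1 k).2 = 0 := rfl
    rw [X_P, sum_univ_succ]
    simp [xi1_mat, h2]

lemma lower_X_xi1 (y : Data₁) : lower (X _ (xi1 k) y) = 0 := by
  have h2 : (xi1 k).2 = 0 := rfl
  refine Data.ext' (fun a => ?_) fun a => ?_
  · ext i j
    change (X _ (xi1 k) y).T a i.succ j.succ = 0
    rw [X_T, Matrix.sub_apply, Matrix.mul_apply, Matrix.mul_apply]
    simp [xi1_mat]
  · funext i
    change (X _ (xi1 k) y).P a i.succ = 0
    rw [X_P]
    simp [xi1_mat, h2]

section

variable {y : Data (k + 1)} (hy : off y = 0)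
include hy

lemma T_succ_zero_of_off (a : Fin 4) (j : Fin k) : y.T a j.succ 0 = 0 :=
  congr_fun₂ (congrArg Prod.fst hy) a j

lemma T_zero_succ_of_off (a : Fin 4) (j : Fin k) : y.T a 0 j.succ = 0 := by
  rw [T_zero_succ, hy]; simp

lemma P_zero_of_off (a : Fin 4) : y.P a 0 = 0 := by
  have := congrFun (congrArg Prod.snd hy) a
  simpa [off] using this

lemma off_X_of_off (ξ : gLie (k + 1)) : off (X _ ξ y) = -symb (T0 y) (lower y) (offG ξ) := by
  refine Prod.ext ?_ ?_
  · funext a j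
    change (X _ ξ y).T a j.succ 0 = -(symb (T0 y) (lower y) (offG ξ)).1 a j
    rw [X_T, Matrix.sub_apply, Matrix.mul_apply, Matrix.mul_apply, sum_univ_succ, sum_univ_succ,
      symb_fst, tau_mulVec]
    simp only [T_succ_zero_of_off hy, T_zero_zero, mul_zero, sum_const_zero, add_zero, zero_mul,
      zero_add, Pi.sub_apply, Pi.smul_apply, smul_eq_mul, mulVec, dotProduct]
    change offG ξ j * _ - ∑ i : Fin k, y.T a j.succ i.succ * offG ξ i =
      -(∑ i : Fin k, y.T a j.succ i.succ * offG ξ i - _ * offG ξ j)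
    ring
  · funext a
    change star ((X _ ξ y).P a 0) = -(symb (T0 y) (lower y) (offG ξ)).2 a
    rw [X_P, sum_univ_succ, symb_snd]
    simp only [P_zero_of_off hy, mat_zero_succ, mul_zero, zero_mul, sum_const_zero, sub_zero,
      zero_add, star_sum, star_mul, star_neg, star_star, dotProduct, Pi.star_apply, mul_neg,
      sum_neg_distrib]
    rfl

lemma lower_X_of_off (ξ : gLie (k + 1)) : lower (X _ ξ y) = X k (lowerG ξ) (lower y) := by
  refine Data.ext' (fun a => ?_) fun a => ?_
  · ext i j
    change (X _ ξ y).T a i.succ j.succ = _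
    rw [X_T, X_T, Matrix.sub_apply, Matrix.sub_apply, Matrix.mul_apply, Matrix.mul_apply,
      Matrix.mul_apply, Matrix.mul_apply, sum_univ_succ, sum_univ_succ]
    simp only [T_succ_zero_of_off hy, T_zero_succ_of_off hy, mul_zero, zero_mul, zero_add]
    rfl
  · funext i
    change (X _ ξ y).P a i.succ = _
    rw [X_P, X_P, sum_univ_succ, P_zero_of_off hy, mul_zero, zero_add]
    rfl

lemma T0_X_of_off (ξ : gLie (k + 1)) (a : Fin 4) : T0 (X _ ξ y) a = 0 := by
  have : (X _ ξ y).T a 0 0 = 0 := by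
    rw [X_T, Matrix.sub_apply, Matrix.mul_apply, Matrix.mul_apply, sum_univ_succ, sum_univ_succ]
    simp only [T_succ_zero_of_off hy, T_zero_succ_of_off hy, mul_zero, zero_mul, sum_const_zero,
      add_zero]
    ring
  change ((X _ ξ y).T a 0 0).re = 0
  rw [this, zero_re]

end

lemma coercivity_aux {c0 cl cg ε δ s ρ M o l : ℝ} (hc0 : 0 < c0) (hcl : 0 < cl) (hcg : 0 < cg)
    (hδ1 : δ * (1 / cl + 1 / cg + 1 / (c0 * cl)) ≤ 1 / 4) (hδ2 : δ ≤ 1 / 2) (hρ0 : 0 ≤ ρ)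
    (hM0 : 0 ≤ M) (h1 : l ≤ 1 / cg * (M + δ * ρ)) (h3 : ε * s ≤ 1 / c0 * (M + δ * ρ))
    (h4 : o ≤ 1 / cl * (M + δ * ρ + ε * s)) (h5 : ρ ≤ o + l) :
    ε * s + ρ ≤ (2 / c0 + 4 * (1 / cl + 1 / cg + 1 / (c0 * cl)) * (1 + 1 / c0)) * M := by
  obtain ⟨b, hb⟩ : ∃ b, b = 1 / cl + 1 / cg + 1 / (c0 * cl) := ⟨_, rfl⟩
  have hbpos : 0 < b := by rw [hb]; positivity
  rw [← hb] at hδ1 ⊢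
  have h6 : ρ ≤ b * (M + δ * ρ) := by
    have : 1 / cl * (ε * s) ≤ 1 / cl * (1 / c0 * (M + δ * ρ)) := by gcongr
    have e : 1 / cl * (1 / c0 * (M + δ * ρ)) = 1 / (c0 * cl) * (M + δ * ρ) := by field_simp
    rw [hb]
    linarith [mul_add (1 / cl) (M + δ * ρ) (ε * s)]
  have h7 : ρ ≤ 2 * b * M := by
    have := mul_le_mul_of_nonneg_right hδ1 hρ0
    linarith [mul_add b M (δ * ρ), mul_nonneg hbpos.le hM0]
  have h9 : δ * ρ ≤ b * M := by
    have := mul_le_mul hδ2 h7 hρ0 (by norm_num)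
    linarith
  have h10 : 1 / c0 * (M + δ * ρ) ≤ 1 / c0 * (M + b * M) := by gcongr
  have e : (2 / c0 + 4 * b * (1 + 1 / c0)) * M =
      2 * (1 / c0 * M) + 4 * (b * M) + 4 * (1 / c0 * (b * M)) := by ring
  have h11 : 0 ≤ 1 / c0 * M := by positivity
  have h12 : 0 ≤ b * M := by positivity
  have h13 : 0 ≤ 1 / c0 * (b * M) := by positivity
  rw [e]
  linarith [mul_add (1 / c0) M (b * M)]

set_option maxHeartbeats 2000000 in
lemma exists_X_ge (hk : 0 < k) {y : Data₁} (hy : y ∈ Sing1reg k) {c0 : ℝ} (hc0 : 0 < c0) :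
    ∃ C > 0, ∀ᶠ y' in 𝓝 y, IsTransverse y c0 y' → ∀ ξ,
      ‖y' - y‖ * |circleG ξ| + ‖restG ξ‖ ≤ C * ‖X (k + 1) ξ y'‖ := by
  have hoffy : off y = 0 := mem_Sing1_iff.1 hy.1
  obtain ⟨cl, hcl, hlow⟩ := exists_norm_symb_ge hy.2
  obtain ⟨CX, hCX, hXb⟩ := exists_X_bound (k + 1)
  obtain ⟨cg, hcg, hgl⟩ : ∃ c > 0, ∀ ξ : gLie k, c * ‖ξ‖ ≤ ‖X k ξ (lower y)‖ := by
    have hinj : Function.Injective (orbitMap (lower y)) := by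
      refine (injective_iff_map_eq_zero (orbitMap (lower y)).toLinearMap).2 fun ξ h => ?_
      exact isFree_of_mem_A hk hy.2 ξ h
    obtain ⟨K, hK, hanti⟩ := ((orbitMap (lower y)).toLinearMap.injective_iff_antilipschitz).1 hinj
    refine ⟨(K : ℝ)⁻¹, inv_pos.2 (NNReal.coe_pos.2 hK), fun ξ => ?_⟩
    have h1 := hanti.le_mul_dist ξ 0
    rw [map_zero, dist_zero_right, dist_zero_right] at h1
    rw [inv_mul_le_iff₀ (NNReal.coe_pos.2 hK)]
    exact h1
  set b : ℝ := 1 / cl + 1 / cg + 1 / (c0 * cl) with hb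
  have hbpos : 0 < b := by positivity
  refine ⟨2 / c0 + 4 * b * (1 + 1 / c0), by positivity, ?_⟩
  have hsm : 0 < min (1 / (4 * b)) (1 / 2) := lt_min (by positivity) (by norm_num)
  filter_upwards [eventually_norm_sub_lt y (div_pos hsm hCX)] with y' hε htr ξ
  rw [lt_div_iff₀' hCX] at hε
  set ε := ‖y' - y‖ with hεdef
  set M := ‖X (k + 1) ξ y'‖ with hM
  set ρ := ‖restG ξ‖ with hρ
  set δ := CX * ε with hδ
  have hδ0 : 0 ≤ δ := mul_nonneg hCX.le (norm_nonneg _)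
  have hMδ : 0 ≤ M + δ * ρ := add_nonneg (norm_nonneg _) (mul_nonneg hδ0 (norm_nonneg _))
  have hδ1 : δ * b ≤ 1 / 4 := by
    have := hε.le.trans (min_le_left _ _)
    rw [le_div_iff₀ (mul_pos four_pos hbpos)] at this
    linarith
  have herr : ‖X (k + 1) (restG ξ) (y' - y)‖ ≤ δ * ρ := by
    exact (hXb _ _).trans (le_of_eq (by rw [hδ]; ring))
  obtain ⟨Z, hZ⟩ : ∃ Z, Z = circleG ξ • X _ (xi1 k) y' + X _ (restG ξ) y := ⟨_, rfl⟩
  have hbound : ‖Z‖ ≤ M + δ * ρ := by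
    have hsub : X _ ξ y' - X _ (restG ξ) (y' - y) = Z := by
      rw [hZ, map_sub (X _ (restG ξ))]
      conv_lhs => enter [1]; rw [← restG_add ξ, map_add, LinearMap.add_apply, map_smul, LinearMap.smul_apply]
      abel
    exact hsub ▸ (norm_sub_le _ _).trans (add_le_add le_rfl herr)
  have hI : ‖(circleG ξ : ℂ) * I‖ = |circleG ξ| := by simp
  have hoffadd : ∀ u v : Data₁, off (u + v) = off u + off v := fun u v => by
    have := off_sub (u + v) v
    rw [add_sub_cancel_right] at this
    rw [this]; abel
  have hoffsmul : ∀ (r : ℝ) (u : Data₁), off (r • u) = r • off u := fun r u => by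
    refine Prod.ext rfl ?_
    funext a
    change star (r • u.P a 0) = r • star (u.P a 0)
    rw [star_smul, star_trivial]
  have h1 : ‖lowerG ξ‖ ≤ 1 / cg * (M + δ * ρ) := by
    have e := norm_lower_le Z
    have e2 : lower Z = X k (lowerG ξ) (lower y) := by
      rw [hZ]
      change circleG ξ • lower (X _ (xi1 k) y') + lower (X _ (restG ξ) y) = _
      rw [lower_X_xi1, lower_X_of_off hoffy, lowerG_restG, smul_zero, zero_add]
    rw [e2] at e
    have e3 := (hgl (lowerG ξ)).trans (e.trans hbound)
    rw [div_mul_eq_mul_div, one_mul, le_div_iff₀ hcg]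
    linarith
  have h2 : ‖((circleG ξ : ℂ) * I) • off y' + symb (T0 y) (lower y) (offG ξ)‖ ≤ M + δ * ρ := by
    have e := norm_off_le Z
    have e2 : off Z = -(((circleG ξ : ℂ) * I) • off y' + symb (T0 y) (lower y) (offG ξ)) := by
      rw [hZ, hoffadd, hoffsmul, off_X_xi1, off_X_of_off hoffy, offG_restG, neg_add, mul_smul,
        neg_smul, smul_neg, coe_smul]
    rw [e2, norm_neg] at e
    exact e.trans hbound
  have h3 : ε * |circleG ξ| ≤ 1 / c0 * (M + δ * ρ) := by
    rcases eq_or_ne (circleG ξ) 0 with h0 | h0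
    · rw [h0, abs_zero, mul_zero]; exact mul_nonneg (one_div_nonneg.2 hc0.le) hMδ
    · have hne : (circleG ξ : ℂ) * I ≠ 0 := mul_ne_zero (Complex.ofReal_ne_zero.2 h0) I_ne_zero
      have e := htr (-((circleG ξ : ℂ) * I)⁻¹ • offG ξ)
      rw [map_smul, neg_smul, sub_neg_eq_add] at e
      have e2 : |circleG ξ| * ‖off y' + ((circleG ξ : ℂ) * I)⁻¹ • symb (T0 y) (lower y) (offG ξ)‖ =
          ‖((circleG ξ : ℂ) * I) • off y' + symb (T0 y) (lower y) (offG ξ)‖ := by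
        rw [← hI, ← norm_smul, smul_add, smul_smul, mul_inv_cancel₀ hne, one_smul]
      have e3 := mul_le_mul_of_nonneg_left e (abs_nonneg (circleG ξ))
      rw [e2] at e3
      rw [div_mul_eq_mul_div, one_mul, le_div_iff₀ hc0]
      linarith
  have h4 : ‖offG ξ‖ ≤ 1 / cl * (M + δ * ρ + ε * |circleG ξ|) := by
    have e := hlow (T0 y) (offG ξ)
    have hoffle : ‖off y'‖ ≤ ε := by
      have := norm_off_le (y' - y)
      rwa [off_sub, hoffy, sub_zero] at this
    have e2 : ‖symb (T0 y) (lower y) (offG ξ)‖ ≤ (M + δ * ρ) + |circleG ξ| * ε := by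
      have : symb (T0 y) (lower y) (offG ξ) =
        (((circleG ξ : ℂ) * I) • off y' + symb (T0 y) (lower y) (offG ξ)) -
        ((circleG ξ : ℂ) * I) • off y' := by abel
      rw [this]
      refine (norm_sub_le _ _).trans (add_le_add h2 ?_)
      rw [norm_smul, hI]
      exact mul_le_mul_of_nonneg_left hoffle (abs_nonneg _)
    rw [div_mul_eq_mul_div, one_mul, le_div_iff₀ hcl]
    linarith
  exact coercivity_aux hc0 hcl hcg hδ1 (hε.le.trans (min_le_right _ _)) (norm_nonneg _)
    (norm_nonneg _) h1 h3 h4 (norm_restG_le ξ)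

/-- The inclusion of the lower right block of the infinitesimal symmetries. -/
def inclG (ξ : gLie k) : gLie (k + 1) :=
  (⟨fun i j => Fin.cases 0 (fun i => Fin.cases 0 (fun j => ξ.mat i j) j) i, by
    intro i j
    cases i using Fin.cases <;> cases j using Fin.cases <;> first | exact ξ.1.2 _ _ | simp⟩, ξ.2)

/-- The inclusion of the lower right block of the data. -/
abbrev incl (z : Data k) : Data₁ := blockData 0 0 z

lemma lowerG_inclG (ξ : gLie k) : lowerG (inclG ξ) = ξ := rfl

lemma offG_inclG (ξ : gLie k) : offG (inclG ξ) = 0 := rfl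

lemma metric_incl (z : Data k) (w : Data₁) : metric (k + 1) (incl z) w = metric k z (lower w) := by
  rw [metric_apply, metric_apply]
  refine sum_ext fun a => ?_
  have e1 : (incl z).T a 0 0 = 0 := by change (((0 : R4) a : ℝ) : ℂ) = 0; simp
  have e2 : ∀ j : Fin k, (incl z).T a 0 j.succ = 0 := fun j => by change star (0 : ℂ) = 0; simp
  have e3 : ∀ j : Fin k, (incl z).T a j.succ 0 = 0 := fun j => rfl
  have e4 : (incl z).P a 0 = 0 := by change star (0 : ℂ) = 0; simp
  intro _
  rw [sum_univ_succ (n := k), sum_univ_succ (n := k), sum_univ_succ (n := k)]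
  simp only [sum_univ_succ (n := k), e1, e2, e3, e4, star_zero, zero_mul, zero_re, sum_const_zero,
    zero_add]
  rfl

lemma X_xi1_incl (z : Data k) : X _ (xi1 k) (incl z) = 0 := mem_Sing1_iff.2 (off_blockData _ _ _)

lemma X_inclG {y : Data₁} (hy : off y = 0) (ξ : gLie k) :
    X _ (inclG ξ) y = incl (X k ξ (lower y)) := by
  have h1 : off (X _ (inclG ξ) y) = 0 := by rw [off_X_of_off hy, offG_inclG, map_zero, neg_zero]
  have h2 : T0 (X _ (inclG ξ) y) = 0 := by
    ext a
    exact T0_X_of_off hy _ a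
  have h := blockData_of_off_eq_zero h1
  rw [h2, lower_X_of_off hy, lowerG_inclG] at h
  exact h.symm

lemma eq_incl_lower {v : Data₁} (hv : v ∈ Sing1 k) (h0 : T0 v = 0) : v = incl (lower v) := by
  have h := blockData_of_off_eq_zero (mem_Sing1_iff.1 hv)
  rw [h0] at h
  exact h.symm

lemma incl_add (z w : Data k) : incl (z + w) = incl z + incl w := by
  have h := eq_incl_lower (v := incl z + incl w)
    (Submodule.add_mem _ (X_xi1_incl z) (X_xi1_incl w)) (by
      ext a; change ((incl z).T a 0 0 + (incl w).T a 0 0).re = 0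
      simp [incl, blockData, Data.T])
  exact h.symm

lemma incl_sub (z w : Data k) : incl (z - w) = incl z - incl w := by
  rw [eq_sub_iff_add_eq, ← incl_add, sub_add_cancel]

lemma exists_norm_lower_X_sub_le (k : ℕ) : ∃ C > 0, ∀ (η : gLie (k + 1)) (w w' : Data (k + 1)),
    off w = 0 → ‖lower (X _ η w') - X k (lowerG η) (lower w)‖ ≤ C * ‖w' - w‖ * ‖restG η‖ := by
  obtain ⟨C, hC, h⟩ := exists_X_bound (k + 1)
  refine ⟨C, hC, fun η w w' hw => ?_⟩
  have e : lower (X _ η w') - X k (lowerG η) (lower w) = lower (X _ (restG η) (w' - w)) := by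
    rw [map_sub, lower_sub, lower_X_of_off hw, lowerG_restG]
    conv_lhs => rw [← restG_add η, map_add, LinearMap.add_apply, map_smul, LinearMap.smul_apply]
    change circleG η • lower (X _ (xi1 k) w') + lower (X _ (restG η) w') -
      X k (lowerG (circleG η • xi1 k + restG η)) (lower w) = _
    rw [lower_X_xi1, smul_zero, zero_add, restG_add]
  rw [e]
  exact (norm_lower_le _).trans ((h _ _).trans (le_of_eq (by ring)))

lemma eventually_X_ge (hk : 0 < k) {y : Data₁} (hy : y ∈ Sing1reg k) (C : ℝ) :
    ∃ B > 0, ∀ᶠ y' in 𝓝[approach C y] y, IsFree y' ∧ ∀ ξ,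
      ‖y' - y‖ * |circleG ξ| + ‖restG ξ‖ ≤ B * ‖X (k + 1) ξ y'‖ := by
  obtain ⟨c0, hc0, h⟩ := eventually_isTransverse hy C
  obtain ⟨B, hB, hX⟩ := exists_X_ge hk hy hc0
  refine ⟨B, hB, ?_⟩
  filter_upwards [h, hX.filter_mono nhdsWithin_le_nhds, self_mem_nhdsWithin] with y' h1 h2 h3
  exact ⟨isFree_of_mem_A k.succ_pos h3.1, h2 h1⟩

lemma le_of_sq_le {M b : ℝ} (h : M ^ 2 ≤ b * M) (hM : 0 ≤ M) (hb : 0 ≤ b) : M ≤ b := by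
  rcases hM.eq_or_lt with h0 | h0
  · rw [← h0]; exact hb
  · exact le_of_mul_le_mul_right (by rwa [sq] at h) h0

lemma eventually_norm_hor_sub_le {y : Data₁} (hy : y ∈ Sing1reg k) (C : ℝ)
    {v : Data₁} (hv : v ∈ Sing1 k) (hv0 : T0 v = 0) :
    ∃ B > 0, ∀ᶠ y' in 𝓝[approach C y] y,
      ‖hor y' v - incl (hor (lower y) (lower v))‖ ≤ B * ‖y' - y‖ := by
  have hvi := eq_incl_lower hv hv0
  rcases k.eq_zero_or_pos with rfl | hk
  · have h1 : lower v = 0 := Subsingleton.elim _ _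
    have h2 : v = 0 := by
      rw [hvi, h1]
      exact (eq_incl_lower (v := 0) (Submodule.zero_mem _) rfl).symm
    have h3 : hor (lower y) (lower v) = 0 := Subsingleton.elim _ _
    refine ⟨1, one_pos, Eventually.of_forall fun y' => ?_⟩
    have h4 : hor y' v = 0 := by rw [h2, hor]; simp
    rw [h4, h3, ← h1, ← hvi, h2, sub_zero, norm_zero]
    exact mul_nonneg zero_le_one (norm_nonneg _)
  obtain ⟨B, hB, hX⟩ := eventually_X_ge hk hy C
  obtain ⟨CX, hCX, hXb⟩ := exists_X_bound (k + 1)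
  obtain ⟨CL, hCL, hLb⟩ := exists_norm_lower_X_sub_le k
  obtain ⟨Cm, hCm, hmb⟩ := exists_metric_bound (k + 1)
  obtain ⟨Cl, hCl, hlb⟩ := exists_metric_bound k
  have hfree := isFree_of_mem_A hk hy.2
  have hoff := mem_Sing1_iff.1 hy.1
  set θ := theta (lower y) (lower v) with hθ
  set h := hor (lower y) (lower v) with hh
  have hK : 0 ≤ Cl * ‖h‖ * CL * B + Cm * (CX * ‖inclG θ‖) :=
    add_nonneg (mul_nonneg (mul_nonneg (mul_nonneg hCl.le (norm_nonneg _)) hCL.le) hB.le)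
      (mul_nonneg hCm.le (mul_nonneg hCX.le (norm_nonneg _)))
  refine ⟨(Cl * ‖h‖ * CL * B + Cm * (CX * ‖inclG θ‖)) + CX * ‖inclG θ‖ + 1,
    by have := mul_nonneg hCX.le (norm_nonneg (inclG θ)); linarith, ?_⟩
  filter_upwards [hX] with y' hy'
  obtain ⟨hf', hge⟩ := hy'
  obtain ⟨η, hη⟩ : ∃ η, η = theta y' v - inclG θ := ⟨_, rfl⟩
  have e1 : v - X _ (inclG θ) y' = incl h - X _ (inclG θ) (y' - y) := by
    rw [map_sub, X_inclG hoff, hh, hor, incl_sub, ← hvi]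
    abel
  have e2 : hor y' v = incl h - X _ (inclG θ) (y' - y) - X _ η y' := by
    rw [← e1, hor, hη, map_sub, LinearMap.sub_apply]
    abel
  have hE : ‖X (k + 1) (inclG θ) (y' - y)‖ ≤ CX * ‖inclG θ‖ * ‖y' - y‖ := hXb _ _
  have e3 : metric (k + 1) (X _ η y') (X _ η y') =
      metric k h (lower (X _ η y') - X k (lowerG η) (lower y)) -
        metric (k + 1) (X _ (inclG θ) (y' - y)) (X _ η y') := by
    have := metric_hor hf' v η
    rw [e2, map_sub, map_sub, LinearMap.sub_apply, LinearMap.sub_apply, metric_incl] at this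
    have h0 : metric k h (X k (lowerG η) (lower y)) = 0 := metric_hor hfree _ _
    rw [map_sub (metric k h), h0, sub_zero]
    linarith
  have hρ : ‖restG η‖ ≤ B * ‖X (k + 1) η y'‖ := by
    have := hge η
    have := mul_nonneg (norm_nonneg (y' - y)) (abs_nonneg (circleG η))
    linarith
  have b1 : metric k h (lower (X _ η y') - X k (lowerG η) (lower y)) ≤
      Cl * ‖h‖ * (CL * ‖y' - y‖ * (B * ‖X (k + 1) η y'‖)) :=
    (le_abs_self _).trans ((hlb _ _).trans (mul_le_mul_of_nonneg_left ((hLb _ _ _ hoff).trans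
      (mul_le_mul_of_nonneg_left hρ (mul_nonneg hCL.le (norm_nonneg _))))
      (mul_nonneg hCl.le (norm_nonneg _))))
  have b2 : -metric (k + 1) (X _ (inclG θ) (y' - y)) (X _ η y') ≤
      Cm * (CX * ‖inclG θ‖ * ‖y' - y‖) * ‖X (k + 1) η y'‖ :=
    (neg_le_abs _).trans ((hmb _ _).trans (mul_le_mul_of_nonneg_right
      (mul_le_mul_of_nonneg_left hE hCm.le) (norm_nonneg _)))
  have hM : ‖X (k + 1) η y'‖ ≤ (Cl * ‖h‖ * CL * B + Cm * (CX * ‖inclG θ‖)) * ‖y' - y‖ := by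
    refine le_of_sq_le ((norm_sq_le_metric _).trans ?_) (norm_nonneg _)
      (mul_nonneg hK (norm_nonneg _))
    rw [e3, sub_eq_add_neg]
    exact (add_le_add b1 b2).trans (le_of_eq (by ring))
  have e4 : hor y' v - incl h = -(X _ (inclG θ) (y' - y) + X _ η y') := by rw [e2]; abel
  rw [e4, norm_neg]
  refine (norm_add_le _ _).trans ((add_le_add hE hM).trans ?_)
  have := norm_nonneg (y' - y)
  linarith

lemma bracket_self (g : gLie k) : bracket g g = 0 := by
  refine Prod.ext (Subtype.ext ?_) ?_
  · funext i j
    change (bracket g g).mat i j = 0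
    rw [bracket_mat, sub_self]
    rfl
  · funext c
    fin_cases c <;> simp [bracket] <;> ring

lemma omega_zero_zero (y : Data k) : omega y 0 0 = 0 := by
  simp only [omega, map_zero, fderiv_fun_const, Pi.zero_apply, sub_zero, bracket_self,
    ContinuousLinearMap.zero_apply]

lemma inclG_zero : inclG (0 : gLie k) = 0 := by
  refine Prod.ext (Subtype.ext ?_) rfl
  funext i j
  cases i using Fin.cases <;> cases j using Fin.cases <;> rfl

set_option maxHeartbeats 2000000 in
lemma eventually_norm_omega_sub_le {y : Data₁} (hy : y ∈ Sing1reg k) (C : ℝ)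
    {u v : Data₁} (hu : u ∈ Sing1 k) (hu0 : T0 u = 0) (hv : v ∈ Sing1 k)
    (hv0 : T0 v = 0) :
    ∃ B > 0, ∀ᶠ y' in 𝓝[approach C y] y, ∃ s : ℝ, |s| ≤ B ∧
      ‖omega y' u v - s • xi1 k - inclG (omega (lower y) (lower u) (lower v))‖ ≤ B * ‖y' - y‖ := by
  have hvi := eq_incl_lower hv hv0
  have hui := eq_incl_lower hu hu0
  obtain ⟨B0, hB0, hhu⟩ := eventually_norm_hor_sub_le hy C hu hu0
  obtain ⟨B1, hB1, hhv⟩ := eventually_norm_hor_sub_le hy C hv hv0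
  rcases k.eq_zero_or_pos with rfl | hk
  · have h1 : lower v = 0 := Subsingleton.elim _ _
    have h1' : lower u = 0 := Subsingleton.elim _ _
    have h0 : (0 : Data 1) = incl 0 := eq_incl_lower (v := 0) (Submodule.zero_mem _) rfl
    have h2 : v = 0 := by rw [hvi, h1, ← h0]
    have h2' : u = 0 := by rw [hui, h1', ← h0]
    refine ⟨1, one_pos, Eventually.of_forall fun y' => ⟨0, by simp, ?_⟩⟩
    rw [h1, h1', h2, h2', omega_zero_zero, omega_zero_zero, inclG_zero, zero_smul, sub_zero,
      sub_zero, norm_zero]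
    exact mul_nonneg zero_le_one (norm_nonneg _)
  obtain ⟨B, hB, hX⟩ := eventually_X_ge hk hy C
  obtain ⟨CX, hCX, hXb⟩ := exists_X_bound (k + 1)
  obtain ⟨CL, hCL, hLb⟩ := exists_norm_lower_X_sub_le k
  obtain ⟨Cm, hCm, hmb⟩ := exists_metric_bound (k + 1)
  obtain ⟨Cl, hCl, hlb⟩ := exists_metric_bound k
  have hfree := isFree_of_mem_A hk hy.2
  have hoff := mem_Sing1_iff.1 hy.1
  obtain ⟨om, hom⟩ : ∃ om, om = omega (lower y) (lower u) (lower v) := ⟨_, rfl⟩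
  obtain ⟨hu', hhu'⟩ : ∃ h, h = hor (lower y) (lower u) := ⟨_, rfl⟩
  obtain ⟨hv', hhv'⟩ : ∃ h, h = hor (lower y) (lower v) := ⟨_, rfl⟩
  rw [← hhu'] at hhu
  rw [← hhv'] at hhv
  rw [← hom]
  obtain ⟨K, hK⟩ : ∃ K, K = 2 * (Cl * ‖hv'‖ * (CL * B0 * B)) +
      2 * (Cm * B1 * (CX * (‖xi1 k‖ * B0 + ‖incl hu'‖ + B0) * B)) +
      Cl * ‖X k om (lower y)‖ * (CL * B) + Cm * (CX * ‖inclG om‖) := ⟨_, rfl⟩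
  have n1 := norm_nonneg hv'
  have n2 := norm_nonneg (xi1 k)
  have n3 := norm_nonneg (incl hu')
  have n4 := norm_nonneg (X k om (lower y))
  have n5 := norm_nonneg (inclG om)
  have hK0 : 0 ≤ K := by
    rw [hK]
    generalize ‖hv'‖ = a1 at *
    generalize ‖xi1 k‖ = a2 at *
    generalize ‖incl hu'‖ = a3 at *
    generalize ‖X k om (lower y)‖ = a4 at *
    generalize ‖inclG om‖ = a5 at *
    clear hLb hlb hmb hXb hX hhu hhv
    positivity
  refine ⟨B * K + 1, by have := mul_nonneg hB.le hK0; linarith, ?_⟩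
  have hlim := (eventually_norm_sub_lt y one_pos).filter_mono
    (nhdsWithin_le_nhds (s := approach C y))
  filter_upwards [hX, hhu, hhv, hlim, eventually_mem_nhdsWithin] with y' hy' hdu hdv hε1 hmem
  obtain ⟨hf', hge⟩ := hy'
  obtain ⟨η, hη⟩ : ∃ η, η = omega y' u v - inclG om := ⟨_, rfl⟩
  have hgeη := hge η
  have hε0 := norm_nonneg (y' - y)
  have hM0 := norm_nonneg (X _ η y')
  have hs0 := mul_nonneg hε0 (abs_nonneg (circleG η))
  have hρ : ‖restG η‖ ≤ B * ‖X (k + 1) η y'‖ := by linarith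
  have hs : ‖y' - y‖ * |circleG η| ≤ B * ‖X (k + 1) η y'‖ := by linarith [norm_nonneg (restG η)]
  have hXu : ‖X (k + 1) η (hor y' u)‖ ≤
      CX * (‖xi1 k‖ * B0 + ‖incl hu'‖ + B0) * B * ‖X (k + 1) η y'‖ := by
    have e : X _ η (hor y' u) = circleG η • X _ (xi1 k) (hor y' u - incl hu') +
        X _ (restG η) (hor y' u) := by
      rw [map_sub, X_xi1_incl, sub_zero]
      conv_lhs => rw [← restG_add η, map_add, LinearMap.add_apply, map_smul, LinearMap.smul_apply]
    have f1 : ‖circleG η • X _ (xi1 k) (hor y' u - incl hu')‖ ≤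
        CX * ‖xi1 k‖ * B0 * (‖y' - y‖ * |circleG η|) := by
      rw [norm_smul, Real.norm_eq_abs]
      refine (mul_le_mul_of_nonneg_left ((hXb _ _).trans (mul_le_mul_of_nonneg_left hdu
        (mul_nonneg hCX.le n2))) (abs_nonneg _)).trans (le_of_eq (by ring))
    have f2 : ‖hor y' u‖ ≤ ‖incl hu'‖ + B0 := by
      have := norm_le_norm_add_norm_sub' (hor y' u) (incl hu')
      have := mul_le_mul_of_nonneg_left hε1.le hB0.le
      linarith
    have f3 : ‖X (k + 1) (restG η) (hor y' u)‖ ≤ CX * (B * ‖X (k + 1) η y'‖) * (‖incl hu'‖ + B0) :=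
      (hXb _ _).trans (mul_le_mul (mul_le_mul_of_nonneg_left hρ hCX.le) f2 (norm_nonneg _)
        (mul_nonneg hCX.le (mul_nonneg hB.le hM0)))
    have f4 := mul_le_mul_of_nonneg_left hs (mul_nonneg (mul_nonneg hCX.le n2) hB0.le)
    rw [e]
    refine (norm_add_le _ _).trans ((add_le_add (f1.trans f4) f3).trans (le_of_eq (by ring)))
  have e1 : metric (k + 1) (X _ (omega y' u v) y') (X _ η y') =
      2 * metric (k + 1) (hor y' v) (X _ η (hor y' u)) := metric_curvature_theta hf' u v η
  have e2 : metric k (X k om (lower y)) (X k (lowerG η) (lower y)) =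
      2 * metric k hv' (X k (lowerG η) hu') := by
    rw [hom, hhv', hhu']; exact metric_curvature_theta hfree _ _ _
  have e3 : X _ η y' = X _ (omega y' u v) y' -
      (incl (X k om (lower y)) + X _ (inclG om) (y' - y)) := by
    rw [map_sub (X _ (inclG om)), X_inclG hoff, hη, map_sub, LinearMap.sub_apply]
    abel
  have e4 : metric (k + 1) (X _ η y') (X _ η y') =
      2 * metric k hv' (lower (X _ η (hor y' u)) - X k (lowerG η) (lower (incl hu'))) +
      2 * metric (k + 1) (hor y' v - incl hv') (X _ η (hor y' u)) -
      metric k (X k om (lower y)) (lower (X _ η y') - X k (lowerG η) (lower y)) -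
      metric (k + 1) (X _ (inclG om) (y' - y)) (X _ η y') := by
    have e5 : ∀ w, metric (k + 1) (X _ η y') w =
        metric (k + 1) (X _ (omega y' u v) y') w - (metric k (X k om (lower y)) (lower w) +
          metric (k + 1) (X _ (inclG om) (y' - y)) w) := fun w => by
      rw [e3, map_sub, LinearMap.sub_apply, map_add, LinearMap.add_apply, metric_incl]
    have e6 : metric (k + 1) (hor y' v) (X _ η (hor y' u)) =
        metric k hv' (lower (X _ η (hor y' u))) +
          metric (k + 1) (hor y' v - incl hv') (X _ η (hor y' u)) := by
      rw [← metric_incl, map_sub, LinearMap.sub_apply]; ring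
    rw [e5, e1, e6, map_sub (metric k hv'), map_sub (metric k (X k om (lower y))), e2,
      lower_blockData]
    ring
  have b1 : metric k hv' (lower (X _ η (hor y' u)) - X k (lowerG η) (lower (incl hu'))) ≤
      Cl * ‖hv'‖ * (CL * (B0 * ‖y' - y‖) * (B * ‖X (k + 1) η y'‖)) :=
    (le_abs_self _).trans ((hlb _ _).trans (mul_le_mul_of_nonneg_left
      ((hLb _ _ _ (off_blockData _ _ _)).trans (mul_le_mul
        (mul_le_mul_of_nonneg_left hdu hCL.le) hρ (norm_nonneg _)
        (mul_nonneg hCL.le (mul_nonneg hB0.le hε0)))) (mul_nonneg hCl.le n1)))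
  have b2 : metric (k + 1) (hor y' v - incl hv') (X _ η (hor y' u)) ≤ Cm * (B1 * ‖y' - y‖) *
        (CX * (‖xi1 k‖ * B0 + ‖incl hu'‖ + B0) * B * ‖X (k + 1) η y'‖) :=
    (le_abs_self _).trans ((hmb _ _).trans (mul_le_mul (mul_le_mul_of_nonneg_left hdv hCm.le)
      hXu (norm_nonneg _) (mul_nonneg hCm.le (mul_nonneg hB1.le hε0))))
  have b3 : -metric k (X k om (lower y)) (lower (X _ η y') - X k (lowerG η) (lower y)) ≤
      Cl * ‖X k om (lower y)‖ * (CL * ‖y' - y‖ * (B * ‖X (k + 1) η y'‖)) :=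
    (neg_le_abs _).trans ((hlb _ _).trans (mul_le_mul_of_nonneg_left ((hLb _ _ _ hoff).trans
      (mul_le_mul_of_nonneg_left hρ (mul_nonneg hCL.le hε0))) (mul_nonneg hCl.le n4)))
  have b4 : -metric (k + 1) (X _ (inclG om) (y' - y)) (X _ η y') ≤
      Cm * (CX * ‖inclG om‖ * ‖y' - y‖) * ‖X (k + 1) η y'‖ :=
    (neg_le_abs _).trans ((hmb _ _).trans (mul_le_mul_of_nonneg_right
      (mul_le_mul_of_nonneg_left (hXb _ _) hCm.le) hM0))
  have hM : ‖X (k + 1) η y'‖ ≤ K * ‖y' - y‖ := by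
    refine le_of_sq_le ((norm_sq_le_metric _).trans ?_) hM0 (mul_nonneg hK0 hε0)
    have e7 : K * ‖y' - y‖ * ‖X (k + 1) η y'‖ =
        2 * (Cl * ‖hv'‖ * (CL * (B0 * ‖y' - y‖) * (B * ‖X (k + 1) η y'‖))) +
        2 * (Cm * (B1 * ‖y' - y‖) *
          (CX * (‖xi1 k‖ * B0 + ‖incl hu'‖ + B0) * B * ‖X (k + 1) η y'‖)) +
        Cl * ‖X k om (lower y)‖ * (CL * ‖y' - y‖ * (B * ‖X (k + 1) η y'‖)) +
        Cm * (CX * ‖inclG om‖ * ‖y' - y‖) * ‖X (k + 1) η y'‖ := by rw [hK]; ring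
    rw [e4, e7]
    linarith
  have hBM := mul_le_mul_of_nonneg_left hM hB.le
  refine ⟨circleG η, ?_, ?_⟩
  · by_cases h0 : ‖y' - y‖ = 0
    · have : y' = y := sub_eq_zero.1 (norm_eq_zero.1 h0)
      exact absurd (hf' (xi1 k) (by rw [this]; exact hy.1)) fun h => by
        have := congrArg circleG h
        rw [← one_smul ℝ (xi1 k), circleG_smul_xi1] at this
        exact one_ne_zero this
    · have hpos : 0 < ‖y' - y‖ := lt_of_le_of_ne hε0 (Ne.symm h0)
      refine (le_of_mul_le_mul_left (hs.trans (hBM.trans (le_of_eq ?_))) hpos).trans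
        (le_add_of_nonneg_right zero_le_one : B * K ≤ B * K + 1)
      ring
  · have e8 : omega y' u v - circleG η • xi1 k - inclG om = restG η := by rw [restG, hη]; abel
    rw [e8]
    refine hρ.trans (hBM.trans ?_)
    linarith

lemma curv_eq_of_mem_A (hy : y ∈ A k) (x : R4) (u v : R4 × Data k) :
    curv (x, y) u v = proj (x, y) * curvCore (x, y) u v * proj (x, y) := by
  refine curv_eq (det_RR_ne_zero (hy.2 x)) (fun v => ?_) u v
  rcases k.eq_zero_or_pos with rfl | hk
  · exact (differentiableAt_const (theta y v)).congr_of_eventuallyEq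
      (Eventually.of_forall fun y' => by rw [Subsingleton.elim y' y])
  · exact ((contDiffAt_theta (isFree_of_mem_A hk hy)).differentiableAt (by simp)).clm_apply
      (differentiableAt_const v)

lemma bracket_swap (g h : gLie k) : bracket g h = -bracket h g := by
  refine Prod.ext (Subtype.ext ?_) ?_
  · funext i j
    change (bracket g h).mat i j = -(bracket h g).mat i j
    rw [bracket_mat, bracket_mat, ← Matrix.neg_apply, neg_sub]
  · funext c
    change (bracket g h).2 c = -(bracket h g).2 c
    fin_cases c <;> simp [bracket] <;> ring

lemma omega_swap (y u v : Data k) : omega y u v = -omega y v u := by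
  rw [omega, omega, bracket_swap (theta y v)]
  abel

lemma curvCore_swap (z u v : R4 × Data k) : curvCore z u v = -curvCore z v u := by
  rw [curvCore, curvCore, omega_swap z.2 v.2, ← rhoL_apply, ← rhoL_apply, map_neg]
  abel

/-- The data of a translation of `ℝ⁴`. -/
def scalarData (t : R4) : Data k := (⟨fun a i j => if i = j then ((t a : ℝ) : ℂ) else 0, by
    intro a i j
    by_cases h : i = j
    · simp [h]
    · simp [h, Ne.symm h]⟩, 0)

lemma scalarData_T (t : R4) (a : Fin 4) :
    (scalarData t : Data k).T a = ((t a : ℝ) : ℂ) • (1 : Mat k) := by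
  ext i j
  change (if i = j then ((t a : ℝ) : ℂ) else 0) = _
  simp [Matrix.one_apply]

lemma X_scalarData (ξ : gLie k) (t : R4) : X k ξ (scalarData t) = 0 := by
  refine Data.ext' (fun a => ?_) fun a => ?_
  · rw [X_T, scalarData_T, Matrix.mul_smul, smul_mul, mul_one, one_mul, sub_self]
    rfl
  · funext i
    have h : ∀ b j, (scalarData t : Data k).P b j = 0 := fun _ _ => rfl
    rw [X_P]
    simp only [h, mul_zero, zero_mul, sum_const_zero, sub_zero]
    rfl

lemma theta_scalarData (y : Data k) (t : R4) : theta y (scalarData t) = 0 := by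
  have h : orbitPairing y (scalarData t) = 0 := by
    refine ContinuousLinearMap.ext fun ξ => ?_
    change metric k (scalarData t) (X k ξ y) = 0
    have := metric_X ξ (scalarData t) y
    rw [X_scalarData, map_zero, LinearMap.zero_apply] at this
    linarith
  rw [theta, ContinuousLinearMap.comp_apply, h, map_zero]

lemma theta_add_scalarData (y : Data k) (t : R4) : theta (y + scalarData t) = theta y := by
  have h1 : orbitMap (y + scalarData t) = orbitMap y := by
    refine ContinuousLinearMap.ext fun ξ => ?_
    change X k ξ (y + scalarData t) = X k ξ y
    rw [map_add, X_scalarData, add_zero]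
  have h2 : orbitPairing (y + scalarData t) = orbitPairing y := by
    refine ContinuousLinearMap.ext fun v => ContinuousLinearMap.ext fun ξ => ?_
    change metric k v (X k ξ (y + scalarData t)) = metric k v (X k ξ y)
    rw [map_add (X k ξ), X_scalarData, add_zero]
  rw [theta, theta, h1, h2]

lemma fderiv_apply_eq_zero {E F : Type*} [NormedAddCommGroup E] [NormedSpace ℝ E]
    [NormedAddCommGroup F] [NormedSpace ℝ F] {f : E → F} {x w : E}
    (h : ∀ r : ℝ, f (x + r • w) = f x) : fderiv ℝ f x w = 0 := by
  by_cases hf : DifferentiableAt ℝ f x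
  · rw [← hf.lineDeriv_eq_fderiv, lineDeriv]
    simp only [h, deriv_const]
  · rw [fderiv_zero_of_not_differentiableAt hf, ContinuousLinearMap.zero_apply]

lemma smul_scalarData (r : ℝ) (t : R4) : r • (scalarData t : Data k) = scalarData (r • t) := by
  refine Data.ext' (fun a => ?_) fun a => ?_
  · ext i j
    change r • (scalarData t : Data k).T a i j = _
    rw [scalarData_T, scalarData_T]
    simp [mul_assoc]
  · funext i
    change r • (0 : ℂ) = 0
    rw [smul_zero]

lemma omega_add_scalarData (y v w : Data k) (t : R4) :
    omega y (v + scalarData t) w = omega y v w := by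
  have h1 : (fun y : Data k => theta y (v + scalarData t)) = fun y => theta y v := by
    funext y
    rw [map_add, theta_scalarData, add_zero]
  have h2 : fderiv ℝ (fun y => theta y w) y (scalarData t) = 0 :=
    fderiv_apply_eq_zero fun r => by rw [smul_scalarData, theta_add_scalarData]
  rw [omega, omega, h1, map_add (fderiv ℝ (fun y => theta y w) y), h2, add_zero, map_add (theta y),
    theta_scalarData, add_zero]

lemma Rop_scalarData (t : R4) : Rop t (scalarData t : Data k) = 0 := by
  ext p (⟨j, u⟩ | u)
  · rw [Rop_eq, fromCols_apply_inl, Matrix.sum_apply]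
    refine sum_eq_zero fun a _ => ?_
    rw [kroneckerMap_apply, tau, scalarData_T, sub_self, Matrix.zero_apply, zero_mul]
  · rw [Rop_eq, fromCols_apply_inr]
    change ∑ a, (scalarData t : Data k).P a p.1 * spin a p.2 u = 0
    exact sum_eq_zero fun a _ => zero_mul _

lemma hor_add_scalarData (y v : Data k) (t : R4) :
    hor y (v + scalarData t) = hor y v + scalarData t := by
  rw [hor, hor, map_add (theta y), theta_scalarData, add_zero]
  abel

lemma curvCore_add_scalarData (z w : R4 × Data k) (e t : R4) (v : Data k) :
    curvCore z (e, v + scalarData t) w = curvCore z (e - t, v) w := by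
  have h : Rop e (hor z.2 v + scalarData t) = Rop (e - t) (hor z.2 v) := by
    have := Rop_add (e - t) t (hor z.2 v) (scalarData t)
    rwa [sub_add_cancel, Rop_scalarData, add_zero] at this
  simp only [curvCore, omega_add_scalarData, hor_add_scalarData, h]

lemma curvCore_add_scalarData_right (z w : R4 × Data k) (e t : R4) (v : Data k) :
    curvCore z w (e, v + scalarData t) = curvCore z w (e - t, v) := by
  rw [curvCore_swap, curvCore_add_scalarData, ← curvCore_swap]

lemma T0_scalarData (t : R4) : T0 (scalarData t : Data₁) = t := by
  ext a
  change ((scalarData t : Data₁).T a 0 0).re = t a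
  rw [scalarData_T]
  simp

lemma lower_scalarData (t : R4) : lower (scalarData t : Data₁) = scalarData t := by
  refine Data.ext' (fun a => ?_) fun a => rfl
  ext i j
  change (scalarData t : Data₁).T a i.succ j.succ = _
  rw [scalarData_T, scalarData_T]
  simp [Matrix.one_apply]

/-- The removal of the mean translation along the fixed circle. -/
def centered (v : Data₁) : Data₁ := v - scalarData (T0 v)

lemma centered_add (v : Data₁) : centered v + scalarData (T0 v) = v := sub_add_cancel _ _

lemma T0_centered (v : Data₁) : T0 (centered v) = 0 := by
  ext a
  rw [centered, T0_sub, T0_scalarData, sub_self]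
  rfl

lemma centered_mem_Sing1 {v : Data₁} (hv : v ∈ Sing1 k) : centered v ∈ Sing1 k :=
  Submodule.sub_mem _ hv (X_scalarData _ _)

lemma lower_centered (v : Data₁) : lower (centered v) + scalarData (T0 v) = lower v := by
  rw [centered, lower_sub, lower_scalarData, sub_add_cancel]

lemma curv_congr (hy : y ∈ A k) (x : R4) {u u' v v' : R4 × Data k}
    (h : curvCore (x, y) u v = curvCore (x, y) u' v') : curv (x, y) u v = curv (x, y) u' v' := by
  rw [curv_eq_of_mem_A hy, curv_eq_of_mem_A hy, h]

lemma chern_add_scalarData (hy : y ∈ A k) (x : R4) (e t : Fin 4 → R4) (v : Fin 4 → Data k) :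
    chern (x, y) (fun i => (e i, v i + scalarData (t i))) =
      chern (x, y) fun i => (e i - t i, v i) := by
  have h : ∀ i j, curv (x, y) (e i, v i + scalarData (t i)) (e j, v j + scalarData (t j)) =
      curv (x, y) (e i - t i, v i) (e j - t j, v j) := fun i j =>
    curv_congr hy x (by rw [curvCore_add_scalarData, curvCore_add_scalarData_right])
  simp only [chern, h]

lemma curvCore_inl (z : R4 × Data k) (e e' : R4) :
    curvCore z (e, 0) (e', 0) = (Rop e (0 : Data k))ᴴ * (RR z)⁻¹ * Rop e' (0 : Data k) -
      (Rop e' (0 : Data k))ᴴ * (RR z)⁻¹ * Rop e (0 : Data k) := by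
  have h : hor z.2 0 = 0 := by rw [hor, map_zero, map_zero, LinearMap.zero_apply, sub_zero]
  have h0 : rho (0 : gLie k) = 0 := by rw [← rhoL_apply, map_zero]
  rw [curvCore, omega_zero_zero, h, h0, sub_zero]

lemma continuous_proj (hy : y ∈ A k) : Continuous fun x : R4 => proj (x, y) := by
  refine continuous_iff_continuousAt.2 fun x => continuousAt_pi.2 fun I => continuousAt_pi.2 fun J => ?_
  have h := (msmoothAt_proj (det_RR_ne_zero (hy.2 x)) I J).continuousAt
  exact ContinuousAt.comp (f := fun x : R4 => (x, y)) h (by fun_prop)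

lemma continuous_curvCore (hy : y ∈ A k) (u v : R4 × Data k) :
    Continuous fun x : R4 => curvCore (x, y) u v := by
  obtain ⟨F, hF⟩ : ∃ F : R4 → Matrix (Fin k × Fin 2) (Fin k × Fin 2) ℂ,
      ∀ x, (RR (x, y))⁻¹ = F x := ⟨_, fun _ => rfl⟩
  have h : Continuous F := by
    rw [← funext hF]
    refine continuous_iff_continuousAt.2 fun x =>
      continuousAt_pi.2 fun I => continuousAt_pi.2 fun J => ?_
    have h := ((msmoothAt_RR (x, y)).inv (det_RR_ne_zero (hy.2 x)) I J).continuousAt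
    exact ContinuousAt.comp (f := fun x : R4 => (x, y)) h (by fun_prop)
  simp only [curvCore, hF]
  generalize Rop u.1 (hor y u.2) = M
  generalize Rop v.1 (hor y v.2) = N
  generalize rho (omega y u.2 v.2) = L
  exact (((continuous_const.matrix_mul h).matrix_mul continuous_const).sub
    ((continuous_const.matrix_mul h).matrix_mul continuous_const)).sub continuous_const

lemma continuous_chern (hy : y ∈ A k) (w : Fin 4 → R4 × Data k) :
    Continuous fun x : R4 => chern (x, y) w := by
  have h : ∀ u v, Continuous fun x : R4 => curv (x, y) u v := fun u v => by
    simp only [curv_eq_of_mem_A hy]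
    exact ((continuous_proj hy).matrix_mul (continuous_curvCore hy u v)).matrix_mul
      (continuous_proj hy)
  refine continuous_const.mul (continuous_re.comp (Continuous.matrix_trace ?_))
  exact (((h _ _).matrix_mul (h _ _)).sub ((h _ _).matrix_mul (h _ _))).add
    ((h _ _).matrix_mul (h _ _))

lemma exists_entry_bound {E : Type*} [NormedAddCommGroup E] [NormedSpace ℝ E]
    [FiniteDimensional ℝ E] {l m : Type*} [Fintype l] [Fintype m] (L : E →ₗ[ℝ] Matrix l m ℂ) :
    ∃ C > 0, ∀ x i j, ‖L x i j‖ ≤ C * ‖x‖ := by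
  let L' : E →ₗ[ℝ] (l → m → ℂ) := { toFun := fun x => L x, map_add' := L.map_add,
                                     map_smul' := L.map_smul }
  refine ⟨‖toContinuousLinearMap L'‖ + 1, by positivity, fun x i j => ?_⟩
  have h := (toContinuousLinearMap L').le_opNorm x
  have h2 : ‖L' x i j‖ ≤ ‖L' x‖ := (norm_le_pi_norm (L' x i) j).trans (norm_le_pi_norm (L' x) i)
  refine h2.trans (h.trans ?_)
  exact mul_le_mul_of_nonneg_right (by linarith) (norm_nonneg x)

lemma norm_mul_apply_le {l m n : Type*} [Fintype m] {M : Matrix l m ℂ} {N : Matrix m n ℂ}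
    {a b : ℝ} (hM : ∀ i j, ‖M i j‖ ≤ a) (hN : ∀ i j, ‖N i j‖ ≤ b) (i : l) (j : n) :
    ‖(M * N) i j‖ ≤ Fintype.card m * (a * b) := by
  rw [Matrix.mul_apply]
  refine (norm_sum_le _ _).trans ((sum_le_card_nsmul _ _ (a * b) fun p _ => ?_).trans ?_)
  · rw [norm_mul]
    exact mul_le_mul (hM i p) (hN p j) (norm_nonneg _) ((norm_nonneg _).trans (hM i p))
  · rw [nsmul_eq_mul, card_univ]

lemma norm_proj_apply_le {z : R4 × Data k} (hz : (RR z).det ≠ 0) (I J : Idx k) :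
    ‖proj z I J‖ ≤ 1 := by
  have h := congr_fun₂ (proj_mul_proj hz) I I
  have h1 : ∀ J, proj z J I = star (proj z I J) := fun J => by
    rw [← conjTranspose_apply, proj_conjTranspose]
  rw [Matrix.mul_apply, sum_ext fun K _ => by rw [h1 K]] at h
  have h2 : ∑ K, ‖proj z I K‖ ^ 2 = (proj z I I).re := by
    rw [← h, re_sum]
    refine sum_ext fun K _ => ?_
    rw [star_def, Complex.mul_conj, ofReal_re, normSq_eq_norm_sq]
  have h3 : ∀ K, ‖proj z I K‖ ^ 2 ≤ ‖proj z I I‖ := fun K =>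
    (single_le_sum (f := fun K => ‖proj z I K‖ ^ 2) (fun _ _ => sq_nonneg _)
      (mem_univ K)).trans (h2.le.trans (re_le_norm _))
  have h4 : ‖proj z I I‖ ≤ 1 := by nlinarith [h3 I, norm_nonneg (proj z I I)]
  have h5 := h3 J
  nlinarith [norm_nonneg (proj z I J)]

lemma norm_symb_sq_le (x : R4) (y : Data k) (b : Fin k → ℂ) :
    ‖symb x y b‖ ^ 2 ≤ (star b ⬝ᵥ (Dm x y *ᵥ b)).re := by
  have hre : ∀ z : ℂ, (star z * z).re = ‖z‖ ^ 2 := fun z => by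
    rw [star_def, ← normSq_eq_conj_mul_self, ofReal_re, normSq_eq_norm_sq]
  have h1 : (star b ⬝ᵥ (Dm x y *ᵥ b)).re =
      ∑ c, (∑ i, ‖(symb x y b).1 c i‖ ^ 2 + ‖(symb x y b).2 c‖ ^ 2) := by
    rw [dotProduct_Dm_mulVec, re_sum]
    refine sum_ext fun c _ => ?_
    rw [add_re, hre, dotProduct, re_sum]
    simp only [Pi.star_apply, hre]
  have h0 : ∀ c, 0 ≤ ∑ i, ‖(symb x y b).1 c i‖ ^ 2 := fun c => sum_nonneg fun _ _ => sq_nonneg _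
  have h2 : ∀ c, ∑ i, ‖(symb x y b).1 c i‖ ^ 2 + ‖(symb x y b).2 c‖ ^ 2 ≤
      (star b ⬝ᵥ (Dm x y *ᵥ b)).re := fun c => by
    rw [h1]
    exact single_le_sum (f := fun c => ∑ i, ‖(symb x y b).1 c i‖ ^ 2 +
      ‖(symb x y b).2 c‖ ^ 2) (fun c _ => add_nonneg (h0 c) (sq_nonneg _)) (mem_univ c)
  have hN : 0 ≤ (star b ⬝ᵥ (Dm x y *ᵥ b)).re := (add_nonneg (h0 0) (sq_nonneg _)).trans (h2 0)
  have h3 : ‖symb x y b‖ ≤ Real.sqrt (star b ⬝ᵥ (Dm x y *ᵥ b)).re := by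
    refine Off.norm_le (Real.sqrt_nonneg _) (fun c i => Real.le_sqrt_of_sq_le ?_)
      fun c => Real.le_sqrt_of_sq_le ?_
    · have := single_le_sum (f := fun i => ‖(symb x y b).1 c i‖ ^ 2)
        (fun _ _ => sq_nonneg _) (mem_univ i)
      linarith [h2 c, sq_nonneg ‖(symb x y b).2 c‖]
    · linarith [h2 c, h0 c]
  exact (pow_le_pow_left₀ (norm_nonneg _) h3 2).trans (Real.sq_sqrt hN).le

lemma norm_inv_Dm_le {x : R4} (hD : (Dm x y).det ≠ 0) {w : Fin k → ℝ} {C : ℝ}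
    (hC : 0 ≤ C) (hw : ∀ i, 0 ≤ w i) (h : ∀ a i, ‖a i‖ ≤ C * w i * ‖symb x y a‖) (i j : Fin k) :
    ‖(Dm x y)⁻¹ i j‖ ≤ C ^ 2 * w i * w j ∧ ∀ a, ‖((Dm x y)⁻¹ * tau x y a) i j‖ ≤ C * w i := by
  have key : ∀ j, ‖symb x y ((Dm x y)⁻¹.col j)‖ ≤ C * w j := fun j => by
    have e1 : Dm x y *ᵥ (Dm x y)⁻¹.col j = Pi.single j 1 := by
      rw [← mulVec_single_one, mulVec_mulVec, mul_nonsing_inv _ (isUnit_iff_ne_zero.2 hD),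
        one_mulVec]
    have h1 := norm_symb_sq_le x y ((Dm x y)⁻¹.col j)
    rw [e1, dotProduct_single_one, Pi.star_apply] at h1
    have h2 := h1.trans ((re_le_norm _).trans ((norm_star _).le.trans (h _ j)))
    exact le_of_sq_le h2 (norm_nonneg _) (mul_nonneg hC (hw j))
  refine ⟨?_, fun a => ?_⟩
  · have h1 := h ((Dm x y)⁻¹.col j) i
    refine h1.trans ((mul_le_mul_of_nonneg_left (key j) (mul_nonneg hC (hw i))).trans
      (le_of_eq (by ring)))
  · have hDh : (Dm x y)ᴴ = Dm x y := by
      rw [Dm, conjTranspose_sum]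
      refine sum_ext fun c _ => ?_
      rw [conjTranspose_add, conjTranspose_mul, tau_conjTranspose, Matrix.conjTranspose_vecMulVec,
        star_star]
    have e : ((Dm x y)⁻¹ * tau x y a) i j = star ((symb x y ((Dm x y)⁻¹.col i)).1 a j) := by
      rw [symb_fst, ← mulVec_single_one, mulVec_mulVec]
      rw [mulVec_single_one, Matrix.col_apply, ← conjTranspose_apply, conjTranspose_mul,
        tau_conjTranspose, Matrix.conjTranspose_nonsing_inv, hDh]
    rw [e, norm_star]
    exact (norm_off_fst_le _ a j).trans (key i)

/-- The weights of the Green's function near the fixed set. -/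
def wt (k : ℕ) (l : ℝ) : Fin (k + 1) → ℝ := Fin.cons l⁻¹ fun _ => 1

lemma wt_nonneg {l : ℝ} (hl : 0 ≤ l) (i : Fin (k + 1)) : 0 ≤ wt k l i :=
  Fin.cases (inv_nonneg.2 hl) (fun _ => zero_le_one) i

lemma wt_le {l : ℝ} (hl : 0 ≤ l) (i : Fin (k + 1)) : wt k l i ≤ 1 + l⁻¹ := by
  have := inv_nonneg.2 hl
  refine Fin.cases ?_ (fun _ => ?_) i
  · change l⁻¹ ≤ _
    linarith
  · change (1 : ℝ) ≤ _
    linarith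

lemma eventually_norm_inv_Dm_le {y : Data₁} (hy : y ∈ Sing1reg k) (C : ℝ) :
    ∃ B > 0, ∀ᶠ y' in 𝓝[approach C y] y, y' ∈ A (k + 1) ∧ 0 < ‖y' - y‖ ∧ ∀ x i j,
      ‖(Dm x y')⁻¹ i j‖ ≤ B * wt k (‖x - T0 y‖ + ‖y' - y‖) i * wt k (‖x - T0 y‖ + ‖y' - y‖) j ∧
      ∀ a, ‖((Dm x y')⁻¹ * tau x y' a) i j‖ ≤ B * wt k (‖x - T0 y‖ + ‖y' - y‖) i := by
  obtain ⟨c0, hc0, h⟩ := eventually_isTransverse hy C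
  obtain ⟨B, hB, hX⟩ := exists_symb_ge hy hc0
  have hyA : y ∉ A (k + 1) := fun hA => by
    have h0 := isFree_of_mem_A k.succ_pos hA (xi1 k) hy.1
    have := congrArg circleG h0
    rw [← one_smul ℝ (xi1 k), circleG_smul_xi1] at this
    exact one_ne_zero this
  refine ⟨max B (B ^ 2), lt_max_of_lt_left hB, ?_⟩
  filter_upwards [h, hX.filter_mono nhdsWithin_le_nhds, self_mem_nhdsWithin] with y' h1 h2 h3
  have hpos : 0 < ‖y' - y‖ := norm_pos_iff.2 (sub_ne_zero.2 fun e => hyA (e ▸ h3.1))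
  refine ⟨h3.1, hpos, fun x i j => ?_⟩
  obtain ⟨l, hl⟩ : ∃ l, l = ‖x - T0 y‖ + ‖y' - y‖ := ⟨_, rfl⟩
  have hl0 : 0 < l := hl ▸ add_pos_of_nonneg_of_pos (norm_nonneg _) hpos
  have hb : ∀ (a : Fin (k + 1) → ℂ) i, ‖a i‖ ≤ B * wt k l i * ‖symb x y' a‖ := fun a i => by
    have := h2 h1 x a
    rw [← hl] at this
    refine Fin.cases ?_ (fun i => ?_) i
    · change ‖a 0‖ ≤ B * l⁻¹ * ‖symb x y' a‖
      rw [mul_right_comm, ← div_eq_mul_inv, le_div_iff₀ hl0, mul_comm]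
      exact (le_add_of_nonneg_right (norm_nonneg _)).trans this
    · change ‖a i.succ‖ ≤ B * 1 * ‖symb x y' a‖
      rw [mul_one]
      exact (norm_le_pi_norm (tail a) i).trans
        ((le_add_of_nonneg_left (mul_nonneg hl0.le (norm_nonneg _))).trans this)
  have hw := wt_nonneg (k := k) hl0.le
  obtain ⟨g1, g2⟩ := norm_inv_Dm_le (det_Dm_ne_zero h3.1 x) hB.le hw hb i j
  rw [← hl]
  exact ⟨g1.trans (mul_le_mul_of_nonneg_right (mul_le_mul_of_nonneg_right (le_max_right _ _)
    (hw i)) (hw j)), fun a => (g2 a).trans (mul_le_mul_of_nonneg_right (le_max_left _ _) (hw i))⟩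

lemma eventually_norm_Rop_hor_le {y : Data₁} (hy : y ∈ Sing1reg k) (C : ℝ)
    {v : Data₁} (hv : v ∈ Sing1 k) (hv0 : T0 v = 0) :
    ∃ B > 0, ∀ᶠ y' in 𝓝[approach C y] y, ∀ x e p s J,
      wt k (‖x - T0 y‖ + ‖y' - y‖) p * ‖Rop e (hor y' v) (p, s) J‖ ≤
        B * (‖e‖ * (1 + (‖x - T0 y‖ + ‖y' - y‖)⁻¹) + 1) := by
  obtain ⟨B0, hB0, hh⟩ := eventually_norm_hor_sub_le hy C hv hv0
  obtain ⟨B1, hB1, hA⟩ := eventually_norm_inv_Dm_le hy C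
  obtain ⟨D, hD, hR⟩ := exists_entry_bound (RopL (k + 1))
  obtain ⟨h, hh'⟩ : ∃ h, h = hor (lower y) (lower v) := ⟨_, rfl⟩
  rw [← hh'] at hh
  have hn := norm_nonneg (incl h)
  have hR' : ∀ e z I J, ‖Rop e z I J‖ ≤ D * (‖e‖ + ‖z‖) := fun e z I J =>
    (hR (e, z) I J).trans (mul_le_mul_of_nonneg_left (by
      rw [Prod.norm_mk]
      exact max_le_add_of_nonneg (norm_nonneg _) (norm_nonneg _)) hD.le)
  have h0 : ∀ s J, Rop 0 (incl h) (0, s) J = 0 := fun s J => by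
    have hc : ∀ J s, colMat (0 : Off k) J s = 0 := fun J s => by
      rcases J with ⟨j, u⟩ | u <;> simp [colMat]
    rcases J with ⟨j, u⟩ | u
    · refine Fin.cases ?_ (fun j => ?_) j
      · exact Rop_blockData_zero_inl_zero _ _ _ _ _
      · rw [Rop_blockData_zero_inl_succ, hc, star_zero]
    · rw [Rop_blockData_zero_inr, hc, star_zero]
  refine ⟨D * (1 + ‖incl h‖ + B0), mul_pos hD (by linarith), ?_⟩
  have hlim := (eventually_norm_sub_lt y one_pos).filter_mono
    (nhdsWithin_le_nhds (s := approach C y))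
  filter_upwards [hh, hA, hlim] with y' h1 h2 h3 x e p s J
  obtain ⟨_, hpos, _⟩ := h2
  obtain ⟨r, hr⟩ : ∃ r, r = ‖x - T0 y‖ := ⟨_, rfl⟩
  have hr0 : 0 ≤ r := hr ▸ norm_nonneg _
  have he0 := norm_nonneg e
  have hs : Rop e (hor y' v) (0, s) J = Rop e (hor y' v - incl h) (0, s) J := by
    have := congr_fun₂ (Rop_sub e 0 (hor y' v) (incl h)) (0, s) J
    rw [sub_zero, Matrix.sub_apply, h0, sub_zero] at this
    exact this.symm
  have b0 : ‖Rop e (hor y' v) (0, s) J‖ ≤ D * (‖e‖ + B0 * ‖y' - y‖) := by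
    rw [hs]
    exact (hR' _ _ _ _).trans (mul_le_mul_of_nonneg_left (add_le_add_right h1 _) hD.le)
  have b1 : ‖Rop e (hor y' v) (p, s) J‖ ≤ D * (‖e‖ + (‖incl h‖ + B0)) := by
    refine (hR' _ _ _ _).trans (mul_le_mul_of_nonneg_left (add_le_add_right ?_ _) hD.le)
    have := norm_le_norm_add_norm_sub' (hor y' v) (incl h)
    have := mul_le_mul_of_nonneg_left h3.le hB0.le
    linarith
  rw [← hr]
  generalize ‖y' - y‖ = ε at *
  generalize ‖incl h‖ = n at *
  generalize ‖e‖ = m at *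
  have hl0 : 0 < r + ε := by linarith
  have hli := inv_pos.2 hl0
  clear hR hR' hs h0 hA hh h1 hlim
  refine Fin.cases (fun b0 _ => ?_) (fun p _ b1 => ?_) p (motive := fun p => _ → 
    ‖Rop e (hor y' v) (p, s) J‖ ≤ D * (m + (n + B0)) → wt k (r + ε) p *
      ‖Rop e (hor y' v) (p, s) J‖ ≤ D * (1 + n + B0) * (m * (1 + (r + ε)⁻¹) + 1)) b0 b1
  · change (r + ε)⁻¹ * _ ≤ _
    refine (mul_le_mul_of_nonneg_left b0 hli.le).trans ?_
    have e1 : (r + ε)⁻¹ * ε ≤ 1 := by rw [inv_mul_le_iff₀ hl0]; linarith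
    have e2 := mul_le_mul_of_nonneg_left e1 hB0.le
    have e3 : 0 ≤ n * (m * (1 + (r + ε)⁻¹) + 1) := by positivity
    have e4 : 0 ≤ B0 * (m * (1 + (r + ε)⁻¹)) := by positivity
    calc (r + ε)⁻¹ * (D * (m + B0 * ε)) = D * (m * (r + ε)⁻¹ + B0 * ((r + ε)⁻¹ * ε)) := by ring
      _ ≤ D * ((1 + n + B0) * (m * (1 + (r + ε)⁻¹) + 1)) :=
        mul_le_mul_of_nonneg_left (by linarith) hD.le
      _ = _ := by ring
  · change 1 * _ ≤ _
    rw [one_mul, mul_assoc]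
    refine b1.trans (mul_le_mul_of_nonneg_left ?_ hD.le)
    have e1 : 0 ≤ m * (r + ε)⁻¹ := by positivity
    have e3 : 0 ≤ (n + B0) * (m * (1 + (r + ε)⁻¹)) := by positivity
    linarith

lemma inv_RR (hy : y ∈ Abar k) (x : R4) : (RR (x, y))⁻¹ = (Dm x y)⁻¹ ⊗ₖ (1 : Mat 2) := by
  rw [RR_eq_of_mem_Abar hy, Matrix.inv_kronecker, inv_one]

lemma norm_conj_mul_mul_le {m n : Type*} [Fintype m] {F : Matrix m m ℂ} {M N : Matrix m n ℂ}
    {w : m → ℝ} {B a b : ℝ} (hF : ∀ p q, ‖F p q‖ ≤ B * w p * w q) (hB : 0 ≤ B)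
    (hw : ∀ p, 0 ≤ w p) (hM : ∀ p J, w p * ‖M p J‖ ≤ a) (hN : ∀ p J, w p * ‖N p J‖ ≤ b) (ha : 0 ≤ a)
    (I J : n) : ‖(Mᴴ * F * N) I J‖ ≤ Fintype.card m ^ 2 * B * a * b := by
  have h : (Mᴴ * F * N) I J = ∑ q, ∑ p, star (M p I) * F p q * N q J := by
    simp only [Matrix.mul_apply, conjTranspose_apply, sum_mul]
  rw [h]
  refine (norm_sum_le _ _).trans ((sum_le_card_nsmul _ _
    (Fintype.card m * (B * a * b)) fun q _ => ?_).trans (le_of_eq ?_))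
  · refine (norm_sum_le _ _).trans ((sum_le_card_nsmul _ _ (B * a * b) fun p _ => ?_).trans
      (le_of_eq ?_))
    · rw [norm_mul, norm_mul, norm_star]
      have h1 := mul_le_mul (hF p q) le_rfl (mul_nonneg (norm_nonneg (M p I)) (norm_nonneg (N q J)))
        ((norm_nonneg _).trans (hF p q))
      calc ‖M p I‖ * ‖F p q‖ * ‖N q J‖ = ‖F p q‖ * (‖M p I‖ * ‖N q J‖) := by ring
        _ ≤ B * w p * w q * (‖M p I‖ * ‖N q J‖) := h1
        _ = B * ((w p * ‖M p I‖) * (w q * ‖N q J‖)) := by ring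
        _ ≤ B * (a * b) := mul_le_mul_of_nonneg_left (mul_le_mul (hM p I) (hN q J)
          (mul_nonneg (hw q) (norm_nonneg _)) ha) hB
        _ = B * a * b := by ring
    · rw [nsmul_eq_mul, card_univ]
  · rw [nsmul_eq_mul, card_univ]; ring

lemma eventually_norm_curv_le {y : Data₁} (hy : y ∈ Sing1reg k) (C : ℝ)
    {u v : Data₁} (hu : u ∈ Sing1 k) (hu0 : T0 u = 0) (hv : v ∈ Sing1 k)
    (hv0 : T0 v = 0) :
    ∃ B > 0, ∀ᶠ y' in 𝓝[approach C y] y, ∀ x e e' I J, ‖curv (x, y') (e, u) (e', v) I J‖ ≤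
        B * (‖e‖ * (1 + (‖x - T0 y‖ + ‖y' - y‖)⁻¹) + 1) *
          (‖e'‖ * (1 + (‖x - T0 y‖ + ‖y' - y‖)⁻¹) + 1) := by
  obtain ⟨B0, hB0, h0⟩ := eventually_norm_inv_Dm_le hy C
  obtain ⟨B1, hB1, h1⟩ := eventually_norm_Rop_hor_le hy C hu hu0
  obtain ⟨B2, hB2, h2⟩ := eventually_norm_Rop_hor_le hy C hv hv0
  obtain ⟨B3, hB3, h3⟩ := eventually_norm_omega_sub_le hy C hu hu0 hv hv0
  obtain ⟨D, hD, hR⟩ := exists_entry_bound (rhoL (k + 1))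
  obtain ⟨om, hom⟩ : ∃ om, om = inclG (omega (lower y) (lower u) (lower v)) := ⟨_, rfl⟩
  rw [← hom] at h3
  have n1 := norm_nonneg (xi1 k)
  have n2 := norm_nonneg om
  obtain ⟨N, hN⟩ : ∃ N : ℝ, N = Fintype.card (Idx (k + 1)) := ⟨_, rfl⟩
  have hN0 : 0 ≤ N := hN ▸ Nat.cast_nonneg _
  obtain ⟨M, hM⟩ : ∃ M : ℝ, M = (Fintype.card (Fin (k + 1) × Fin 2) : ℝ) ^ 2 * B0 * B1 * B2 :=
    ⟨_, rfl⟩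
  have hM0 : 0 ≤ M := by
    rw [hM]
    exact mul_nonneg (mul_nonneg (mul_nonneg (sq_nonneg _) hB0.le) hB1.le) hB2.le
  obtain ⟨L, hL⟩ : ∃ L, L = D * (B3 * ‖xi1 k‖ + ‖om‖ + B3) := ⟨_, rfl⟩
  have hL0 : 0 ≤ L := by
    rw [hL]
    exact mul_nonneg hD.le (add_nonneg (add_nonneg (mul_nonneg hB3.le n1) n2) hB3.le)
  refine ⟨N ^ 2 * (2 * M + L) + 1, add_pos_of_nonneg_of_pos (mul_nonneg (sq_nonneg N)
    (add_nonneg (mul_nonneg zero_le_two hM0) hL0)) one_pos, ?_⟩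
  have hlim := (eventually_norm_sub_lt y one_pos).filter_mono
    (nhdsWithin_le_nhds (s := approach C y))
  filter_upwards [h0, h1, h2, h3, hlim] with y' h0 h1 h2 h3 h4 x e e' I J
  obtain ⟨hA, hpos, h0⟩ := h0
  obtain ⟨l, hl⟩ : ∃ l, l = ‖x - T0 y‖ + ‖y' - y‖ := ⟨_, rfl⟩
  have hl0 : 0 < l := hl ▸ add_pos_of_nonneg_of_pos (norm_nonneg _) hpos
  have hw := wt_nonneg (k := k) hl0.le
  obtain ⟨W, hW⟩ : ∃ W, W = 1 + l⁻¹ := ⟨_, rfl⟩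
  have hW0 : 0 ≤ W := by rw [hW]; exact add_nonneg zero_le_one (inv_nonneg.2 hl0.le)
  have hF : ∀ p q : Fin (k + 1) × Fin 2, ‖(RR (x, y'))⁻¹ p q‖ ≤
      B0 * wt k l p.1 * wt k l q.1 := fun p q => by
    rw [inv_RR hA.1, kroneckerMap_apply, norm_mul]
    have e1 : ‖(1 : Mat 2) p.2 q.2‖ ≤ 1 := by rw [Matrix.one_apply]; split_ifs <;> simp
    refine (mul_le_of_le_one_right (norm_nonneg _) e1).trans ?_
    rw [hl]
    exact (h0 x p.1 q.1).1
  obtain ⟨a, ha⟩ : ∃ a, a = ‖e‖ * W + 1 := ⟨_, rfl⟩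
  obtain ⟨b, hb⟩ : ∃ b, b = ‖e'‖ * W + 1 := ⟨_, rfl⟩
  have ha1 : 1 ≤ a := ha ▸ le_add_of_nonneg_left (mul_nonneg (norm_nonneg _) hW0)
  have hb1 : 1 ≤ b := hb ▸ le_add_of_nonneg_left (mul_nonneg (norm_nonneg _) hW0)
  have ha0 : 0 ≤ B1 * a := mul_nonneg hB1.le (zero_le_one.trans ha1)
  have hb0 : 0 ≤ B2 * b := mul_nonneg hB2.le (zero_le_one.trans hb1)
  have hU : ∀ (p : Fin (k + 1) × Fin 2) J, wt k l p.1 * ‖Rop e (hor y' u) p J‖ ≤ B1 * a :=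
    fun p J => by rw [ha, hW, hl]; exact h1 x e p.1 p.2 J
  have hV : ∀ (p : Fin (k + 1) × Fin 2) J, wt k l p.1 * ‖Rop e' (hor y' v) p J‖ ≤ B2 * b :=
    fun p J => by rw [hb, hW, hl]; exact h2 x e' p.1 p.2 J
  have hom' : ∀ I J, ‖rho (omega y' u v) I J‖ ≤ L := fun I J => by
    obtain ⟨s, hs, hs2⟩ := h3
    refine (hR _ I J).trans ?_
    rw [hL]
    refine mul_le_mul_of_nonneg_left ?_ hD.le
    have e1 : omega y' u v = s • xi1 k + om + (omega y' u v - s • xi1 k - om) := by abel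
    rw [e1]
    refine (norm_add_le _ _).trans (add_le_add ((norm_add_le _ _).trans (add_le_add ?_ le_rfl)) ?_)
    · rw [norm_smul]
      exact mul_le_mul_of_nonneg_right hs n1
    · refine hs2.trans ((mul_le_mul_of_nonneg_left h4.le hB3.le).trans (le_of_eq (mul_one _)))
  have hab : 1 ≤ a * b := one_le_mul_of_one_le_of_one_le ha1 hb1
  have hcore : ∀ I J, ‖curvCore (x, y') (e, u) (e', v) I J‖ ≤ (2 * M + L) * (a * b) := fun I J => by
    have f1 := norm_conj_mul_mul_le hF hB0.le (fun p => hw p.1) hU hV ha0 I J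
    have f2 := norm_conj_mul_mul_le hF hB0.le (fun p => hw p.1) hV hU hb0 I J
    have f3 := mul_le_mul_of_nonneg_left hab hL0
    have f4 := hom' I J
    change ‖((Rop e (hor y' u))ᴴ * (RR (x, y'))⁻¹ * Rop e' (hor y' v)) I J -
      ((Rop e' (hor y' v))ᴴ * (RR (x, y'))⁻¹ * Rop e (hor y' u)) I J -
      rho (omega y' u v) I J‖ ≤ _
    refine (norm_sub_le _ _).trans ((add_le_add ((norm_sub_le _ _).trans (add_le_add f1 f2))
      (show _ ≤ L * (a * b) by linarith)).trans (le_of_eq (by rw [hM]; ring)))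
  have hP : ∀ I J, ‖proj (x, y') I J‖ ≤ 1 := norm_proj_apply_le (det_RR_ne_zero (hA.2 x))
  rw [curv_eq_of_mem_A hA, ← hl, ← hW, ← ha, ← hb]
  refine (norm_mul_apply_le (norm_mul_apply_le hP hcore) hP I J).trans ?_
  rw [← hN]
  calc N * (N * (1 * ((2 * M + L) * (a * b))) * 1) = N ^ 2 * (2 * M + L) * (a * b) := by ring
    _ ≤ (N ^ 2 * (2 * M + L) + 1) * (a * b) :=
      mul_le_mul_of_nonneg_right (by linarith) (zero_le_one.trans hab)
    _ = _ := by ring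

section

variable {m n l : Type*} [Fintype m] [DecidableEq m]

/-- The matrix of the inclusion of coordinates along `φ`. -/
def embMat (φ : n → m) : Matrix m n ℂ := (1 : Matrix m m ℂ).submatrix id φ

lemma mul_embMat (φ : n → m) (M : Matrix l m ℂ) : M * embMat φ = M.submatrix id φ := by
  ext i j
  simp [embMat, Matrix.mul_apply, Matrix.one_apply]

lemma embMat_conjTranspose_mul (φ : n → m) (M : Matrix m l ℂ) :
    (embMat φ)ᴴ * M = M.submatrix φ id := by
  ext i j
  simp [embMat, Matrix.mul_apply, Matrix.one_apply]

lemma embMat_conjTranspose_mul_self [DecidableEq n] {φ : n → m} (hφ : Function.Injective φ) :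
    (embMat φ)ᴴ * embMat φ = 1 := by
  rw [embMat_conjTranspose_mul]
  ext i j
  simp [embMat, Matrix.one_apply, hφ.eq_iff]

end

/-- The inclusion of the indices of the lower right block. -/
def embRow (k : ℕ) : Fin k × Fin 2 → Fin (k + 1) × Fin 2 := Prod.map Fin.succ id

/-- The inclusion of the indices of the lower right block. -/
def embIdx (k : ℕ) : Idx k → Idx (k + 1) := Sum.map (embRow k) id

lemma embRow_injective : Function.Injective (embRow k) :=
  Function.Injective.prodMap (Fin.succ_injective k) Function.injective_id

lemma embIdx_injective : Function.Injective (embIdx k) :=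
  Function.Injective.sumMap embRow_injective Function.injective_id

section

variable {y : Data (k + 1)} (hy : off y = 0)
include hy

lemma Rop_zero_succ_of_off (x : R4) (s u : Fin 2) (j : Fin k) :
    Rop x y (0, s) (inl (j.succ, u)) = 0 := by
  rw [Rop_eq, fromCols_apply_inl, Matrix.sum_apply]
  refine sum_eq_zero fun a _ => ?_
  rw [kroneckerMap_apply, tau, Matrix.sub_apply, T_zero_succ_of_off hy]
  simp [(succ_ne_zero j).symm]

lemma Rop_succ_zero_of_off (x : R4) (s u : Fin 2) (j : Fin k) :
    Rop x y (j.succ, s) (inl (0, u)) = 0 := by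
  rw [Rop_eq, fromCols_apply_inl, Matrix.sum_apply]
  refine sum_eq_zero fun a _ => ?_
  rw [kroneckerMap_apply, tau, Matrix.sub_apply, T_succ_zero_of_off hy]
  simp

lemma Rop_zero_inr_of_off (x : R4) (s u : Fin 2) : Rop x y (0, s) (inr u) = 0 := by
  rw [Rop_eq, fromCols_apply_inr]
  change ∑ a, y.P a 0 * spin a s u = 0
  exact sum_eq_zero fun a _ => by rw [P_zero_of_off hy, zero_mul]

lemma Rop_mul_embMat (x : R4) :
    Rop x y * embMat (embIdx k) = embMat (embRow k) * Rop x (lower y) := by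
  have h0 : ∀ s J, (embMat (embRow k) * Rop x (lower y)) (0, s) J = 0 := fun s J => by
    rw [Matrix.mul_apply]
    refine sum_eq_zero fun p _ => ?_
    have : ((0, s) : Fin (k + 1) × Fin 2) ≠ embRow k p := fun h =>
      succ_ne_zero p.1 (congrArg Prod.fst h).symm
    simp [embMat, Matrix.one_apply, this]
  have h1 : ∀ i s J, (embMat (embRow k) * Rop x (lower y)) (i.succ, s) J =
      Rop x (lower y) (i, s) J := fun i s J => by
    rw [Matrix.mul_apply, sum_eq_single (i, s)]
    · simp [embMat, embRow, Matrix.one_apply]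
    · intro p _ hp
      have : ((i.succ, s) : Fin (k + 1) × Fin 2) ≠ embRow k p := fun h =>
        hp (embRow_injective h.symm)
      simp [embMat, Matrix.one_apply, this]
    · simp
  rw [mul_embMat]
  ext ⟨i, s⟩ J
  refine Fin.cases ?_ (fun i => ?_) i
  · rw [h0]
    rcases J with ⟨j, u⟩ | u
    · exact Rop_zero_succ_of_off hy x s u j
    · exact Rop_zero_inr_of_off hy x s u
  · rw [h1]
    rcases J with ⟨j, u⟩ | u
    · exact Rop_succ_inl_succ x y i j s u
    · exact Rop_succ_inr x y i s u

lemma embMat_mul_Rop (x : R4) :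
    (embMat (embRow k))ᴴ * Rop x y = Rop x (lower y) * (embMat (embIdx k))ᴴ := by
  rw [embMat_conjTranspose_mul]
  ext ⟨i, s⟩ J
  have h0 : ∀ J J', J' = embIdx k J →
      (Rop x (lower y) * (embMat (embIdx k))ᴴ) (i, s) J' = Rop x (lower y) (i, s) J := by
    rintro J _ rfl
    rw [Matrix.mul_apply, sum_eq_single J]
    · simp [embMat, Matrix.one_apply]
    · intro p _ hp
      have : embIdx k J ≠ embIdx k p := fun h => hp (embIdx_injective h.symm)
      simp [embMat, Matrix.one_apply, this]
    · simp
  rcases J with ⟨j, u⟩ | u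
  · refine Fin.cases ?_ (fun j => ?_) j
    · rw [Matrix.mul_apply, sum_eq_zero fun p _ => ?_]
      · exact Rop_succ_zero_of_off hy x s u i
      · have : (inl (0, u) : Idx (k + 1)) ≠ embIdx k p := by
          rcases p with p | p
          · intro h
            exact succ_ne_zero p.1 (congrArg Prod.fst (inl.inj h)).symm
          · exact Sum.inl_ne_inr
        simp [embMat, Matrix.one_apply, this]
    · exact (Rop_succ_inl_succ x y i j s u).trans (h0 (inl (j, u)) _ rfl).symm
  · exact (Rop_succ_inr x y i s u).trans (h0 (inr u) _ rfl).symm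

lemma symb_of_off {x : R4} (a : Fin (k + 1) → ℂ) (h : symb x y a = 0) :
    (∀ c, ((T0 y c - x c : ℝ) : ℂ) * a 0 = 0) ∧ symb x (lower y) (tail a) = 0 := by
  have hP : ∀ c, y.P c 0 = 0 := P_zero_of_off hy
  refine ⟨fun c => ?_, Prod.ext ?_ ?_⟩
  · have h1 : (symb x y a).1 c 0 = 0 := by rw [h]; rfl
    rw [symb_fst, tau_mulVec, Pi.sub_apply, Pi.smul_apply, mulVec, dotProduct, sum_univ_succ,
      T_zero_zero] at h1
    simp only [T_zero_succ_of_off hy, zero_mul, sum_const_zero, add_zero, smul_eq_mul] at h1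
    rw [ofReal_sub, sub_mul]
    exact h1
  · funext c i
    have h1 : (symb x y a).1 c i.succ = 0 := by rw [h]; rfl
    rw [symb_fst, tau_mulVec, Pi.sub_apply, Pi.smul_apply, mulVec, dotProduct, sum_univ_succ,
      T_succ_zero_of_off hy, zero_mul, zero_add] at h1
    rw [symb_fst, tau_mulVec]
    exact h1
  · funext c
    have h1 : (symb x y a).2 c = 0 := by rw [h]; rfl
    rw [symb_snd, dotProduct, sum_univ_succ, Pi.star_apply, hP, star_zero, zero_mul, zero_add] at h1
    rw [symb_snd]
    exact h1

end

lemma Sing1reg_mem_Abar {y : Data₁} (hy : y ∈ Sing1reg k) : y ∈ Abar (k + 1) := by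
  have h := blockData_zero_mem_Abar (T0 y) hy.2.1
  rwa [blockData_of_off_eq_zero (mem_Sing1_iff.1 hy.1)] at h

lemma det_RR_ne_zero_of_Sing1reg {y : Data₁} (hy : y ∈ Sing1reg k) {x : R4}
    (hx : x ≠ T0 y) : (Dm x y).det ≠ 0 ∧ (RR (x, y)).det ≠ 0 := by
  have hD : (Dm x y).det ≠ 0 := fun h0 => by
    obtain ⟨a, ha, ha0⟩ := exists_mulVec_eq_zero_iff.2 h0
    obtain ⟨h1, h2⟩ := symb_of_off (mem_Sing1_iff.1 hy.1) a (Dm_mulVec_eq_zero.1 ha0)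
    have ht := symb_injective hy.2 x h2
    refine ha (funext fun i => Fin.cases ?_ (fun i => congrFun ht i) i)
    by_contra h
    refine hx ?_
    ext c
    have := (mul_eq_zero.1 (h1 c)).resolve_right h
    rw [Complex.ofReal_eq_zero] at this
    linarith
  refine ⟨hD, ?_⟩
  rw [RR_eq_of_mem_Abar (Sing1reg_mem_Abar hy), det_kronecker]
  simp [hD]

section

variable {y : Data (k + 1)} (hy : y ∈ Sing1reg k) {x : R4} (hx : x ≠ T0 y)
include hy hx

lemma inv_RR_mul_embMat : (RR (x, y))⁻¹ * embMat (embRow k) =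
    embMat (embRow k) * (RR (x, lower y))⁻¹ := by
  have hoff := mem_Sing1_iff.1 hy.1
  have h1 : IsUnit (RR (x, y)).det := isUnit_iff_ne_zero.2 (det_RR_ne_zero_of_Sing1reg hy hx).2
  have h2 : IsUnit (RR (x, lower y)).det := isUnit_iff_ne_zero.2 (det_RR_ne_zero (hy.2.2 x))
  have h : RR (x, y) * embMat (embRow k) = embMat (embRow k) * RR (x, lower y) := by
    have e := congrArg conjTranspose (embMat_mul_Rop hoff x)
    rw [conjTranspose_mul, conjTranspose_mul, conjTranspose_conjTranspose,
      conjTranspose_conjTranspose] at e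
    rw [RR, RR, Matrix.mul_assoc, e, ← Matrix.mul_assoc, Rop_mul_embMat hoff, Matrix.mul_assoc]
  calc (RR (x, y))⁻¹ * embMat (embRow k)
      = (RR (x, y))⁻¹ * (embMat (embRow k) * RR (x, lower y) * (RR (x, lower y))⁻¹) := by
        rw [Matrix.mul_nonsing_inv_cancel_right _ _ h2]
    _ = _ := by rw [← h, Matrix.mul_assoc, Matrix.nonsing_inv_mul_cancel_left _ _ h1]

lemma proj_mul_embMat : proj (x, y) * embMat (embIdx k) =
    embMat (embIdx k) * proj (x, lower y) := by
  have hoff := mem_Sing1_iff.1 hy.1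
  have e := congrArg conjTranspose (embMat_mul_Rop hoff x)
  rw [conjTranspose_mul, conjTranspose_mul, conjTranspose_conjTranspose,
    conjTranspose_conjTranspose] at e
  rw [proj_eq, proj_eq, Matrix.sub_mul, Matrix.mul_sub, Matrix.one_mul, Matrix.mul_one]
  congr 1
  rw [Matrix.mul_assoc, Rop_mul_embMat hoff, Matrix.mul_assoc, ← Matrix.mul_assoc (RR (x, y))⁻¹,
    inv_RR_mul_embMat hy hx, ← Matrix.mul_assoc, ← Matrix.mul_assoc, e]
  simp only [Matrix.mul_assoc]

lemma proj_apply_zero (I : Idx (k + 1)) (u : Fin 2) : proj (x, y) I (inl (0, u)) = 0 := by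
  have hoff := mem_Sing1_iff.1 hy.1
  obtain ⟨hD, hR⟩ := det_RR_ne_zero_of_Sing1reg hy hx
  let N : Mat 2 := Matrix.of fun s u => Rop x y (0, s) (inl (0, u))
  have hrow : ∀ s (f : Idx (k + 1) → ℂ), ∑ J, f J * star (Rop x y (0, s) J) =
      ∑ u, f (inl (0, u)) * star (N s u) := fun s f => by
    rw [Fintype.sum_sum_type, Fintype.sum_prod_type, sum_univ_succ]
    simp only [Rop_zero_succ_of_off hoff, Rop_zero_inr_of_off hoff, star_zero, mul_zero,
      sum_const_zero, add_zero]
    rfl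
  have hN : N * Nᴴ = (Dm x y 0 0) • 1 := by
    ext s t
    have h := congr_fun₂ (RR_eq_of_mem_Abar (Sing1reg_mem_Abar hy) x) (0, s) (0, t)
    rw [RR, Matrix.mul_apply] at h
    simp only [conjTranspose_apply] at h
    rw [hrow] at h
    rw [Matrix.mul_apply]
    simp only [conjTranspose_apply]
    rw [kroneckerMap_apply] at h
    exact h
  have hd : Dm x y 0 0 ≠ 0 := fun h0 => by
    have e : Dm x y *ᵥ Pi.single 0 1 = 0 := by
      have hs : ∀ i : Fin k, Dm x y i.succ 0 = 0 := fun i => by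
        rw [Dm, Matrix.sum_apply]
        refine sum_eq_zero fun a _ => ?_
        have h1 : ∀ j : Fin k, tau x y a j.succ 0 = 0 := fun j => by
          rw [tau, Matrix.sub_apply, T_succ_zero_of_off hoff]; simp
        have h2 : ∀ j : Fin k, tau x y a 0 j.succ = 0 := fun j => by
          rw [tau, Matrix.sub_apply, T_zero_succ_of_off hoff]; simp [(succ_ne_zero j).symm]
        rw [Matrix.add_apply, Matrix.mul_apply, sum_univ_succ, vecMulVec_apply, Pi.star_apply,
          P_zero_of_off hoff]
        simp [h1]
      rw [mulVec_single_one]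
      exact funext fun i => Fin.cases h0 hs i
    exact hD (exists_mulVec_eq_zero_iff.1 ⟨Pi.single 0 1, by simp, e⟩)
  have hN2 : Nᴴ * N = (Dm x y 0 0) • 1 := by
    have h1 : N * ((Dm x y 0 0)⁻¹ • Nᴴ) = 1 := by
      rw [Matrix.mul_smul, hN, smul_smul, inv_mul_cancel₀ hd, one_smul]
    have h2 := mul_eq_one_comm.1 h1
    rw [smul_mul] at h2
    rw [← h2, smul_smul, mul_inv_cancel₀ hd, one_smul]
  let p : Fin 2 → ℂ := fun u => proj (x, y) I (inl (0, u))
  have hp : p ᵥ* Nᴴ = 0 := by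
    funext s
    have h := congr_fun₂ (proj_mul_Rop hR) I (0, s)
    rw [Matrix.mul_apply] at h
    simp only [conjTranspose_apply] at h
    rw [hrow] at h
    exact h
  have hp2 : (Dm x y 0 0) • p = 0 := by
    have := congrArg (fun q => q ᵥ* N) hp
    simp only [Matrix.vecMul_vecMul, hN2, Matrix.zero_vecMul, Matrix.vecMul_smul, Matrix.vecMul_one]
      at this
    exact this
  exact congrFun ((smul_eq_zero.1 hp2).resolve_left hd) u

lemma proj_eq_embMat : proj (x, y) =
    embMat (embIdx k) * proj (x, lower y) * (embMat (embIdx k))ᴴ := by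
  rw [← proj_mul_embMat hy hx]
  ext I J
  have h0 : ∀ J, (proj (x, y) * embMat (embIdx k) * (embMat (embIdx k))ᴴ) I (embIdx k J) =
      proj (x, y) I (embIdx k J) := fun J => by
    rw [Matrix.mul_assoc]
    have : embMat (embIdx k) * (embMat (embIdx k))ᴴ * embMat (embIdx k) = embMat (embIdx k) := by
      rw [Matrix.mul_assoc, embMat_conjTranspose_mul_self embIdx_injective, Matrix.mul_one]
    have h := congr_fun₂ (mul_embMat (embIdx k) (proj (x, y) * (embMat (embIdx k) *
      (embMat (embIdx k))ᴴ))) I J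
    rw [Matrix.mul_assoc, this, mul_embMat] at h
    exact h.symm
  have hout : ∀ u, (proj (x, y) * embMat (embIdx k) * (embMat (embIdx k))ᴴ) I (inl (0, u)) =
      0 := fun u => by
    rw [Matrix.mul_apply]
    refine sum_eq_zero fun p _ => ?_
    have : (inl (0, u) : Idx (k + 1)) ≠ embIdx k p := by
      rcases p with p | p
      · intro h
        exact succ_ne_zero p.1 (congrArg Prod.fst (inl.inj h)).symm
      · exact Sum.inl_ne_inr
    simp [embMat, Matrix.one_apply, this]
  rcases J with ⟨j, u⟩ | u
  · refine Fin.cases ?_ (fun j => ?_) j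
    · rw [hout, proj_apply_zero hy hx]
    · exact (h0 (inl (j, u))).symm
  · exact (h0 (inr u)).symm

end

lemma Tendsto.matrix_mul {α l m n : Type*} [Fintype m] {F : Filter α}
    {M : α → Matrix l m ℂ} {N : α → Matrix m n ℂ} {M0 : Matrix l m ℂ} {N0 : Matrix m n ℂ}
    (hM : Tendsto M F (𝓝 M0)) (hN : Tendsto N F (𝓝 N0)) :
    Tendsto (fun x => M x * N x) F (𝓝 (M0 * N0)) := by
  refine tendsto_pi_nhds.2 fun i => tendsto_pi_nhds.2 fun j => ?_
  simp only [Matrix.mul_apply]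
  exact tendsto_finsetSum _ fun p _ => (tendsto_pi_nhds.1 (tendsto_pi_nhds.1 hM i) p).mul
    (tendsto_pi_nhds.1 (tendsto_pi_nhds.1 hN p) j)

lemma Tendsto.conjTranspose {α l m : Type*} {F : Filter α}
    {M : α → Matrix l m ℂ} {M0 : Matrix l m ℂ} (hM : Tendsto M F (𝓝 M0)) :
    Tendsto (fun x => (M x)ᴴ) F (𝓝 M0ᴴ) := by
  refine tendsto_pi_nhds.2 fun i => tendsto_pi_nhds.2 fun j => ?_
  exact (tendsto_pi_nhds.1 (tendsto_pi_nhds.1 hM j) i).star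

lemma MSmoothAt.tendsto {E : Type*} [NormedAddCommGroup E] [NormedSpace ℝ E]
    {l m : Type*} {M : E → Matrix l m ℂ} {z : E} (hM : MSmoothAt M z) :
    Tendsto M (𝓝 z) (𝓝 (M z)) :=
  tendsto_pi_nhds.2 fun I => tendsto_pi_nhds.2 fun J => (hM I J).continuousAt

lemma tendsto_of_norm_sub_le {E F : Type*} [NormedAddCommGroup E] [NormedAddCommGroup F]
    {f : E → F} {a : F} {y : E} {s : Set E} {B : ℝ}
    (h : ∀ᶠ y' in 𝓝[s] y, ‖f y' - a‖ ≤ B * ‖y' - y‖) : Tendsto f (𝓝[s] y) (𝓝 a) := by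
  rw [tendsto_iff_norm_sub_tendsto_zero]
  have h' : Tendsto (fun y' => B * ‖y' - y‖) (𝓝 y) (𝓝 0) := by
    have : Continuous fun y' => B * ‖y' - y‖ := by fun_prop
    simpa using this.tendsto y
  exact squeeze_zero' (Eventually.of_forall fun _ => norm_nonneg _) h
    (h'.mono_left nhdsWithin_le_nhds)

lemma tendsto_compress {α m n : Type*} [Fintype m] [Fintype n] {l : Filter α}
    {P W : α → Matrix n n ℂ} {F : α → Matrix m m ℂ} {U V : α → Matrix m n ℂ} {s : α → ℝ}
    {P0 W0 X : Matrix n n ℂ} {F0 : Matrix m m ℂ} {U0 V0 : Matrix m n ℂ} {B : ℝ}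
    (hP : Tendsto P l (𝓝 P0)) (hW : Tendsto W l (𝓝 W0)) (hF : Tendsto F l (𝓝 F0))
    (hU : Tendsto U l (𝓝 U0)) (hV : Tendsto V l (𝓝 V0)) (hs : ∀ᶠ a in l, |s a| ≤ B)
    (hX : P0 * X * P0 = 0) :
    Tendsto (fun a => P a * ((U a)ᴴ * F a * V a - (V a)ᴴ * F a * U a - (W a + s a • X)) * P a) l
      (𝓝 (P0 * (U0ᴴ * F0 * V0 - V0ᴴ * F0 * U0 - W0) * P0)) := by
  have tX : Tendsto (fun a => s a • (P a * X * P a)) l (𝓝 0) := by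
    have t0 := Tendsto.matrix_mul (Tendsto.matrix_mul hP (tendsto_const_nhds (x := X))) hP
    rw [hX] at t0
    refine tendsto_pi_nhds.2 fun I => tendsto_pi_nhds.2 fun J => ?_
    have t1 := ((tendsto_pi_nhds.1 (tendsto_pi_nhds.1 t0 I) J).norm).const_mul B
    rw [Matrix.zero_apply, norm_zero, mul_zero] at t1
    refine squeeze_zero_norm' (hs.mono fun a h => ?_) t1
    change ‖s a • (P a * X * P a) I J‖ ≤ _
    rw [norm_smul]
    exact mul_le_mul_of_nonneg_right h (norm_nonneg _)
  have tK := ((Tendsto.matrix_mul (Tendsto.matrix_mul (Tendsto.conjTranspose hU) hF) hV).sub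
    (Tendsto.matrix_mul (Tendsto.matrix_mul (Tendsto.conjTranspose hV) hF) hU)).sub hW
  have t := (Tendsto.matrix_mul (Tendsto.matrix_mul hP tK) hP).sub tX
  rw [sub_zero] at t
  refine t.congr fun a => ?_
  rw [← smul_mul, ← Matrix.mul_smul, ← Matrix.sub_mul, ← Matrix.mul_sub, sub_sub _ (W a)]

lemma rho_xi1_mul_embMat : rho (xi1 k) * embMat (embIdx k) = 0 := by
  rw [mul_embMat]
  ext (⟨i, s⟩ | s) (⟨j, t⟩ | t)
  · change (xi1 k).mat i j.succ * _ = 0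
    rw [xi1_mat]
    simp
  · rfl
  · rfl
  · change (∑ c : Fin 3, (((0 : Fin 3 → ℝ) c : ℝ) : ℂ) • spin c.succ) s t = 0
    simp

lemma embMat_rho_inclG (ξ : gLie k) :
    (embMat (embIdx k))ᴴ * rho (inclG ξ) * embMat (embIdx k) = rho ξ := by
  rw [mul_embMat, embMat_conjTranspose_mul]
  ext (⟨i, s⟩ | s) (⟨j, t⟩ | t) <;> rfl

lemma embMat_conj_mul {y : Data₁} (hy : y ∈ Sing1reg k) {x : R4} (hx : x ≠ T0 y)
    (e e' : R4) (u v : Data k) :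
    (embMat (embIdx k))ᴴ * ((Rop e (incl u))ᴴ * (RR (x, y))⁻¹ * Rop e' (incl v)) *
      embMat (embIdx k) = (Rop e u)ᴴ * (RR (x, lower y))⁻¹ * Rop e' v := by
  have h : ∀ (e : R4) (u : Data k), Rop e (incl u) * embMat (embIdx k) =
      embMat (embRow k) * Rop e u := fun e u => Rop_mul_embMat (off_blockData 0 0 u) e
  have h1 := congrArg conjTranspose (h e u)
  rw [conjTranspose_mul, conjTranspose_mul] at h1
  calc _ = ((embMat (embIdx k))ᴴ * (Rop e (incl u))ᴴ) * (RR (x, y))⁻¹ *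
        (Rop e' (incl v) * embMat (embIdx k)) := by simp only [Matrix.mul_assoc]
    _ = (Rop e u)ᴴ * (embMat (embRow k))ᴴ * ((RR (x, y))⁻¹ * embMat (embRow k)) *
        Rop e' v := by rw [h1, h]; simp only [Matrix.mul_assoc]
    _ = (Rop e u)ᴴ * ((embMat (embRow k))ᴴ * embMat (embRow k)) * (RR (x, lower y))⁻¹ *
        Rop e' v := by rw [inv_RR_mul_embMat hy hx]; simp only [Matrix.mul_assoc]
    _ = _ := by rw [embMat_conjTranspose_mul_self embRow_injective, Matrix.mul_one]

lemma tendsto_Rop {α : Type*} {l : Filter α} (e : R4) {f : α → Data k} {h : Data k}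
    (hf : Tendsto f l (𝓝 h)) : Tendsto (fun a => Rop e (f a)) l (𝓝 (Rop e h)) := by
  refine tendsto_pi_nhds.2 fun I => tendsto_pi_nhds.2 fun J => ?_
  have h1 : Continuous fun y : Data k => entryL (RopL k) I J (e, y) :=
    (entryL (RopL k) I J).continuous.comp (by fun_prop)
  exact (h1.tendsto h).comp hf

lemma tendsto_curv {y : Data₁} (hy : y ∈ Sing1reg k) (C : ℝ) {x : R4} (hx : x ≠ T0 y)
    {u v : Data₁} (hu : u ∈ Sing1 k) (hu0 : T0 u = 0) (hv : v ∈ Sing1 k)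
    (hv0 : T0 v = 0) (e e' : R4) :
    Tendsto (fun y' => curv (x, y') (e, u) (e', v)) (𝓝[approach C y] y)
      (𝓝 (embMat (embIdx k) * curv (x, lower y) (e, lower u) (e', lower v) *
        (embMat (embIdx k))ᴴ)) := by
  obtain ⟨B1, -, h1⟩ := eventually_norm_hor_sub_le hy C hu hu0
  obtain ⟨B2, -, h2⟩ := eventually_norm_hor_sub_le hy C hv hv0
  obtain ⟨B3, -, h3⟩ := eventually_norm_omega_sub_le hy C hu hu0 hv hv0
  have hR := (det_RR_ne_zero_of_Sing1reg hy hx).2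
  obtain ⟨s, hs⟩ : ∃ s : Data₁ → ℝ, ∀ᶠ y' in 𝓝[approach C y] y, |s y'| ≤ B3 ∧
      ‖omega y' u v - s y' • xi1 k - inclG (omega (lower y) (lower u) (lower v))‖ ≤ B3 * ‖y' - y‖ :=
    ⟨fun y' => Classical.epsilon fun s => |s| ≤ B3 ∧
      ‖omega y' u v - s • xi1 k - inclG (omega (lower y) (lower u) (lower v))‖ ≤
        B3 * ‖y' - y‖, h3.mono fun y' h => Classical.epsilon_spec h⟩
  have hx' : Tendsto (fun y' => (x, y')) (𝓝[approach C y] y) (𝓝 (x, y)) :=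
    ((by fun_prop : Continuous fun y' : Data₁ => (x, y')).tendsto y).mono_left
      nhdsWithin_le_nhds
  have tP : Tendsto (fun y' => proj (x, y')) (𝓝[approach C y] y) (𝓝 (proj (x, y))) :=
    Tendsto.comp (g := proj) (msmoothAt_proj hR).tendsto hx'
  have tF : Tendsto (fun y' => (RR (x, y'))⁻¹) (𝓝[approach C y] y) (𝓝 (RR (x, y))⁻¹) :=
    Tendsto.comp (g := fun z => (RR z)⁻¹) ((msmoothAt_RR (x, y)).inv hR).tendsto hx'
  have tom : Tendsto (fun y' => rho (omega y' u v - s y' • xi1 k)) (𝓝[approach C y] y)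
      (𝓝 (rho (inclG (omega (lower y) (lower u) (lower v))))) :=
    Tendsto.comp (g := rho) (msmoothAt_linear_id (rhoL (k + 1)) _).tendsto
      (tendsto_of_norm_sub_le (hs.mono fun _ h => h.2))
  have e0 : proj (x, y) * rho (xi1 k) * proj (x, y) = 0 := by
    rw [Matrix.mul_assoc, proj_eq_embMat hy hx, ← Matrix.mul_assoc (rho (xi1 k)), ← Matrix.mul_assoc
      (rho (xi1 k)), rho_xi1_mul_embMat, Matrix.zero_mul, Matrix.zero_mul, Matrix.mul_zero]
  have t := tendsto_compress tP tom tF (tendsto_Rop e (tendsto_of_norm_sub_le h1)) (tendsto_Rop e' (tendsto_of_norm_sub_le h2)) (hs.mono fun _ h => h.1) e0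
  have hlim : ∀ᶠ y' in 𝓝[approach C y] y, y' ∈ A (k + 1) :=
    eventually_mem_nhdsWithin.mono fun _ h => h.1
  have e1 : embMat (embIdx k) * curv (x, lower y) (e, lower u) (e', lower v) *
      (embMat (embIdx k))ᴴ = proj (x, y) * ((Rop e (incl (hor (lower y) (lower u))))ᴴ *
        (RR (x, y))⁻¹ * Rop e' (incl (hor (lower y) (lower v))) -
        (Rop e' (incl (hor (lower y) (lower v))))ᴴ * (RR (x, y))⁻¹ *
          Rop e (incl (hor (lower y) (lower u))) -
        rho (inclG (omega (lower y) (lower u) (lower v)))) * proj (x, y) := by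
    have e2 := embMat_conj_mul hy hx e e' (hor (lower y) (lower u)) (hor (lower y) (lower v))
    have e3 := embMat_conj_mul hy hx e' e (hor (lower y) (lower v)) (hor (lower y) (lower u))
    have e4 := embMat_rho_inclG (omega (lower y) (lower u) (lower v))
    rw [curv_eq_of_mem_A hy.2, proj_eq_embMat hy hx, curvCore]
    dsimp only
    rw [← e2, ← e3, ← e4]
    generalize (Rop e (incl (hor (lower y) (lower u))))ᴴ * (RR (x, y))⁻¹ *
      Rop e' (incl (hor (lower y) (lower v))) = M1
    generalize (Rop e' (incl (hor (lower y) (lower v))))ᴴ * (RR (x, y))⁻¹ *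
      Rop e (incl (hor (lower y) (lower u))) = M2
    generalize rho (inclG (omega (lower y) (lower u) (lower v))) = M3
    simp only [Matrix.mul_sub, Matrix.sub_mul, Matrix.mul_assoc]
  rw [e1]
  have e2 : ∀ y' ∈ A (k + 1), proj (x, y') * ((Rop e (hor y' u))ᴴ * (RR (x, y'))⁻¹ *
      Rop e' (hor y' v) - (Rop e' (hor y' v))ᴴ * (RR (x, y'))⁻¹ * Rop e (hor y' u) -
      (rho (omega y' u v - s y' • xi1 k) + s y' • rho (xi1 k))) * proj (x, y') =
      curv (x, y') (e, u) (e', v) := fun y' hA => by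
    have h := curv_eq_of_mem_A hA x (e, u) (e', v)
    rw [curvCore] at h
    dsimp only at h
    rw [← rhoL_apply (omega y' u v - s y' • xi1 k), map_sub, map_smul, rhoL_apply, rhoL_apply,
      sub_add_cancel, h]
  exact Tendsto.congr' (hlim.mono e2) t

lemma trace_conj_mul_conj {m n : Type*} [Fintype m] [Fintype n] [DecidableEq n]
    {E : Matrix m n ℂ} (hE : Eᴴ * E = 1) (A B : Matrix n n ℂ) :
    (E * A * Eᴴ * (E * B * Eᴴ)).trace = (A * B).trace := by
  have : E * A * Eᴴ * (E * B * Eᴴ) = E * (A * (Eᴴ * E) * B * Eᴴ) := by simp only [Matrix.mul_assoc]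
  rw [this, hE, Matrix.mul_one, trace_mul_comm, Matrix.mul_assoc, hE, Matrix.mul_one]

lemma tendsto_chern {y : Data₁} (hy : y ∈ Sing1reg k) (C : ℝ) {x : R4} (hx : x ≠ T0 y)
    (e : Fin 4 → R4) {v : Fin 4 → Data₁} (hv : ∀ i, v i ∈ Sing1 k)
    (hv0 : ∀ i, T0 (v i) = 0) :
    Tendsto (fun y' => chern (x, y') fun i => (e i, v i)) (𝓝[approach C y] y)
      (𝓝 (chern (x, lower y) fun i => (e i, lower (v i)))) := by
  have h := fun i j => tendsto_curv hy C hx (hv i) (hv0 i) (hv j) (hv0 j) (e i) (e j)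
  have tm : ∀ i j p q, Tendsto (fun y' => (curv (x, y') (e i, v i) (e j, v j) *
      curv (x, y') (e p, v p) (e q, v q)).trace) (𝓝[approach C y] y)
      (𝓝 (curv (x, lower y) (e i, lower (v i)) (e j, lower (v j)) *
        curv (x, lower y) (e p, lower (v p)) (e q, lower (v q))).trace) := fun i j p q => by
    rw [← trace_conj_mul_conj (embMat_conjTranspose_mul_self embIdx_injective)]
    have t0 := Tendsto.matrix_mul (h i j) (h p q)
    exact tendsto_finsetSum _ fun I _ => tendsto_pi_nhds.1 (tendsto_pi_nhds.1 t0 I) I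
  simp only [chern, trace_add, trace_sub]
  exact ((continuous_re.tendsto _).comp
    (((tm 0 1 2 3).sub (tm 0 2 1 3)).add (tm 0 3 1 2))).const_mul _

section

lemma spin_anticomm (a b : Fin 4) :
    spin a * (spin b)ᴴ + spin b * (spin a)ᴴ = if a = b then 2 else 0 := by
  fin_cases a <;> fin_cases b <;> ext s t <;> fin_cases s <;> fin_cases t <;>
    simp [spin, Matrix.mul_apply, vecMul, dotProduct, Matrix.ofNat_apply] <;> norm_num

lemma spin_anticomm' (a b : Fin 4) :
    (spin a)ᴴ * spin b + (spin b)ᴴ * spin a = if a = b then 2 else 0 := by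
  fin_cases a <;> fin_cases b <;> ext s t <;> fin_cases s <;> fin_cases t <;>
    simp [spin, Matrix.mul_apply, vecMul, dotProduct, Matrix.ofNat_apply] <;> norm_num

lemma trace_spin_mul_star (a b : Fin 4) : (spin a * (spin b)ᴴ).trace = if a = b then 2 else 0 := by
  fin_cases a <;> fin_cases b <;> simp [spin, trace_fin_two, Matrix.mul_apply, vecMul, dotProduct] <;> norm_num

lemma sum_spin_mul_mul (M N : Mat 2) : ∑ c : Fin 3, (spin c.succ * M * (spin c.succ * N)).trace =
      (M * N).trace - 2 * M.trace * N.trace := by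
  have hI : I ^ 2 = -1 := I_sq
  simp [spin, sum_univ_three, trace_fin_two, Matrix.mul_apply]
  linear_combination (M 0 0 * N 0 0 + M 1 1 * N 1 1 - M 0 1 * N 1 0 - M 1 0 * N 0 1  +
    M 1 1 * N 0 0 + M 0 0 * N 1 1 + M 0 1 * N 0 1 + M 1 0 * N 1 0) * hI

lemma trace_spin_four (a b d e : Fin 4) : (spin a * (spin b)ᴴ * (spin d * (spin e)ᴴ)).trace +
      (spin b * (spin d)ᴴ * (spin e * (spin a)ᴴ)).trace =
      4 * ((if a = b then 1 else 0) * (if d = e then 1 else 0) -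
        (if a = d then 1 else 0) * (if b = e then 1 else 0) +
        (if a = e then 1 else 0) * (if b = d then 1 else 0)) := by
  have h (p q : Fin 4) (M : Mat 2) : ((if p = q then (2 : Mat 2) else 0) * M).trace =
        (if p = q then 2 else 0) * M.trace := by
    split_ifs
    · rw [two_mul, trace_add, two_mul]
    · simp
  have h1 := congrArg (fun M => (M * (spin d * (spin e)ᴴ)).trace) (spin_anticomm a b)
  have h2 := congrArg (fun M => (M * ((spin e)ᴴ * spin b)).trace) (spin_anticomm' a d)
  have h3 := congrArg (fun M => (M * (spin b * (spin d)ᴴ)).trace) (spin_anticomm a e)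
  simp only [h, add_mul, trace_add, trace_spin_mul_star] at h1 h2 h3
  have e1 : ((spin e)ᴴ * spin b).trace = if b = e then 2 else 0 := by
    rw [trace_mul_comm, trace_spin_mul_star]
  have e2 : ((spin a)ᴴ * spin d * ((spin e)ᴴ * spin b)).trace =
      (spin b * (spin a)ᴴ * (spin d * (spin e)ᴴ)).trace := by
    rw [← mul_assoc, trace_mul_comm]; simp only [mul_assoc]
  have e3 : ((spin d)ᴴ * spin a * ((spin e)ᴴ * spin b)).trace =
      (spin a * (spin e)ᴴ * (spin b * (spin d)ᴴ)).trace := by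
    rw [mul_assoc, trace_mul_comm]; simp only [mul_assoc]
  have e4 : (spin e * (spin a)ᴴ * (spin b * (spin d)ᴴ)).trace =
      (spin b * (spin d)ᴴ * (spin e * (spin a)ᴴ)).trace := trace_mul_comm _ _
  rw [e1, e2, e3] at h2
  rw [e4] at h3
  have c (p q : Fin 4) : (if p = q then (2 : ℂ) else 0) = 2 * if p = q then 1 else 0 := by
    split_ifs <;> simp
  rw [c, c] at h1 h2 h3
  linear_combination h1 - h2 + h3

lemma sum_rotate (F : Fin 4 → Fin 4 → Fin 4 → Fin 4 → ℂ) :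
    ∑ a, ∑ b, ∑ d, ∑ e, F b d e a = ∑ a, ∑ b, ∑ d, ∑ e, F a b d e := by
  rw [sum_comm]
  refine sum_ext fun b _ => ?_
  rw [sum_comm]
  refine sum_ext fun d _ => ?_
  rw [sum_comm]

variable {n : Type*} [Fintype n] [DecidableEq n]

lemma sum_trace_spin_four (M : Fin 4 → Fin 4 → Fin 4 → Fin 4 → ℂ)
    (hM : ∀ a b d e, M a b d e = M b d e a) :
    ∑ a, ∑ b, ∑ d, ∑ e, M a b d e * (spin a * (spin b)ᴴ * (spin d * (spin e)ᴴ)).trace =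
      4 * (∑ a, ∑ b, M a a b b) - 2 * ∑ a, ∑ b, M a b a b := by
  have h1 : ∑ a, ∑ b, ∑ d, ∑ e, M a b d e * (spin b * (spin d)ᴴ * (spin e * (spin a)ᴴ)).trace =
      ∑ a, ∑ b, ∑ d, ∑ e, M a b d e * (spin a * (spin b)ᴴ * (spin d * (spin e)ᴴ)).trace := by
    rw [← sum_rotate fun a b d e => M a b d e * (spin a * (spin b)ᴴ * (spin d * (spin e)ᴴ)).trace]
    simp only [← hM]
  have h2 : ∑ a, ∑ b, ∑ d, ∑ e, M a b d e * ((spin a * (spin b)ᴴ * (spin d * (spin e)ᴴ)).trace +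
      (spin b * (spin d)ᴴ * (spin e * (spin a)ᴴ)).trace) =
      4 * ((∑ a, ∑ b, M a a b b) - (∑ a, ∑ b, M a b a b) + ∑ a, ∑ b, M a b b a) := by
    simp only [trace_spin_four, mul_add, mul_sub, sum_add_distrib, sum_sub_distrib, mul_sum]
    simp [mul_comm, mul_assoc]
  have h3 : ∑ a, ∑ b, M a b b a = ∑ a, ∑ b, M a a b b := by
    rw [sum_comm]
    refine sum_ext fun b _ => sum_ext fun a _ => hM a b b a
  simp only [mul_add, sum_add_distrib] at h2
  rw [h1, h3] at h2
  linear_combination h2 / 2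

lemma sum_trace_density (f : Matrix n n ℂ) (t h : Fin 4 → Matrix n n ℂ) (hh : ∀ a, h a = f * t a) :
    ∑ c : Fin 3, ((f ⊗ₖ spin c.succ) * (1 - ∑ a, ∑ b, (t a * f * t b) ⊗ₖ (spin a * (spin b)ᴴ)) *
      ((f ⊗ₖ spin c.succ) * (1 - ∑ a, ∑ b, (t a * f * t b) ⊗ₖ (spin a * (spin b)ᴴ)))).trace =
      -6 * (f * f).trace + 12 * (∑ a, (h a * h a * f).trace) -
        4 * (∑ a, ∑ b, (h a * h a * h b * h b).trace) -
        2 * ∑ a, ∑ b, (h a * h b * h a * h b).trace := by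
  have hBK (c : Fin 3) : (f ⊗ₖ spin c.succ) * (∑ a, ∑ b, (t a * f * t b) ⊗ₖ (spin a * (spin b)ᴴ)) =
      ∑ a, ∑ b, (h a * h b) ⊗ₖ (spin c.succ * (spin a * (spin b)ᴴ)) := by
    simp only [mul_sum, ← mul_kronecker_mul, hh, mul_assoc]
  generalize hK : (∑ a, ∑ b, (t a * f * t b) ⊗ₖ (spin a * (spin b)ᴴ)) = K at *
  have hexp (c : Fin 3) : ((f ⊗ₖ spin c.succ) * (1 - K) * ((f ⊗ₖ spin c.succ) * (1 - K))).trace =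
      (f * f).trace * (spin c.succ * spin c.succ).trace - 2 * (∑ a, ∑ b, (h a * h b * f).trace *
          (spin c.succ * (spin a * (spin b)ᴴ) * (spin c.succ * 1)).trace) +
        ∑ a, ∑ b, ∑ d, ∑ e, (h a * h b * (h d * h e)).trace *
          (spin c.succ * (spin a * (spin b)ᴴ) * (spin c.succ * (spin d * (spin e)ᴴ))).trace := by
    rw [mul_sub, mul_one, hBK, sub_mul, mul_sub, mul_sub, trace_sub, trace_sub, trace_sub,
      trace_mul_comm (f ⊗ₖ spin c.succ) (∑ a, ∑ b, _)]
    simp only [sum_mul, mul_sum, trace_sum, ← mul_kronecker_mul, Matrix.trace_kronecker, mul_one]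
    have : ∑ d, ∑ e, ∑ a, ∑ b, (h a * h b * (h d * h e)).trace *
          (spin c.succ * (spin a * (spin b)ᴴ) * (spin c.succ * (spin d * (spin e)ᴴ))).trace =
        ∑ a, ∑ b, ∑ d, ∑ e, (h a * h b * (h d * h e)).trace *
          (spin c.succ * (spin a * (spin b)ᴴ) * (spin c.succ * (spin d * (spin e)ᴴ))).trace := by
      rw [← sum_rotate, ← sum_rotate]
    rw [this]
    simp only [two_mul, sum_add_distrib, ← mul_sum]
    ring
  simp only [hexp, sum_add_distrib, sum_sub_distrib, ← mul_sum]
  have s1 : ∑ c : Fin 3, (spin c.succ * spin c.succ).trace = -6 := by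
    have := sum_spin_mul_mul 1 1
    simp only [mul_one, Matrix.trace_one, Fintype.card_fin] at this
    rw [this]; norm_num
  have s2 : ∑ c : Fin 3, ∑ a, ∑ b, (h a * h b * f).trace *
      (spin c.succ * (spin a * (spin b)ᴴ) * (spin c.succ * 1)).trace =
      -6 * ∑ a, (h a * h a * f).trace := by
    rw [sum_comm, mul_sum]
    refine sum_ext fun a _ => ?_
    rw [sum_comm]
    simp only [← mul_sum, sum_spin_mul_mul]
    simp only [mul_one, trace_spin_mul_star, Matrix.trace_one, Fintype.card_fin]
    rw [sum_eq_single a]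
    · simp; ring
    · intro b _ hb; simp [Ne.symm hb]
    · simp
  have s3 : ∑ c : Fin 3, ∑ a, ∑ b, ∑ d, ∑ e, (h a * h b * (h d * h e)).trace *
      (spin c.succ * (spin a * (spin b)ᴴ) * (spin c.succ * (spin d * (spin e)ᴴ))).trace =
      -4 * (∑ a, ∑ b, (h a * h a * (h b * h b)).trace) -
        2 * ∑ a, ∑ b, (h a * h b * (h a * h b)).trace := by
    have e : ∑ c : Fin 3, ∑ a, ∑ b, ∑ d, ∑ e, (h a * h b * (h d * h e)).trace *
        (spin c.succ * (spin a * (spin b)ᴴ) * (spin c.succ * (spin d * (spin e)ᴴ))).trace =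
        ∑ a, ∑ b, ∑ d, ∑ e, (h a * h b * (h d * h e)).trace *
          ((spin a * (spin b)ᴴ * (spin d * (spin e)ᴴ)).trace -
            2 * (if a = b then 2 else 0) * (if d = e then 2 else 0)) := by
      simp only [← trace_spin_mul_star, ← sum_spin_mul_mul, mul_sum]
      rw [sum_comm]
      refine sum_ext fun a _ => ?_
      rw [sum_comm]
      refine sum_ext fun b _ => ?_
      rw [sum_comm]
      refine sum_ext fun d _ => ?_
      rw [sum_comm]
    rw [e]
    simp only [mul_sub, sum_sub_distrib]
    rw [sum_trace_spin_four (fun a b d e => (h a * h b * (h d * h e)).trace) fun a b d e => by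
      change (h a * h b * (h d * h e)).trace = (h b * h d * (h e * h a)).trace
      rw [mul_assoc, trace_mul_comm]
      simp only [mul_assoc]]
    have : ∑ a, ∑ b, ∑ d, ∑ e, (h a * h b * (h d * h e)).trace *
        (2 * (if a = b then 2 else 0) * (if d = e then 2 else 0)) =
        8 * ∑ a, ∑ b, (h a * h a * (h b * h b)).trace := by
      simp [mul_sum, mul_comm]
      refine sum_ext fun a _ => sum_ext fun b _ => ?_
      ring
    rw [this]
    ring
  rw [s1, s2, s3]
  simp only [mul_assoc]
  ring

end

lemma finrank_R4 : Module.finrank ℝ R4 = 4 := by simp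

lemma integrableOn_inv_norm_cube (R : ℝ) :
    IntegrableOn (fun x : R4 => (‖x‖ ^ 3)⁻¹) (Metric.ball 0 R) := by
  have h := (integrableOn_fun_norm_addHaar (E := R4) volume (f := fun r : ℝ => (r ^ 3)⁻¹) (r := R)).2
  refine h ?_
  have e : Set.EqOn (fun y : ℝ => y ^ (Module.finrank ℝ R4 - 1) • (y ^ 3)⁻¹) (fun _ => 1)
      (Set.Ioo 0 R) := fun y hy => by
    have : y ≠ 0 := hy.1.ne'
    simp only [finrank_R4, smul_eq_mul]
    exact mul_inv_cancel₀ (pow_ne_zero 3 this)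
  rw [integrableOn_congr_fun e measurableSet_Ioo]
  exact integrableOn_const (by simp)

lemma integrableOn_inv_norm_sub_cube (t : R4) {K : Set R4} (hK : Bornology.IsBounded K) :
    IntegrableOn (fun x : R4 => (‖x - t‖ ^ 3)⁻¹) K := by
  obtain ⟨R, hR⟩ := hK.subset_ball t
  refine IntegrableOn.mono_set ?_ hR
  have h := (integrableOn_inv_norm_cube R)
  rw [← integrable_indicator_iff Metric.isOpen_ball.measurableSet] at h ⊢
  refine (h.comp_sub_right t).congr (Eventually.of_forall fun x => ?_)
  simp only [Set.indicator, Metric.mem_ball, dist_eq_norm, sub_zero]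

lemma integrable_radial {φ : R4 → ℝ} (hφ : ContDiff ℝ 1 φ) (hc : HasCompactSupport φ) :
    Integrable fun x : R4 => fderiv ℝ φ x x / ‖x‖ ^ 4 := by
  have hcont : Continuous (fderiv ℝ φ) := hφ.continuous_fderiv one_ne_zero
  obtain ⟨M, hM⟩ := (hc.fderiv ℝ).exists_bound_of_continuous hcont
  obtain ⟨R, hR⟩ := (hc.fderiv ℝ).isCompact.isBounded.subset_ball 0
  have hm : Measurable fun x : R4 => fderiv ℝ φ x x / ‖x‖ ^ 4 :=
    (hcont.clm_apply continuous_id).measurable.div (by fun_prop)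
  rw [← integrableOn_iff_integrable_of_support_subset (s := Metric.ball (0 : R4) R)]
  · refine ((integrableOn_inv_norm_cube R).const_mul M).mono' hm.aestronglyMeasurable
      (Eventually.of_forall fun x => ?_)
    rcases eq_or_ne x 0 with rfl | hx
    · simp
    · have hx' : 0 < ‖x‖ := norm_pos_iff.2 hx
      rw [norm_div, norm_pow, norm_norm, div_le_iff₀ (by positivity)]
      calc ‖fderiv ℝ φ x x‖ ≤ M * ‖x‖ :=
            ((fderiv ℝ φ x).le_opNorm x).trans (mul_le_mul_of_nonneg_right (hM x) hx'.le)
        _ = M * (‖x‖ ^ 3)⁻¹ * ‖x‖ ^ 4 := by field_simp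
  · intro x hx
    by_contra h
    refine hx ?_
    have h0 : fderiv ℝ φ x = 0 := image_eq_zero_of_notMem_tsupport fun h' => h (hR h')
    simp [h0]

lemma integral_radial {φ : R4 → ℝ} (hφ : ContDiff ℝ 1 φ) (hc : HasCompactSupport φ) :
    ∫ x : R4, fderiv ℝ φ x x / ‖x‖ ^ 4 = -(2 * Real.pi ^ 2) * φ 0 := by
  set g : R4 → ℝ := fun x => fderiv ℝ φ x x / ‖x‖ ^ 4 with hg
  have hgi : Integrable g := integrable_radial hφ hc
  have hmp := (volume : Measure R4).measurePreserving_homeomorphUnitSphereProd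
  have hemb := (homeomorphUnitSphereProd R4).measurableEmbedding
  let G : Metric.sphere (0 : R4) 1 × Set.Ioi (0 : ℝ) → ℝ := fun p => g (p.2.1 • p.1.1)
  have hG : ∀ x : ({0}ᶜ : Set R4), G (homeomorphUnitSphereProd R4 x) = g x := fun x => by
    have := congrArg Subtype.val ((homeomorphUnitSphereProd R4).symm_apply_apply x)
    simp only [homeomorphUnitSphereProd_symm_apply_coe] at this
    exact congrArg g this
  have hms : MeasurableSet ({0}ᶜ : Set R4) := (measurableSet_singleton _).compl
  have hGi : Integrable G ((volume : Measure R4).toSphere.prod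
      (Measure.volumeIoiPow (Module.finrank ℝ R4 - 1))) := by
    rw [← hmp.integrable_comp_emb hemb]
    have : G ∘ homeomorphUnitSphereProd R4 = g ∘ Subtype.val := funext hG
    rw [this, ← integrableOn_iff_comap_subtypeVal hms]
    exact hgi.integrableOn
  have h1 : ∫ x, g x = ∫ p, G p ∂((volume : Measure R4).toSphere.prod
      (Measure.volumeIoiPow (Module.finrank ℝ R4 - 1))) := by
    rw [← hmp.integral_comp hemb]
    simp only [hG]
    rw [integral_subtype_comap hms g, restrict_compl_singleton]
  have h2 : ∀ θ : Metric.sphere (0 : R4) 1,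
      ∫ r, G (θ, r) ∂(Measure.volumeIoiPow (Module.finrank ℝ R4 - 1)) = -φ 0 := fun θ => by
    have hθ : ‖(θ : R4)‖ = 1 := by simpa using θ.2
    rw [finrank_R4, Measure.volumeIoiPow, integral_withDensity_eq_integral_toReal_smul
      (by fun_prop) (by simp)]
    have e1 : ∀ r : Set.Ioi (0 : ℝ), (ENNReal.ofReal (r.1 ^ 3)).toReal • G (θ, r) =
        deriv (fun r : ℝ => φ (r • (θ : R4))) r.1 := fun r => by
      have hr : (0 : ℝ) < r.1 := r.2
      have hd : HasDerivAt (fun r : ℝ => φ (r • (θ : R4))) (fderiv ℝ φ (r.1 • (θ : R4)) θ) r.1 := by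
        have h1 := (hφ.differentiable one_ne_zero (r.1 • (θ : R4))).hasFDerivAt
        have h2 : HasDerivAt (fun r : ℝ => r • (θ : R4)) ((1 : ℝ) • (θ : R4)) r.1 :=
          (hasDerivAt_id r.1).smul_const (θ : R4)
        rw [one_smul] at h2
        exact h1.comp_hasDerivAt r.1 h2
      rw [hd.deriv, ENNReal.toReal_ofReal (by positivity)]
      change r.1 ^ 3 * (fderiv ℝ φ (r.1 • (θ : R4)) (r.1 • (θ : R4)) / ‖r.1 • (θ : R4)‖ ^ 4) = _
      rw [map_smul, norm_smul, hθ, Real.norm_eq_abs, abs_of_pos hr, smul_eq_mul]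
      field_simp
    simp only [show 4 - 1 = 3 from rfl, e1]
    rw [integral_subtype_comap measurableSet_Ioi fun r : ℝ => deriv (fun r : ℝ => φ (r • (θ : R4))) r]
    have hc' : HasCompactSupport fun r : ℝ => φ (r • (θ : R4)) := by
      refine hc.comp_isClosedEmbedding (g := fun r : ℝ => r • (θ : R4)) ?_
      exact isClosedEmbedding_smul_left (by intro h; rw [h, norm_zero] at hθ; norm_num at hθ)
    rw [hc'.integral_Ioi_deriv_eq (by fun_prop), zero_smul]
  rw [h1, integral_prod _ hGi]
  rw [integral_congr_ae (Eventually.of_forall h2)]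
  simp only [integral_const, Measure.toSphere_real_apply_univ, finrank_R4, smul_eq_mul]
  have hv : (volume : Measure R4).real (Metric.ball 0 1) = Real.pi ^ 2 / 2 := by
    rw [measureReal_def, InnerProductSpace.volume_ball_of_dim_even (k := 2) (by simp)]
    simp
    positivity
  rw [hv]
  push_cast
  ring

/-- The density of the Chern form along `ℝ⁴`. -/
def density (x : R4) (y : Data k) : ℝ := chern (x, y) fun a => (single a 1, 0)

lemma neg_kronecker {m n : Type*} (M : Matrix m m ℂ) (N : Matrix n n ℂ) :
    (-M) ⊗ₖ N = -(M ⊗ₖ N) := by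
  ext i j
  simp [kronecker_apply]

lemma kronecker_sub {m n : Type*} (M : Matrix m m ℂ) (N N' : Matrix n n ℂ) :
    M ⊗ₖ (N - N') = M ⊗ₖ N + -(M ⊗ₖ N') := by
  ext i j
  simp [kronecker_apply, mul_sub, sub_eq_add_neg]
  ring

lemma Rop_single_zero (a : Fin 4) : Rop (single a 1) (0 : Data k) =
    fromCols (-((1 : Mat k) ⊗ₖ (spin a)ᴴ)) 0 := by
  have h : ∀ b, tau (single a 1) (0 : Data k) b =
      -((if b = a then (1 : ℂ) else 0) • (1 : Mat k)) := fun b => by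
    have : (0 : Data k).T b = 0 := rfl
    rw [tau, this, zero_sub]
    congr 2
    split_ifs with h <;> simp [h]
  rw [Rop_eq]
  congr 1
  · rw [sum_eq_single a]
    · rw [h, if_pos rfl, one_smul, neg_kronecker]
    · intro b _ hb
      rw [h, if_neg hb, zero_smul, neg_zero, zero_kronecker]
    · simp
  · ext p s
    change ∑ c, (0 : Data k).P c p.1 * spin c p.2 s = 0
    exact sum_eq_zero fun c _ => zero_mul _

lemma curvCore_single (hy : y ∈ Abar k) (x : R4) (a b : Fin 4) :
    curvCore (x, y) (single a 1, 0) (single b 1, 0) =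
      fromBlocks ((Dm x y)⁻¹ ⊗ₖ (spin a * (spin b)ᴴ - spin b * (spin a)ᴴ)) 0 0 0 := by
  have h : ∀ a b : Fin 4, (Rop (single a 1) (0 : Data k))ᴴ * (RR (x, y))⁻¹ *
      Rop (single b 1) (0 : Data k) =
      fromBlocks ((Dm x y)⁻¹ ⊗ₖ (spin a * (spin b)ᴴ)) 0 0 0 := fun a b => by
    rw [inv_RR hy, Rop_single_zero, Rop_single_zero,
      Matrix.conjTranspose_fromCols_eq_fromRows_conjTranspose, Matrix.fromRows_mul,
      Matrix.fromRows_mul_fromCols, Matrix.conjTranspose_neg, conjTranspose_kronecker,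
      conjTranspose_conjTranspose, conjTranspose_one, neg_mul, neg_mul, mul_neg, neg_neg, ←
      mul_kronecker_mul, ← mul_kronecker_mul, one_mul, mul_one, mul_one, Matrix.mul_zero,
      Matrix.conjTranspose_zero, Matrix.zero_mul, Matrix.zero_mul, Matrix.zero_mul]
  rw [curvCore_inl, h, h, sub_eq_add_neg (fromBlocks _ _ _ _), fromBlocks_neg, fromBlocks_add]
  rw [kronecker_sub]
  simp

lemma toBlocks_proj (hy : y ∈ Abar k) (x : R4) : (proj (x, y)).toBlocks₁₁ = 1 - ∑ a, ∑ b,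
      (tau x y a * (Dm x y)⁻¹ * tau x y b) ⊗ₖ (spin a * (spin b)ᴴ) := by
  have h1 : (1 : Matrix (Idx k) (Idx k) ℂ) = fromBlocks 1 0 0 1 := Matrix.fromBlocks_one.symm
  rw [proj_eq, inv_RR hy, Rop_eq, Matrix.conjTranspose_fromCols_eq_fromRows_conjTranspose,
    Matrix.fromRows_mul, Matrix.fromRows_mul_fromCols, h1, sub_eq_add_neg, fromBlocks_neg,
    fromBlocks_add, Matrix.toBlocks_fromBlocks₁₁, ← sub_eq_add_neg, conjTranspose_sum, sum_mul,
    sum_mul_sum]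
  simp only [conjTranspose_kronecker, conjTranspose_conjTranspose, tau_conjTranspose, ←
    mul_kronecker_mul, mul_one]

lemma trace_proj_mul {n : Type*} [Fintype n] {P B B' : Matrix n n ℂ}
    (hP : P * P = P) : (P * B * P * (P * B' * P)).trace = (B * P * (B' * P)).trace := by
  have : P * B * P * (P * B' * P) = P * (B * (P * P) * B' * P) := by simp only [mul_assoc]
  rw [this, hP, trace_mul_comm]
  have : B * P * B' * P * P = B * P * B' * (P * P) := by simp only [mul_assoc]
  rw [this, hP]
  simp only [mul_assoc]

lemma trace_fromBlocks_mul {m n : Type*} [Fintype m] [Fintype n] (b b' : Matrix m m ℂ)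
    (P : Matrix (m ⊕ n) (m ⊕ n) ℂ) :
    (fromBlocks b 0 0 0 * P * (fromBlocks b' 0 0 0 * P)).trace =
      (b * P.toBlocks₁₁ * (b' * P.toBlocks₁₁)).trace := by
  conv_lhs => rw [← Matrix.fromBlocks_toBlocks P]
  simp [Matrix.fromBlocks_multiply, Matrix.trace, Fintype.sum_sum_type]

lemma density_eq (hy : y ∈ A k) (x : R4) : density x y = (1 / Real.pi ^ 2) *
      (-6 * ((Dm x y)⁻¹ * (Dm x y)⁻¹).trace +
        12 * (∑ a, ((Dm x y)⁻¹ * tau x y a * ((Dm x y)⁻¹ * tau x y a) * (Dm x y)⁻¹).trace) -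
        4 * (∑ a, ∑ b, ((Dm x y)⁻¹ * tau x y a * ((Dm x y)⁻¹ * tau x y a) *
          ((Dm x y)⁻¹ * tau x y b) * ((Dm x y)⁻¹ * tau x y b)).trace) -
        2 * ∑ a, ∑ b, ((Dm x y)⁻¹ * tau x y a * ((Dm x y)⁻¹ * tau x y b) *
          ((Dm x y)⁻¹ * tau x y a) * ((Dm x y)⁻¹ * tau x y b)).trace).re := by
  rw [← sum_trace_density (Dm x y)⁻¹ (tau x y) (fun a => (Dm x y)⁻¹ * tau x y a) fun _ => rfl,
    ← toBlocks_proj hy.1]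
  have hPP := proj_mul_proj (det_RR_ne_zero (hy.2 x))
  have h : ∀ a b c d : Fin 4, (curv (x, y) (single a 1, 0)
      (single b 1, 0) * curv (x, y) (single c 1, 0)
      (single d 1, 0)).trace =
      (((Dm x y)⁻¹ ⊗ₖ (spin a * (spin b)ᴴ - spin b * (spin a)ᴴ)) * (proj (x, y)).toBlocks₁₁ *
        (((Dm x y)⁻¹ ⊗ₖ (spin c * (spin d)ᴴ - spin d * (spin c)ᴴ)) *
          (proj (x, y)).toBlocks₁₁)).trace := fun a b c d => by
    rw [curv_eq_of_mem_A hy, curv_eq_of_mem_A hy, trace_proj_mul hPP, curvCore_single hy.1,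
      curvCore_single hy.1, trace_fromBlocks_mul]
  have s01 : spin 0 * (spin 1)ᴴ - spin 1 * (spin 0)ᴴ = (-2 : ℂ) • spin 1 := by
    ext s t; fin_cases s <;> fin_cases t <;> simp [spin, vecMul, dotProduct] <;> ring
  have s02 : spin 0 * (spin 2)ᴴ - spin 2 * (spin 0)ᴴ = (-2 : ℂ) • spin 2 := by
    ext s t; fin_cases s <;> fin_cases t <;> simp [spin, vecMul, dotProduct] <;> ring
  have s03 : spin 0 * (spin 3)ᴴ - spin 3 * (spin 0)ᴴ = (-2 : ℂ) • spin 3 := by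
    ext s t; fin_cases s <;> fin_cases t <;> simp [spin, vecMul, dotProduct] <;> ring
  have s23 : spin 2 * (spin 3)ᴴ - spin 3 * (spin 2)ᴴ = (-2 : ℂ) • spin 1 := by
    ext s t; fin_cases s <;> fin_cases t <;> simp [spin, vecMul, dotProduct] <;> ring
  have s13 : spin 1 * (spin 3)ᴴ - spin 3 * (spin 1)ᴴ = (2 : ℂ) • spin 2 := by
    ext s t; fin_cases s <;> fin_cases t <;> simp [spin, vecMul, dotProduct] <;> ring
  have s12 : spin 1 * (spin 2)ᴴ - spin 2 * (spin 1)ᴴ = (-2 : ℂ) • spin 3 := by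
    ext s t; fin_cases s <;> fin_cases t <;> simp [spin, vecMul, dotProduct] <;> ring
  rw [density, chern, trace_add, trace_sub, h, h, h, s01, s02, s03, s23, s13, s12]
  simp only [Matrix.kronecker_smul, smul_mul, Matrix.mul_smul, trace_smul, smul_smul,
    sum_univ_three, smul_eq_mul]
  obtain ⟨g, hg⟩ : ∃ g : Fin 4 → ℂ, ∀ c, (((Dm x y)⁻¹ ⊗ₖ spin c) * (proj (x, y)).toBlocks₁₁ *
    (((Dm x y)⁻¹ ⊗ₖ spin c) * (proj (x, y)).toBlocks₁₁)).trace = g c := ⟨_, fun _ => rfl⟩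
  simp only [hg]
  change _ = 1 / Real.pi ^ 2 * (g 1 + g 2 + g 3).re
  have e : (-2 * -2 * g 1 - 2 * -2 * g 2 + -2 * -2 * g 3 : ℂ) =
      ((4 : ℝ) : ℂ) * (g 1 + g 2 + g 3) := by
    push_cast; ring
  rw [e, re_ofReal_mul]
  field_simp

/-- A vector field on `ℝ⁴` whose divergence is the density of the Chern form. -/
def greenVec (x : R4) (y : Data k) (a : Fin 4) : ℝ :=
  (1 / (2 * Real.pi ^ 2)) * (3 * ((Dm x y)⁻¹ * ((Dm x y)⁻¹ * tau x y a)).trace.re -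
    2 * ∑ b, ((Dm x y)⁻¹ * tau x y a * ((Dm x y)⁻¹ * tau x y b) *
      ((Dm x y)⁻¹ * tau x y b)).trace.re)

section

variable {E : Type*} [NormedAddCommGroup E] [NormedSpace ℝ E] {m n : Type*} [Fintype m]

lemma MSmoothAt.add {M N : E → Matrix m n ℂ} {z : E} (hM : MSmoothAt M z)
    (hN : MSmoothAt N z) : MSmoothAt (fun z => M z + N z) z := fun i j => (hM i j).add (hN i j)

lemma MSmoothAt.sum {ι : Type*} {s : Finset ι} {M : ι → E → Matrix m n ℂ} {z : E}
    (hM : ∀ i, MSmoothAt (M i) z) : MSmoothAt (fun z => ∑ i ∈ s, M i z) z := fun i j => by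
  simp only [Matrix.sum_apply]
  exact ContDiffAt.sum fun a _ => hM a i j

lemma mderiv_add {M N : E → Matrix m n ℂ} {z : E} (hM : MDiffAt M z) (hN : MDiffAt N z)
    (u : E) : mderiv (fun z => M z + N z) z u = mderiv M z u + mderiv N z u := by
  ext i j
  simp [mderiv, fderiv_fun_add (hM i j) (hN i j)]

lemma mderiv_sum {ι : Type*} {s : Finset ι} {M : ι → E → Matrix m n ℂ} {z : E}
    (hM : ∀ i, MDiffAt (M i) z) (u : E) :
    mderiv (fun z => ∑ i ∈ s, M i z) z u = ∑ i ∈ s, mderiv (M i) z u := by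
  ext i j
  simp only [mderiv, of_apply, Matrix.sum_apply]
  rw [fderiv_fun_sum fun a _ => hM a i j, ContinuousLinearMap.sum_apply]

lemma MSmoothAt.trace_re {M : E → Matrix m m ℂ} {z : E} (hM : MSmoothAt M z) :
    ContDiffAt ℝ ∞ (fun z => (M z).trace.re) z :=
  reCLM.contDiff.contDiffAt.comp z (ContDiffAt.sum fun i _ => hM i i)

lemma fderiv_trace_re {M : E → Matrix m m ℂ} {z : E} (hM : MDiffAt M z) (u : E) :
    fderiv ℝ (fun z => (M z).trace.re) z u = (mderiv M z u).trace.re := by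
  have h : HasFDerivAt (fun z => (M z).trace.re) (reCLM ∘L ∑ i, fderiv ℝ (fun z => M z i i) z) z :=
    reCLM.hasFDerivAt.comp z (HasFDerivAt.fun_sum fun i _ => (hM i i).hasFDerivAt)
  rw [h.fderiv]
  simp [Matrix.trace, mderiv]

lemma mderiv_inv [DecidableEq m] {M : E → Matrix m m ℂ} (hM : ∀ z, MSmoothAt M z)
    (hdet : ∀ z, (M z).det ≠ 0) (z u : E) :
    mderiv (fun z => (M z)⁻¹) z u = -((M z)⁻¹ * mderiv M z u * (M z)⁻¹) := by
  have h := mderiv_mul ((hM z).inv (hdet z)).mdiffAt (hM z).mdiffAt u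
  have e : (fun z => (M z)⁻¹ * M z) = fun _ => 1 :=
    funext fun z => nonsing_inv_mul _ (isUnit_iff_ne_zero.2 (hdet z))
  rw [e, mderiv_const] at h
  have h2 := congrArg (· * (M z)⁻¹) h
  simp only [Matrix.zero_mul, add_mul] at h2
  rw [mul_assoc (mderiv _ z u), mul_nonsing_inv _ (isUnit_iff_ne_zero.2 (hdet z)), mul_one] at h2
  exact eq_neg_of_add_eq_zero_left h2.symm

end

/-- Multiples of the identity matrix. -/
def coordL (k : ℕ) (b : Fin 4) : R4 →ₗ[ℝ] Mat k where
  toFun x := ((x b : ℝ) : ℂ) • 1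
  map_add' x x' := by rw [← add_smul]; simp
  map_smul' r x := by
    ext i j
    simp [mul_assoc]

lemma msmoothAt_tau (y : Data k) (b : Fin 4) (x : R4) : MSmoothAt (fun x => tau x y b) x :=
  (msmoothAt_const (y.T b) x).sub (msmoothAt_linear_id (coordL k b) x)

lemma mderiv_tau (y : Data k) (a b : Fin 4) (x : R4) :
    mderiv (fun x => tau x y b) x (single a 1) = if a = b then -1 else 0 := by
  have h := mderiv_sub (msmoothAt_const (y.T b) x).mdiffAt
    (msmoothAt_linear_id (coordL k b) x).mdiffAt (single a 1)
  have h2 := mderiv_linear (coordL k b) (g := fun x => x) (z := x) differentiableAt_id (single a 1)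
  rw [mderiv_const, h2, zero_sub] at h
  refine h.trans ?_
  simp only [fderiv_fun_id, ContinuousLinearMap.id_apply]
  change -((((single a (1 : ℝ) : R4) b : ℝ) : ℂ) • (1 : Mat k)) = _
  split_ifs with hab
  · simp [hab]
  · simp [Ne.symm hab]

lemma msmoothAt_Dm (y : Data k) (x : R4) : MSmoothAt (fun x => Dm x y) x :=
  MSmoothAt.sum fun a => ((msmoothAt_tau y a x).mul (msmoothAt_tau y a x)).add
    (msmoothAt_const (vecMulVec (y.P a) (star (y.P a))) x)

lemma mderiv_Dm (y : Data k) (a : Fin 4) (x : R4) :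
    mderiv (fun x => Dm x y) x (single a 1) = (-2 : ℂ) • tau x y a := by
  have h := mderiv_sum (s := Finset.univ) (fun b => (((msmoothAt_tau y b x).mul
    (msmoothAt_tau y b x)).add
    (msmoothAt_const (vecMulVec (y.P b) (star (y.P b))) x)).mdiffAt)
    (single a 1)
  refine h.trans ?_
  rw [sum_eq_single a]
  · rw [mderiv_add ((msmoothAt_tau y a x).mul (msmoothAt_tau y a x)).mdiffAt (msmoothAt_const _
      x).mdiffAt, mderiv_const, mderiv_mul (msmoothAt_tau y a x).mdiffAt (msmoothAt_tau y a
      x).mdiffAt, mderiv_tau, if_pos rfl]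
    rw [neg_mul, mul_neg, one_mul, mul_one, add_zero, neg_smul, two_smul, neg_add]
  · intro b _ hb
    rw [mderiv_add ((msmoothAt_tau y b x).mul (msmoothAt_tau y b x)).mdiffAt (msmoothAt_const _
      x).mdiffAt, mderiv_const, mderiv_mul (msmoothAt_tau y b x).mdiffAt (msmoothAt_tau y b
      x).mdiffAt, mderiv_tau, if_neg (Ne.symm hb), Matrix.zero_mul, Matrix.mul_zero, add_zero,
      add_zero]
  · simp

section

variable {y : Data k} (hy : y ∈ A k)
include hy

lemma msmoothAt_inv_Dm (x : R4) : MSmoothAt (fun x => (Dm x y)⁻¹) x :=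
  (msmoothAt_Dm y x).inv (det_Dm_ne_zero hy x)

lemma msmoothAt_inv_Dm_mul (b : Fin 4) (x : R4) : MSmoothAt (fun x => (Dm x y)⁻¹ * tau x y b) x :=
  (msmoothAt_inv_Dm hy x).mul (msmoothAt_tau y b x)

lemma mderiv_inv_Dm (a : Fin 4) (x : R4) : mderiv (fun x => (Dm x y)⁻¹) x (single a 1) =
      (2 : ℂ) • ((Dm x y)⁻¹ * tau x y a * (Dm x y)⁻¹) := by
  rw [mderiv_inv (msmoothAt_Dm y) (det_Dm_ne_zero hy), mderiv_Dm]
  simp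

lemma mderiv_inv_Dm_mul (a b : Fin 4) (x : R4) :
    mderiv (fun x => (Dm x y)⁻¹ * tau x y b) x (single a 1) =
      (2 : ℂ) • ((Dm x y)⁻¹ * tau x y a * ((Dm x y)⁻¹ * tau x y b)) -
        if a = b then (Dm x y)⁻¹ else 0 := by
  rw [mderiv_mul (msmoothAt_inv_Dm hy x).mdiffAt (msmoothAt_tau y b x).mdiffAt, mderiv_inv_Dm hy,
    mderiv_tau]
  split_ifs <;> simp [mul_assoc, sub_eq_add_neg]

lemma contDiff_greenVec (a : Fin 4) : ContDiff ℝ ∞ fun x => greenVec x y a := by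
  refine contDiff_iff_contDiffAt.2 fun x => contDiffAt_const.mul
    ((contDiffAt_const.mul ?_).sub (contDiffAt_const.mul (ContDiffAt.sum fun b _ => ?_)))
  · exact ((msmoothAt_inv_Dm hy x).mul (msmoothAt_inv_Dm_mul hy a x)).trace_re
  · exact (((msmoothAt_inv_Dm_mul hy a x).mul (msmoothAt_inv_Dm_mul hy b x)).mul
      (msmoothAt_inv_Dm_mul hy b x)).trace_re

omit hy in
lemma trace_divergence {n : Type*} [Fintype n] (f : Matrix n n ℂ) (h : Fin 4 → Matrix n n ℂ)  :
    ∑ a, (3 * ((2 : ℂ) • (h a * f) * h a + f * ((2 : ℂ) • (h a * h a) - f)).trace -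
      2 * ∑ b, (((2 : ℂ) • (h a * h a) - f) * h b * h b +
        h a * ((2 : ℂ) • (h a * h b) - if a = b then f else 0) * h b +
        h a * h b * ((2 : ℂ) • (h a * h b) - if a = b then f else 0)).trace) =
    2 * (-6 * (f * f).trace + 12 * (∑ a, (h a * h a * f).trace) -
        4 * (∑ a, ∑ b, (h a * h a * h b * h b).trace) -
        2 * ∑ a, ∑ b, (h a * h b * h a * h b).trace) := by
  have c1 : ∀ a, (h a * f * h a).trace = (h a * h a * f).trace := fun a => by
    rw [trace_mul_comm, mul_assoc]
  have c2 : ∀ a, (f * (h a * h a)).trace = (h a * h a * f).trace := fun a => trace_mul_comm _ _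
  have e1 : ∀ a b, (((2 : ℂ) • (h a * h a) - f) * h b * h b +
        h a * ((2 : ℂ) • (h a * h b) - if a = b then f else 0) * h b +
        h a * h b * ((2 : ℂ) • (h a * h b) - if a = b then f else 0)).trace =
      4 * (h a * h a * h b * h b).trace + 2 * (h a * h b * h a * h b).trace -
        (h b * h b * f).trace - if a = b then 2 * (h a * h a * f).trace else 0 := fun a b => by
    split_ifs with hab
    · subst hab
      simp only [trace_add, sub_mul, mul_sub, trace_sub, smul_mul, Matrix.mul_smul, trace_smul,
        smul_eq_mul, c1, ← mul_assoc]
      rw [mul_assoc f, c2]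
      ring
    · simp only [trace_add, sub_mul, mul_sub, trace_sub, smul_mul, Matrix.mul_smul, trace_smul,
        smul_eq_mul, ← mul_assoc, sub_zero]
      rw [mul_assoc f, c2]
      ring
  have e2 : ∀ a, ((2 : ℂ) • (h a * f) * h a + f * ((2 : ℂ) • (h a * h a) - f)).trace =
      4 * (h a * h a * f).trace - (f * f).trace := fun a => by
    simp only [trace_add, mul_sub, trace_sub, smul_mul, Matrix.mul_smul, trace_smul, smul_eq_mul,
        c1, c2]
    ring
  simp only [e1, e2]
  simp only [sum_sub_distrib, sum_add_distrib, ← mul_sum, sum_ite_eq, mem_univ, if_true, mul_sub,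
    mul_add]
  simp only [Finset.sum_const, card_univ, Fintype.card_fin, nsmul_eq_mul, Nat.cast_ofNat]
  ring

lemma sum_fderiv_greenVec (x : R4) :
    ∑ a, fderiv ℝ (fun x => greenVec x y a) x (single a 1) = density x y := by
  have h := fun b => msmoothAt_inv_Dm_mul hy b x
  have hf := msmoothAt_inv_Dm hy x
  have e : ∀ a, fderiv ℝ (fun x => greenVec x y a) x (single a 1) =
      1 / (2 * Real.pi ^ 2) * (3 * (mderiv (fun x => (Dm x y)⁻¹ * ((Dm x y)⁻¹ * tau x y a)) x
        (single a 1)).trace.re - 2 * ∑ b, (mderiv (fun x => (Dm x y)⁻¹ * tau x y a *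
        ((Dm x y)⁻¹ * tau x y b) * ((Dm x y)⁻¹ * tau x y b)) x
        (single a 1)).trace.re) := fun a => by
    have d1 := (hf.mul (h a)).trace_re.differentiableAt (by simp)
    have d2 := fun b => (((h a).mul (h b)).mul (h b)).trace_re.differentiableAt (by simp)
    have d3 : HasFDerivAt (fun x => greenVec x y a) _ x :=
      ((d1.hasFDerivAt.const_mul 3).fun_sub ((HasFDerivAt.fun_sum (u := Finset.univ) fun b _ =>
        (d2 b).hasFDerivAt).const_mul 2)).const_mul (1 / (2 * Real.pi ^ 2))
    rw [d3.fderiv]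
    simp only [ContinuousLinearMap.smul_apply, ContinuousLinearMap.sub_apply,
      ContinuousLinearMap.sum_apply, smul_eq_mul, fderiv_trace_re (hf.mul (h a)).mdiffAt,
      fun b => fderiv_trace_re (((h a).mul (h b)).mul (h b)).mdiffAt]
  have e1 : ∀ a, mderiv (fun x => (Dm x y)⁻¹ * ((Dm x y)⁻¹ * tau x y a)) x
      (single a 1) = (2 : ℂ) • ((Dm x y)⁻¹ * tau x y a * (Dm x y)⁻¹) *
        ((Dm x y)⁻¹ * tau x y a) + (Dm x y)⁻¹ * ((2 : ℂ) • ((Dm x y)⁻¹ * tau x y a *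
        ((Dm x y)⁻¹ * tau x y a)) - (Dm x y)⁻¹) := fun a => by
    rw [mderiv_mul hf.mdiffAt (h a).mdiffAt, mderiv_inv_Dm hy, mderiv_inv_Dm_mul hy, if_pos rfl]
  have e2 : ∀ a b, mderiv (fun x => (Dm x y)⁻¹ * tau x y a * ((Dm x y)⁻¹ * tau x y b) *
      ((Dm x y)⁻¹ * tau x y b)) x (single a 1) = 
      ((2 : ℂ) • ((Dm x y)⁻¹ * tau x y a * ((Dm x y)⁻¹ * tau x y a)) - (Dm x y)⁻¹) *
        ((Dm x y)⁻¹ * tau x y b) * ((Dm x y)⁻¹ * tau x y b) + (Dm x y)⁻¹ * tau x y a *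
        ((2 : ℂ) • ((Dm x y)⁻¹ * tau x y a * ((Dm x y)⁻¹ * tau x y b)) -
        if a = b then (Dm x y)⁻¹ else 0) * ((Dm x y)⁻¹ * tau x y b) + (Dm x y)⁻¹ * tau x y a *
        ((Dm x y)⁻¹ * tau x y b) * ((2 : ℂ) • ((Dm x y)⁻¹ * tau x y a *
        ((Dm x y)⁻¹ * tau x y b)) - if a = b then (Dm x y)⁻¹ else 0) := fun a b => by
    rw [mderiv_mul ((h a).mul (h b)).mdiffAt (h b).mdiffAt, mderiv_mul (h a).mdiffAt (h b).mdiffAt,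
      mderiv_inv_Dm_mul hy, mderiv_inv_Dm_mul hy, if_pos rfl, add_mul]
  have key := congrArg Complex.re (trace_divergence (Dm x y)⁻¹ fun a => (Dm x y)⁻¹ * tau x y a)
  simp only [← e1, ← e2] at key
  have er : ∀ (r : ℝ) (z : ℂ), ((r : ℂ) * z).re = r * z.re := fun r z => re_ofReal_mul r z
  have e3 : ∀ z : ℂ, (3 * z).re = 3 * z.re := fun z => by simp
  have e4 : ∀ z : ℂ, (2 * z).re = 2 * z.re := fun z => by simp
  rw [density_eq hy, sum_ext fun a _ => e a, ← mul_sum]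
  rw [e4] at key
  generalize Complex.re (_ - _ : ℂ) = Z at key ⊢
  simp only [re_sum, sub_re, e3, e4] at key
  rw [key]
  field_simp

end

/-- The block diagonal matrix with blocks `m` and `M`. -/
def blockDiag (m : ℂ) (M : Mat k) : Mat (k + 1) :=
  Matrix.of fun i j => Fin.cases (Fin.cases m (fun _ => 0) j)
    (fun i => Fin.cases 0 (fun j => M i j) j) i

lemma ext_blocks {M N : Mat (k + 1)} (h0 : M 0 0 = N 0 0)
    (h1 : ∀ j : Fin k, M 0 j.succ = N 0 j.succ) (h2 : ∀ i : Fin k, M i.succ 0 = N i.succ 0)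
    (h3 : ∀ i j : Fin k, M i.succ j.succ = N i.succ j.succ) : M = N := by
  ext i j
  exact Fin.cases (Fin.cases h0 h1 j) (fun i => Fin.cases (h2 i) (h3 i) j) i

lemma blockDiag_mul (m n : ℂ) (M N : Mat k) :
    blockDiag m M * blockDiag n N = blockDiag (m * n) (M * N) := by
  refine ext_blocks ?_ (fun j => ?_) (fun i => ?_) fun i j => ?_ <;>
    simp [blockDiag, Matrix.mul_apply, sum_univ_succ]

lemma blockDiag_one : blockDiag 1 (1 : Mat k) = 1 := by
  refine ext_blocks ?_ (fun j => ?_) (fun i => ?_) fun i j => ?_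
  · simp [blockDiag]
  · simp [blockDiag, (succ_ne_zero j).symm]
  · simp [blockDiag]
  · simp [blockDiag, Matrix.one_apply]

lemma trace_blockDiag (m : ℂ) (M : Mat k) : (blockDiag m M).trace = m + M.trace := by
  simp [blockDiag, Matrix.trace, sum_univ_succ]

section

variable {y : Data (k + 1)} (hy : off y = 0)
include hy

lemma tau_of_off (x : R4) (a : Fin 4) :
    tau x y a = blockDiag ((T0 y a - x a : ℝ) : ℂ) (tau x (lower y) a) := by
  refine ext_blocks ?_ (fun j => ?_) (fun i => ?_) fun i j => ?_
  · simp [tau, blockDiag, T_zero_zero]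
  · simp [tau, blockDiag, T_zero_succ_of_off hy, (succ_ne_zero j).symm]
  · simp [tau, blockDiag, T_succ_zero_of_off hy]
  · simp only [tau, blockDiag, Matrix.sub_apply, Matrix.smul_apply, of_apply, Fin.cases_succ]
    simp only [Matrix.one_apply, Fin.succ_inj]
    rfl

lemma Dm_of_off (x : R4) : Dm x y = blockDiag ((‖x - T0 y‖ ^ 2 : ℝ) : ℂ) (Dm x (lower y)) := by
  have h : ∀ a, tau x y a * tau x y a + vecMulVec (y.P a) (star (y.P a)) =
      blockDiag (((T0 y a - x a : ℝ) : ℂ) * ((T0 y a - x a : ℝ) : ℂ))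
        (tau x (lower y) a * tau x (lower y) a +
          vecMulVec ((lower y).P a) (star ((lower y).P a))) := fun a => by
    rw [tau_of_off hy, blockDiag_mul]
    refine ext_blocks ?_ (fun j => ?_) (fun i => ?_) fun i j => ?_
    · simp [blockDiag, vecMulVec_apply, P_zero_of_off hy]
    · simp [blockDiag, vecMulVec_apply, P_zero_of_off hy]
    · simp [blockDiag, vecMulVec_apply, P_zero_of_off hy]
    · simp only [blockDiag, vecMulVec_apply, Matrix.add_apply, of_apply, Fin.cases_succ]
      rfl
  rw [Dm, sum_ext fun a _ => h a, Dm, norm_sq_eq]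
  refine ext_blocks ?_ (fun j => ?_) (fun i => ?_) fun i j => ?_
  · rw [Matrix.sum_apply]
    simp only [blockDiag, of_apply, Fin.cases_zero]
    push_cast
    refine sum_ext fun a _ => ?_
    rw [Real.norm_eq_abs, ← Complex.ofReal_pow, sq_abs]
    simp
    ring
  · rw [Matrix.sum_apply]; simp [blockDiag]
  · rw [Matrix.sum_apply]; simp [blockDiag]
  · rw [Matrix.sum_apply]; simp [blockDiag, Matrix.sum_apply]

lemma greenVec_of_off {x : R4} (hx : x ≠ T0 y) (hD : (Dm x (lower y)).det ≠ 0) (a : Fin 4) :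
    greenVec x y a = greenVec x (lower y) a -
      (1 / (2 * Real.pi ^ 2)) * ((x - T0 y) a / ‖x - T0 y‖ ^ 4) := by
  obtain ⟨r, hr⟩ : ∃ r, r = ‖x - T0 y‖ ^ 2 := ⟨_, rfl⟩
  have hr0 : r ≠ 0 := hr ▸ pow_ne_zero 2 (norm_ne_zero_iff.2 (sub_ne_zero.2 hx))
  have hr4 : ‖x - T0 y‖ ^ 4 = r ^ 2 := by rw [hr]; ring
  have hinv : (Dm x y)⁻¹ = blockDiag ((r⁻¹ : ℝ) : ℂ) (Dm x (lower y))⁻¹ := by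
    refine Matrix.inv_eq_right_inv ?_
    rw [Dm_of_off hy, blockDiag_mul, mul_nonsing_inv _ (isUnit_iff_ne_zero.2 hD), ← hr, ←
      ofReal_mul, mul_inv_cancel₀ hr0, Complex.ofReal_one, blockDiag_one]
  have hs : ∑ b, (T0 y b - x b) ^ 2 = r := by
    rw [hr, norm_sq_eq]
    refine sum_ext fun b _ => ?_
    rw [Real.norm_eq_abs, sq_abs]
    simp
    ring
  rw [greenVec, greenVec, hinv, hr4]
  simp only [tau_of_off hy, blockDiag_mul, trace_blockDiag, ← ofReal_mul, add_re, ofReal_re,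
    sum_add_distrib]
  have e : ∑ b, r⁻¹ * (T0 y a - x a) * (r⁻¹ * (T0 y b - x b)) * (r⁻¹ * (T0 y b - x b)) =
      (T0 y a - x a) / r ^ 2 := by
    have : ∀ b, r⁻¹ * (T0 y a - x a) * (r⁻¹ * (T0 y b - x b)) * (r⁻¹ * (T0 y b - x b)) =
      (r⁻¹) ^ 3 * (T0 y a - x a) * (T0 y b - x b) ^ 2 := fun b => by ring
    simp only [this]
    rw [← mul_sum, hs]
    field_simp
  rw [e]
  have e2 : (x - T0 y) a = x a - T0 y a := rfl
  rw [e2]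
  field_simp
  ring

end

lemma tendsto_inv_Dm {y : Data₁} (hy : y ∈ Sing1reg k) (C : ℝ) {x : R4} (hx : x ≠ T0 y) :
    Tendsto (fun y' => (Dm x y')⁻¹) (𝓝[approach C y] y) (𝓝 (Dm x y)⁻¹) := by
  have hR := (det_RR_ne_zero_of_Sing1reg hy hx).2
  have hx' : Tendsto (fun y' => (x, y')) (𝓝[approach C y] y) (𝓝 (x, y)) :=
    ((by fun_prop : Continuous fun y' : Data₁ => (x, y')).tendsto y).mono_left
      nhdsWithin_le_nhds
  have tF : Tendsto (fun y' => (RR (x, y'))⁻¹) (𝓝[approach C y] y) (𝓝 (RR (x, y))⁻¹) :=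
    Tendsto.comp (g := fun z => (RR z)⁻¹) ((msmoothAt_RR (x, y)).inv hR).tendsto hx'
  have h : ∀ y' ∈ Abar (k + 1), ∀ i j, (RR (x, y'))⁻¹ (i, 0) (j, 0) = (Dm x y')⁻¹ i j :=
    fun y' hA i j => by rw [inv_RR hA, kroneckerMap_apply, Matrix.one_apply_eq, mul_one]
  refine tendsto_pi_nhds.2 fun i => tendsto_pi_nhds.2 fun j => ?_
  have h1 := tendsto_pi_nhds.1 (tendsto_pi_nhds.1 tF (i, 0)) (j, 0)
  rw [h y (Sing1reg_mem_Abar hy)] at h1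
  exact h1.congr' (eventually_mem_nhdsWithin.mono fun y' hA => h y' hA.1.1 i j)

lemma tendsto_tau {s : Set (Data k)} (x : R4) (a : Fin 4) :
    Tendsto (fun y' => tau x y' a) (𝓝[s] y) (𝓝 (tau x y a)) := by
  have h : Tendsto (fun y' : Data k => y'.T a) (𝓝 y) (𝓝 (y.T a)) :=
    (msmoothAt_linear_id (TL k a) y).tendsto
  exact (h.mono_left nhdsWithin_le_nhds).sub tendsto_const_nhds

lemma tendsto_greenVec {y : Data₁} (hy : y ∈ Sing1reg k) (C : ℝ) {x : R4}
    (hx : x ≠ T0 y) (a : Fin 4) :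
    Tendsto (fun y' => greenVec x y' a) (𝓝[approach C y] y) (𝓝 (greenVec x y a)) := by
  have tf := tendsto_inv_Dm hy C hx
  have th := fun b => Tendsto.matrix_mul tf (tendsto_tau (s := approach C y) x b)
  have tr : ∀ {M : Data₁ → Mat (k + 1)} {M0 : Mat (k + 1)}, Tendsto M (𝓝[approach C y] y) (𝓝 M0) →
      Tendsto (fun y' => (M y').trace.re) (𝓝[approach C y] y) (𝓝 M0.trace.re) := fun h =>
    (continuous_re.tendsto _).comp
      (tendsto_finsetSum _ fun I _ => tendsto_pi_nhds.1 (tendsto_pi_nhds.1 h I) I)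
  exact (((tr (Tendsto.matrix_mul tf (th a))).const_mul 3).sub ((tendsto_finsetSum _ fun b _ =>
    tr (Tendsto.matrix_mul (Tendsto.matrix_mul (th a) (th b)) (th b))).const_mul 2)).const_mul _

lemma norm_trace_le {n : Type*} [Fintype n] {M : Matrix n n ℂ} {B : ℝ}
    (h : ∀ i j, ‖M i j‖ ≤ B) : |M.trace.re| ≤ Fintype.card n * B :=
  (Complex.abs_re_le_norm _).trans ((norm_sum_le _ _).trans
    ((sum_le_card_nsmul _ _ B fun i _ => h i i).trans (le_of_eq (by rw [nsmul_eq_mul, card_univ]))))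

lemma eventually_abs_greenVec_le {y : Data₁} (hy : y ∈ Sing1reg k) (C : ℝ) :
    ∃ B > 0, ∀ᶠ y' in 𝓝[approach C y] y, ∀ x a,
      |greenVec x y' a| ≤ B * (1 + (‖x - T0 y‖ + ‖y' - y‖)⁻¹) ^ 3 := by
  obtain ⟨B, hB, h⟩ := eventually_norm_inv_Dm_le hy C
  obtain ⟨N, hN⟩ : ∃ N : ℝ, N = Fintype.card (Fin (k + 1)) := ⟨_, rfl⟩
  have hN0 : 0 ≤ N := hN ▸ Nat.cast_nonneg _
  have hK : 0 ≤ 3 * (N * (N * (B * B))) + 8 * (N * (N * (N * (B * B) * B))) := by positivity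
  have hpi : 0 < 1 / (2 * Real.pi ^ 2) := by positivity
  refine ⟨1 / (2 * Real.pi ^ 2) * (3 * (N * (N * (B * B))) + 8 * (N * (N * (N * (B * B) * B)))) + 1,
    add_pos_of_nonneg_of_pos (mul_nonneg hpi.le hK) one_pos, ?_⟩
  filter_upwards [h] with y' hy' x a
  obtain ⟨hA, hpos, h⟩ := hy'
  obtain ⟨l, hl⟩ : ∃ l, l = ‖x - T0 y‖ + ‖y' - y‖ := ⟨_, rfl⟩
  have hl0 : 0 < l := hl ▸ add_pos_of_nonneg_of_pos (norm_nonneg _) hpos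
  have h := h x
  rw [← hl] at h ⊢
  obtain ⟨W, hW⟩ : ∃ W, W = 1 + l⁻¹ := ⟨_, rfl⟩
  have hW0 : 0 ≤ W := by rw [hW]; exact add_nonneg zero_le_one (inv_nonneg.2 hl0.le)
  have hw : ∀ i, wt k l i ≤ W := fun i => hW ▸ wt_le hl0.le i
  have hw0 := wt_nonneg (k := k) hl0.le
  have hf : ∀ i j, ‖(Dm x y')⁻¹ i j‖ ≤ B * W * W := fun i j => (h i j).1.trans
    (mul_le_mul (mul_le_mul_of_nonneg_left (hw i) hB.le) (hw j) (hw0 j) (mul_nonneg hB.le hW0))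
  have hh : ∀ b i j, ‖((Dm x y')⁻¹ * tau x y' b) i j‖ ≤ B * W := fun b i j =>
    ((h i j).2 b).trans (mul_le_mul_of_nonneg_left (hw i) hB.le)
  have b1 := norm_trace_le (norm_mul_apply_le hf (hh a))
  have b2 := fun b => norm_trace_le (norm_mul_apply_le (norm_mul_apply_le (hh a) (hh b)) (hh b))
  rw [← hN] at b1
  simp only [← hN] at b2
  have b3 := (Finset.abs_sum_le_sum_abs (fun b => ((Dm x y')⁻¹ * tau x y' a *
    ((Dm x y')⁻¹ * tau x y' b) * ((Dm x y')⁻¹ * tau x y' b)).trace.re) Finset.univ).trans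
    (sum_le_card_nsmul _ _ _ fun b _ => b2 b)
  rw [card_univ, Fintype.card_fin, nsmul_eq_mul, Nat.cast_ofNat] at b3
  rw [greenVec, abs_mul, abs_of_pos hpi, ← hW]
  generalize (∑ b, ((Dm x y')⁻¹ * tau x y' a * ((Dm x y')⁻¹ * tau x y' b) *
    ((Dm x y')⁻¹ * tau x y' b)).trace.re) = S at b3 ⊢
  generalize ((Dm x y')⁻¹ * ((Dm x y')⁻¹ * tau x y' a)).trace.re = R at b1 ⊢
  have e : |3 * R - 2 * S| ≤ (3 * (N * (N * (B * B))) + 8 * (N * (N * (N * (B * B) * B)))) *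
      W ^ 3 := by
    have := abs_sub (3 * R) (2 * S)
    rw [abs_mul, abs_mul, abs_of_pos (by norm_num : (0 : ℝ) < 3), abs_of_pos (by norm_num : (0 : ℝ) < 2)] at this
    refine this.trans ((add_le_add (mul_le_mul_of_nonneg_left b1 (by norm_num))
      (mul_le_mul_of_nonneg_left b3 (by norm_num))).trans (le_of_eq (by ring)))
  refine (mul_le_mul_of_nonneg_left e hpi.le).trans ?_
  have := pow_nonneg hW0 3
  rw [← mul_assoc]
  exact mul_le_mul_of_nonneg_right (le_add_of_nonneg_right zero_le_one) this

lemma one_add_inv_cube_le {r e : ℝ} (hr : 0 < r) (he : 0 ≤ e) :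
    (1 + (r + e)⁻¹) ^ 3 ≤ 4 * (1 + (r ^ 3)⁻¹) := by
  have h0 : 0 ≤ (r + e)⁻¹ := inv_nonneg.2 (add_nonneg hr.le he)
  have h1 : (r + e)⁻¹ ≤ r⁻¹ := inv_anti₀ hr (le_add_of_nonneg_right he)
  have h2 : 0 ≤ r⁻¹ := inv_nonneg.2 hr.le
  rw [← inv_pow]
  refine (pow_le_pow_left₀ (add_nonneg zero_le_one h0) (add_le_add_right h1 1) 3).trans ?_
  nlinarith [mul_nonneg (add_nonneg zero_le_one h2) (sq_nonneg (1 - r⁻¹))]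

lemma tendsto_integral_approach {y : Data₁} {C : ℝ} {F : R4 → Data₁ → ℝ}
    {F0 : R4 → ℝ} {K : Set R4} (hK : IsCompact K)
    (hmeas : ∀ y' ∈ A (k + 1), Continuous fun x => F x y') (hsupp : ∀ x ∉ K, ∀ y', F x y' = 0)
    (hbound : ∃ B > 0, ∀ᶠ y' in 𝓝[approach C y] y, ∀ x,
      |F x y'| ≤ B * (1 + (‖x - T0 y‖ + ‖y' - y‖)⁻¹) ^ 3)
    (hlim : ∀ x ≠ T0 y, Tendsto (F x) (𝓝[approach C y] y) (𝓝 (F0 x))) :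
    Tendsto (fun y' => ∫ x, F x y') (𝓝[approach C y] y) (𝓝 (∫ x, F0 x)) := by
  obtain ⟨B, hB, hb⟩ := hbound
  have hne : ∀ᵐ x : R4, x ≠ T0 y := by
    rw [ae_iff]
    simp
  refine tendsto_integral_filter_of_dominated_convergence
    (K.indicator fun x => B * (4 * (1 + (‖x - T0 y‖ ^ 3)⁻¹))) ?_ ?_ ?_ ?_
  · exact eventually_mem_nhdsWithin.mono fun y' h => (hmeas y' h.1).aestronglyMeasurable
  · refine hb.mono fun y' h => hne.mono fun x hx => ?_
    by_cases hxK : x ∈ K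
    · rw [Set.indicator_of_mem hxK]
      exact (h x).trans (mul_le_mul_of_nonneg_left (one_add_inv_cube_le
        (norm_pos_iff.2 (sub_ne_zero.2 hx)) (norm_nonneg _)) hB.le)
    · rw [Set.indicator_of_notMem hxK, hsupp x hxK, norm_zero]
  · rw [integrable_indicator_iff hK.measurableSet]
    exact (((integrableOn_const hK.measure_lt_top.ne).add
      (integrableOn_inv_norm_sub_cube (T0 y) hK.isBounded)).const_mul 4).const_mul B
  · exact hne.mono hlim

lemma integrable_of_compact {φ f : R4 → ℝ} (hf : Continuous f) (hφ : Continuous φ)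
    (hc : HasCompactSupport φ) : Integrable fun x => f x * φ x :=
  (hf.mul hφ).integrable_of_hasCompactSupport hc.mul_left

lemma hasCompactSupport_fderiv_apply {φ : R4 → ℝ} (hc : HasCompactSupport φ) (e : R4) :
    HasCompactSupport fun x => fderiv ℝ φ x e :=
  (hc.fderiv ℝ).comp_left (g := fun L : R4 →L[ℝ] ℝ => L e) rfl

lemma integral_density_mul (hy : y ∈ A k) {φ : R4 → ℝ} (hφ : ContDiff ℝ 1 φ)
    (hc : HasCompactSupport φ) :
    ∫ x, density x y * φ x = -∫ x, ∑ a, greenVec x y a * fderiv ℝ φ x (single a 1) := by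
  have hφ' : ∀ e, Continuous fun x => fderiv ℝ φ x e := fun e =>
    (hφ.continuous_fderiv one_ne_zero).clm_apply continuous_const
  have hV := fun a => contDiff_greenVec hy a
  have hV' : ∀ a e, Continuous fun x => fderiv ℝ (fun x => greenVec x y a) x e := fun a e =>
    ((hV a).continuous_fderiv (by simp)).clm_apply continuous_const
  have i1 : ∀ a, Integrable fun x => greenVec x y a * fderiv ℝ φ x (single a 1) := fun a =>
    integrable_of_compact (hV a).continuous (hφ' _) (hasCompactSupport_fderiv_apply hc _)
  have i2 : ∀ a, Integrable fun x => fderiv ℝ (fun x => greenVec x y a) x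
      (single a 1) * φ x := fun a =>
    integrable_of_compact (hV' a _) hφ.continuous hc
  rw [integral_finset_sum _ fun a _ => i1 a, ← sum_neg_distrib]
  have h : ∀ a, -∫ x, greenVec x y a * fderiv ℝ φ x (single a 1) =
      ∫ x, fderiv ℝ (fun x => greenVec x y a) x (single a 1) * φ x := fun a => by
    rw [integral_mul_fderiv_eq_neg_fderiv_mul_of_integrable (i2 a) (i1 a)
      (integrable_of_compact (hV a).continuous hφ.continuous hc)
      (fun x _ => (hV a).differentiable (by simp) x)
      (fun x _ => hφ.differentiable one_ne_zero x), neg_neg]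
  rw [sum_ext fun a _ => h a, ← integral_finset_sum _ fun a _ => i2 a]
  refine integral_congr_ae (Eventually.of_forall fun x => ?_)
  dsimp only
  rw [← sum_mul, sum_fderiv_greenVec hy]

lemma fderiv_eq_sum_single (φ : R4 → ℝ) (x w : R4) :
    fderiv ℝ φ x w = ∑ a, w a * fderiv ℝ φ x (single a 1) := by
  conv_lhs => rw [← (basisFun (Fin 4) ℝ).sum_repr w, map_sum]
  simp

lemma tendsto_integral_density {y : Data₁} (hy : y ∈ Sing1reg k) (C : ℝ) {φ : R4 → ℝ}
    (hφ : ContDiff ℝ 1 φ) (hc : HasCompactSupport φ) :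
    Tendsto (fun y' => ∫ x, density x y' * φ x) (𝓝[approach C y] y)
      (𝓝 ((∫ x, density x (lower y) * φ x) - φ (T0 y))) := by
  have hφ' : ∀ e, Continuous fun x => fderiv ℝ φ x e := fun e =>
    (hφ.continuous_fderiv one_ne_zero).clm_apply continuous_const
  have hlim : ∀ x ≠ T0 y, Tendsto (fun y' => ∑ a, greenVec x y' a * fderiv ℝ φ x (single a 1))
      (𝓝[approach C y] y)
      (𝓝 (∑ a, greenVec x (lower y) a * fderiv ℝ φ x (single a 1) -
        1 / (2 * Real.pi ^ 2) * (fderiv ℝ φ x (x - T0 y) / ‖x - T0 y‖ ^ 4))) := fun x hx => by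
    have e : ∑ a, greenVec x (lower y) a * fderiv ℝ φ x (single a 1) -
        1 / (2 * Real.pi ^ 2) * (fderiv ℝ φ x (x - T0 y) / ‖x - T0 y‖ ^ 4) =
        ∑ a, greenVec x y a * fderiv ℝ φ x (single a 1) := by
      rw [fderiv_eq_sum_single φ x (x - T0 y), Finset.sum_div, mul_sum, ← sum_sub_distrib]
      refine sum_ext fun a _ => ?_
      rw [greenVec_of_off (mem_Sing1_iff.1 hy.1) hx (det_Dm_ne_zero hy.2 x)]
      ring
    rw [e]
    exact tendsto_finsetSum _ fun a _ => (tendsto_greenVec hy C hx a).mul_const _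
  obtain ⟨M, hM⟩ := (hc.fderiv ℝ).exists_bound_of_continuous (hφ.continuous_fderiv one_ne_zero)
  have hM0 : 0 ≤ M := (norm_nonneg _).trans (hM 0)
  obtain ⟨B, hB, hb⟩ := eventually_abs_greenVec_le hy C
  have t := tendsto_integral_approach (C := C) (y := y) (K := tsupport (fderiv ℝ φ))
    (F := fun x y' => ∑ a, greenVec x y' a * fderiv ℝ φ x (single a 1))
    (hc.fderiv ℝ) ?_ ?_ ?_ hlim
  · have i1 : Integrable fun x => ∑ a, greenVec x (lower y) a *
        fderiv ℝ φ x (single a 1) := integrable_finset_sum _ fun a _ =>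
      integrable_of_compact (contDiff_greenVec hy.2 a).continuous (hφ' _)
        (hasCompactSupport_fderiv_apply hc _)
    obtain ⟨ψ, hψ⟩ : ∃ ψ : R4 → ℝ, ∀ x, ψ x = φ (x + T0 y) := ⟨_, fun _ => rfl⟩
    have hψ1 : ψ = fun x => φ (x + T0 y) := funext hψ
    have hψd : ∀ x, fderiv ℝ ψ (x - T0 y) = fderiv ℝ φ x := fun x => by
      rw [hψ1, fderiv_comp_add_right, sub_add_cancel]
    have hψc : ContDiff ℝ 1 ψ := by rw [hψ1]; exact hφ.comp (contDiff_id.add contDiff_const)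
    have hψs : HasCompactSupport ψ := by
      rw [hψ1]; exact hc.comp_homeomorph (Homeomorph.addRight (T0 y))
    have i2 : Integrable fun x => 1 / (2 * Real.pi ^ 2) *
        (fderiv ℝ φ x (x - T0 y) / ‖x - T0 y‖ ^ 4) := by
      have := ((integrable_radial hψc hψs).comp_sub_right (T0 y)).const_mul (1 / (2 * Real.pi ^ 2))
      simpa only [hψd] using this
    have e2 : ∫ x, 1 / (2 * Real.pi ^ 2) * (fderiv ℝ φ x (x - T0 y) / ‖x - T0 y‖ ^ 4) =
        -φ (T0 y) := by
      have h3 := integral_sub_right_eq_self (μ := (volume : Measure R4))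
        (fun x => fderiv ℝ ψ x x / ‖x‖ ^ 4) (T0 y)
      rw [integral_radial hψc hψs, hψ, zero_add] at h3
      simp only [hψd] at h3
      rw [integral_const_mul, h3]
      have := Real.pi_ne_zero
      field_simp
    rw [integral_sub i1 i2, e2] at t
    have t2 := t.neg
    rw [integral_density_mul hy.2 hφ hc]
    have e3 : -((∫ x, ∑ a, greenVec x (lower y) a * fderiv ℝ φ x (single a 1)) -
        -φ (T0 y)) = (-∫ x, ∑ a, greenVec x (lower y) a *
          fderiv ℝ φ x (single a 1)) - φ (T0 y) := by ring
    rw [e3] at t2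
    exact t2.congr' (eventually_mem_nhdsWithin.mono fun y' h =>
      (integral_density_mul h.1 hφ hc).symm)
  · exact fun y' h => continuous_finset_sum _ fun a _ =>
      (contDiff_greenVec h a).continuous.mul (hφ' _)
  · intro x hx y'
    have : fderiv ℝ φ x = 0 := image_eq_zero_of_notMem_tsupport hx
    simp [this]
  · refine ⟨4 * (B * M) + 1, by have := mul_nonneg hB.le hM0; linarith, hb.mono fun y' h x => ?_⟩
    obtain ⟨W, hW⟩ : ∃ W, W = (1 + (‖x - T0 y‖ + ‖y' - y‖)⁻¹) ^ 3 := ⟨_, rfl⟩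
    have h := h x
    rw [← hW] at h ⊢
    have hW0 : 0 ≤ W := by
      rw [hW]
      exact pow_nonneg (add_nonneg zero_le_one
        (inv_nonneg.2 (add_nonneg (norm_nonneg _) (norm_nonneg _)))) 3
    refine (Finset.abs_sum_le_sum_abs _ _).trans ((sum_le_card_nsmul _ _ (B * W * M)
      fun a _ => ?_).trans ?_)
    · rw [abs_mul]
      refine mul_le_mul (h a) ?_ (abs_nonneg _) (mul_nonneg hB.le hW0)
      have := (fderiv ℝ φ x).le_opNorm (single a 1)
      rw [EuclideanSpace.norm_single, norm_one, mul_one] at this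
      exact this.trans (hM x)
    · rw [card_univ, Fintype.card_fin, nsmul_eq_mul, Nat.cast_ofNat]
      linarith

section

variable {d m : ℕ} {M : Type*} [AddCommGroup M] [Module ℝ M]

lemma sum_perm_sum_aux (D : M [⋀^Fin d ⊕ Fin m]→ₗ[ℝ] ℝ) (a : M [⋀^Fin m]→ₗ[ℝ] ℝ)
    (w : Fin d ⊕ Fin m → M) :
    ∑ σ : Equiv.Perm (Fin d ⊕ Fin m), ((Equiv.Perm.sign σ : ℤ) : ℝ) *
      D (elim (fun p => w (σ (inl p))) fun p => w (inr p)) * a (fun p => w (σ (inr p))) =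
      (d.factorial * m.factorial : ℝ) * (D w * a fun p => w (inr p)) := by
  classical
  have h0 : ∀ σ ∈ Finset.univ, σ ∉ Finset.univ.map
      ⟨Equiv.Perm.sumCongrHom (Fin d) (Fin m), Equiv.Perm.sumCongrHom_injective⟩ →
      ((Equiv.Perm.sign σ : ℤ) : ℝ) *
      D (elim (fun p => w (σ (inl p))) fun p => w (inr p)) *
        a (fun p => w (σ (inr p))) = 0 := fun σ _ hσ => by
    obtain ⟨i, j, hij⟩ : ∃ i j, σ (inl i) = inr j := by
      by_contra! hc
      refine hσ ?_
      have : σ ∈ (Equiv.Perm.sumCongrHom (Fin d) (Fin m)).range :=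
        Equiv.Perm.mem_sumCongrHom_range_of_perm_mapsTo_inl (by
          rintro _ ⟨i, rfl⟩
          rcases h : σ (inl i) with p | p
          · exact ⟨p, rfl⟩
          · exact absurd h (hc i p))
      obtain ⟨τ, hτ⟩ := this
      exact Finset.mem_map.2 ⟨τ, mem_univ _, hτ⟩
    rw [D.map_eq_zero_of_eq _ (i := inl i) (j := inr j) (by simp [hij]) (by simp)]
    simp
  rw [← Finset.sum_subset (Finset.subset_univ _) h0, Finset.sum_map]
  have h1 : ∀ τ : Equiv.Perm (Fin d) × Equiv.Perm (Fin m),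
      ((Equiv.Perm.sign (Equiv.Perm.sumCongrHom (Fin d) (Fin m) τ) : ℤ) : ℝ) *
      D (elim (fun p => w (Equiv.Perm.sumCongrHom (Fin d) (Fin m) τ (inl p))) fun p => w (inr p)) *
        a (fun p => w (Equiv.Perm.sumCongrHom (Fin d) (Fin m) τ (inr p))) =
      D w * a fun p => w (inr p) := fun τ => by
    have e1 : (elim (fun p => w (Equiv.Perm.sumCongrHom (Fin d) (Fin m) τ (inl p)))
        fun p => w (inr p)) = fun i => w (Equiv.Perm.sumCongr τ.1 1 i) := by
      funext i
      rcases i with i | i <;> rfl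
    have e2 := D.map_perm w (Equiv.Perm.sumCongr τ.1 1)
    have e3 := a.map_perm (fun p => w (inr p)) τ.2
    have e4 : Equiv.Perm.sign (Equiv.Perm.sumCongrHom (Fin d) (Fin m) τ) =
        Equiv.Perm.sign τ.1 * Equiv.Perm.sign τ.2 := Equiv.Perm.sign_sumCongr _ _
    rw [e1, e4]
    erw [e2, e3]
    rw [Equiv.Perm.sign_sumCongr]
    rcases Int.units_eq_one_or (Equiv.Perm.sign τ.1) with h | h <;>
      rcases Int.units_eq_one_or (Equiv.Perm.sign τ.2) with h' | h' <;> simp [h, h']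
  refine (sum_ext fun τ _ => h1 τ).trans ?_
  simp [Fintype.card_perm, mul_assoc]

/-- An alternating form with some arguments fixed. -/
def fixLeft (D : M [⋀^Fin d ⊕ Fin m]→ₗ[ℝ] ℝ) (u : Fin d → M) : M [⋀^Fin m]→ₗ[ℝ] ℝ :=
  { D.toMultilinearMap.currySum u with
    map_eq_zero_of_eq' := fun v i j h hij => by
      refine D.map_eq_zero_of_eq _ (i := inr i) (j := inr j) ?_ (by simpa using hij)
      simpa using h }

lemma fixLeft_apply (D : M [⋀^Fin d ⊕ Fin m]→ₗ[ℝ] ℝ) (u : Fin d → M) (t : Fin m → M) :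
    fixLeft D u t = D (elim u t) := rfl

lemma alternating_sum_apply {ι : Type*} (s : Finset ι) (f : ι → M [⋀^Fin m]→ₗ[ℝ] ℝ)
    (t : Fin m → M) : (∑ i ∈ s, f i) t = ∑ i ∈ s, f i t := by
  classical
  induction s using Finset.induction_on with
  | empty => simp
  | insert i s hi ih => rw [Finset.sum_insert hi, Finset.sum_insert hi, AlternatingMap.add_apply, ih]

lemma sum_perm_sum (D : M [⋀^Fin d ⊕ Fin m]→ₗ[ℝ] ℝ) (a : M [⋀^Fin m]→ₗ[ℝ] ℝ)
    (b : Module.Basis (Fin d ⊕ Fin m) ℝ M) (t : Fin m → M) :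
    ∑ σ : Equiv.Perm (Fin d ⊕ Fin m), ((Equiv.Perm.sign σ : ℤ) : ℝ) *
      D (elim (fun p => b (σ (inl p))) t) * a (fun p => b (σ (inr p))) =
      (d.factorial * m.factorial : ℝ) * (D b * a t) := by
  classical
  have key : (∑ σ : Equiv.Perm (Fin d ⊕ Fin m), (((Equiv.Perm.sign σ : ℤ) : ℝ) *
      a (fun p => b (σ (inr p)))) • fixLeft D fun p => b (σ (inl p))) =
      ((d.factorial * m.factorial : ℝ) * D b) • a := by
    refine Module.Basis.ext_alternating b fun v hv => ?_
    obtain ⟨ρ, hρ⟩ : ∃ ρ : Equiv.Perm (Fin d ⊕ Fin m), ∀ p, ρ (inr p) = v p := by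
      refine ⟨((Equiv.ofInjective inr Sum.inr_injective).symm.trans
        (Equiv.ofInjective v hv)).extendSubtype, fun p => ?_⟩
      rw [Equiv.extendSubtype_apply_of_mem _ _ ⟨p, rfl⟩]
      simp
    have h := sum_perm_sum_aux D a fun i => b (ρ i)
    have e1 := D.map_perm b ρ
    rw [alternating_sum_apply, ← Equiv.sum_comp (Equiv.mulLeft ρ)]
    simp only [AlternatingMap.smul_apply, fixLeft_apply, smul_eq_mul, Equiv.coe_mulLeft,
      Equiv.Perm.sign_mul, Equiv.Perm.mul_apply, ← hρ]
    change D (fun i => b (ρ i)) = _ at e1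
    rw [e1] at h
    have hs : ((Equiv.Perm.sign ρ : ℤ) : ℝ) * ((Equiv.Perm.sign ρ : ℤ) : ℝ) = 1 := by
      rcases Int.units_eq_one_or (Equiv.Perm.sign ρ) with h | h <;> simp [h]
    have h2 := congrArg (((Equiv.Perm.sign ρ : ℤ) : ℝ) * ·) h
    simp only [mul_sum, Units.smul_def, zsmul_eq_mul] at h2
    refine (sum_ext fun σ _ => ?_).trans (h2.trans ?_)
    · push_cast; ring
    · linear_combination (d.factorial * m.factorial * (D b * a fun p => b (ρ (inr p))) : ℝ) * hs
  have := congrArg (fun f : M [⋀^Fin m]→ₗ[ℝ] ℝ => f t) key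
  simp only [alternating_sum_apply, AlternatingMap.smul_apply, fixLeft_apply, smul_eq_mul] at this
  rw [← mul_assoc, ← this]
  exact sum_ext fun σ _ => by ring

end

lemma append_neg_eq {d n : ℕ} (hdn : d + n = 3) (D : R4 [⋀^Fin 4]→ₗ[ℝ] ℝ) (e : Fin d → R4)
    (t : Fin (n + 1) → R4) :
    (D fun i => append (-t) e (Fin.cast (by omega : 4 = n + 1 + d) i)) =
      D fun i => append e t (Fin.cast (by omega : 4 = d + (n + 1)) i) := by
  obtain ⟨w, hw⟩ : ∃ w : Fin 4 → R4, ∀ i, append e t (Fin.cast (by omega : 4 = d + (n + 1)) i)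
    = w i := ⟨_, fun _ => rfl⟩
  have key : ∀ (c : Fin 4 → ℝ) (σ : Equiv.Perm (Fin 4)),
      (∏ i, c i) * ((Equiv.Perm.sign σ : ℤ) : ℝ) = 1 →
      (∀ i, append (-t) e (Fin.cast (by omega : 4 = n + 1 + d) i) = c i • w (σ i)) →
      (D fun i => append (-t) e (Fin.cast (by omega : 4 = n + 1 + d) i)) = D w :=
    fun c σ h hv => by
      rw [funext hv]
      have h1 := D.map_perm w σ
      have h2 := D.toMultilinearMap.map_smul_univ c (w ∘ σ)
      change (D fun i => c i • w (σ i)) = _ • D (w ∘ σ) at h2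
      rw [h2, h1, Units.smul_def, zsmul_eq_mul, smul_eq_mul, ← mul_assoc, h, one_mul]
  simp only [hw]
  have hd : d ≤ 3 := by omega
  interval_cases d
  · obtain rfl : n = 3 := by omega
    refine key (fun _ => -1) 1 (by norm_num) fun i => ?_
    rw [← hw]
    fin_cases i <;> simp [append, addCases] <;> rfl
  · obtain rfl : n = 2 := by omega
    refine key ![-1, -1, -1, 1] (finRotate 4) (by simp [Fin.prod_univ_four, sign_finRotate]) fun i => ?_
    rw [← hw]
    fin_cases i <;> simp [append, addCases] <;> rfl
  · obtain rfl : n = 1 := by omega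
    refine key ![-1, -1, 1, 1] ((finRotate 4) ^ 2) (by simp [Fin.prod_univ_four, sign_finRotate]) fun i => ?_
    rw [← hw]
    fin_cases i <;> simp [append, addCases] <;> rfl
  · obtain rfl : n = 0 := by omega
    refine key ![-1, 1, 1, 1] ((finRotate 4) ^ 3) (by simp [Fin.prod_univ_four, sign_finRotate]) fun i => ?_
    rw [← hw]
    fin_cases i <;> simp [append, addCases] <;> rfl

/-- The volume form of `ℝ⁴`. -/
def vol4 : R4 [⋀^Fin 4]→ₗ[ℝ] ℝ := (basisFun (Fin 4) ℝ).toBasis.det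

lemma wedgeTop_vol4 {d n : ℕ} (hdn : d + n = 3) (t : Fin (n + 1) → R4)
    (a : R4 [⋀^Fin (n + 1)]→L[ℝ] ℝ) :
    wedgeTop hdn (fun e => vol4 fun i => append (-t) e
      (Fin.cast (by omega : 4 = n + 1 + d) i)) a = a t := by
  obtain ⟨E, hE⟩ : ∃ E : Fin d ⊕ Fin (n + 1) ≃ Fin 4,
      E = finSumFinEquiv.trans (finCongr (by omega)) := ⟨_, rfl⟩
  obtain ⟨b, hb⟩ : ∃ b, b = (basisFun (Fin 4) ℝ).toBasis := ⟨_, rfl⟩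
  have hbs : ∀ i, b i = single i 1 := fun i => by simp [hb]
  have h := sum_perm_sum (vol4.domDomCongr E.symm) a.toAlternatingMap (b.reindex E.symm) t
  have e0 : (vol4.domDomCongr E.symm) (b.reindex E.symm) = 1 := by
    rw [AlternatingMap.domDomCongr_apply, vol4, ← hb]
    convert b.det_self using 2
    ext i
    simp
  rw [e0, one_mul] at h
  have hf : (d.factorial * (n + 1).factorial : ℝ) ≠ 0 := by positivity
  rw [wedgeTop, one_div, inv_mul_eq_iff_eq_mul₀ hf]
  refine Eq.trans ?_ h
  rw [← Equiv.sum_comp E.permCongr]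
  refine sum_ext fun σ _ => ?_
  rw [Equiv.Perm.sign_permCongr, append_neg_eq hdn]
  have e1 : ∀ p, Fin.cast (by omega : d + (n + 1) = 4) (Fin.castAdd (n + 1) p) = E (inl p) :=
    fun p => by rw [hE]; rfl
  have e2 : ∀ p, Fin.cast (by omega : d + (n + 1) = 4) (natAdd d p) = E (inr p) :=
    fun p => by rw [hE]; rfl
  have e3 : ∀ (u : Fin d → R4) i, append u t (Fin.cast (by omega : 4 = d + (n + 1)) i) =
      elim u t (E.symm i) := fun u i => by
    obtain ⟨j, rfl⟩ := E.surjective i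
    rw [E.symm_apply_apply]
    rcases j with p | p
    · rw [← e1]; simp
    · rw [← e2]; simp
  simp only [e1, e2, e3, Equiv.permCongr_apply, E.symm_apply_apply,
    AlternatingMap.domDomCongr_apply, Module.Basis.reindex_apply, Equiv.symm_symm, hbs]
  rfl

/-- The second Chern form of a matrix-valued two-form. -/
def chernAlt {V n : Type*} [AddCommGroup V] [Module ℝ V] [Fintype n]
    (L : V →ₗ[ℝ] V →ₗ[ℝ] Matrix n n ℂ) (hL : ∀ e, L e e = 0) :
    V [⋀^Fin 4]→ₗ[ℝ] ℝ where
  toFun e := (1 / (4 * Real.pi ^ 2)) * (Matrix.trace (L (e 0) (e 1) * L (e 2) (e 3) -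
    L (e 0) (e 2) * L (e 1) (e 3) + L (e 0) (e 3) * L (e 1) (e 2))).re
  map_update_add' m i x y := by
    have : ‹DecidableEq (Fin 4)› = instDecidableEqFin 4 := Subsingleton.elim _ _
    subst this
    rw [← mul_add, ← add_re, ← trace_add]
    congr 3
    fin_cases i <;> simp [Matrix.add_mul, Matrix.mul_add] <;> abel
  map_update_smul' m i c x := by
    have : ‹DecidableEq (Fin 4)› = instDecidableEqFin 4 := Subsingleton.elim _ _
    subst this
    rw [smul_eq_mul, mul_left_comm c, ← re_ofReal_mul c, ← smul_eq_mul (c : ℂ), ← trace_smul,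
      coe_smul]
    congr 3
    fin_cases i <;> simp [smul_sub, smul_add]
  map_eq_zero_of_eq' e i j h hij := by
    have hs : ∀ e e', L e e' = -L e' e := fun e e' => by
      have := hL (e + e')
      simp only [map_add, LinearMap.add_apply, hL, zero_add, add_zero] at this
      exact eq_neg_of_add_eq_zero_left (by rw [add_comm]; exact this)
    obtain ⟨q, hq⟩ : ∃ q : V → V → V → V → ℝ, q = fun e e' f f' =>
      (L e e' * L f f').trace.re := ⟨_, rfl⟩
    have ht : ∀ e e' f f', q e e' f f' = q f f' e e' := fun e e' f f' => by
      simp only [hq, trace_mul_comm (L e e')]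
    have hn : ∀ e e' f f', q e e' f f' = -q e' e f f' := fun e e' f f' => by
      simp only [hq, hs e e', Matrix.neg_mul, trace_neg, neg_re]
    have : q (e 0) (e 1) (e 2) (e 3) - q (e 0) (e 2) (e 1) (e 3) + q (e 0) (e 3) (e 1) (e 2) = 0 :=
      by
      clear hq hs
      fin_cases i <;> fin_cases j <;> simp only [Fin.isValue, ne_eq, not_true, Fin.reduceFinMk] at h hij <;> grind
    simp only [trace_add, trace_sub, add_re, sub_re]
    simp only [hq] at this
    rw [this, mul_zero]

lemma omega_eq (hy : y ∈ A k) (u v : Data k) :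
    omega y u v = fderiv ℝ (theta (k := k)) y u v - fderiv ℝ (theta (k := k)) y v u -
      bracket (theta y u) (theta y v) := by
  have hd : DifferentiableAt ℝ (theta (k := k)) y := by
    rcases k.eq_zero_or_pos with rfl | hk
    · exact (differentiableAt_const (theta y)).congr_of_eventuallyEq
        (Eventually.of_forall fun y' => by rw [Subsingleton.elim y' y])
    · exact (contDiffAt_theta (isFree_of_mem_A hk hy)).differentiableAt (by simp)
  have h : ∀ u v : Data k, fderiv ℝ (fun y => theta y v) y u =
      fderiv ℝ (theta (k := k)) y u v := fun u v => by
    rw [fderiv_clm_apply hd (differentiableAt_const v)]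
    simp
  rw [omega, h, h]

lemma bracket_add_left (g g' h : gLie k) : bracket (g + g') h = bracket g h + bracket g' h := by
  refine Prod.ext (Subtype.ext ?_) ?_
  · funext i j
    change ((g.mat + g'.mat) * h.mat - h.mat * (g.mat + g'.mat)) i j =
      (g.mat * h.mat - h.mat * g.mat) i j + (g'.mat * h.mat - h.mat * g'.mat) i j
    rw [← Matrix.add_apply, Matrix.add_mul, Matrix.mul_add, add_sub_add_comm]
  · funext c
    fin_cases c <;> simp [bracket] <;> ring

lemma bracket_smul_left (r : ℝ) (g h : gLie k) : bracket (r • g) h = r • bracket g h := by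
  refine Prod.ext (Subtype.ext ?_) ?_
  · funext i j
    change ((r • g.mat) * h.mat - h.mat * (r • g.mat)) i j = r • (g.mat * h.mat - h.mat * g.mat) i j
    rw [← Matrix.smul_apply, smul_mul, Matrix.mul_smul, smul_sub]
  · funext c
    fin_cases c <;> simp [bracket] <;> ring

lemma curvCore_add_left (hy : y ∈ A k) (x : R4) (u u' w : R4 × Data k) :
    curvCore (x, y) (u + u') w = curvCore (x, y) u w + curvCore (x, y) u' w := by
  have h : Rop (u + u').1 (hor y (u + u').2) = Rop u.1 (hor y u.2) + Rop u'.1 (hor y u'.2) := by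
    rw [← Rop_add, Prod.fst_add, Prod.snd_add]
    simp only [hor, map_add, LinearMap.add_apply]
    congr 1
    abel
  have ho : omega y (u + u').2 w.2 = omega y u.2 w.2 + omega y u'.2 w.2 := by
    simp only [omega_eq hy, Prod.snd_add, map_add, ContinuousLinearMap.add_apply, bracket_add_left]
    abel
  simp only [curvCore, h, ho, ← rhoL_apply, map_add, conjTranspose_add, Matrix.add_mul,
    Matrix.mul_add]
  abel

lemma curvCore_smul_left (hy : y ∈ A k) (x : R4) (r : ℝ) (u w : R4 × Data k) :
    curvCore (x, y) (r • u) w = r • curvCore (x, y) u w := by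
  have h : Rop (r • u).1 (hor y (r • u).2) = r • Rop u.1 (hor y u.2) := by
    rw [← RopL_apply (u.1, hor y u.2), ← map_smul, RopL_apply, Prod.smul_fst, Prod.smul_snd]
    simp only [hor, map_smul, LinearMap.smul_apply, smul_sub, Prod.smul_mk]
  have ho : omega y (r • u).2 w.2 = r • omega y u.2 w.2 := by
    simp only [omega_eq hy, Prod.smul_snd, map_smul, ContinuousLinearMap.smul_apply,
      bracket_smul_left, smul_sub]
  simp only [curvCore, h, ho, ← rhoL_apply, map_smul, conjTranspose_smul, star_trivial, smul_mul,
    Matrix.mul_smul, smul_sub]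

/-- The curvature as a bilinear map. -/
def curvL (hy : y ∈ A k) (x : R4) : R4 × Data k →ₗ[ℝ] R4 × Data k →ₗ[ℝ] Matrix (Idx k) (Idx k) ℂ :=
  mk₂ ℝ (curv (x, y)) (fun u u' w => by
      simp only [curv_eq_of_mem_A hy, curvCore_add_left hy, Matrix.add_mul, Matrix.mul_add])
    (fun r u w => by
      simp only [curv_eq_of_mem_A hy, curvCore_smul_left hy, smul_mul, Matrix.mul_smul])
    (fun u w w' => by
      simp only [curv_eq_of_mem_A hy, curvCore_swap _ u, curvCore_add_left hy, Matrix.add_mul,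
        Matrix.mul_add, neg_add])
    (fun r u w => by
      simp only [curv_eq_of_mem_A hy, curvCore_swap _ u, curvCore_smul_left hy, smul_mul,
        Matrix.mul_smul, Matrix.mul_neg, Matrix.neg_mul, smul_neg])

/-- The second Chern form as an alternating map. -/
def chernForm (hy : y ∈ A k) (x : R4) : (R4 × Data k) [⋀^Fin 4]→ₗ[ℝ] ℝ :=
  chernAlt (curvL hy x) fun e => by
    have h := curvCore_swap (x, y) e e
    rw [eq_neg_iff_add_eq_zero, ← two_smul ℝ, smul_eq_zero_iff_right two_ne_zero] at h
    change curv (x, y) e e = 0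
    rw [curv_eq_of_mem_A hy, h, Matrix.mul_zero, Matrix.zero_mul]

lemma chernForm_apply (hy : y ∈ A k) (x : R4) (u : Fin 4 → R4 × Data k) :
    chernForm hy x u = chern (x, y) u := rfl

lemma chern_inl (hy : y ∈ A k) (x : R4) (e : Fin 4 → R4) :
    chern (x, y) (fun i => (e i, 0)) = density x y * vol4 e := by
  have h : ∀ e : Fin 4 → R4, chern (x, y) (fun i => (e i, 0)) =
      (chernForm hy x).compLinearMap (LinearMap.inl ℝ R4 (Data k)) e := fun e => rfl
  rw [h, ((chernForm hy x).compLinearMap _).eq_smul_basis_det (basisFun (Fin 4) ℝ).toBasis,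
    AlternatingMap.smul_apply, ← h, density, vol4, smul_eq_mul]
  simp

lemma eventually_abs_chern_le {y : Data₁} (hy : y ∈ Sing1reg k) (C : ℝ)
    {v : Fin 4 → Data₁} (hv : ∀ i, v i ∈ Sing1 k) (hv0 : ∀ i, T0 (v i) = 0) :
    ∃ B > 0, ∀ᶠ y' in 𝓝[approach C y] y, ∀ x (e : Fin 4 → R4),
      |chern (x, y') (fun i => (e i, v i))| ≤
        B * ∏ i, (‖e i‖ * (1 + (‖x - T0 y‖ + ‖y' - y‖)⁻¹) + 1) := by
  choose B hB h using fun i j => eventually_norm_curv_le hy C (hv i) (hv0 i) (hv j) (hv0 j)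
  obtain ⟨N, hN⟩ : ∃ N : ℝ, N = Fintype.card (Idx (k + 1)) := ⟨_, rfl⟩
  have hN0 : 0 < N := hN ▸ Nat.cast_pos.2 Fintype.card_pos
  have hpi : 0 < 1 / (4 * Real.pi ^ 2) := by positivity
  refine ⟨1 / (4 * Real.pi ^ 2) * (N ^ 2 * (B 0 1 * B 2 3 + B 0 2 * B 1 3 + B 0 3 * B 1 2)),
    mul_pos hpi (mul_pos (pow_pos hN0 2) (add_pos (add_pos (mul_pos (hB _ _) (hB _ _))
      (mul_pos (hB _ _) (hB _ _))) (mul_pos (hB _ _) (hB _ _)))), ?_⟩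
  filter_upwards [eventually_all.2 fun i => eventually_all.2 (h i)] with y' h x e
  have t : ∀ a b c d : Fin 4, |(curv (x, y') (e a, v a) (e b, v b) *
      curv (x, y') (e c, v c) (e d, v d)).trace.re| ≤ _ := fun a b c d =>
    norm_trace_le (norm_mul_apply_le (h a b x (e a) (e b)) (h c d x (e c) (e d)))
  rw [chern, abs_mul, abs_of_pos hpi, mul_assoc]
  refine mul_le_mul_of_nonneg_left ?_ hpi.le
  have t1 := abs_le.1 (t 0 1 2 3)
  have t2 := abs_le.1 (t 0 2 1 3)
  have t3 := abs_le.1 (t 0 3 1 2)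
  rw [← hN] at t1 t2 t3
  simp only [trace_add, trace_sub, add_re, sub_re, Fin.prod_univ_four]
  exact abs_le.2 ⟨by linarith [t1.1, t2.2, t3.1], by linarith [t1.2, t2.1, t3.2]⟩

lemma eventually_abs_chern_sub_le {y : Data₁} (hy : y ∈ Sing1reg k) (C : ℝ)
    (e : Fin 4 → R4) {v : Fin 4 → Data₁} (hv : ∀ i, v i ∈ Sing1 k)
    (hv0 : ∀ i, T0 (v i) = 0) :
    ∃ B > 0, ∀ᶠ y' in 𝓝[approach C y] y, ∀ x,
      |chern (x, y') (fun i => (e i, v i)) - chern (x, y') (fun i => (e i, 0))| ≤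
        B * (1 + (‖x - T0 y‖ + ‖y' - y‖)⁻¹) ^ 3 := by
  have hp : ∀ (s : Finset (Fin 4)) i, s.piecewise 0 v i ∈ Sing1 k ∧
      T0 (s.piecewise 0 v i) = 0 := fun s i => by
    by_cases h : i ∈ s
    · rw [Finset.piecewise_eq_of_mem _ _ _ h]
      exact ⟨Submodule.zero_mem _, rfl⟩
    · rw [Finset.piecewise_eq_of_notMem _ _ _ h]
      exact ⟨hv i, hv0 i⟩
  choose B hB h using fun s =>
    eventually_abs_chern_le hy C (fun i => (hp s i).1) fun i => (hp s i).2
  refine ⟨(∑ s, B s) * (‖e‖ + 1) ^ 3, mul_pos (Finset.sum_pos (fun s _ => hB s)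
    Finset.univ_nonempty) (by positivity), ?_⟩
  filter_upwards [eventually_all.2 h, eventually_mem_nhdsWithin] with y' h hA x
  have hW : (1 : ℝ) ≤ 1 + (‖x - T0 y‖ + ‖y' - y‖)⁻¹ := le_add_of_nonneg_right (by positivity)
  have h := fun s => h s x (s.piecewise e 0)
  generalize (1 + (‖x - T0 y‖ + ‖y' - y‖)⁻¹) = W at *
  have e1 : ∀ s : Finset (Fin 4), (fun i => (s.piecewise e 0 i, s.piecewise 0 v i)) =
      s.piecewise (fun i => (e i, (0 : Data₁))) fun i => (0, v i) := fun s => by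
    funext i
    by_cases h : i ∈ s <;> simp [h]
  have e2 : (fun i => (e i, v i)) = (fun i => (e i, (0 : Data₁))) + fun i => (0, v i) := by
    funext i
    simp
  have e3 := (chernForm hA.1 x).toMultilinearMap.map_add_univ
    (fun i => (e i, (0 : Data₁))) fun i => (0, v i)
  rw [← e2, ← Finset.add_sum_erase _ _ (mem_univ Finset.univ), Finset.piecewise_univ] at e3
  have e4 : chern (x, y') (fun i => (e i, v i)) - chern (x, y') (fun i => (e i, 0)) =
      ∑ s ∈ Finset.univ.erase Finset.univ,
        chern (x, y') fun i => (s.piecewise e 0 i, s.piecewise 0 v i) := by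
    simp only [e1]
    exact sub_eq_iff_eq_add'.2 e3
  rw [e4, mul_assoc, ← mul_pow, sum_mul]
  refine (Finset.abs_sum_le_sum_abs _ _).trans ((sum_le_sum fun s hs => (h s).trans
    (mul_le_mul_of_nonneg_left ?_ (hB s).le)).trans (Finset.sum_le_sum_of_subset_of_nonneg
    (Finset.erase_subset _ _) fun s _ _ => mul_nonneg (hB s).le (by positivity)))
  obtain ⟨j, hj⟩ : ∃ j, j ∉ s := by
    by_contra! hj
    exact (Finset.mem_erase.1 hs).1 (Finset.eq_univ_iff_forall.2 hj)
  rw [← Finset.mul_prod_erase _ _ (mem_univ j), Finset.piecewise_eq_of_notMem _ _ _ hj,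
    Pi.zero_apply, norm_zero, zero_mul, zero_add, one_mul]
  refine (Finset.prod_le_prod (g := fun _ => (‖e‖ + 1) * W) (fun i _ => by positivity)
    fun i _ => ?_).trans (le_of_eq (by simp))
  have h1 : ‖s.piecewise e 0 i‖ ≤ ‖e‖ := by
    by_cases h : i ∈ s
    · simpa [h] using norm_le_pi_norm e i
    · simp [h]
  nlinarith

lemma tendsto_integral_chern {y : Data₁} (hy : y ∈ Sing1reg k) (C : ℝ)
    (e : Fin 4 → R4) {v : Fin 4 → Data₁} (hv : ∀ i, v i ∈ Sing1 k)
    (hv0 : ∀ i, T0 (v i) = 0) {g : R4 → ℝ} (hg : ContDiff ℝ 1 g) (hc : HasCompactSupport g) :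
    Tendsto (fun y' => ∫ x, chern (x, y') (fun i => (e i, v i)) * g x) (𝓝[approach C y] y)
      (𝓝 ((∫ x, chern (x, lower y) (fun i => (e i, lower (v i))) * g x) - vol4 e * g (T0 y))) := by
  have z1 : (0 : Data₁) ∈ Sing1 k := Submodule.zero_mem _
  have z2 : T0 (0 : Data₁) = 0 := rfl
  have hgc := hg.continuous
  obtain ⟨M, hM⟩ := hgc.bounded_above_of_compact_support hc
  obtain ⟨B, hB, hbound⟩ := eventually_abs_chern_sub_le hy C e hv hv0
  have hM0 : 0 ≤ M := (norm_nonneg _).trans (hM 0)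
  have split : ∀ {m : ℕ} {z : Data m}, z ∈ A m → ∀ w : Fin 4 → Data m,
      ∫ x, chern (x, z) (fun i => (e i, w i)) * g x =
        (∫ x, (chern (x, z) (fun i => (e i, w i)) - chern (x, z) (fun i => (e i, 0))) * g x) +
          vol4 e * ∫ x, density x z * g x := fun hz w => by
    have i1 := integrable_of_compact (continuous_chern hz fun i => (e i, w i)) hgc hc
    have i2 := integrable_of_compact (continuous_chern hz fun i => (e i, 0)) hgc hc
    rw [← integral_const_mul, ← integral_add]
    · congr 1
      funext x
      rw [chern_inl hz]
      ring
    · exact (i1.sub i2).congr (ae_of_all _ fun x => (sub_mul _ _ _).symm)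
    · simpa only [chern_inl hz, mul_comm (density _ _), mul_assoc] using i2
  have h1 := tendsto_integral_approach (y := y) (C := C) (K := tsupport g)
    (F := fun x y' => (chern (x, y') (fun i => (e i, v i)) -
      chern (x, y') (fun i => (e i, 0))) * g x)
    (F0 := fun x => (chern (x, lower y) (fun i => (e i, lower (v i))) -
      chern (x, lower y) (fun i => (e i, 0))) * g x) hc
    (fun y' hy' => ((continuous_chern hy' _).sub (continuous_chern hy' _)).mul hgc)
    (fun x hx y' => by rw [image_eq_zero_of_notMem_tsupport hx, mul_zero])
    ⟨B * (M + 1), by positivity, by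
      filter_upwards [hbound] with y' h x
      rw [abs_mul, mul_right_comm]
      refine mul_le_mul (h x) ((hM x).trans (by linarith)) (abs_nonneg _)
        ((abs_nonneg _).trans (h x))⟩
    (fun x hx => ((tendsto_chern hy C hx e hv hv0).sub
      (tendsto_chern hy C hx e (v := fun _ => 0) (fun _ => z1) fun _ => z2)).mul_const _)
  have h2 := h1.add ((tendsto_integral_density hy C hg hc).const_mul (vol4 e))
  rw [split hy.2 fun i => lower (v i), add_sub_assoc, ← mul_sub]
  refine h2.congr' ?_
  filter_upwards [eventually_mem_nhdsWithin] with y' hy'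
  exact (split hy'.1 v).symm

lemma append_prod {m d : ℕ} (w : Fin m → Data k) (t : Fin m → R4) (e : Fin d → R4)
    (j : Fin (m + d)) :
    append (fun p => ((0 : R4), w p + scalarData (t p))) (fun p => (e p, (0 : Data k))) j =
      (append (0 : Fin m → R4) e j, append w 0 j + scalarData (append t 0 j)) := by
  have hs : scalarData (0 : R4) = (0 : Data k) := by
    have := smul_scalarData (k := k) 0 0
    rwa [zero_smul, zero_smul, eq_comm] at this
  refine addCases (fun p => ?_) (fun p => ?_) j
  · simp only [Fin.append_left, Pi.zero_apply]
  · simp only [Fin.append_right, Pi.zero_apply, hs, add_zero]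

lemma append_zero_sub {m d : ℕ} (t : Fin m → R4) (e : Fin d → R4) (j : Fin (m + d)) :
    append (0 : Fin m → R4) e j - append t 0 j = append (-t) e j := by
  refine addCases (fun p => ?_) (fun p => ?_) j
  · simp only [Fin.append_left, Pi.zero_apply, Pi.neg_apply, zero_sub]
  · simp only [Fin.append_right, Pi.zero_apply, sub_zero]

lemma chernSlice_add_scalarData {d n : ℕ} (hdn : d + n = 3) (hy : y ∈ A k)
    (w : Fin (n + 1) → Data k) (t : Fin (n + 1) → R4) (x : R4) (e : Fin d → R4) :
    chernSlice hdn y (fun i => w i + scalarData (t i)) x e =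
      chern (x, y) fun i => (append (-t) e (Fin.cast (by omega : 4 = n + 1 + d) i),
        append w 0 (Fin.cast (by omega : 4 = n + 1 + d) i)) := by
  simp only [chernSlice, append_prod, ← append_zero_sub]
  exact chern_add_scalarData hy x _ _ _

/-- The integral of a component of the Chern form against a component of `α`. -/
def chernIntegral {m d : ℕ} (hm : 4 = m + d) (α : R4 → R4 [⋀^Fin m]→L[ℝ] ℝ)
    (t : Fin m → R4) (p : Fin d → R4) (q : Fin m → R4) (w : Fin m → Data k) (y : Data k) : ℝ :=
  ∫ x, (chern (x, y) fun i => (append (-t) p (Fin.cast hm i), append w 0 (Fin.cast hm i))) * α x q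

lemma muDual_add_scalarData {d n : ℕ} (hdn : d + n = 3)
    {α : R4 → R4 [⋀^Fin (n + 1)]→L[ℝ] ℝ} (hα : Continuous α) (hc : HasCompactSupport α)
    (hy : y ∈ A k) (w : Fin (n + 1) → Data k) (t : Fin (n + 1) → R4) :
    muDual hdn α y (fun i => w i + scalarData (t i)) =
      -((1 / ((d.factorial : ℝ) * ((n + 1).factorial : ℝ))) *
        ∑ σ : Equiv.Perm (Fin 4), ((Equiv.Perm.sign σ : ℤ) : ℝ) *
          chernIntegral (by omega : 4 = n + 1 + d) α t
          (fun p => single (σ (Fin.cast (by omega : d + (n + 1) = 4) (Fin.castAdd (n + 1) p))) 1)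
          (fun p => single (σ (Fin.cast (by omega : d + (n + 1) = 4) (natAdd d p))) 1) w y) := by
  simp only [muDual, integralR4, wedgeTop, chernSlice_add_scalarData hdn hy, chernIntegral]
  rw [integral_const_mul, integral_finset_sum]
  · simp only [mul_assoc, integral_const_mul]
  · intro σ _
    simp only [mul_assoc]
    refine (integrable_of_compact (continuous_chern hy _) ?_ ?_).const_mul _
    · fun_prop
    · exact hc.comp_left (g := fun a : R4 [⋀^Fin (n + 1)]→L[ℝ] ℝ => a _) rfl

lemma append_zero_induction {m d : ℕ} {w : Fin m → Data k} {p : Data k → Prop} (h0 : p 0)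
    (h : ∀ i, p (w i)) (j : Fin (m + d)) : p (append w 0 j) := by
  refine addCases (fun i => ?_) (fun i => ?_) j
  · rw [Fin.append_left]
    exact h i
  · rw [Fin.append_right]
    exact h0

lemma lower_append {m d : ℕ} (w : Fin m → Data₁) (j : Fin (m + d)) :
    lower (append w 0 j) = append (fun i => lower (w i)) 0 j := by
  refine addCases (fun p => ?_) (fun p => ?_) j
  · simp only [Fin.append_left]
  · simp only [Fin.append_right]
    rfl

lemma tendsto_chernIntegral {m d : ℕ} (hm : 4 = m + d)
    {α : R4 → R4 [⋀^Fin m]→L[ℝ] ℝ} (hα : ContDiff ℝ ∞ α) (hc : HasCompactSupport α)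
    (t : Fin m → R4) (p : Fin d → R4) (q : Fin m → R4) {w : Fin m → Data₁}
    (hw : ∀ i, w i ∈ Sing1 k) (hw0 : ∀ i, T0 (w i) = 0) {y : Data₁} (hy : y ∈ Sing1reg k)
    (C : ℝ) :
    Tendsto (chernIntegral hm α t p q w) (𝓝[approach C y] y)
      (𝓝 (chernIntegral hm α t p q (fun i => lower (w i)) (lower y) -
        (vol4 fun i => append (-t) p (Fin.cast hm i)) * α (T0 y) q)) := by
  have hα1 : ContDiff ℝ 1 α := hα.of_le (by exact_mod_cast le_top)
  have h := tendsto_integral_chern hy C (fun i => append (-t) p (Fin.cast hm i))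
    (v := fun i => append w 0 (Fin.cast hm i))
    (fun i => append_zero_induction (p := (· ∈ Sing1 k)) (Submodule.zero_mem _) hw _)
    (fun i => append_zero_induction (p := (T0 · = 0)) rfl hw0 _)
    (g := fun x => α x q)
    (((ContinuousAlternatingMap.apply ℝ R4 ℝ q).contDiff).comp hα1)
    (hc.comp_left (g := fun a : R4 [⋀^Fin m]→L[ℝ] ℝ => a q) rfl)
  simp only [lower_append] at h
  exact h

lemma restrictsTo_muDual {d n : ℕ} (hdn : d + n = 3)
    {α : R4 → R4 [⋀^Fin (n + 1)]→L[ℝ] ℝ} (hα : ContDiff ℝ ∞ α) (hc : HasCompactSupport α) :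
    RestrictsTo (muDual hdn α) (fun y v => muDual hdn α (lower y) (fun i => lower (v i)) +
        α (T0 y) (fun i => T0 (v i))) (Sing1reg k) := by
  intro y hy v hv C
  have e1 : v = fun i => centered (v i) + scalarData (T0 (v i)) :=
    funext fun i => (centered_add _).symm
  have e2 : (fun i => lower (v i)) = fun i => lower (centered (v i)) + scalarData (T0 (v i)) :=
    funext fun i => (lower_centered _).symm
  have h := ((tendsto_finset_sum Finset.univ fun (σ : Equiv.Perm (Fin 4)) _ => (tendsto_chernIntegral
    (by omega : 4 = n + 1 + d) hα hc (fun i => T0 (v i))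
          (fun p => single (σ (Fin.cast (by omega : d + (n + 1) = 4) (Fin.castAdd (n + 1) p))) 1)
          (fun p => single
            (σ (Fin.cast (by omega : d + (n + 1) = 4) (natAdd d p))) 1) (w := fun i => centered (v i)) (fun i => centered_mem_Sing1 (hv i))
    (fun i => T0_centered _) hy C).const_mul ((Equiv.Perm.sign σ : ℤ) : ℝ)).const_mul
      (1 / ((d.factorial : ℝ) * ((n + 1).factorial : ℝ)))).neg
  have hw := wedgeTop_vol4 hdn (fun i => T0 (v i)) (α (T0 y))
  simp only [e2, muDual_add_scalarData hdn hα.continuous hc hy.2]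
  rw [← hw]
  refine Tendsto.congr' (f₁ := _) ?_ (h.trans (le_of_eq (congrArg 𝓝 ?_)))
  · filter_upwards [eventually_mem_nhdsWithin] with y' hy'
    conv_rhs => rw [e1]
    rw [muDual_add_scalarData hdn hα.continuous hc hy'.1]
  · simp only [wedgeTop, mul_sub, sum_sub_distrib, mul_assoc]
    ring

lemma exists_antilipschitz_of_mem {d n : ℕ} (S : Submfd d n) {x : R4} (hx : x ∈ S.carrier) :
    ∃ V ∈ 𝓝 x, ∃ (L : R4 →L[ℝ] (Fin d → ℝ)) (K : NNReal), ∀ z ∈ S.carrier ∩ V,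
      ∀ z' ∈ S.carrier ∩ V, ‖z - z'‖ ≤ K * ‖L z - L z'‖ := by
  obtain ⟨U, hU, hxU, g, hg, hz, hT⟩ := S.locally_regular x hx
  obtain ⟨-, hspan⟩ := hT x ⟨hxU, hx⟩
  let L : R4 →L[ℝ] (Fin d → ℝ) := ContinuousLinearMap.pi fun i => innerSL ℝ (S.frame x i)
  obtain ⟨K, hK, hanti⟩ := ((fderiv ℝ g x).prod L).toLinearMap.exists_antilipschitzWith (by
    refine LinearMap.ker_eq_bot'.2 fun w hw => ?_
    have h1 : w ∈ Submodule.span ℝ (Set.range (S.frame x)) := by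
      rw [hspan]
      exact congrArg Prod.fst hw
    have h2 : ∀ v ∈ Submodule.span ℝ (Set.range (S.frame x)), inner ℝ v w = 0 := fun v hv => by
      induction hv using Submodule.span_induction with
      | mem v hv =>
        obtain ⟨i, rfl⟩ := hv
        exact congrFun (congrArg Prod.snd hw) i
      | zero => exact inner_zero_left _
      | add a b _ _ ha hb => rw [inner_add_left, ha, hb, add_zero]
      | smul r a _ ha => rw [inner_smul_left, ha, mul_zero]
    exact inner_self_eq_zero.1 (h2 w h1))
  have hd : HasStrictFDerivAt g (fderiv ℝ g x) x :=
    (hg.contDiffAt (hU.mem_nhds hxU)).hasStrictFDerivAt (by simp)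
  have hK0 : (0 : NNReal) < (2 * K)⁻¹ := inv_pos.2 (mul_pos two_pos hK)
  obtain ⟨V, hV, happ⟩ := hd.approximates_deriv_on_nhds (c := (2 * K)⁻¹) (Or.inr hK0)
  refine ⟨V ∩ U, inter_mem hV (hU.mem_nhds hxU), L, 2 * K, fun z hzS z' hzS' => ?_⟩
  have h1 := happ z hzS.2.1 z' hzS'.2.1
  rw [(hz z hzS.2.2).1 hzS.1, (hz z' hzS'.2.2).1 hzS'.1, sub_zero, zero_sub, norm_neg] at h1
  have h2 := hanti.le_mul_dist z z'
  rw [dist_eq_norm, dist_eq_norm, ← map_sub] at h2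
  have h3 : ‖(fderiv ℝ g x).prod L (z - z')‖ ≤ ‖fderiv ℝ g x (z - z')‖ + ‖L z - L z'‖ := by
    rw [← map_sub]
    exact (max_le_add_of_nonneg (norm_nonneg _) (norm_nonneg _))
  have hK1 : (0 : ℝ) < K := hK
  push_cast at h1 ⊢
  have h4 : (K : ℝ) * ‖fderiv ℝ g x (z - z')‖ ≤ ‖z - z'‖ / 2 := by
    calc _ ≤ (K : ℝ) * ((2 * (K : ℝ))⁻¹ * ‖z - z'‖) := mul_le_mul_of_nonneg_left h1 hK1.le
      _ = _ := by field_simp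
  have h5 := h2.trans (mul_le_mul_of_nonneg_left h3 hK1.le)
  linarith

lemma Submfd.measure_lt_top {d n : ℕ} (S : Submfd d n) : (μHE[d] : Measure R4) S.carrier < ⊤ := by
  refine S.isCompact.measure_lt_top_of_nhdsWithin fun x hx => ?_
  obtain ⟨V, hV, L, K, h⟩ := exists_antilipschitz_of_mem S hx
  refine ⟨S.carrier ∩ V, inter_mem_nhdsWithin _ hV, ?_⟩
  have hanti : AntilipschitzWith K fun z : (S.carrier ∩ V : Set R4) => L z :=
    AntilipschitzWith.of_le_mul_dist fun z z' => by
      rw [Subtype.dist_eq, dist_eq_norm, dist_eq_norm]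
      exact h z z.2 z' z'.2
  have h1 := hanti.le_hausdorffMeasure_image (d := d) d.cast_nonneg Set.univ
  have h2 := isometry_subtype_coe.hausdorffMeasure_image (X := (S.carrier ∩ V : Set R4))
    (d := d) (Or.inl d.cast_nonneg) Set.univ
  have h3 : (μH[(d : ℝ)] : Measure (Fin d → ℝ))
      ((fun z : (S.carrier ∩ V : Set R4) => L z) '' Set.univ) < ⊤ := by
    have := hausdorffMeasure_pi_real (ι := Fin d)
    rw [Fintype.card_fin] at this
    rw [this]
    refine (measure_mono ?_).trans_lt (S.isCompact.image L.continuous).measure_lt_top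
    rintro _ ⟨z, -, rfl⟩
    exact ⟨z, z.2.1, rfl⟩
  rw [Set.image_univ, Subtype.range_coe] at h2
  rw [Measure.euclideanHausdorffMeasure, Measure.smul_apply, h2]
  exact ENNReal.mul_lt_top ENNReal.coe_lt_top (h1.trans_lt (ENNReal.mul_lt_top
    (ENNReal.rpow_lt_top_of_nonneg d.cast_nonneg ENNReal.coe_ne_top) h3))

lemma _root_.AlternatingMap.eq_sum_single {d : ℕ} (f : R4 [⋀^Fin d]→ₗ[ℝ] ℝ) (e : Fin d → R4) :
    f e = ∑ r : Fin d → Fin 4, (∏ p, e p (r p)) * f fun p => single (r p) 1 := by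
  have h : e = fun p => ∑ j, e p j • single j (1 : ℝ) := funext fun p => by
    conv_lhs => rw [← (basisFun (Fin 4) ℝ).sum_repr (e p)]
    simp
  conv_lhs => rw [h]
  refine (f.toMultilinearMap.map_sum _).trans (sum_ext fun r _ => ?_)
  exact f.toMultilinearMap.map_smul_univ _ _

/-- An alternating map on `ℝ⁴` is continuous. -/
def toContAlt {d : ℕ} (f : R4 [⋀^Fin d]→ₗ[ℝ] ℝ) : R4 [⋀^Fin d]→L[ℝ] ℝ := { f with
    cont := by
      change Continuous f
      rw [show (f : (Fin d → R4) → ℝ) = _ from funext f.eq_sum_single]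
      fun_prop }

lemma exists_dual_alternating (d : ℕ) :
    ∃ b : (Fin d → Fin 4) → R4 [⋀^Fin d]→L[ℝ] ℝ, ∀ (f : R4 [⋀^Fin d]→ₗ[ℝ] ℝ) (e : Fin d → R4),
      f e = ∑ r, f (fun p => single (r p) 1) * b r e := by
  let ev : (R4 [⋀^Fin d]→ₗ[ℝ] ℝ) →ₗ[ℝ] ((Fin d → Fin 4) → ℝ) :=
    { toFun := fun f r => f fun p => single (r p) 1
      map_add' := fun _ _ => rfl
      map_smul' := fun _ _ => rfl }
  obtain ⟨l, hl⟩ := ev.exists_leftInverse_of_injective (ker_eq_bot.2 fun f g h => by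
    ext e
    rw [f.eq_sum_single, g.eq_sum_single]
    exact sum_ext fun r _ => congrArg _ (congrFun h r))
  refine ⟨fun r => toContAlt (l (Pi.single r 1)), fun f e => ?_⟩
  have h1 : f = l (ev f) := (LinearMap.congr_fun hl f).symm
  have h2 : ev f = ∑ r, ev f r • Pi.single r (1 : ℝ) := by simpa using (pi_eq_sum_univ' (ev f))
  conv_lhs => rw [h1, h2, map_sum]
  simp only [map_smul]
  exact alternating_sum_apply _ _ _

lemma elim_pair {k m d : ℕ} (t : Fin m → R4) (w : Fin m → Data k) (e : Fin d → R4)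
    (j : Fin (m + d)) : elim (fun p => (t p, w p)) (fun p => (e p, (0 : Data k)))
      (finSumFinEquiv.symm j) = (append t e j, append w 0 j) := by
  refine addCases (fun p => ?_) (fun p => ?_) j <;> simp

lemma chern_append_eq_sum {d : ℕ} {b : (Fin d → Fin 4) → R4 [⋀^Fin d]→L[ℝ] ℝ}
    (hb : ∀ (f : R4 [⋀^Fin d]→ₗ[ℝ] ℝ) (e : Fin d → R4),
      f e = ∑ r, f (fun p => single (r p) 1) * b r e) {k m : ℕ} (hm : 4 = m + d)
    {y : Data k} (hy : y ∈ A k) (t : Fin m → R4) (w : Fin m → Data k) (x : R4) (e : Fin d → R4) :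
    (chern (x, y) fun i => (append t e (Fin.cast hm i), append w 0 (Fin.cast hm i))) =
      ∑ r : Fin d → Fin 4, (chern (x, y) fun i => (append t
        (fun p => single (r p) 1) (Fin.cast hm i), append w 0 (Fin.cast hm i))) * b r e := by
  have h : ∀ e : Fin d → R4, (chern (x, y) fun i =>
      (append t e (Fin.cast hm i), append w 0 (Fin.cast hm i))) =
      (fixLeft ((chernForm hy x).domDomCongr ((finCongr hm).trans finSumFinEquiv.symm)) fun p =>
        (t p, w p)).compLinearMap (LinearMap.inl ℝ R4 (Data k)) e := fun e => by
    rw [← chernForm_apply hy]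
    simp only [← elim_pair]
    rfl
  simp only [h]
  exact hb _ e

lemma Submfd.tendsto_integral_chern {d n : ℕ} (S : Submfd d n) {y : Data₁}
    (hy : y ∈ Sing1reg k) (hyS : T0 y ∉ S.carrier) (C : ℝ) (e : Fin 4 → R4)
    {v : Fin 4 → Data₁} (hv : ∀ i, v i ∈ Sing1 k) (hv0 : ∀ i, T0 (v i) = 0) {g : R4 → ℝ}
    (hg : ContinuousOn g S.carrier) :
    Tendsto (fun y' => ∫ x in S.carrier, chern (x, y') (fun i => (e i, v i)) * g x
      ∂(μHE[d] : Measure R4)) (𝓝[approach C y] y)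
      (𝓝 (∫ x in S.carrier, chern (x, lower y) (fun i => (e i, lower (v i))) * g x
        ∂(μHE[d] : Measure R4))) := by
  obtain ⟨r, hr, hrS⟩ := Metric.mem_nhds_iff.1 (S.isCompact.isClosed.isOpen_compl.mem_nhds hyS)
  have hrS : ∀ x ∈ S.carrier, r ≤ ‖x - T0 y‖ := fun x hx => by
    by_contra h
    exact hrS (by rw [Metric.mem_ball, dist_eq_norm]; exact not_le.1 h) hx
  obtain ⟨M, hM⟩ := S.isCompact.exists_bound_of_continuousOn hg
  obtain ⟨B, hB0, hB⟩ := eventually_abs_chern_le hy C hv hv0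
  have hS : MeasurableSet S.carrier := S.isCompact.isClosed.measurableSet
  have hfin : IsFiniteMeasure ((μHE[d] : Measure R4).restrict S.carrier) :=
    ⟨by rw [Measure.restrict_apply_univ]; exact S.measure_lt_top⟩
  refine tendsto_integral_filter_of_dominated_convergence 
    (fun _ => B * (∏ i, (‖e i‖ * (1 + r⁻¹) + 1)) * M) ?_ ?_
    (integrable_const _) ?_
  · filter_upwards [eventually_mem_nhdsWithin] with y' hy'
    exact ((continuous_chern hy'.1 _).continuousOn.mul hg).aestronglyMeasurable hS
  · filter_upwards [hB] with y' h
    refine (ae_restrict_iff' hS).2 (ae_of_all _ fun x hx => ?_)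
    rw [norm_mul]
    have hW : (‖x - T0 y‖ + ‖y' - y‖)⁻¹ ≤ r⁻¹ :=
      inv_anti₀ hr ((hrS x hx).trans (le_add_of_nonneg_right (norm_nonneg _)))
    have h1 := (h x e).trans (mul_le_mul_of_nonneg_left (Finset.prod_le_prod
      (fun i _ => by positivity) fun i _ => add_le_add_left (mul_le_mul_of_nonneg_left
        (add_le_add_right hW 1) (norm_nonneg (e i))) 1) hB0.le)
    exact mul_le_mul h1 (hM x hx) (norm_nonneg _) ((abs_nonneg _).trans h1)
  · refine (ae_restrict_iff' hS).2 (ae_of_all _ fun x hx => ?_)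
    exact (tendsto_chern hy C (fun h => hyS (h ▸ hx)) e hv hv0).mul_const _

lemma exists_muSub_eq {d n : ℕ} (hdn : d + n = 3) (S : Submfd d n) (t : Fin (n + 1) → R4) :
    ∃ g : (Fin d → Fin 4) → R4 → ℝ, (∀ r, ContinuousOn (g r) S.carrier) ∧
      ∀ {k : ℕ} {y : Data k}, y ∈ A k → ∀ w : Fin (n + 1) → Data k,
        muSub hdn S y (fun i => w i + scalarData (t i)) =
          ∑ r : Fin d → Fin 4, ∫ x in S.carrier, (chern (x, y) fun i => (append (-t)
            (fun p => single (r p) 1) (Fin.cast (by omega : 4 = n + 1 + d) i),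
              append w 0 (Fin.cast (by omega : 4 = n + 1 + d) i))) * g r x
            ∂(μHE[d] : Measure R4) := by
  obtain ⟨b, hb⟩ := exists_dual_alternating d
  have hg := fun r => S.orientation_continuous (b r)
  have hfin : IsFiniteMeasure ((μHE[d] : Measure R4).restrict S.carrier) :=
    ⟨by rw [Measure.restrict_apply_univ]; exact S.measure_lt_top⟩
  refine ⟨fun r x => S.sign x * b r (S.frame x), hg, fun {k y} hy w => ?_⟩
  rw [← integral_finset_sum]
  · refine integral_congr_ae (ae_of_all _ fun x => ?_)
    dsimp only
    rw [chernSlice_add_scalarData hdn hy, chern_append_eq_sum hb _ hy, mul_sum]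
    exact sum_ext fun r _ => mul_left_comm _ _ _
  · intro r _
    have hc := (continuous_chern hy fun i => (append (-t)
      (fun p => single (r p) 1) (Fin.cast (by omega : 4 = n + 1 + d) i),
        append w 0 (Fin.cast (by omega : 4 = n + 1 + d) i))).continuousOn.mul (hg r)
    have hS : MeasurableSet S.carrier := S.isCompact.isClosed.measurableSet
    obtain ⟨M, hM⟩ := S.isCompact.exists_bound_of_continuousOn hc
    exact Integrable.of_bound (hc.aestronglyMeasurable hS) M
      ((ae_restrict_iff' hS).2 (ae_of_all _ hM))

lemma restrictsTo_muSub {d n : ℕ} (hdn : d + n = 3) (S : Submfd d n) :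
    RestrictsTo (muSub hdn S) (fun y v => muSub hdn S (lower y) (fun i => lower (v i)))
      {y ∈ Sing1reg k | T0 y ∉ S.carrier} := by
  rintro y ⟨hy, hyS⟩ v hv C
  have e1 : v = fun i => centered (v i) + scalarData (T0 (v i)) :=
    funext fun i => (centered_add _).symm
  have e2 : (fun i => lower (v i)) = fun i => lower (centered (v i)) + scalarData (T0 (v i)) :=
    funext fun i => (lower_centered _).symm
  obtain ⟨g, hg, hmu⟩ := exists_muSub_eq hdn S fun i => T0 (v i)
  have h := tendsto_finset_sum Finset.univ fun (r : Fin d → Fin 4) _ =>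
    S.tendsto_integral_chern hy hyS C (fun i => append (-fun i => T0 (v i))
      (fun p => single (r p) 1) (Fin.cast (by omega : 4 = n + 1 + d) i))
    (v := fun i => append (fun i => centered (v i)) 0 (Fin.cast (by omega : 4 = n + 1 + d) i))
    (fun i => append_zero_induction (p := (· ∈ Sing1 k)) (Submodule.zero_mem _)
      (fun i => centered_mem_Sing1 (hv i)) _)
    (fun i => append_zero_induction (p := (T0 · = 0)) rfl (fun i => T0_centered _) _) (hg r)
  simp only [lower_append] at h
  simp only [e2, hmu hy.2]
  refine h.congr' ?_
  filter_upwards [eventually_mem_nhdsWithin] with y' hy'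
  conv_rhs => rw [e1]
  rw [hmu hy'.1]

end ADHM

end

theorem mainTheorem7 (k d n : ℕ) (hdn : d + n = 3) (S : ADHM.Submfd d n) :
    (∀ y ∈ ADHM.Sing1reg k, ∃ C : ℝ, y ∈ closure (ADHM.approach C y)) ∧
    (∀ α : ADHM.R4 → ADHM.R4 [⋀^Fin (n + 1)]→L[ℝ] ℝ, ADHM.IsPoincareDual hdn S α →
      ∃ γ : ADHM.Data (k + 1) → ADHM.Data (k + 1) [⋀^Fin n]→L[ℝ] ℝ, ADHM.IsBasic γ ∧
        ADHM.RestrictsTo (ADHM.muDual hdn α)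
          (fun y v => ADHM.muDual hdn α (ADHM.lower y) (fun i => ADHM.lower (v i)) +
            α (ADHM.T0 y) (fun i => ADHM.T0 (v i)) + extDeriv γ y v)
          (ADHM.Sing1reg k)) ∧
    (∃ γ : ADHM.Data (k + 1) → ADHM.Data (k + 1) [⋀^Fin n]→L[ℝ] ℝ, ADHM.IsBasic γ ∧
      ADHM.RestrictsTo (ADHM.muSub hdn S)
        (fun y v => ADHM.muSub hdn S (ADHM.lower y) (fun i => ADHM.lower (v i)) +
          extDeriv γ y v)
        {y ∈ ADHM.Sing1reg k | ADHM.T0 y ∉ S.carrier}) := by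
  have h0 : ∀ (y : ADHM.Data (k + 1)) (v : Fin (n + 1) → ADHM.Data (k + 1)),
      extDeriv (fun _ : ADHM.Data (k + 1) =>
        (0 : ADHM.Data (k + 1) [⋀^Fin n]→L[ℝ] ℝ)) y v = 0 := fun y v => by
    rw [extDeriv_apply (differentiableAt_const _)]
    simp
  have hb : ADHM.IsBasic fun _ : ADHM.Data (k + 1) =>
      (0 : ADHM.Data (k + 1) [⋀^Fin n]→L[ℝ] ℝ) :=
    ⟨contDiff_const, fun _ _ _ => rfl, fun y v _ => h0 y v⟩
  refine ⟨fun y hy => ADHM.exists_mem_closure_approach hy, fun α hα => ⟨_, hb, ?_⟩, ⟨_, hb, ?_⟩⟩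
  · simp only [h0, add_zero]
    exact ADHM.restrictsTo_muDual hdn hα.smooth hα.compact_support
  · simp only [h0, add_zero]
    exact ADHM.restrictsTo_muSub hdn S
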